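/- **Setting.** Let $\Bbbk\subset\mathbb K$ be fields, and fix a grading datum: an abelian group $Y$ with morphisms $\mathbb Z\to Y\to\mathbb Z/2$ whose composition is nonzero. Everything is $Y$-graded; put $|a|'=|a|-1$. Let $\mathcal C$ be a $\mathbb K$-linear $A_\infty$ category, with structure maps $\mu^s$, $s\ge 1$, of degree $2-s$, written so that $\mu^s(a_1,\dots,a_s)\in hom(X_0,X_s)$ for $a_i\in hom(X_{i-1},X_i)$, satisfying $\sum(-1)^{|a_1|'+\dots+|a_j|'}\mu^*(a_1,\dots,\mu^*(a_{j+1},\dots),\dots,a_s)=0$. Let $\mathcal C^+$ be $\mathcal C$ with a strict unit $e^+$ adjoined at every object: $\mu^2(e^+,a)=a=(-1)^{|a|}\mu^2(a,e^+)$ and $\mu^s(\dots,e^+,\dots)=0$ for $s\neq 2$. Let $CC^{nu}_\bullet(\mathcal C)$ be the quotient of the Hochschild chains of $\mathcal C^+$, spanned by the cyclically composable $a_0[a_1|\dots|a_s]$ (in degree $1+\sum_i|a_i|'$), by the span of those with some $a_i=e^+$, $i>0$, and of the length-zero chains $e^+$. An overbrace on part of a formula in $a_0,\dots,a_s$ means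 the sum over all cyclic rotations of $(a_0,\dots,a_s)$, with Koszul signs for the degrees $|\cdot|'$, for which $a_0$ lands underneath the brace; $\varepsilon_j$ is the sum of the degrees $|\cdot|'$ of the inputs $a_i$ to the left of the inserted operation. Define $$b(a_0[a_1|\dots|a_s])=\sum\mu^*(\overbrace{a_0,\dots,a_j})[a_{j+1}|\dots|a_s]+\sum(-1)^{\varepsilon_j}a_0[\dots|\mu^*(a_{j+1},\dots,a_k)|\dots|a_s],$$ $$B(a_0[a_1|\dots|a_s])=e^+[\overbrace{a_0|\dots|a_s}],$$ and, for a Hochschild cochain $\varphi$ of degree $2$, $$b^{1|1}(\varphi|a_0,\dots,a_s)=\sum(-1)^{\varepsilon_j}\mu^*(a_0,\dots,\varphi^*(a_{j+1},\dots),\overbrace{\dots,a_k})[\dots|a_s],$$ $$B^{1|1}(\varphi|a_0,\dots,a_s)=\sum(-1)^{\varepsilon_j}e^+[a_0|\dots|\varphi^*(a_{j+1},\dots)|\overbrace{\dots|a_s}],$$ where in the last two formulas there may be no input $a_i$ to the left of $\varphi^*$. Let $CC^-_\bullet(\mathcal C)$ be the graded $u$-adic completion of $CC^{nu}_\bullet(\mathcal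 C)\otimes\mathbb K[u]$, $|u|=2$, with differential $b+uB$. Its cohomology is the negative cyclic homology $HC^-_\bullet(\mathcal C)$. Let $\mathcal B$ be a choice of homogeneous $\mathbb K$-bases of the morphism spaces of $\mathcal C$ (extended to $\mathcal C^+$ by the elements $e^+$). For $v\in\mathrm{Deriv}_\Bbbk\mathbb K$ let $v(\alpha)$ and $v(\mu^*)$ be obtained by letting $v$ act on the coefficients of a chain $\alpha$, and on the matrix entries of $\mu^*$, in these bases. The Getzler–Gauss–Manin connection is defined on chains by $$\nabla^{\mathcal B}_v(\alpha)=v(\alpha)-u^{-1}b^{1|1}(v(\mu^*)|\alpha)-B^{1|1}(v(\mu^*)|\alpha)\in u^{-1}CC^-_\bullet(\mathcal C).$$ An $A_\infty$ functor $F:\mathcal C\to\mathcal D$ consists of a map on objects and maps $F^s$, $s\ge1$, of degree $1-s$, with $\sum\mu^*(F^*(a_1,\dots),\dots,F^*(\dots,a_s))=\sum(-1)^{|a_1|'+\dots+|a_j|'}F^*(a_1,\dots,\mu^*(a_{j+1},\dots),\dots,a_s)$. It is extended to $\mathcal C^+\to\mathcal D^+$ by $F^1(e^+)=e^+$ and $F^s(\dots,e^+,\dots)=0$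 for $s\ge2$, and it acts on chains, $u$-linearly, by $F_*(a_0[a_1|\dots|a_s])=\sum F^*(\overbrace{a_0,\dots})[F^*(\dots)|\dots|F^*(\dots,a_s)]$. **Theorem.** Let $\mathcal C$ and $\mathcal D$ be $\mathbb K$-linear $A_\infty$ categories with choices $\mathcal B_{\mathcal C}$, $\mathcal B_{\mathcal D}$ of homogeneous bases of their morphism spaces, and let $F:\mathcal C\to\mathcal D$ be an $A_\infty$ functor. 1. $F_*$ induces well-defined $\mathbb K$-linear maps $HC^-_\bullet(\mathcal C)\to HC^-_\bullet(\mathcal D)$ (and $u^pHC^-_\bullet(\mathcal C)\to u^pHC^-_\bullet(\mathcal D)$ for all $p\in\mathbb Z$), and for every $v\in\mathrm{Deriv}_\Bbbk\mathbb K$ the connections induce well-defined additive maps $[\nabla_v^{\mathcal B_{\mathcal C}}]:HC^-_\bullet(\mathcal C)\to u^{-1}HC^-_\bullet(\mathcal C)$ and $[\nabla_v^{\mathcal B_{\mathcal D}}]:HC^-_\bullet(\mathcal D)\to u^{-1}HC^-_\bullet(\mathcal D)$ of degree $0$, which satisfy $$F_*\circ[\nabla_v^{\mathcal B_{\mathcal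 C}}]=[\nabla_v^{\mathcal B_{\mathcal D}}]\circ F_*.$$ 2. If $\mathcal B_{\mathcal C}'$ is another choice of homogeneous bases for $\mathcal C$, then $[\nabla_v^{\mathcal B_{\mathcal C}}]=[\nabla_v^{\mathcal B_{\mathcal C}'}]$ on $HC^-_\bullet(\mathcal C)$ for every $v$. -/

import Mathlib

noncomputable section

open DirectSum Finset

set_option linter.unusedSectionVars false
set_option linter.checkUnivs false

universe uK uY uO uH uO' uH'

/-! ## Words and multilinear functions of words -/

section Words

variable {K : Type*} [Field K] {A B M N : Type*} [AddCommGroup A] [Module K A]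
  [AddCommGroup B] [Module K B] [AddCommGroup M] [Module K M] [AddCommGroup N] [Module K N]

/-- The pure tensor `a₁ ⊗ ⋯ ⊗ aₛ` in the tensor algebra `⨁ₛ A^{⊗ s}`. -/
def word (K : Type*) [Field K] {A : Type*} [AddCommGroup A] [Module K A] (l : List A) :
    TensorAlgebra K A :=
  (l.map (TensorAlgebra.ι K)).prod

/-- A function of words is multilinear if it is linear in each letter
(for each length separately). -/
def IsML (K : Type*) [Field K] {A M : Type*} [AddCommGroup A] [Module K A]
    [AddCommGroup M] [Module K M] (f : List A → M) : Prop :=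
  ∀ p q : List A, IsLinearMap K fun x => f (p ++ x :: q)

/-- Sum over all ways of cutting a word into an initial and a final part (either may be empty). -/
def splitSum (f : List A → List A → M) (l : List A) : M :=
  ∑ j ∈ range (l.length + 1), f (l.take j) (l.drop j)

/-- Sum over all ways of cutting a word into three consecutive parts. -/
def splitSum₃ (f : List A → List A → List A → M) : List A → M :=
  splitSum fun p s => splitSum (f p) s

/-- Sum over all ways of cutting a word into four consecutive parts. -/
def splitSum₄ (f : List A → List A → List A → List A → M) : List A → M :=
  splitSum fun p s => splitSum₃ (f p) s

/-- All decompositions of a word into consecutive nonempty blocks. -/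
def parts {α : Type*} : List α → List (List (List α))
  | [] => [[]]
  | a :: l => (parts l).flatMap fun P =>
      match P with
      | [] => [[[a]]]
      | b :: P' => [[a] :: b :: P', (a :: b) :: P']

theorem isLinearMap_zero : IsLinearMap K (fun _ : A => (0 : M)) := ⟨by simp, by simp⟩

theorem IsLinearMap.add' {f g : A → M} (hf : IsLinearMap K f) (hg : IsLinearMap K g) :
    IsLinearMap K fun x => f x + g x :=
  ⟨fun x y => by rw [hf.map_add, hg.map_add]; abel,
   fun c x => by rw [hf.map_smul, hg.map_smul, smul_add]⟩

theorem IsLinearMap.sum' {ι : Type*} (s : Finset ι) {f : ι → A → M}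
    (hf : ∀ i ∈ s, IsLinearMap K (f i)) : IsLinearMap K fun x => ∑ i ∈ s, f i x :=
  ⟨fun x y => by
    rw [← sum_add_distrib]; exact sum_congr rfl fun i hi => (hf i hi).map_add x y,
   fun c x => by
    rw [smul_sum]; exact sum_congr rfl fun i hi => (hf i hi).map_smul c x⟩

theorem IsLinearMap.lcomp {f : A → M} (hf : IsLinearMap K f) (L : M →ₗ[K] N) :
    IsLinearMap K fun x => L (f x) :=
  (L ∘ₗ hf.mk' f).isLinear

theorem IsML.zero : IsML K (fun _ : List A => (0 : M)) := fun _ _ => isLinearMap_zero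

theorem IsML.add {f g : List A → M} (hf : IsML K f) (hg : IsML K g) :
    IsML K fun l => f l + g l := fun p q => (hf p q).add' (hg p q)

theorem IsML.lcomp {f : List A → M} (hf : IsML K f) (L : M →ₗ[K] N) :
    IsML K fun l => L (f l) := fun p q => (hf p q).lcomp L

theorem IsML.map {f : List B → M} (hf : IsML K f) (φ : A →ₗ[K] B) :
    IsML K fun l : List A => f (l.map φ) := fun p q => by
  have h := hf (p.map φ) (q.map φ)
  refine ⟨fun x y => ?_, fun c x => ?_⟩
  · simpa using h.map_add (φ x) (φ y)
  · simpa using h.map_smul c (φ x)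

/-- Finite sums whose range depends on the length only. -/
theorem IsML.sumLength {f : ℕ → List A → M} (s : ℕ → Finset ℕ) (hf : ∀ i, IsML K (f i)) :
    IsML K fun l => ∑ i ∈ s l.length, f i l := fun p q => by
  have h : IsLinearMap K fun x => ∑ i ∈ s (p.length + (q.length + 1)), f i (p ++ x :: q) :=
    IsLinearMap.sum' _ fun i _ => hf i p q
  simpa using h

theorem IsML.iteLength {f : List A → M} (c : ℕ → Prop) [DecidablePred c] (hf : IsML K f) :
    IsML K fun l => if c l.length then f l else 0 := fun p q => by
  by_cases h : c (p.length + (q.length + 1))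
  · simpa [h] using hf p q
  · simpa [h] using isLinearMap_zero (K := K) (A := A) (M := M)

theorem IsML.word : IsML K (word K : List A → TensorAlgebra K A) := fun p q => by
  refine ⟨fun x y => ?_, fun c x => ?_⟩
  · simp [_root_.word, add_mul, mul_add]
  · simp [_root_.word]

theorem IsML.append_right {f : List A → M} (hf : IsML K f) (r : List A) :
    IsML K fun l => f (l ++ r) := fun p q => by simpa using hf p (q ++ r)

theorem IsML.append_left {f : List A → M} (hf : IsML K f) (r : List A) :
    IsML K fun l => f (r ++ l) := fun p q => by simpa using hf (r ++ p) q

/-- Insert the value of a multilinear function as a letter. -/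
theorem IsML.insert {f : List B → M} (hf : IsML K f) {g : List A → B} (hg : IsML K g)
    (p q : List B) : IsML K fun l => f (p ++ g l :: q) := fun p' q' => by
  refine ⟨fun x y => ?_, fun c x => ?_⟩
  · simp only [(hg p' q').map_add]; exact (hf p q).map_add _ _
  · simp only [(hg p' q').map_smul]; exact (hf p q).map_smul _ _

theorem IsML.cons {f : List A → M} (hf : IsML K f) (a : A) : IsML K fun l => f (a :: l) :=
  hf.append_left [a]

theorem IsML.splitSum {f : List A → List A → M} (h₁ : ∀ r, IsML K fun l => f l r)
    (h₂ : ∀ r, IsML K fun l => f r l) : IsML K (splitSum f) := by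
  refine IsML.sumLength (f := fun j l => f (l.take j) (l.drop j)) (fun n => range (n + 1)) ?_
  intro j p q
  rcases le_or_gt j p.length with h | h
  · have := h₂ (p.take j) (p.drop j) q
    simpa [List.take_append, List.drop_append, Nat.sub_eq_zero_of_le h] using this
  · obtain ⟨m, rfl⟩ : ∃ m, j = p.length + 1 + m := ⟨j - (p.length + 1), by omega⟩
    have e1 : p.length + 1 + m - p.length = m + 1 := by omega
    have e2 : p.take (p.length + 1 + m) = p := List.take_of_length_le (by omega)
    have e3 : p.drop (p.length + 1 + m) = [] := List.drop_of_length_le (by omega)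
    have := h₁ (q.drop m) p (q.take m)
    simpa [List.take_append, List.drop_append, e1, e2, e3] using this

theorem IsML.splitSum₃ {f : List A → List A → List A → M}
    (h₁ : ∀ q r, IsML K fun p => f p q r) (h₂ : ∀ p r, IsML K fun q => f p q r)
    (h₃ : ∀ p q, IsML K fun r => f p q r) : IsML K (splitSum₃ f) :=
  IsML.splitSum
    (fun s => IsML.sumLength (f := fun j l => f l (s.take j) (s.drop j))
      (fun _ => range (s.length + 1)) fun _ => h₁ _ _)
    (fun p => IsML.splitSum (h₂ p) (h₃ p))

theorem IsML.splitSum₄ {f : List A → List A → List A → List A → M}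
    (h₁ : ∀ q r s, IsML K fun p => f p q r s) (h₂ : ∀ p r s, IsML K fun q => f p q r s)
    (h₃ : ∀ p q s, IsML K fun r => f p q r s) (h₄ : ∀ p q r, IsML K fun s => f p q r s) :
    IsML K (splitSum₄ f) :=
  IsML.splitSum
    (fun s => IsML.sumLength (f := fun j l => _root_.splitSum (f l (s.take j)) (s.drop j))
      (fun _ => range (s.length + 1)) fun j =>
      IsML.sumLength (f := fun j' l => f l (s.take j) ((s.drop j).take j') ((s.drop j).drop j'))
        (fun _ => range ((s.drop j).length + 1)) fun _ => h₁ _ _ _)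
    (fun p => IsML.splitSum₃ (h₂ p) (h₃ p) (h₄ p))

/-- Extend a function of one letter by zero to all words. -/
def onOne (f : A → M) : List A → M
  | [a] => f a
  | _ => 0

/-- Extend a function of two letters by zero to all words. -/
def onTwo (f : A → A → M) : List A → M
  | [a, b] => f a b
  | _ => 0

theorem IsML.onOne {f : A → M} (hf : IsLinearMap K f) : IsML K (onOne f) := fun p q => by
  match p, q with
  | [], [] => exact hf
  | [], _ :: _ => exact isLinearMap_zero
  | [_], _ => exact isLinearMap_zero
  | _ :: _ :: _, _ => exact isLinearMap_zero

theorem IsML.onTwo (L : A →ₗ[K] A →ₗ[K] M) : IsML K (onTwo fun a b => L a b) := fun p q => by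
  match p, q with
  | [], [] => exact isLinearMap_zero
  | [], [b] => exact (L.flip b).isLinear
  | [], _ :: _ :: _ => exact isLinearMap_zero
  | [a], [] => exact (L a).isLinear
  | [_], _ :: _ => exact isLinearMap_zero
  | [_, _], _ => exact isLinearMap_zero
  | _ :: _ :: _ :: _, _ => exact isLinearMap_zero

theorem IsML.parts {f : List B → M} (hf : IsML K f) {g : List A → B} (hg : IsML K g) :
    IsML K fun l => ((parts l).map fun P => f (P.map g)).sum := by
  have key : ∀ (p : List A) (F : List (List A) → M),
      (∀ P₁ b₁ b₂ P₂, IsLinearMap K fun x => F (P₁ ++ (b₁ ++ x :: b₂) :: P₂)) →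
      ∀ q, IsLinearMap K fun x => ((_root_.parts (p ++ x :: q)).map F).sum := by
    have hadd : ∀ (S : List (List (List A))) (G : A → List (List A) → M),
        (∀ P ∈ S, IsLinearMap K fun x => G x P) →
        IsLinearMap K fun x => (S.map (G x)).sum := by
      intro S
      induction S with
      | nil => intro G _; exact isLinearMap_zero
      | cons P S ih =>
        intro G h
        simp only [List.map_cons, List.sum_cons]
        exact (h P (by simp)).add' (ih G fun P' h' => h P' (by simp [h']))
    have hflat : ∀ (S : List (List (List A))) (h : List (List A) → List (List (List A)))
        (F : List (List A) → M),
        ((S.flatMap h).map F).sum = (S.map fun P => ((h P).map F).sum).sum := by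
      intro S h F
      induction S with
      | nil => rfl
      | cons P S ih => simp [ih]
    intro p
    induction p with
    | nil =>
      intro F hF q
      simp only [List.nil_append, _root_.parts, hflat]
      refine hadd _ _ ?_
      rintro (_ | ⟨b, P⟩) -
      · simpa using hF [] [] [] []
      · have h1 := hF [] [] [] (b :: P)
        have h2 := hF [] [] b P
        simpa using h1.add' h2
    | cons a p ih =>
      intro F hF q
      simp only [List.cons_append, _root_.parts, hflat]
      refine ih (fun P => ((match P with
        | [] => [[[a]]]
        | b :: P' => [[a] :: b :: P', (a :: b) :: P']).map F).sum) ?_ q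
      intro P₁ b₁ b₂ P₂
      rcases P₁ with _ | ⟨c, P₁⟩
      · have h1 := hF [[a]] b₁ b₂ P₂
        have h2 := hF [] (a :: b₁) b₂ P₂
        simpa using h1.add' h2
      · have h1 := hF ([a] :: c :: P₁) b₁ b₂ P₂
        have h2 := hF ((a :: c) :: P₁) b₁ b₂ P₂
        simpa using h1.add' h2
  intro p q
  refine key p _ ?_ q
  intro P₁ b₁ b₂ P₂
  have := (IsML.insert hf hg (P₁.map g) (P₂.map g)) b₁ b₂
  simpa using this

theorem IsML.ofFn_update {f : List A → M} (hf : IsML K f) {n : ℕ} (m : Fin n → A) (i : Fin n) :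
    IsLinearMap K fun x => f (List.ofFn (Function.update m i x)) := by
  have h : ∀ x, List.ofFn (Function.update m i x) =
      (List.ofFn m).take i ++ x :: (List.ofFn m).drop (i + 1) := by
    intro x
    have hlen : (i : ℕ) < (List.ofFn m).length := by simp
    rw [← List.set_eq_take_append_cons_drop.trans (if_pos hlen)]
    apply List.ext_getElem
    · simp
    · intro k h1 h2
      simp only [List.getElem_ofFn, List.getElem_set]
      by_cases hk : (i : ℕ) = k
      · subst hk; simp
      · rw [if_neg hk, Function.update_of_ne]
        intro h'; exact hk (by rw [← h'])
  simp only [h]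
  exact hf _ _

/-- The linear map on `⨁ₛ A^{⊗ s}` with prescribed (multilinear) values on pure tensors. -/
def linExt (f : List A → M) (hf : IsML K f) : TensorAlgebra K A →ₗ[K] M :=
  (DirectSum.toModule K ℕ M fun n => PiTensorProduct.lift
    { toFun := fun m : Fin n → A => f (List.ofFn m)
      map_update_add' := fun {inst} m i x y => by
        obtain rfl : inst = instDecidableEqFin n := Subsingleton.elim _ _
        exact (hf.ofFn_update m i).map_add x y
      map_update_smul' := fun {inst} m i c x => by
        obtain rfl : inst = instDecidableEqFin n := Subsingleton.elim _ _
        exact (hf.ofFn_update m i).map_smul c x }) ∘ₗ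
  (TensorAlgebra.toDirectSum (R := K) (M := A)).toLinearMap

@[simp]
theorem linExt_word (f : List A → M) (hf : IsML K f) (l : List A) :
    linExt f hf (word K l) = f l := by
  have h : word K l = TensorAlgebra.tprod K A l.length l.get := by
    rw [TensorAlgebra.tprod_apply, word]
    congr 1
    conv_lhs => rw [← List.ofFn_get l, List.map_ofFn]
    rfl
  rw [h, linExt]
  simp only [LinearMap.comp_apply, AlgHom.toLinearMap_apply,
    TensorAlgebra.toDirectSum_tensorPower_tprod]
  rw [← DirectSum.lof_eq_of K, DirectSum.toModule_lof, PiTensorProduct.lift.tprod]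
  simp

/-- Let a derivation of the field act on the coefficients of a vector with respect to a basis. -/
def coeffDer {k : Type*} [Field k] [Algebra k K] (v : Derivation k K K) {ι : Type*}
    (b : Module.Basis ι K M) : M →+ M :=
  b.repr.symm.toLinearMap.toAddMonoidHom.comp
    ((Finsupp.mapRange.addMonoidHom (v : K →+ K)).comp b.repr.toLinearMap.toAddMonoidHom)

/-- Let a derivation of the field act on the entries of the matrix of a linear map. -/
def matrixDer {k : Type*} [Field k] [Algebra k K] (v : Derivation k K K) {ι κ : Type*}
    (b : Module.Basis ι K M) (c : Module.Basis κ K N) (φ : M →ₗ[K] N) : M →ₗ[K] N :=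
  b.constr K fun i => coeffDer v c (φ (b i))

end Words

/-! ## Graded quivers and `A∞` categories -/

/-- A grading datum: an abelian group `Y` with morphisms `ℤ → Y → ℤ/2` whose composition is
nonzero. -/
structure GradingDatum (Y : Type uY) [AddCommGroup Y] where
  fromInt : ℤ →+ Y
  parity : Y →+ ZMod 2
  comp_ne_zero : parity.comp fromInt ≠ 0

/-- A set of objects, with a `Y`-graded `K`-vector space of morphisms for every pair of objects
(a pre-`A∞` category); `Hom X Z y` is the degree `y` part of `hom(X, Z)`. -/
structure GQuiver (K : Type uK) [Field K] (Y : Type uY) where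
  Ob : Type uO
  Hom : Ob → Ob → Y → Type uH
  [addCommGroupHom : ∀ X Z y, AddCommGroup (Hom X Z y)]
  [moduleHom : ∀ X Z y, Module K (Hom X Z y)]

attribute [instance] GQuiver.addCommGroupHom GQuiver.moduleHom

/-- The source, target and degree of a homogeneous morphism. -/
structure Label (Ob : Type uO) (Y : Type uY) where
  src : Ob
  tgt : Ob
  deg : Y

instance {Ob : Type uO} {Y : Type uY} : DecidableEq (Label Ob Y) := Classical.decEq _

namespace GQuiver

variable {K : Type uK} [Field K] {Y : Type uY} [AddCommGroup Y]

/-- The direct sum of all morphism spaces. -/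
abbrev Tot (Q : GQuiver.{uK, uY, uO, uH} K Y) : Type _ :=
  ⨁ l : Label Q.Ob Y, Q.Hom l.src l.tgt l.deg

/-- The tensor algebra `⨁ₛ Tot^{⊗ s}`; it contains the spaces `hom(X₀,X₁) ⊗ ⋯ ⊗ hom(Xₛ₋₁,Xₛ)`. -/
abbrev T (Q : GQuiver.{uK, uY, uO, uH} K Y) : Type _ := TensorAlgebra K Q.Tot

variable (Q : GQuiver.{uK, uY, uO, uH} K Y)

/-- The inclusion of the space of morphisms `X → Z` of degree `y`. -/
def inc (X Z : Q.Ob) (y : Y) : Q.Hom X Z y →ₗ[K] Q.Tot :=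
  DirectSum.lof K (Label Q.Ob Y) (fun l => Q.Hom l.src l.tgt l.deg) ⟨X, Z, y⟩

/-- `Q.IsPath G X Z r l` means that the word `l` is a composable sequence of homogeneous morphisms
from `X` to `Z` of total reduced degree `r`, where the reduced degree of `a` is `|a|' = |a| - 1`. -/
inductive IsPath (G : GradingDatum Y) : Q.Ob → Q.Ob → Y → List Q.Tot → Prop
  | nil (X : Q.Ob) : IsPath G X X 0 []
  | cons {X W Z : Q.Ob} {d r : Y} {l : List Q.Tot} (a : Q.Hom X W d) (h : IsPath G W Z r l) :
      IsPath G X Z (d - G.fromInt 1 + r) (Q.inc X W d a :: l)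

/-- The operator `a ↦ (-1)^{|a|'} a`. -/
def sgn (G : GradingDatum Y) : Q.Tot →ₗ[K] Q.Tot :=
  DirectSum.lmap fun l =>
    if G.parity l.deg = 1 then LinearMap.id else -LinearMap.id

/-- The projection to the part where `|a|'` is even. -/
def evenPart (G : GradingDatum Y) : Q.Tot →ₗ[K] Q.Tot :=
  DirectSum.lmap fun l =>
    if G.parity l.deg = 1 then LinearMap.id else 0

/-- The projection to the part where `|a|'` is odd. -/
def oddPart (G : GradingDatum Y) : Q.Tot →ₗ[K] Q.Tot :=
  DirectSum.lmap fun l =>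
    if G.parity l.deg = 1 then 0 else LinearMap.id

open Classical in
/-- The projection to the morphisms with source `X`. -/
def srcPart (X : Q.Ob) : Q.Tot →ₗ[K] Q.Tot :=
  DirectSum.lmap fun l => if l.src = X then LinearMap.id else 0

open Classical in
/-- The projection to the morphisms with target `X`. -/
def tgtPart (X : Q.Ob) : Q.Tot →ₗ[K] Q.Tot :=
  DirectSum.lmap fun l => if l.tgt = X then LinearMap.id else 0

/-- Families of multilinear operations `φˢ` on the morphism spaces, `s ≥ 0`. Only the values on
composable words matter. -/
abbrev Cochain : Type _ := Q.T →ₗ[K] Q.Tot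

/-- `(a₁,…,aₛ) ↦ ∑ (-1)^{ε_j} φ(a₁,…,ψ(a_{j+1},…),a_{k+1},…,aₛ)`, `ε_j = |a₁|' + ⋯ + |a_j|'`:
the operation `ψ` (of odd reduced degree) is inserted in `φ` in all possible ways. -/
def insertSum (G : GradingDatum Y) {M : Type*} [AddCommGroup M] [Module K M] (φ : Q.T →ₗ[K] M)
    (ψ : Q.Cochain) : List Q.Tot → M :=
  splitSum₃ fun p q r => φ (word K (p.map (Q.sgn G) ++ ψ (word K q) :: r))

end GQuiver

/-- An `A∞` category over `K`, graded by the grading datum `G`. The structure maps `μˢ` are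
multilinear maps on composable sequences of morphisms; they are collected in one linear map on the
tensor algebra, extended by zero to words that are not composable. -/
structure AInfCat (K : Type uK) [Field K] {Y : Type uY} [AddCommGroup Y] (G : GradingDatum Y)
    extends GQuiver.{uK, uY, uO, uH} K Y where
  μ : toGQuiver.Cochain
  /-- there is no `μ⁰` -/
  μ_one : μ 1 = 0
  /-- `μˢ` maps `hom(X₀,X₁) ⊗ ⋯ ⊗ hom(Xₛ₋₁,Xₛ)` to `hom(X₀,Xₛ)`, with degree `2 - s` -/
  μ_mem : ∀ (X Z : Ob) (r : Y) (l : List toGQuiver.Tot), l ≠ [] → toGQuiver.IsPath G X Z r l →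
    μ (word K l) ∈ LinearMap.range (toGQuiver.inc X Z (r + G.fromInt 2))
  μ_of_not_composable : ∀ (p q : List toGQuiver.Tot) (X W W' Z : Ob) (d d' : Y)
    (a : Hom X W d) (b : Hom W' Z d'), W ≠ W' →
    μ (word K (p ++ toGQuiver.inc X W d a :: toGQuiver.inc W' Z d' b :: q)) = 0
  /-- the `A∞` relations `μ ∘ μ = 0` -/
  μ_μ : ∀ (X Z : Ob) (r : Y) (l : List toGQuiver.Tot), toGQuiver.IsPath G X Z r l →
    toGQuiver.insertSum G μ μ l = 0

/-- An `A∞` functor. Again the maps `Fˢ` are collected in one linear map on the tensor algebra and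
extended by zero to words that are not composable. -/
structure AInfFunctor {K : Type uK} [Field K] {Y : Type uY} [AddCommGroup Y] {G : GradingDatum Y}
    (C : AInfCat.{uK, uY, uO, uH} K G) (D : AInfCat.{uK, uY, uO', uH'} K G) where
  obj : C.Ob → D.Ob
  F : C.T →ₗ[K] D.Tot
  /-- there is no `F⁰` -/
  F_one : F 1 = 0
  /-- `Fˢ` maps `hom(X₀,X₁) ⊗ ⋯ ⊗ hom(Xₛ₋₁,Xₛ)` to `hom(FX₀,FXₛ)`, with degree `1 - s` -/
  F_mem : ∀ (X Z : C.Ob) (r : Y) (l : List C.Tot), l ≠ [] → C.IsPath G X Z r l →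
    F (word K l) ∈ LinearMap.range (D.inc (obj X) (obj Z) (r + G.fromInt 1))
  F_of_not_composable : ∀ (p q : List C.Tot) (X W W' Z : C.Ob) (d d' : Y)
    (a : C.Hom X W d) (b : C.Hom W' Z d'), W ≠ W' →
    F (word K (p ++ C.inc X W d a :: C.inc W' Z d' b :: q)) = 0
  /-- `∑ μ(F(a₁,…),F(…),…,F(…,aₛ)) = ∑ (-1)^{ε_j} F(a₁,…,μ(a_{j+1},…),…,aₛ)` -/
  F_μ : ∀ (X Z : C.Ob) (r : Y) (l : List C.Tot), C.IsPath G X Z r l →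
    ((parts l).map fun P => D.μ (word K (P.map fun m => F (word K m)))).sum =
      C.insertSum G F C.μ l

/-! ## Operations on Hochschild chains

Hochschild chains `a₀[a₁|…|aₛ]` are the elements `a₀ ⊗ a₁ ⊗ ⋯ ⊗ aₛ` of the tensor algebra with
`s ≥ 0` and `(a₀,…,aₛ)` cyclically composable. -/

namespace GQuiver

variable {K : Type uK} [Field K] {Y : Type uY} [AddCommGroup Y]
  (Q : GQuiver.{uK, uY, uO, uH} K Y) (G : GradingDatum Y)

/-- The chains of degree `y`: spanned by the cyclically composable words `a₀[a₁|…|aₛ]` of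
homogeneous morphisms with `|a₀|' + ⋯ + |aₛ|' + 1 = y`. -/
def chains (y : Y) : Submodule K Q.T :=
  Submodule.span K {w | ∃ (X : Q.Ob) (l : List Q.Tot), l ≠ [] ∧
    Q.IsPath G X X (y - G.fromInt 1) l ∧ w = word K l}

/-- The values of `t` on words. -/
def rotateFun : List Q.Tot → Q.T :=
  splitSum fun p => onOne fun a =>
    word K (Q.evenPart G a :: p) + word K (Q.oddPart G a :: p.map (Q.sgn G))

theorem rotateFun_isML : IsML K (Q.rotateFun G) := by
  refine IsML.splitSum (fun r => ?_) (fun p => ?_)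
  · match r with
    | [] => exact IsML.zero
    | [a] => exact (IsML.word.cons _).add ((IsML.word.cons _).map _)
    | _ :: _ :: _ => exact IsML.zero
  · have h (p' : List Q.Tot) (φ : Q.Tot →ₗ[K] Q.Tot) :
        IsLinearMap K fun a => word K (φ a :: p') :=
      ((IsML.word [] p').mk' _ ∘ₗ φ).isLinear
    exact IsML.onOne ((h p (Q.evenPart G)).add' (h (p.map (Q.sgn G)) (Q.oddPart G)))

/-- The cyclic rotation `t(a₀[a₁|…|aₛ]) = (-1)^{|aₛ|' ε} aₛ[a₀|…|aₛ₋₁]`, where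
`ε = |a₀|' + ⋯ + |aₛ₋₁|'`. -/
def t : Q.T →ₗ[K] Q.T := linExt (Q.rotateFun G) (Q.rotateFun_isML G)

/-- The values of `brace` on words. -/
def braceFun {M : Type*} [AddCommGroup M] [Module K M] (P : ℕ → List Q.Tot → M)
    (hP : ∀ i, IsML K (P i)) (l : List Q.Tot) : M :=
  ∑ i ∈ range l.length, linExt (P i) (hP i) (((Q.t G) ^ i) (word K l))

/-- The brace notation: sum over all cyclic rotations `tⁱ`, `0 ≤ i ≤ s`, of a chain
`a₀[a₁|…|aₛ]`, where `P i` collects the terms of a formula in which `a₀`, which is now in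
position `i`, lands underneath the brace. -/
def brace {M : Type*} [AddCommGroup M] [Module K M] (P : ℕ → List Q.Tot → M)
    (hP : ∀ i, IsML K (P i)) : Q.T →ₗ[K] M :=
  linExt (Q.braceFun G P hP) <| by
    refine IsML.sumLength
      (f := fun i l => linExt (P i) (hP i) (((Q.t G) ^ i) (word K l))) range fun i => ?_
    exact (IsML.word.lcomp ((Q.t G) ^ i)).lcomp (linExt (P i) (hP i))

section Operations

variable {Q}

theorem IsML.insert₃ {M : Type*} [AddCommGroup M] [Module K M] {f : List Q.Tot → M}
    (hf : IsML K f) (ψ : Q.Cochain) :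
    IsML K (splitSum₃ fun p q r => f (p.map (Q.sgn G) ++ ψ (word K q) :: r)) := by
  refine IsML.splitSum₃ (fun q r => ?_) (fun p r => ?_) (fun p q => ?_)
  · exact (hf.append_right (ψ (word K q) :: r)).map (Q.sgn G)
  · exact hf.insert (IsML.word.lcomp ψ) _ r
  · exact (hf.append_left (p.map (Q.sgn G))).cons (ψ (word K q))

/-- `∑ μ(a₀,…,aⱼ)[aⱼ₊₁|…|aₛ]`, with a brace over `a₀,…,aⱼ`: the terms in which `a₀` is in
position `i` after the rotation. -/
def bOuter (μ : Q.Cochain) (i : ℕ) : List Q.Tot → Q.T :=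
  splitSum fun p r => if i < p.length then word K (μ (word K p) :: r) else 0

theorem bOuter_isML (μ : Q.Cochain) (i : ℕ) : IsML K (bOuter μ i) := by
  refine IsML.splitSum (fun r => ?_) (fun p => ?_)
  · exact IsML.iteLength (fun n => i < n) (IsML.word.insert (IsML.word.lcomp μ) [] r)
  · exact IsML.iteLength (fun _ => i < p.length) (IsML.word.cons _)

/-- `∑ (-1)^{ε_j} a₀[…|μ(aⱼ₊₁,…,aₖ)|…|aₛ]`, where `ε_j = |a₀|' + ⋯ + |aⱼ|'`. -/
def bInner (μ : Q.Cochain) : List Q.Tot → Q.T :=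
  splitSum₃ fun p q r =>
    if p ≠ [] then word K (p.map (Q.sgn G) ++ μ (word K q) :: r) else 0

theorem bInner_isML (μ : Q.Cochain) : IsML K (bInner G μ) := by
  have hw : IsML K (word K : List Q.Tot → Q.T) := IsML.word
  refine IsML.splitSum₃ (fun q r => ?_) (fun p r => ?_) (fun p q => ?_)
  · have := IsML.iteLength (fun n => n ≠ 0)
      ((hw.append_right (μ (word K q) :: r)).map (Q.sgn G))
    simpa [List.length_eq_zero_iff] using this
  · exact IsML.iteLength (fun _ => p ≠ []) (hw.insert (hw.lcomp μ) _ r)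
  · exact IsML.iteLength (fun _ => p ≠ [])
      ((hw.append_left (p.map (Q.sgn G))).cons (μ (word K q)))

/-- The Hochschild differential `b(a₀[a₁|…|aₛ]) =
∑ μ(a₀,…,aⱼ)[aⱼ₊₁|…|aₛ] + ∑ (-1)^{ε_j} a₀[…|μ(aⱼ₊₁,…,aₖ)|…|aₛ]`, the first sum with a brace
over `a₀,…,aⱼ`. -/
def hochschildB (μ : Q.Cochain) : Q.T →ₗ[K] Q.T :=
  Q.brace G (bOuter μ) (bOuter_isML μ) + linExt (bInner G μ) (bInner_isML G μ)

/-- The terms of `bOneOne` in which `a₀` is in position `i` after the rotation. -/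
def bOneOneFun (μ φ : Q.Cochain) (i : ℕ) : List Q.Tot → Q.T :=
  splitSum₄ fun p q r s =>
    if p.length + q.length ≤ i ∧ i < p.length + q.length + r.length then
      word K (μ (word K (p.map (Q.sgn G) ++ φ (word K q) :: r)) :: s) else 0

theorem bOneOneFun_isML (μ φ : Q.Cochain) (i : ℕ) : IsML K (bOneOneFun G μ φ i) := by
  have hw : IsML K (word K : List Q.Tot → Q.T) := IsML.word
  have hf (s : List Q.Tot) : IsML K fun l => word K (μ (word K l) :: s) :=
    hw.insert (hw.lcomp μ) [] s
  refine IsML.splitSum₄ (fun q r s => ?_) (fun p r s => ?_) (fun p q s => ?_) (fun p q r => ?_)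
  · exact IsML.iteLength (fun n => n + q.length ≤ i ∧ i < n + q.length + r.length)
      (((hf s).append_right (φ (word K q) :: r)).map (Q.sgn G))
  · exact IsML.iteLength (fun n => p.length + n ≤ i ∧ i < p.length + n + r.length)
      ((hf s).insert (hw.lcomp φ) _ r)
  · exact IsML.iteLength (fun n => p.length + q.length ≤ i ∧ i < p.length + q.length + n)
      (((hf s).append_left (p.map (Q.sgn G))).cons (φ (word K q)))
  · exact IsML.iteLength (fun _ => p.length + q.length ≤ i ∧ i < p.length + q.length + r.length)
      (hw.cons _)

/-- The operation `b^{1|1}(φ | a₀[a₁|…|aₛ]) =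
∑ (-1)^{ε_j} μ(a₀,…,φ(aⱼ₊₁,…),…,aₖ)[aₖ₊₁|…|aₛ]` for a cochain `φ` of degree two. The brace is
over the inputs of `μ` to the right of `φ`; there may be no input of `μ` to the left of `φ`. -/
def bOneOne (μ φ : Q.Cochain) : Q.T →ₗ[K] Q.T :=
  Q.brace G (bOneOneFun G μ φ) (bOneOneFun_isML G μ φ)

/-- `a ↦ e_X ⊗ a` for morphisms `a` with source `X`. -/
def unitTensor (e : Q.Ob → Q.Tot) : Q.Tot →ₗ[K] Q.T :=
  DirectSum.toModule K (Label Q.Ob Y) Q.T fun l =>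
    LinearMap.mulLeft K (TensorAlgebra.ι K (e l.src)) ∘ₗ TensorAlgebra.ι K ∘ₗ
      Q.inc l.src l.tgt l.deg

/-- The values of `prependUnit` on words. -/
def prependUnitFun (e : Q.Ob → Q.Tot) : List Q.Tot → Q.T
  | [] => 0
  | a :: p => unitTensor e a * word K p

theorem prependUnitFun_isML (e : Q.Ob → Q.Tot) : IsML K (prependUnitFun e) := fun p q => by
  have hw : IsML K (word K : List Q.Tot → Q.T) := IsML.word
  match p with
  | [] => exact (LinearMap.mulRight K (word K q) ∘ₗ unitTensor e).isLinear
  | a :: p => exact (hw p q).lcomp (LinearMap.mulLeft K (unitTensor e a))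

/-- `(a₀,…,aₛ) ↦ e[a₀|…|aₛ]`, where `e` is the unit at the source of `a₀`. -/
def prependUnit (e : Q.Ob → Q.Tot) : Q.T →ₗ[K] Q.T :=
  linExt (prependUnitFun e) (prependUnitFun_isML e)

/-- The Connes differential `B(a₀[a₁|…|aₛ]) = e[a₀|…|aₛ]`, with a brace over `a₀,…,aₛ`. -/
def connesB (e : Q.Ob → Q.Tot) : Q.T →ₗ[K] Q.T :=
  Q.brace G (fun _ l => prependUnit e (word K l)) fun _ => IsML.word.lcomp (prependUnit e)

/-- The terms of `connesBOneOne` in which `a₀` is in position `i` after the rotation. -/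
def connesBOneOneFun (e : Q.Ob → Q.Tot) (φ : Q.Cochain) (i : ℕ) : List Q.Tot → Q.T :=
  splitSum₃ fun p q r =>
    if p.length + q.length ≤ i then
      prependUnit e (word K (p.map (Q.sgn G) ++ φ (word K q) :: r)) else 0

theorem connesBOneOneFun_isML (e : Q.Ob → Q.Tot) (φ : Q.Cochain) (i : ℕ) :
    IsML K (connesBOneOneFun G e φ i) := by
  have hw : IsML K (word K : List Q.Tot → Q.T) := IsML.word
  have hf := hw.lcomp (prependUnit e)
  refine IsML.splitSum₃ (fun q r => ?_) (fun p r => ?_) (fun p q => ?_)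
  · exact IsML.iteLength (fun n => n + q.length ≤ i)
      ((hf.append_right (φ (word K q) :: r)).map (Q.sgn G))
  · exact IsML.iteLength (fun n => p.length + n ≤ i) (hf.insert (hw.lcomp φ) _ r)
  · exact IsML.iteLength (fun _ => p.length + q.length ≤ i)
      ((hf.append_left (p.map (Q.sgn G))).cons (φ (word K q)))

/-- The operation `B^{1|1}(φ | a₀[a₁|…|aₛ]) = ∑ (-1)^{ε_j} e[a₀|…|φ(aⱼ₊₁,…)|…|aₛ]` for a cochain
`φ` of degree two. The brace is over the letters to the right of `φ`; there may be no letter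
between `e` and `φ`. -/
def connesBOneOne (e : Q.Ob → Q.Tot) (φ : Q.Cochain) : Q.T →ₗ[K] Q.T :=
  Q.brace G (connesBOneOneFun G e φ) (connesBOneOneFun_isML G e φ)

variable {Q' : GQuiver.{uK, uY, uO', uH'} K Y}

/-- The terms of `pushforward` in which `a₀` is in position `i` after the rotation. -/
def pushforwardFun (F : Q.T →ₗ[K] Q'.Tot) (i : ℕ) : List Q.Tot → Q'.T :=
  splitSum fun p r =>
    if i < p.length then
      ((parts r).map fun P => word K (F (word K p) :: P.map fun m => F (word K m))).sum else 0

theorem pushforwardFun_isML (F : Q.T →ₗ[K] Q'.Tot) (i : ℕ) : IsML K (pushforwardFun F i) := by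
  have hw : IsML K (word K : List Q.Tot → Q.T) := IsML.word
  have hw' : IsML K (word K : List Q'.Tot → Q'.T) := IsML.word
  refine IsML.splitSum (fun r => ?_) (fun p => ?_)
  · refine IsML.iteLength (fun n => i < n) ?_
    generalize parts r = S
    induction S with
    | nil => exact IsML.zero
    | cons P S ih =>
      simp only [List.map_cons, List.sum_cons]
      exact (hw'.insert (hw.lcomp F) [] _).add ih
  · exact IsML.iteLength (fun _ => i < p.length) (IsML.parts (hw'.cons _) (hw.lcomp F))

/-- The map `F_*(a₀[a₁|…|aₛ]) = ∑ F(a₀,…)[F(…)|…|F(…,aₛ)]` with a brace over the inputs of the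
first `F`. -/
def pushforward (F : Q.T →ₗ[K] Q'.Tot) : Q.T →ₗ[K] Q'.T :=
  Q.brace G (pushforwardFun F) (pushforwardFun_isML F)

end Operations

/-! ## Adjoining strict units -/

/-- The quiver of `C⁺`: a morphism `e⁺` of degree zero is added at every object. -/
abbrev plus : GQuiver.{uK, uY, uO, max uK uH} K Y where
  Ob := Q.Ob
  Hom X Z y := Q.Hom X Z y × (PLift (X = Z ∧ y = 0) →₀ K)

/-- The morphism `e⁺` at the object `X`. -/
def ePlus (X : Q.Ob) : Q.plus.Tot :=
  Q.plus.inc X X 0 (0, Finsupp.single ⟨⟨rfl, rfl⟩⟩ 1)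

/-- The inclusion of the morphisms of `C` in those of `C⁺`. -/
def toPlus : Q.Tot →ₗ[K] Q.plus.Tot :=
  DirectSum.lmap fun _ : Label Q.Ob Y => LinearMap.inl K _ _

/-- The projection from the morphisms of `C⁺` to those of `C`, with `e⁺ ↦ 0`. -/
def ofPlus : Q.plus.Tot →ₗ[K] Q.Tot :=
  DirectSum.lmap fun _ : Label Q.Ob Y => LinearMap.fst K _ _

/-- The projection `a₁ ⊗ ⋯ ⊗ aₛ ↦ ofPlus a₁ ⊗ ⋯ ⊗ ofPlus aₛ`. -/
def wordsOfPlus : Q.plus.T →ₐ[K] Q.T :=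
  TensorAlgebra.lift K (TensorAlgebra.ι K ∘ₗ Q.ofPlus)

/-- The coefficients of the morphisms `e⁺`. -/
def ePlusCoeff : Q.plus.Tot →ₗ[K] (Q.Ob →₀ K) :=
  DirectSum.toModule K (Label Q.Ob Y) _ fun l =>
    Finsupp.lsingle l.src ∘ₗ Finsupp.linearCombination K (fun _ => (1 : K)) ∘ₗ LinearMap.snd K _ _

/-- The part of `μ²` on `C⁺` that involves `e⁺`: `μ²(e⁺, a) = a` and `μ²(a, e⁺) = (-1)^{|a|} a`. -/
def unitProduct : Q.plus.Tot →ₗ[K] Q.plus.Tot →ₗ[K] Q.plus.Tot :=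
  Finsupp.linearCombination K (fun X : Q.Ob => Q.plus.srcPart X) ∘ₗ Q.ePlusCoeff +
  (Finsupp.linearCombination K
    (fun X : Q.Ob => -(Q.plus.sgn G ∘ₗ Q.toPlus ∘ₗ Q.ofPlus ∘ₗ Q.plus.tgtPart X)) ∘ₗ
      Q.ePlusCoeff).flip

variable {Q}

/-- The structure maps of `C⁺`: those of `C`, extended by `μˢ(…, e⁺, …) = 0` for `s ≠ 2`,
`μ²(e⁺, a) = a` and `μ²(a, e⁺) = (-1)^{|a|} a`. -/
def μPlus (μ : Q.Cochain) : Q.plus.Cochain :=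
  Q.toPlus ∘ₗ μ ∘ₗ Q.wordsOfPlus.toLinearMap +
  linExt (onTwo fun a b => Q.unitProduct G a b) (IsML.onTwo (Q.unitProduct G))

variable {Q' : GQuiver.{uK, uY, uO', uH'} K Y}

/-- The extension of a functor to `C⁺ → D⁺`: `F¹(e⁺) = e⁺` and `Fˢ(…, e⁺, …) = 0` for `s ≥ 2`. -/
def FPlus (obj : Q.Ob → Q'.Ob) (F : Q.T →ₗ[K] Q'.Tot) : Q.plus.T →ₗ[K] Q'.plus.Tot :=
  Q'.toPlus ∘ₗ F ∘ₗ Q.wordsOfPlus.toLinearMap +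
  linExt (onOne (Finsupp.linearCombination K (fun X : Q.Ob => Q'.ePlus (obj X)) ∘ₗ Q.ePlusCoeff))
    (IsML.onOne (LinearMap.isLinear _))

variable (Q)

/-- The span of the degenerate elements of the chains of `C⁺`: the words `a₀[a₁|…|aₛ]` with
`aᵢ = e⁺` for some `i > 0`, and the words `e⁺[]` of length zero. -/
def degenerate : Submodule K Q.plus.T :=
  Submodule.span K ({w | ∃ (a : Q.plus.Tot) (p q : List Q.plus.Tot) (X : Q.Ob),
      w = word K (a :: p ++ Q.ePlus X :: q)} ∪
    {w | ∃ X : Q.Ob, w = word K [Q.ePlus X]})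

end GQuiver

/-! ## Bases of the morphism spaces -/

/-- A choice of homogeneous bases of all morphism spaces. -/
structure HomBases {K : Type uK} [Field K] {Y : Type uY} (Q : GQuiver.{uK, uY, uO, uH} K Y) where
  idx : Q.Ob → Q.Ob → Y → Type uH
  basis : ∀ X Z y, Module.Basis (idx X Z y) K (Q.Hom X Z y)

namespace HomBases

variable {K : Type uK} [Field K] {Y : Type uY} [AddCommGroup Y]
  {Q : GQuiver.{uK, uY, uO, uH} K Y} (𝓑 : HomBases Q)

/-- The basis of the sum of all morphism spaces. -/
def tot : Module.Basis (Σ l : Label Q.Ob Y, 𝓑.idx l.src l.tgt l.deg) K Q.Tot :=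
  DFinsupp.basis fun l => 𝓑.basis l.src l.tgt l.deg

/-- The induced basis of `⨁ₛ Tot^{⊗ s}` by words in the basis elements. -/
def words : Module.Basis (FreeMonoid (Σ l : Label Q.Ob Y, 𝓑.idx l.src l.tgt l.deg)) K Q.T :=
  𝓑.tot.tensorAlgebra

/-- The bases of the morphism spaces of `C⁺`, obtained by adding the elements `e⁺`. -/
def plus : HomBases Q.plus where
  idx X Z y := ULift.{max uK uH} (𝓑.idx X Z y ⊕ PLift (X = Z ∧ y = 0))
  basis X Z y := ((𝓑.basis X Z y).prod Finsupp.basisSingleOne).reindex Equiv.ulift.symm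

end HomBases

/-! ## Negative cyclic homology -/

namespace AInfCat

variable {K : Type uK} [Field K] {Y : Type uY} [AddCommGroup Y] {G : GradingDatum Y}
  (C : AInfCat.{uK, uY, uO, uH} K G)

/-- The space `⨁ₛ (Tot C⁺)^{⊗ s}`, which contains the Hochschild chains of `C⁺`. -/
abbrev ChainsPlus : Type _ := C.plus.T

/-- The differential `b` on the chains of `C⁺`. -/
def b : C.ChainsPlus →ₗ[K] C.ChainsPlus := GQuiver.hochschildB G (GQuiver.μPlus G C.μ)

/-- The Connes differential `B` on the chains of `C⁺`. -/
def B : C.ChainsPlus →ₗ[K] C.ChainsPlus := GQuiver.connesB G C.ePlus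

/-- Laurent series `∑ₙ αₙ uⁿ` with coefficients in the chains of `C⁺`. -/
abbrev Series : Type _ := ℤ → C.ChainsPlus

/-- The operator `b + uB`. -/
def d : C.Series →ₗ[K] C.Series :=
  LinearMap.pi fun n => C.b ∘ₗ LinearMap.proj n + C.B ∘ₗ LinearMap.proj (n - 1)

/-- The series `∑ₙ αₙ uⁿ` of degree `y` (where `|u| = 2`) with `αₙ = 0` for `n < p`. -/
def seriesFrom (p : ℤ) (y : Y) : Submodule K C.Series where
  carrier := {α | (∀ n, α n ∈ C.plus.chains G (y - G.fromInt (2 * n))) ∧ ∀ n < p, α n = 0}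
  add_mem' := fun hα hβ => ⟨fun n => Submodule.add_mem _ (hα.1 n) (hβ.1 n),
    fun n hn => by simp [hα.2 n hn, hβ.2 n hn]⟩
  zero_mem' := ⟨fun _ => Submodule.zero_mem _, fun _ _ => rfl⟩
  smul_mem' := fun c _ hα => ⟨fun n => Submodule.smul_mem _ c (hα.1 n),
    fun n hn => by simp [hα.2 n hn]⟩

/-- The series with degenerate coefficients. -/
def degenerateSeries : Submodule K C.Series :=
  Submodule.pi Set.univ fun _ => C.degenerate

/-- Representatives of cocycles of degree `y` in the complex `uᵖ CC⁻(C)`. This is the complex of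
series in `uᵖ K[[u]]` with coefficients in the quotient of the chains of `C⁺` by the degenerate
elements, with the differential `b + uB`; a series is a cocycle there if its differential has
degenerate coefficients. -/
def cocycles (p : ℤ) (y : Y) : Submodule K C.Series :=
  C.seriesFrom p y ⊓ C.degenerateSeries.comap C.d

/-- Representatives of coboundaries of degree `y` in the complex `uᵖ CC⁻(C)`. -/
def coboundaries (p : ℤ) (y : Y) : Submodule K C.Series :=
  (C.seriesFrom p (y - G.fromInt 1)).map C.d ⊔ C.degenerateSeries

/-- The degree `y` part of the cohomology of `uᵖ CC⁻(C)`, which is `uᵖ HC⁻(C)`. -/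
abbrev HC (p : ℤ) (y : Y) : Type _ :=
  C.cocycles p y ⧸ (C.coboundaries p y).comap (C.cocycles p y).subtype

/-- The negative cyclic homology `HC⁻(C)` in degree `y`. -/
abbrev HCneg (y : Y) : Type _ := C.HC 0 y

variable {k : Type*} [Field k] [Algebra k K]

/-- The Hochschild cochain `v(μ)`: the derivation acts on the entries of the matrix of the
structure maps of `C⁺`. -/
def vμ (𝓑 : HomBases C.toGQuiver) (v : Derivation k K K) : C.plus.Cochain :=
  matrixDer v 𝓑.plus.words 𝓑.plus.tot (GQuiver.μPlus G C.μ)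

/-- The Getzler–Gauss–Manin connection
`∇_v(α) = v(α) - u⁻¹ b^{1|1}(v(μ) | α) - B^{1|1}(v(μ) | α)` on series. -/
def connection (𝓑 : HomBases C.toGQuiver) (v : Derivation k K K) (α : C.Series) : C.Series :=
  fun n => coeffDer v 𝓑.plus.words (α n)
    - GQuiver.bOneOne G (GQuiver.μPlus G C.μ) (C.vμ 𝓑 v) (α (n + 1))
    - GQuiver.connesBOneOne G C.ePlus (C.vμ 𝓑 v) (α n)

end AInfCat

section Induced

variable {K : Type uK} [Field K] {Y : Type uY} [AddCommGroup Y] {G : GradingDatum Y}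
  {C : AInfCat.{uK, uY, uO, uH} K G} {D : AInfCat.{uK, uY, uO', uH'} K G}

/-- The map `F_*` on series, given by the extension of `F` to `C⁺ → D⁺`. -/
def AInfFunctor.pushforwardSeries (F : AInfFunctor C D) (α : C.Series) : D.Series :=
  fun n => GQuiver.pushforward G (GQuiver.FPlus F.obj F.F) (α n)

/-- `T` maps cocycles to cocycles, and `f` is the map that it induces on cohomology. -/
def Induces (T : C.Series → D.Series) {p q : ℤ} {y z : Y} (f : C.HC p y → D.HC q z) : Prop :=
  ∀ α : C.cocycles p y, ∃ h : T α ∈ D.cocycles q z,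
    f (Submodule.Quotient.mk α) = Submodule.Quotient.mk ⟨T α, h⟩

end Induced

end

noncomputable section

open DirectSum Finset

set_option linter.unusedSectionVars false
set_option linter.checkUnivs false

universe u v w uK uY uO uH uO' uH'

/-! ## Sums over cuttings of a word -/

section SplitSum

variable {A A' M N : Type*} [AddCommGroup M] [AddCommGroup N]

@[simp]
theorem splitSum_nil (k : List A → List A → M) : splitSum k [] = k [] [] := by
  simp [splitSum]

theorem splitSum_cons (k : List A → List A → M) (x : A) (l : List A) :
    splitSum k (x :: l) = k [] (x :: l) + splitSum (fun p q => k (x :: p) q) l := by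
  simp only [splitSum, List.length_cons]
  rw [sum_range_succ']
  simp [add_comm]

theorem splitSum_congr {k k' : List A → List A → M} {l : List A}
    (h : ∀ p q, p ++ q = l → k p q = k' p q) : splitSum k l = splitSum k' l :=
  sum_congr rfl fun _ _ => h _ _ (List.take_append_drop _ _)

theorem splitSum_add (k k' : List A → List A → M) (l : List A) :
    splitSum (fun p q => k p q + k' p q) l = splitSum k l + splitSum k' l :=
  sum_add_distrib

theorem splitSum_sub (k k' : List A → List A → M) (l : List A) :
    splitSum (fun p q => k p q - k' p q) l = splitSum k l - splitSum k' l :=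
  sum_sub_distrib _ _

theorem splitSum_neg (k : List A → List A → M) (l : List A) :
    splitSum (fun p q => -k p q) l = -splitSum k l :=
  sum_neg_distrib _

theorem map_splitSum {F : Type*} [FunLike F M N] [AddMonoidHomClass F M N] (φ : F)
    (k : List A → List A → M) (l : List A) :
    φ (splitSum k l) = splitSum (fun p q => φ (k p q)) l :=
  map_sum φ _ _

theorem splitSum_zsmul (n : ℤ) (k : List A → List A → M) (l : List A) :
    splitSum (fun p q => n • k p q) l = n • splitSum k l :=
  smul_sum.symm

theorem splitSum_eq_zero {k : List A → List A → M} {l : List A}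
    (h : ∀ p q, p ++ q = l → k p q = 0) : splitSum k l = 0 :=
  sum_eq_zero fun _ _ => h _ _ (List.take_append_drop _ _)

theorem splitSum_map (σ : A → A') (k : List A' → List A' → M) (l : List A) :
    splitSum k (l.map σ) = splitSum (fun p q => k (p.map σ) (q.map σ)) l := by
  simp [splitSum]

theorem splitSum_comm (k : List A → List A → List A' → List A' → M) (l : List A) (l' : List A') :
    splitSum (fun p q => splitSum (fun r s => k p q r s) l') l =
      splitSum (fun r s => splitSum (fun p q => k p q r s) l) l' :=
  sum_comm

theorem splitSum_append_cons (k : List A → List A → M) (u : List A) (x : A) (m : List A) :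
    splitSum k (u ++ x :: m) = splitSum (fun u₁ u₂ => k u₁ (u₂ ++ x :: m)) u +
      splitSum (fun m₁ m₂ => k (u ++ x :: m₁) m₂) m := by
  induction u generalizing k with
  | nil => simp [splitSum_cons]
  | cons c u ih => simp [splitSum_cons, ih, add_assoc]

theorem splitSum_concat (k : List A → List A → M) (u : List A) (x : A) :
    splitSum k (u ++ [x]) = splitSum (fun u₁ u₂ => k u₁ (u₂ ++ [x])) u + k (u ++ [x]) [] := by
  rw [splitSum_append_cons, splitSum_nil]

theorem splitSum_assoc (k : List A → List A → List A → M) (l : List A) :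
    splitSum (fun p r => splitSum (fun p₁ p₂ => k p₁ p₂ r) p) l =
      splitSum (fun p₁ s => splitSum (fun p₂ r => k p₁ p₂ r) s) l := by
  induction l generalizing k with
  | nil => simp
  | cons x l ih =>
    rw [splitSum_cons, splitSum_cons]
    simp only [splitSum_nil, splitSum_cons, splitSum_add]
    rw [ih (fun p₁ p₂ r => k (x :: p₁) p₂ r)]
    abel

theorem splitSum_eq_left {k : List A → List A → M} {l : List A}
    (h : ∀ p q, p ++ q = l → p ≠ [] → k p q = 0) : splitSum k l = k [] l := by
  cases l with
  | nil => simp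
  | cons x l =>
    rw [splitSum_cons, splitSum_eq_zero, add_zero]
    intro p q hpq
    exact h _ _ (by simp [hpq]) (by simp)

theorem splitSum_eq_right {k : List A → List A → M} {l : List A}
    (h : ∀ p q, p ++ q = l → q ≠ [] → k p q = 0) : splitSum k l = k l [] := by
  rcases l.eq_nil_or_concat with rfl | ⟨u, x, rfl⟩
  · simp
  · rw [List.concat_eq_append] at h ⊢
    rw [splitSum_concat, splitSum_eq_zero, zero_add]
    intro p q hpq
    exact h _ _ (by simp [← hpq]) (by simp)

theorem list_sum_map_splitSum {ι : Type*} (S : List ι) (k : ι → List A → List A → M) (l : List A) :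
    (S.map fun i => splitSum (k i) l).sum = splitSum (fun p q => (S.map fun i => k i p q).sum) l := by
  induction S with
  | nil => simp [splitSum]
  | cons i S ih => simp [ih, splitSum_add]

end SplitSum

/-! ## The convolution ring -/

/-- Functions on words, with the convolution product. -/
@[ext]
structure Conv (A E : Type*) where
  toFun : List A → E

namespace Conv

variable {A A' E : Type*} [Ring E]

instance : CoeFun (Conv A E) fun _ => List A → E := ⟨toFun⟩

theorem toFun_injective : Function.Injective (toFun : Conv A E → List A → E) := fun _ _ => Conv.ext

theorem ext' {f g : Conv A E} (h : ∀ l, f l = g l) : f = g := Conv.ext (funext h)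

@[simp] theorem mk_apply (f : List A → E) (l : List A) : (⟨f⟩ : Conv A E) l = f l := rfl

instance : Zero (Conv A E) := ⟨⟨0⟩⟩
instance : Add (Conv A E) := ⟨fun f g => ⟨fun l => f l + g l⟩⟩
instance : Neg (Conv A E) := ⟨fun f => ⟨fun l => -f l⟩⟩
instance : Sub (Conv A E) := ⟨fun f g => ⟨fun l => f l - g l⟩⟩
instance : SMul ℕ (Conv A E) := ⟨fun n f => ⟨fun l => n • f l⟩⟩
instance : SMul ℤ (Conv A E) := ⟨fun n f => ⟨fun l => n • f l⟩⟩
instance : Mul (Conv A E) := ⟨fun f g => ⟨splitSum fun p q => f p * g q⟩⟩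
instance : One (Conv A E) := ⟨⟨fun l => match l with | [] => 1 | _ => 0⟩⟩

instance : AddCommGroup (Conv A E) :=
  toFun_injective.addCommGroup _ rfl (fun _ _ => rfl) (fun _ => rfl) (fun _ _ => rfl)
    (fun _ _ => rfl) fun _ _ => rfl

theorem mul_apply (f g : Conv A E) (l : List A) : (f * g) l = splitSum (fun p q => f p * g q) l :=
  rfl

@[simp] theorem one_nil : (1 : Conv A E) [] = 1 := rfl

@[simp] theorem one_cons (x : A) (l : List A) : (1 : Conv A E) (x :: l) = 0 := rfl

@[simp] theorem add_apply (f g : Conv A E) (l : List A) : (f + g) l = f l + g l := rfl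

@[simp] theorem sub_apply (f g : Conv A E) (l : List A) : (f - g) l = f l - g l := rfl

@[simp] theorem neg_apply (f : Conv A E) (l : List A) : (-f) l = -f l := rfl

@[simp] theorem zero_apply (l : List A) : (0 : Conv A E) l = 0 := rfl

@[simp] theorem zsmul_apply (n : ℤ) (f : Conv A E) (l : List A) : (n • f) l = n • f l := rfl

theorem one_of_ne_nil {l : List A} (h : l ≠ []) : (1 : Conv A E) l = 0 := by
  cases l with
  | nil => exact absurd rfl h
  | cons => rfl

instance : Ring (Conv A E) where
  __ := (inferInstance : AddCommGroup (Conv A E))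
  mul_assoc f g h := by
    refine ext' fun l => ?_
    simp only [mul_apply, splitSum, Finset.sum_mul, Finset.mul_sum]
    have := splitSum_assoc (fun p q r => f p * g q * h r) l
    simpa only [splitSum, mul_assoc] using this
  one_mul f := by
    refine ext' fun l => ?_
    rw [mul_apply, splitSum_eq_left]
    · simp
    · intro p q _ hp; simp [one_of_ne_nil hp]
  mul_one f := by
    refine ext' fun l => ?_
    rw [mul_apply, splitSum_eq_right]
    · simp
    · intro p q _ hp; simp [one_of_ne_nil hp]
  left_distrib f g h := by
    refine ext' fun l => ?_
    simp only [mul_apply, add_apply, mul_add, splitSum_add]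
  right_distrib f g h := by
    refine ext' fun l => ?_
    simp only [mul_apply, add_apply, add_mul, splitSum_add]
  zero_mul f := by refine ext' fun l => ?_; simp [mul_apply, splitSum]
  mul_zero f := by refine ext' fun l => ?_; simp [mul_apply, splitSum]

/-- Composition with a ring homomorphism on the values. -/
def mapRing {E' : Type*} [Ring E'] (s : E →+* E') : Conv A E →+* Conv A E' where
  toFun f := ⟨fun l => s (f l)⟩
  map_one' := by
    refine ext' fun l => ?_
    cases l with
    | nil => exact map_one s
    | cons x l => exact map_zero s
  map_mul' f g := by
    refine ext' fun l => ?_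
    simp only [mul_apply, map_splitSum, map_mul]
  map_zero' := by refine ext' fun l => ?_; exact map_zero s
  map_add' f g := by refine ext' fun l => ?_; exact map_add s _ _

@[simp] theorem mapRing_apply {E' : Type*} [Ring E'] (s : E →+* E') (f : Conv A E) (l : List A) :
    mapRing s f l = s (f l) := rfl

/-- Composition with a map of letters. -/
def comap (σ : A → A') : Conv A' E →+* Conv A E where
  toFun f := ⟨fun l => f (l.map σ)⟩
  map_one' := by refine ext' fun l => ?_; cases l <;> rfl
  map_mul' f g := by refine ext' fun l => ?_; simp only [mul_apply, splitSum_map]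
  map_zero' := rfl
  map_add' _ _ := rfl

@[simp] theorem comap_apply (σ : A → A') (f : Conv A' E) (l : List A) :
    comap σ f l = f (l.map σ) := rfl

/-- The functions that vanish on all words with a given property. -/
def Van (P : List A → Prop) (f : Conv A E) : Prop := ∀ l, P l → f l = 0

end Conv

/-- A property of words that is inherited by subwords. -/
structure IsInfix {A : Type*} (P : List A → Prop) : Prop where
  left : ∀ p q, P (p ++ q) → P p
  right : ∀ p q, P (p ++ q) → P q

namespace Conv

variable {A A' E : Type*} [Ring E]

theorem Van.mul_left {P : List A → Prop} (hP : IsInfix P) {f : Conv A E} (g : Conv A E)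
    (hf : Van P f) : Van P (g * f) := fun l hl =>
  splitSum_eq_zero (k := fun p q => g p * f q) fun p q h => by rw [hf q (hP.right p q (h ▸ hl)), mul_zero]

theorem Van.mul_right {P : List A → Prop} (hP : IsInfix P) {f : Conv A E} (g : Conv A E)
    (hf : Van P f) : Van P (f * g) := fun l hl =>
  splitSum_eq_zero (k := fun p q => f p * g q) fun p q h => by rw [hf p (hP.left p q (h ▸ hl)), zero_mul]

theorem Van.add {P : List A → Prop} {f g : Conv A E} (hf : Van P f) (hg : Van P g) :
    Van P (f + g) := fun l hl => by rw [add_apply, hf l hl, hg l hl, add_zero]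

theorem Van.zsmul {P : List A → Prop} {f : Conv A E} (n : ℤ) (hf : Van P f) :
    Van P (n • f) := fun l hl => by rw [zsmul_apply, hf l hl, smul_zero]

end Conv

/-! ## Maps that send a word to a sum of words -/

section Blocks

variable {A A' M N : Type*} [AddCommGroup M] [AddCommGroup N]

/-- Sum the values of `f` over a family of words that depends on `l`. -/
def bsum (B : List A → List (List A')) (f : List A' → M) (l : List A) : M :=
  ((B l).map f).sum

theorem bsum_congr {B : List A → List (List A')} {f g : List A' → M} {l : List A}
    (h : ∀ P ∈ B l, f P = g P) : bsum B f l = bsum B g l := by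
  rw [bsum, bsum, List.map_congr_left h]

theorem bsum_add (B : List A → List (List A')) (f g : List A' → M) (l : List A) :
    bsum B (fun P => f P + g P) l = bsum B f l + bsum B g l := by
  simp [bsum, List.sum_map_add]

theorem bsum_zero (B : List A → List (List A')) (l : List A) :
    bsum B (fun _ => (0 : M)) l = 0 := by
  simp [bsum]

theorem map_bsum {F : Type*} [FunLike F M N] [AddMonoidHomClass F M N] (φ : F)
    (B : List A → List (List A')) (f : List A' → M) (l : List A) :
    φ (bsum B f l) = bsum B (fun P => φ (f P)) l := by
  rw [bsum, map_list_sum, List.map_map]; rfl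

theorem bsum_zsmul (n : ℤ) (B : List A → List (List A')) (f : List A' → M) (l : List A) :
    bsum B (fun P => n • f P) l = n • bsum B f l :=
  (map_bsum (zsmulAddGroupHom (α := M) n) B f l).symm

theorem bsum_splitSum (B : List A → List (List A')) (k : List A' → List A → List A → M)
    (l l' : List A) :
    bsum B (fun P => splitSum (k P) l') l = splitSum (fun p q => bsum B (fun P => k P p q) l) l' :=
  list_sum_map_splitSum _ _ _

theorem bsum_comm (B : List A → List (List A')) (k : List A' → List A' → M) (l l' : List A) :
    bsum B (fun P => bsum B (fun Q => k P Q) l') l =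
      bsum B (fun Q => bsum B (fun P => k P Q) l) l' := by
  simp only [bsum]
  induction B l with
  | nil => simp
  | cons P S ih => simp [ih, List.sum_map_add]

/-- The assignment `B` extends to a morphism of coalgebras (for the deconcatenation of words). -/
structure IsCoalg (B : List A → List (List A')) : Prop where
  split : ∀ {M : Type w} [AddCommGroup M] (k : List A' → List A' → M) (l : List A),
    bsum B (splitSum k) l = splitSum (fun p q => bsum B (fun p' => bsum B (k p') q) p) l
  nil : B [] = [[]]
  ne_nil : ∀ l, l ≠ [] → [] ∉ B l

theorem IsCoalg.bsum_nil {B : List A → List (List A')} (hB : IsCoalg.{w} B) (f : List A' → M) :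
    bsum B f [] = f [] := by
  simp [bsum, hB.nil]

/-- The identity. -/
def idBlocks (l : List A) : List (List A) := [l]

@[simp]
theorem bsum_idBlocks (f : List A → M) (l : List A) : bsum idBlocks f l = f l := by
  simp [bsum, idBlocks]

theorem isCoalg_idBlocks : IsCoalg.{w} (idBlocks : List A → List (List A)) where
  split k l := by simp
  nil := rfl
  ne_nil l hl := by simpa [idBlocks] using hl.symm

theorem sum_parts_cons (a : A) (l : List A) (g : List (List A) → M) :
    ((parts (a :: l)).map g).sum =
      splitSum (fun p q => ((parts q).map fun Q => g ((a :: p) :: Q)).sum) l := by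
  induction l generalizing a g with
  | nil => simp [parts]
  | cons c l ih =>
    rw [parts, splitSum_cons, ih c fun Q => g ([a] :: Q)]
    have hflat : ∀ (S : List (List (List A))) (h : List (List A) → List (List (List A))),
        ((S.flatMap h).map g).sum = (S.map fun P => ((h P).map g).sum).sum := by
      intro S h
      induction S with
      | nil => rfl
      | cons P S ih => simp [ih]
    rw [hflat, ih c, ← splitSum_add]
    refine splitSum_congr fun p q _ => ?_
    rw [← List.sum_map_add]
    simp

/-- The blocks of a word, with a function of words applied to each of them. -/
def partsBlocks (F : List A → A') (l : List A) : List (List A') :=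
  (parts l).map fun P => P.map F

theorem bsum_partsBlocks (F : List A → A') (f : List A' → M) (l : List A) :
    bsum (partsBlocks F) f l = ((parts l).map fun P => f (P.map F)).sum := by
  simp [bsum, partsBlocks, Function.comp_def]

@[simp]
theorem bsum_partsBlocks_nil (F : List A → A') (f : List A' → M) :
    bsum (partsBlocks F) f [] = f [] := by
  simp [bsum, partsBlocks, parts]

theorem bsum_partsBlocks_cons (F : List A → A') (f : List A' → M) (a : A) (l : List A) :
    bsum (partsBlocks F) f (a :: l) =
      splitSum (fun p q => bsum (partsBlocks F) (fun Q => f (F (a :: p) :: Q)) q) l := by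
  rw [bsum_partsBlocks, sum_parts_cons]
  simp [bsum_partsBlocks]

theorem mem_parts_ne_nil {l : List A} (hl : l ≠ []) : ∀ P ∈ parts l, P ≠ [] := by
  cases l with
  | nil => exact absurd rfl hl
  | cons a l =>
    intro P hP
    simp only [parts, List.mem_flatMap] at hP
    obtain ⟨Q, -, hQ⟩ := hP
    rcases Q with _ | ⟨b, Q⟩
    · simp at hQ; simp [hQ]
    · simp at hQ; rcases hQ with rfl | rfl <;> simp

theorem isCoalg_partsBlocks (F : List A → A') : IsCoalg.{w} (partsBlocks F) where
  split {M} _ k l := by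
    have key : ∀ (n : ℕ) (l : List A), l.length ≤ n → ∀ k : List A' → List A' → M,
        bsum (partsBlocks F) (splitSum k) l =
          splitSum (fun p q => bsum (partsBlocks F) (fun p' => bsum (partsBlocks F) (k p') q) p)
            l := by
      intro n
      induction n with
      | zero =>
        intro l hl k
        obtain rfl : l = [] := by simpa using hl
        simp
      | succ n ih =>
        intro l hl k
        rcases l with _ | ⟨a, l⟩
        · simp
        rw [bsum_partsBlocks_cons, splitSum_cons, bsum_partsBlocks_nil]
        simp only [splitSum_cons, bsum_add, splitSum_add, bsum_partsBlocks_cons]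
        congr 1
        rw [splitSum_assoc]
        refine splitSum_congr fun p q h => ?_
        refine ih q ?_ _
        simp only [← h, List.length_cons, List.length_append] at hl
        omega
    exact key _ l le_rfl k
  nil := by simp [partsBlocks, parts]
  ne_nil l hl h := by
    simp only [partsBlocks, List.mem_map, List.map_eq_nil_iff] at h
    obtain ⟨P, hP, rfl⟩ := h
    exact mem_parts_ne_nil hl _ hP rfl

/-! ## Insertion operations -/

/-- The values of `f` on the words obtained by inserting `ψ` in all possible ways, applying `B` to
the letters on both sides, and `ς` to the letters on the left; the weight `w` is a function of the
letters on the right of `ψ`. -/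
def insOp (c : List A → ℤ) (B : List A → List (List A')) (ς : A' → A') (ψ : List A → A')
    (f : List A' → M) : List A → M :=
  splitSum₃ fun p q r =>
    c r • bsum B (fun p' => bsum B (fun r' => f (p'.map ς ++ ψ q :: r')) r) p

theorem map_insOp {F : Type*} [FunLike F M N] [AddMonoidHomClass F M N] (φ : F)
    (c : List A → ℤ) (B : List A → List (List A')) (ς : A' → A') (ψ : List A → A')
    (f : List A' → M) (l : List A) :
    φ (insOp c B ς ψ f l) = insOp c B ς ψ (fun P => φ (f P)) l := by
  simp only [insOp, splitSum₃, map_splitSum (N := N), map_zsmul, map_bsum (N := N)]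

theorem insOp_add (c : List A → ℤ) (B : List A → List (List A')) (ς : A' → A') (ψ : List A → A')
    (f g : List A' → M) (l : List A) :
    insOp c B ς ψ (fun P => f P + g P) l = insOp c B ς ψ f l + insOp c B ς ψ g l := by
  simp only [insOp, splitSum₃, splitSum_add, smul_add, bsum_add]

theorem insOp_congr {c : List A → ℤ} {B : List A → List (List A')} {ς : A' → A'}
    {ψ : List A → A'} {f g : List A' → M} {l : List A}
    (h : ∀ p q r, p ++ (q ++ r) = l → ∀ p' ∈ B p, ∀ r' ∈ B r,
      f (p'.map ς ++ ψ q :: r') = g (p'.map ς ++ ψ q :: r')) :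
    insOp c B ς ψ f l = insOp c B ς ψ g l := by
  unfold insOp splitSum₃
  refine splitSum_congr fun p s hs => splitSum_congr fun q r hr => ?_
  subst hr
  exact congrArg _ (bsum_congr fun p' hp' => bsum_congr fun r' hr' => h p q r hs p' hp' r' hr')

end Blocks

namespace Conv

variable {A A' : Type*} {E : Type w} [Ring E]

/-- The pullback along a morphism of coalgebras, as a ring homomorphism. -/
def pull {B : List A → List (List A')} (hB : IsCoalg.{w} B) : Conv A' E →+* Conv A E where
  toFun f := ⟨bsum B f⟩
  map_one' := by
    refine ext' fun l => ?_
    rcases l with _ | ⟨a, l⟩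
    · exact hB.bsum_nil (1 : Conv A' E)
    · refine (bsum_congr (g := fun _ => (0 : E)) ?_).trans (bsum_zero _ _)
      intro P hP
      refine one_of_ne_nil (E := E) ?_
      rintro rfl
      exact hB.ne_nil _ (by simp) hP
  map_mul' f g := by
    refine ext' fun l => ?_
    rw [mul_apply]
    refine (hB.split (fun p q => f p * g q) l).trans (splitSum_congr fun p q _ => ?_)
    have h (p' : List A') : bsum B (fun q' => f p' * g q') q = f p' * bsum B g q :=
      (map_bsum (AddMonoidHom.mulLeft (f p')) B g q).symm
    simp only [h]
    exact (map_bsum (AddMonoidHom.mulRight (bsum B g q)) B f p).symm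
  map_zero' := by refine ext' fun l => ?_; exact bsum_zero B l
  map_add' f g := by refine ext' fun l => ?_; exact bsum_add B f g l

theorem pull_apply {B : List A → List (List A')} (hB : IsCoalg.{w} B) (f : Conv A' E)
    (l : List A) : pull hB f l = bsum B f l := rfl

/-- Multiplication with an integer that depends on the word. -/
def weight (c : List A → ℤ) (f : Conv A E) : Conv A E := ⟨fun l => c l • f l⟩

theorem weight_apply (c : List A → ℤ) (f : Conv A E) (l : List A) :
    weight c f l = c l • f l := rfl

theorem weight_mul {c : List A → ℤ} (hc : ∀ p q, c (p ++ q) = c p + c q) (f g : Conv A E) :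
    weight c (f * g) = weight c f * g + f * weight c g := by
  refine ext' fun l => ?_
  simp only [weight_apply, mul_apply, add_apply, ← splitSum_zsmul, ← splitSum_add]
  refine splitSum_congr fun p q h => ?_
  rw [← h, hc, add_smul, smul_mul_assoc, mul_smul_comm]

/-- `insOp` on the convolution ring. -/
def ins (c : List A → ℤ) (B : List A → List (List A')) (ς : A' → A') (ψ : List A → A')
    (f : Conv A' E) : Conv A E := ⟨insOp c B ς ψ f⟩

theorem ins_apply (c : List A → ℤ) (B : List A → List (List A')) (ς : A' → A') (ψ : List A → A')
    (f : Conv A' E) (l : List A) : ins c B ς ψ f l = insOp c B ς ψ f l := rfl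

theorem ins_mul_aux {B : List A → List (List A')} (hB : IsCoalg.{w} B) (c : List A → ℤ)
    (ς : A' → A') (ψ : List A → A') (f g : Conv A' E) (l : List A) :
    ins c B ς ψ (f * g) l = (pull hB (comap ς f) * ins c B ς ψ g) l +
      splitSum₃ (fun p q r => c r • splitSum (fun r₁ r₂ =>
        bsum B (fun p' => bsum B (fun r' => f (p'.map ς ++ ψ q :: r')) r₁) p * bsum B g r₂) r)
        l := by
  have hl (x : E) (h : List A' → E) (m : List A) :
      bsum B (fun q' => x * h q') m = x * bsum B h m :=
    (map_bsum (AddMonoidHom.mulLeft x) B h m).symm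
  have hr (x : E) (h : List A' → E) (m : List A) :
      bsum B (fun q' => h q' * x) m = bsum B h m * x :=
    (map_bsum (AddMonoidHom.mulRight x) B h m).symm
  have e : ∀ p' x r', (f * g) (p'.map ς ++ x :: r') =
      splitSum (fun u v => f (u.map ς) * g (v.map ς ++ x :: r')) p' +
        splitSum (fun u v => f (p'.map ς ++ x :: u) * g v) r' := by
    intro p' x r'
    rw [mul_apply, splitSum_append_cons, splitSum_map]
  simp only [ins_apply, insOp, splitSum₃, e, bsum_add, smul_add, splitSum_add]
  congr 1
  · have e1 : ∀ p q r, bsum B (fun p' => bsum B (fun r' =>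
        splitSum (fun u v => f (u.map ς) * g (v.map ς ++ ψ q :: r')) p') r) p =
        splitSum (fun p₁ p₂ => bsum B (fun u => f (u.map ς)) p₁ *
          bsum B (fun v => bsum B (fun r' => g (v.map ς ++ ψ q :: r')) r) p₂) p := by
      intro p q r
      have : ∀ p', bsum B (fun r' =>
          splitSum (fun u v => f (u.map ς) * g (v.map ς ++ ψ q :: r')) p') r =
          splitSum (fun u v => f (u.map ς) * bsum B (fun r' => g (v.map ς ++ ψ q :: r')) r) p' := by
        intro p'
        simp only [← hl]
        exact list_sum_map_splitSum _ _ _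
      simp only [this]
      rw [show (fun p' => splitSum (fun u v => f (u.map ς) *
        bsum B (fun r' => g (v.map ς ++ ψ q :: r')) r) p') = splitSum (fun u v => f (u.map ς) *
        bsum B (fun r' => g (v.map ς ++ ψ q :: r')) r) from rfl, hB.split]
      simp only [hl, hr]
    simp only [e1, ← splitSum_zsmul]
    refine (splitSum_congr fun p s _ => splitSum_comm (fun q r p₁ p₂ => c r •
      (bsum B (fun u => f (u.map ς)) p₁ *
        bsum B (fun v => bsum B (fun r' => g (v.map ς ++ ψ q :: r')) r) p₂)) s p).trans ?_
    rw [splitSum_assoc (fun p₁ p₂ s => splitSum (fun q r => c r • (bsum B (fun u => f (u.map ς)) p₁ *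
          bsum B (fun v => bsum B (fun r' => g (v.map ς ++ ψ q :: r')) r) p₂)) s), mul_apply]
    refine splitSum_congr fun p s _ => ?_
    rw [pull_apply, ins_apply, insOp, splitSum₃]
    have hmul (x : E) (k : List A → List A → E) (m : List A) :
      x * splitSum k m = splitSum (fun u v => x * k u v) m := map_splitSum (AddMonoidHom.mulLeft x) k m
    simp only [hmul, mul_smul_comm]
    rfl
  · refine splitSum_congr fun p s _ => splitSum_congr fun q r _ => ?_
    congr 1
    have : ∀ p' : List A', bsum B (fun r' => splitSum (fun u v => f (List.map ς p' ++ ψ q :: u) * g v) r') r =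
        splitSum (fun r₁ r₂ => bsum B (fun u => f (p'.map ς ++ ψ q :: u)) r₁ * bsum B g r₂) r := by
      intro p'
      refine (hB.split (fun u v => f (p'.map ς ++ ψ q :: u) * g v) r).trans ?_
      simp only [hl, hr]
    simp only [this]
    rw [bsum_splitSum]
    simp only [hr]

theorem ins_one_mul {B : List A → List (List A')} (hB : IsCoalg.{w} B)
    (ς : A' → A') (ψ : List A → A') (f g : Conv A' E) :
    ins (fun _ => 1) B ς ψ (f * g) =
      pull hB (comap ς f) * ins (fun _ => 1) B ς ψ g + ins (fun _ => 1) B ς ψ f * pull hB g := by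
  refine ext' fun l => ?_
  rw [ins_mul_aux hB, add_apply]
  congr 1
  have hmul (x : E) (k : List A → List A → E) (m : List A) :
    splitSum k m * x = splitSum (fun u v => k u v * x) m := map_splitSum (AddMonoidHom.mulRight x) k m
  simp only [one_smul, splitSum₃, mul_apply, ins_apply, insOp, hmul, pull_apply]
  rw [splitSum_assoc]
  refine splitSum_congr fun p s _ => ?_
  rw [splitSum_assoc]

theorem ins_weight_mul {B : List A → List (List A')} (hB : IsCoalg.{w} B) {c : List A → ℤ}
    (hc : ∀ p q, c (p ++ q) = c p + c q)
    (ς : A' → A') (ψ : List A → A') (f g : Conv A' E) :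
    ins c B ς ψ (f * g) =
      pull hB (comap ς f) * ins c B ς ψ g + ins c B ς ψ f * pull hB g +
        ins (fun _ => 1) B ς ψ f * weight c (pull hB g) := by
  refine ext' fun l => ?_
  rw [ins_mul_aux hB, add_assoc, add_apply, add_apply]
  congr 1
  have hmul (x : E) (k : List A → List A → E) (m : List A) :
    splitSum k m * x = splitSum (fun u v => k u v * x) m := map_splitSum (AddMonoidHom.mulRight x) k m
  simp only [one_smul, splitSum₃, mul_apply, ins_apply, insOp, hmul, pull_apply, weight_apply,
    ← splitSum_zsmul]
  rw [splitSum_assoc, splitSum_assoc, ← splitSum_add]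
  refine splitSum_congr fun p s _ => ?_
  rw [splitSum_assoc, splitSum_assoc, ← splitSum_add]
  refine splitSum_congr fun q r _ => ?_
  rw [← splitSum_add]
  refine splitSum_congr fun r₁ r₂ h => ?_
  rw [← h, hc, add_smul, smul_mul_assoc, mul_smul_comm]

end Conv

/-! ## Words with marked letters -/

section Marked

variable {K : Type*} [Field K] {V V' M N : Type*} [AddCommGroup V] [Module K V]
  [AddCommGroup V'] [Module K V'] [AddCommGroup M] [Module K M] [AddCommGroup N] [Module K N]

/-- The number of marks in a word whose letters carry integers. -/
def cnt (l : List (V × ℤ)) : ℤ := (l.map Prod.snd).sum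

@[simp] theorem cnt_nil : cnt ([] : List (V × ℤ)) = 0 := rfl

@[simp] theorem cnt_cons (a : V × ℤ) (l : List (V × ℤ)) : cnt (a :: l) = a.2 + cnt l := by
  simp [cnt]

@[simp] theorem cnt_append (p q : List (V × ℤ)) : cnt (p ++ q) = cnt p + cnt q := by
  simp [cnt]

/-- Apply a map to all letters, keeping the marks. -/
abbrev mapLetter (σ : V → V') : V × ℤ → V' × ℤ := Prod.map σ id

@[simp] theorem cnt_map (σ : V → V') (l : List (V × ℤ)) : cnt (l.map (mapLetter σ)) = cnt l := by
  simp [cnt, Function.comp_def]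

/-- The letter `k l`, with as many marks as `l`. -/
abbrev markedLetter (k : List (V × ℤ) → V') (l : List (V × ℤ)) : V' × ℤ := (k l, cnt l)

/-- A function of marked words is multilinear if it is linear in each letter. -/
def FML (K : Type*) [Field K] {V M : Type*} [AddCommGroup V] [Module K V]
    [AddCommGroup M] [Module K M] (f : List (V × ℤ) → M) : Prop :=
  ∀ (p q : List (V × ℤ)) (n : ℤ), IsLinearMap K fun x => f (p ++ (x, n) :: q)

theorem IsLinearMap.comp' {f : V' → M} {g : V → V'} (hf : IsLinearMap K f) (hg : IsLinearMap K g) :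
    IsLinearMap K fun x => f (g x) :=
  ⟨fun x y => by rw [hg.map_add, hf.map_add], fun c x => by rw [hg.map_smul, hf.map_smul]⟩

theorem IsLinearMap.zsmul' {f : V → M} (n : ℤ) (hf : IsLinearMap K f) :
    IsLinearMap K fun x => n • f x :=
  ⟨fun x y => by rw [hf.map_add, smul_add], fun c x => by rw [hf.map_smul, smul_comm]⟩

theorem IsLinearMap.splitSum' {A : Type*} {k : V → List A → List A → M} {l : List A}
    (h : ∀ p q, p ++ q = l → IsLinearMap K fun x => k x p q) :
    IsLinearMap K fun x => splitSum (k x) l :=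
  IsLinearMap.sum' _ fun _ _ => h _ _ (List.take_append_drop _ _)

theorem IsLinearMap.bsum' {A A' : Type*} {B : List A → List (List A')} {k : V → List A' → M}
    {l : List A} (h : ∀ P ∈ B l, IsLinearMap K fun x => k x P) :
    IsLinearMap K fun x => bsum B (k x) l := by
  simp only [bsum]
  generalize B l = S at h ⊢
  induction S with
  | nil => exact isLinearMap_zero
  | cons P S ih =>
    simp only [List.map_cons, List.sum_cons]
    exact (h P (by simp)).add' (ih fun P' h' => h P' (by simp [h']))

namespace FML

theorem zero : FML K (fun _ : List (V × ℤ) => (0 : M)) := fun _ _ _ => isLinearMap_zero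

theorem add {f g : List (V × ℤ) → M} (hf : FML K f) (hg : FML K g) : FML K fun l => f l + g l :=
  fun p q n => (hf p q n).add' (hg p q n)

theorem lcomp {f : List (V × ℤ) → M} (hf : FML K f) (L : M →ₗ[K] N) : FML K fun l => L (f l) :=
  fun p q n => (hf p q n).lcomp L

theorem zsmul {f : List (V × ℤ) → M} (m : ℤ) (hf : FML K f) : FML K fun l => m • f l :=
  fun p q n => (hf p q n).zsmul' m

theorem neg {f : List (V × ℤ) → M} (hf : FML K f) : FML K fun l => -f l := by
  simpa using hf.zsmul (-1)

theorem sub {f g : List (V × ℤ) → M} (hf : FML K f) (hg : FML K g) : FML K fun l => f l - g l := by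
  simpa only [sub_eq_add_neg] using hf.add hg.neg

theorem cons {f : List (V × ℤ) → M} (hf : FML K f) (a : V × ℤ) : FML K fun l => f (a :: l) :=
  fun p q n => hf (a :: p) q n

theorem append_left {f : List (V × ℤ) → M} (hf : FML K f) (r : List (V × ℤ)) :
    FML K fun l => f (r ++ l) := fun p q n => by simpa using hf (r ++ p) q n

theorem append_right {f : List (V × ℤ) → M} (hf : FML K f) (r : List (V × ℤ)) :
    FML K fun l => f (l ++ r) := fun p q n => by simpa using hf p (q ++ r) n

theorem map {f : List (V' × ℤ) → M} (hf : FML K f) (φ : V →ₗ[K] V') :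
    FML K fun l : List (V × ℤ) => f (l.map (mapLetter φ)) := fun p q n => by
  simpa using (hf (p.map (mapLetter φ)) (q.map (mapLetter φ)) n).comp' φ.isLinear

theorem weight {f : List (V × ℤ) → M} (hf : FML K f) : FML K fun l => cnt l • f l :=
  fun p q n => by simpa using (hf p q n).zsmul' (cnt p + (n + cnt q))

theorem insert {f : List (V' × ℤ) → M} (hf : FML K f) {k : List (V × ℤ) → V'} (hk : FML K k)
    (p q : List (V' × ℤ)) : FML K fun l => f (p ++ markedLetter k l :: q) := fun p' q' n => by
  simpa [markedLetter] using (hf p q (cnt p' + (n + cnt q'))).comp' (hk p' q' n)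

theorem splitSum {f : List (V × ℤ) → List (V × ℤ) → M} (h₁ : ∀ r, FML K fun l => f l r)
    (h₂ : ∀ r, FML K fun l => f r l) : FML K (splitSum f) := fun p q n => by
  simp only [splitSum_append_cons]
  refine IsLinearMap.add' (IsLinearMap.splitSum' fun u v _ => ?_)
    (IsLinearMap.splitSum' fun u v _ => ?_)
  · exact h₂ u v q n
  · exact h₁ v p u n

theorem bsum {A A' : Type*} {B : List A → List (List A')} {f : List A' → List (V × ℤ) → M}
    (hf : ∀ P, FML K (f P)) (l : List A) : FML K fun l' => bsum B (fun P => f P l') l :=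
  fun p q n => IsLinearMap.bsum' fun P _ => hf P p q n

theorem bsum_partsBlocks {f : List (V' × ℤ) → M} (hf : FML K f) {k : List (V × ℤ) → V'}
    (hk : FML K k) : FML K (_root_.bsum (partsBlocks (markedLetter k)) f) := by
  have key : ∀ (m : ℕ) (p : List (V × ℤ)), p.length ≤ m → ∀ {f : List (V' × ℤ) → M}, FML K f →
      ∀ (q : List (V × ℤ)) (n : ℤ),
        IsLinearMap K fun x => _root_.bsum (partsBlocks (markedLetter k)) f (p ++ (x, n) :: q) := by
    intro m
    induction m with
    | zero =>
      intro p hp f hf q n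
      obtain rfl : p = [] := by simpa using hp
      simp only [List.nil_append, bsum_partsBlocks_cons]
      refine IsLinearMap.splitSum' fun u v _ => IsLinearMap.bsum' fun Q _ => ?_
      exact (hf.insert hk [] Q) [] u n
    | succ m ih =>
      intro p hp f hf q n
      rcases p with _ | ⟨a, p⟩
      · exact ih [] (by simp) hf q n
      simp only [List.cons_append, bsum_partsBlocks_cons, splitSum_append_cons]
      refine IsLinearMap.add' (IsLinearMap.splitSum' fun u v h => ?_)
        (IsLinearMap.splitSum' fun u v _ => IsLinearMap.bsum' fun Q _ => ?_)
      · refine ih v ?_ (hf.cons _) q n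
        simp only [List.length_cons, ← h, List.length_append] at hp
        omega
      · exact (hf.insert hk [] Q) (a :: p) u n
  exact fun p q n => key p.length p le_rfl hf q n

end FML

/-! ### The universal multilinear function -/

/-- The extension of a function of marked words to words in the letters `∑ vₙ tⁿ`. -/
def extFun : (f : List (V × ℤ) → M) → List (ℤ →₀ V) → M
  | f, [] => f []
  | f, x :: l => x.sum fun n v => extFun (fun l' => f ((v, n) :: l')) l

theorem extFun_single (f : List (V × ℤ) → M) (hf : FML K f) (l : List (V × ℤ)) :
    extFun f (l.map fun a => Finsupp.single a.2 a.1) = f l := by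
  induction l generalizing f with
  | nil => rfl
  | cons a l ih =>
    have h0 : extFun (fun l' => f ((0, a.2) :: l')) (l.map fun a => Finsupp.single a.2 a.1) = 0 := by
      rw [ih _ (hf.cons _)]
      exact (hf [] l a.2).map_zero
    rw [List.map_cons, extFun, Finsupp.sum_single_index h0, ih _ (hf.cons _)]

theorem extFun_isLinearMap {W : Type*} [AddCommGroup W] [Module K W] {f : W → List (V × ℤ) → M}
    (hf : ∀ l, IsLinearMap K fun x => f x l) (l : List (ℤ →₀ V)) :
    IsLinearMap K fun x => extFun (f x) l := by
  induction l generalizing f with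
  | nil => exact hf []
  | cons y l ih =>
    simp only [extFun, Finsupp.sum]
    exact IsLinearMap.sum' _ fun n _ => ih fun l' => hf _

theorem extFun_isML {f : List (V × ℤ) → M} (hf : FML K f) : IsML K (extFun f) := by
  intro p q
  induction p generalizing f with
  | nil =>
    have hl : ∀ n, IsLinearMap K fun v => extFun (fun l' => f ((v, n) :: l')) q := fun n =>
      extFun_isLinearMap (fun l => hf [] l n) q
    have : (fun x : ℤ →₀ V => extFun f ([] ++ x :: q)) =
        Finsupp.lsum K fun n => (hl n).mk' _ := by
      funext x; rfl
    rw [this]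
    exact LinearMap.isLinear _
  | cons y p ih =>
    simp only [List.cons_append, extFun, Finsupp.sum]
    exact IsLinearMap.sum' _ fun n _ => ih (hf.cons _)

/-- The word with letters `lt n v` for given linear maps `lt n` to an algebra. -/
def algWord {R : Type*} [Ring R] [Algebra K R] (lt : ℤ → V →ₗ[K] R) (l : List (V × ℤ)) : R :=
  (l.map fun a => lt a.2 a.1).prod

theorem FML.algWord {R : Type*} [Ring R] [Algebra K R] (lt : ℤ → V →ₗ[K] R) :
    FML K (algWord lt) := fun p q n => by
  refine ⟨fun x y => ?_, fun c x => ?_⟩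
  · simp [_root_.algWord, add_mul, mul_add]
  · simp [_root_.algWord]

/-- The letters of the universal multilinear function of marked words. -/
def univLetter (K V : Type*) [Field K] [AddCommGroup V] [Module K V] (n : ℤ) :
    V →ₗ[K] TensorAlgebra K (ℤ →₀ V) :=
  TensorAlgebra.ι K ∘ₗ Finsupp.lsingle n

theorem exists_eq_algWord {f : List (V × ℤ) → M} (hf : FML K f) :
    ∃ L : TensorAlgebra K (ℤ →₀ V) →ₗ[K] M, ∀ l, f l = L (algWord (univLetter K V) l) := by
  refine ⟨linExt (extFun f) (extFun_isML hf), fun l => ?_⟩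
  have : algWord (univLetter K V) l = word K (l.map fun a => Finsupp.single a.2 a.1) := by
    rw [word, List.map_map]; rfl
  rw [this, linExt_word, extFun_single f hf]

/-! ### Operations on functions of marked words -/

/-- Insert the letter `k q` for a subword `q` in all possible ways, apply `B` to the letters on both
sides, and `ς` to those on the left. -/
def insL (B : List (V × ℤ) → List (List (V' × ℤ))) (ς : V' → V') (k : List (V × ℤ) → V')
    (f : List (V' × ℤ) → M) : List (V × ℤ) → M :=
  insOp (fun _ => 1) B (mapLetter ς) (markedLetter k) f

/-- The same as `insL`, for insertions on the left of the mark. -/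
def insH (B : List (V × ℤ) → List (List (V' × ℤ))) (ς : V' → V') (k : List (V × ℤ) → V')
    (f : List (V' × ℤ) → M) : List (V × ℤ) → M :=
  insOp cnt B (mapLetter ς) (markedLetter k) f

/-- Words with marked letters go to words with the same number of marks, and multilinearity is
preserved. -/
structure IsMarked (K : Type*) [Field K] {V V' : Type*} [AddCommGroup V] [Module K V]
    [AddCommGroup V'] [Module K V'] (B : List (V × ℤ) → List (List (V' × ℤ))) : Prop extends
    IsCoalg.{w} B where
  cnt_eq : ∀ l, ∀ P ∈ B l, cnt P = cnt l
  fml : ∀ {M : Type w} [AddCommGroup M] [Module K M] {f : List (V' × ℤ) → M}, FML K f →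
    FML K (bsum B f)

theorem isMarked_idBlocks : IsMarked.{w} K (idBlocks : List (V × ℤ) → _) where
  toIsCoalg := isCoalg_idBlocks
  cnt_eq l P hP := by
    obtain rfl : P = l := by simpa [idBlocks] using hP
    rfl
  fml {M} _ _ f hf := by
    have : bsum idBlocks f = f := funext fun l => bsum_idBlocks f l
    rwa [this]

theorem isMarked_partsBlocks {k : List (V × ℤ) → V'} (hk : FML K k) :
    IsMarked.{w} K (partsBlocks (markedLetter k)) where
  toIsCoalg := isCoalg_partsBlocks _
  cnt_eq l P hP := by
    simp only [partsBlocks, List.mem_map] at hP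
    obtain ⟨Q, hQ, rfl⟩ := hP
    have key : ∀ (l : List (V × ℤ)), ∀ Q ∈ parts l, Q.flatten = l := by
      intro l
      induction l with
      | nil => simp [parts]
      | cons a l ih =>
        intro Q hQ
        simp only [parts, List.mem_flatMap] at hQ
        obtain ⟨P, hP, hQ⟩ := hQ
        rcases P with _ | ⟨b, P⟩
        · have := ih _ hP
          simp at hQ this; simp [hQ, this]
        · have := ih _ hP
          simp at hQ this
          rcases hQ with rfl | rfl <;> simp [this]
    rw [← key l Q hQ]
    clear hQ
    induction Q with
    | nil => simp
    | cons b Q ih => simp [ih]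
  fml hf := hf.bsum_partsBlocks hk

end Marked

section MarkedRing

variable {K : Type*} [Field K] {V V' : Type*} [AddCommGroup V] [Module K V]
  [AddCommGroup V'] [Module K V'] {M : Type w} [AddCommGroup M] [Module K M]
  {B : List (V × ℤ) → List (List (V' × ℤ))}

theorem FML.insOp {c : List (V × ℤ) → ℤ} (hc : ∀ p q n (x y : V), c (p ++ (x, n) :: q) =
    c (p ++ (y, n) :: q)) (hB : IsMarked.{w} K B) (ς : V' →ₗ[K] V') {k : List (V × ℤ) → V'}
    (hk : FML K k) {f : List (V' × ℤ) → M} (hf : FML K f) :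
    FML K (insOp c B (mapLetter ς) (markedLetter k) f) := by
  have h1 (q r : List (V × ℤ)) : FML K fun p => c r • _root_.bsum B (fun p' => _root_.bsum B
      (fun r' => f (p'.map (mapLetter ς) ++ markedLetter k q :: r')) r) p := by
    refine FML.zsmul _ (hB.fml ?_)
    exact FML.bsum (B := B) (fun P => (hf.append_right (markedLetter k q :: P)).map ς) r
  have h2 (p r : List (V × ℤ)) : FML K fun q => c r • _root_.bsum B (fun p' => _root_.bsum B
      (fun r' => f (p'.map (mapLetter ς) ++ markedLetter k q :: r')) r) p := by
    refine FML.zsmul _ ?_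
    refine FML.bsum (B := B) (fun P => ?_) p
    exact FML.bsum (B := B) (fun Q => hf.insert hk _ _) r
  have h3 (p q : List (V × ℤ)) : FML K fun r => c r • _root_.bsum B (fun p' => _root_.bsum B
      (fun r' => f (p'.map (mapLetter ς) ++ markedLetter k q :: r')) r) p := by
    have : FML K fun r => _root_.bsum B (fun p' => _root_.bsum B
        (fun r' => f (p'.map (mapLetter ς) ++ markedLetter k q :: r')) r) p :=
      FML.bsum (B := B) (fun P => hB.fml ((hf.append_left _).cons _)) p
    intro p' q' n
    refine ⟨fun x y => ?_, fun a x => ?_⟩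
    · simp only [(this p' q' n).map_add, smul_add]
      rw [hc p' q' n (x + y) 0, hc p' q' n x 0, hc p' q' n y 0]
    · simp only [(this p' q' n).map_smul]
      rw [hc p' q' n (a • x) x, smul_comm]
  refine FML.splitSum (fun s => ?_) (fun p => FML.splitSum (h2 p) (h3 p))
  intro p q n
  exact IsLinearMap.splitSum' fun u v _ => h1 u v p q n

theorem FML.insL (hB : IsMarked.{w} K B) (ς : V' →ₗ[K] V') {k : List (V × ℤ) → V'}
    (hk : FML K k) {f : List (V' × ℤ) → M} (hf : FML K f) : FML K (insL B ς k f) :=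
  FML.insOp (by simp) hB ς hk hf

theorem FML.insH (hB : IsMarked.{w} K B) (ς : V' →ₗ[K] V') {k : List (V × ℤ) → V'}
    (hk : FML K k) {f : List (V' × ℤ) → M} (hf : FML K f) : FML K (insH B ς k f) :=
  FML.insOp (by simp) hB ς hk hf

variable {R : Type w} [Ring R] [Algebra K R] (lt : ℤ → V' →ₗ[K] R)

namespace Conv

/-- The word function of an algebra, in the convolution ring. -/
def wordC : Conv (V' × ℤ) R := ⟨algWord lt⟩

/-- A one-letter function in the convolution ring. -/
def letterC {A : Type*} (k : List (A × ℤ) → V') : Conv (A × ℤ) R :=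
  ⟨fun l => lt (l.map Prod.snd).sum (k l)⟩

theorem letterC_apply (k : List (V × ℤ) → V') (l : List (V × ℤ)) :
    letterC lt k l = lt (cnt l) (k l) := rfl

/-- The projection to words with one letter. -/
def oneLetter {V : Type*} [AddCommGroup V] : List (V × ℤ) → V
  | [a] => a.1
  | _ => 0

theorem wordC_eq : wordC lt = 1 + letterC lt oneLetter * wordC lt := by
  refine ext' fun l => ?_
  rcases l with _ | ⟨a, l⟩
  · simp [wordC, algWord, mul_apply, letterC, oneLetter]
  · rw [add_apply, one_cons, zero_add, mul_apply, splitSum_cons, splitSum_eq_left]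
    · simp [wordC, algWord, letterC, oneLetter]
    · intro p q _ hp
      obtain ⟨b, p, rfl⟩ := List.exists_cons_of_ne_nil hp
      simp [letterC, oneLetter]

theorem wordC_eq' : wordC lt = 1 + wordC lt * letterC lt oneLetter := by
  refine ext' fun l => ?_
  rcases l.eq_nil_or_concat with rfl | ⟨l, a, rfl⟩
  · simp [wordC, algWord, mul_apply, letterC, oneLetter]
  · rw [List.concat_eq_append, add_apply, one_of_ne_nil (by simp), zero_add, mul_apply,
      splitSum_concat, splitSum_eq_right]
    · simp [wordC, algWord, letterC, oneLetter]
    · intro p q _ hp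
      obtain ⟨b, q, rfl⟩ := List.exists_cons_of_ne_nil hp
      simp [letterC, oneLetter]

theorem weight_cnt_mul (f g : Conv (V × ℤ) R) :
    weight cnt (f * g) = weight cnt f * g + f * weight cnt g :=
  weight_mul cnt_append f g

theorem pull_weight (hB : IsMarked.{w} K B) (f : Conv (V' × ℤ) R) :
    pull hB.toIsCoalg (weight cnt f) = weight cnt (pull hB.toIsCoalg f) := by
  refine ext' fun l => ?_
  rw [weight_apply, pull_apply, pull_apply, ← bsum_zsmul]
  exact bsum_congr fun P hP => by rw [weight_apply, hB.cnt_eq l P hP]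

theorem pull_letterC (hB : IsMarked.{w} K B) (k : List (V' × ℤ) → V') :
    pull hB.toIsCoalg (letterC lt k) = letterC lt (bsum B k) := by
  refine ext' fun l => ?_
  rw [letterC_apply, pull_apply, map_bsum]
  exact bsum_congr fun P hP => by rw [letterC_apply, hB.cnt_eq l P hP]

theorem pull_id (f : Conv (V × ℤ) R) : pull isCoalg_idBlocks f = f :=
  ext' fun l => bsum_idBlocks f l

theorem ins_wordC (hB : IsMarked.{w} K B) (c : List (V × ℤ) → ℤ) (ς : V' → V')
    (k : List (V × ℤ) → V') :
    ins c B (mapLetter ς) (markedLetter k) (wordC lt) =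
      pull hB.toIsCoalg (comap (mapLetter ς) (wordC lt)) * letterC lt k *
        weight c (pull hB.toIsCoalg (wordC lt)) := by
  refine ext' fun l => ?_
  have hw : ∀ p x r, wordC lt (p ++ x :: r) = wordC lt p * lt x.2 x.1 * wordC lt r := by
    intro p x r; simp [wordC, algWord, mul_assoc]
  have hmul (x : R) (k : List (V × ℤ) → List (V × ℤ) → R) (m : List (V × ℤ)) :
    x * splitSum k m = splitSum (fun u v => x * k u v) m := map_splitSum (AddMonoidHom.mulLeft x) k m
  have hl (x : R) (h : List (V' × ℤ) → R) (m : List (V × ℤ)) :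
      bsum B (fun q' => x * h q') m = x * bsum B h m :=
    (map_bsum (AddMonoidHom.mulLeft x) B h m).symm
  have hr (x : R) (h : List (V' × ℤ) → R) (m : List (V × ℤ)) :
      bsum B (fun q' => h q' * x) m = bsum B h m * x :=
    (map_bsum (AddMonoidHom.mulRight x) B h m).symm
  rw [mul_assoc]
  simp only [mul_apply, hmul, ins_apply, insOp, splitSum₃, hw, weight_apply, pull_apply, hl, hr,
    letterC_apply]
  refine splitSum_congr fun p s _ => splitSum_congr fun q r _ => ?_
  simp only [mul_assoc, mul_smul_comm]
  rfl

/-- The number of marks of a word into which a letter was inserted. -/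
theorem cnt_insert (hB : IsMarked.{w} K B) {k : List (V × ℤ) → V'} {ς : V' → V'}
    {p q r l : List (V × ℤ)} (h : p ++ (q ++ r) = l) {p' r' : List (V' × ℤ)} (hp : p' ∈ B p)
    (hr : r' ∈ B r) : cnt (p'.map (mapLetter ς) ++ markedLetter k q :: r') = cnt l := by
  rw [← h, cnt_append, cnt_map, cnt_cons, hB.cnt_eq p p' hp, hB.cnt_eq r r' hr]
  simp

theorem ins_letterC {U U' : Type*} [AddCommGroup U] [Module K U] [AddCommGroup U'] [Module K U']
    {B : List (U × ℤ) → List (List (U' × ℤ))} (hB : IsMarked.{w} K B) (c : List (U × ℤ) → ℤ)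
    (ς : U' → U') (k : List (U × ℤ) → U') (k' : List (U' × ℤ) → V') :
    ins c B (mapLetter ς) (markedLetter k) (letterC lt k') =
      letterC lt (insOp c B (mapLetter ς) (markedLetter k) k') := by
  have hcnt (l : List (U' × ℤ)) : letterC lt k' l = lt (cnt l) (k' l) := rfl
  refine ext' fun l => ?_
  rw [show letterC lt (insOp c B (mapLetter ς) (markedLetter k) k') l =
    lt (cnt l) (insOp c B (mapLetter ς) (markedLetter k) k' l) from rfl, map_insOp, ins_apply]
  exact insOp_congr fun p q r h p' hp r' hr => by rw [hcnt, cnt_insert hB h hp hr]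

theorem ins_weight (hB : IsMarked.{w} K B) (c : List (V × ℤ) → ℤ) (ς : V' → V')
    (k : List (V × ℤ) → V') (f : Conv (V' × ℤ) R) :
    ins c B (mapLetter ς) (markedLetter k) (weight cnt f) =
      weight cnt (ins c B (mapLetter ς) (markedLetter k) f) := by
  refine ext' fun l => ?_
  rw [weight_apply, ins_apply, ins_apply]
  refine Eq.trans ?_ (map_insOp (zsmulAddGroupHom (cnt l) : R →+ R) ..).symm
  exact insOp_congr fun p q r h p' hp r' hr => by
    rw [weight_apply, cnt_insert hB h hp hr]; rfl

theorem ins_mapRing (c : List (V × ℤ) → ℤ) (ς : V' × ℤ → V' × ℤ)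
    (k : List (V × ℤ) → V' × ℤ) (f : Conv (V' × ℤ) R) (s : R →+* R) :
    ins c B ς k (mapRing s f) = mapRing s (ins c B ς k f) :=
  ext' fun l => (map_insOp s c B ς k f l).symm

theorem pull_mapRing (hB : IsCoalg.{w} B) (f : Conv (V' × ℤ) R) (s : R →+* R) :
    pull hB (mapRing s f) = mapRing s (pull hB f) :=
  ext' fun l => (map_bsum s B f l).symm

theorem weight_mapRing (c : List (V × ℤ) → ℤ) (f : Conv (V × ℤ) R) (s : R →+* R) :
    weight c (mapRing s f) = mapRing s (weight c f) :=
  ext' fun l => (map_zsmul s (c l) (f l)).symm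

theorem weight_one (f : Conv (V × ℤ) R) : weight (fun _ => 1) f = f :=
  ext' fun _ => one_smul _ _

theorem comap_wordC {σ : V' →ₗ[K] V'} {s : R →+* R} (hs : ∀ n v, s (lt n v) = lt n (σ v)) :
    comap (mapLetter σ) (wordC lt) = mapRing s (wordC lt) := by
  refine ext' fun l => ?_
  simp only [comap_apply, mapRing_apply, wordC, algWord, map_list_prod, List.map_map]
  congr 1
  exact List.map_congr_left fun a _ => (hs _ _).symm

theorem Van.mapRing {P : List (V × ℤ) → Prop} {f : Conv (V × ℤ) R} (hf : Van P f) (s : R →+* R) :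
    Van P (mapRing s f) := fun l hl => by rw [mapRing_apply, hf l hl, map_zero]

theorem Van.weight {P : List (V × ℤ) → Prop} {f : Conv (V × ℤ) R} (hf : Van P f)
    (c : List (V × ℤ) → ℤ) : Van P (weight c f) := fun l hl => by
  rw [weight_apply, hf l hl, smul_zero]

theorem ins_one (c : List (V × ℤ) → ℤ) (ς : V' × ℤ → V' × ℤ) (k : List (V × ℤ) → V' × ℤ) :
    ins c B ς k (1 : Conv (V' × ℤ) R) = 0 := by
  refine ext' fun l => ?_
  rw [ins_apply, insOp_congr (g := fun _ => (0 : R))]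
  · simp [insOp, splitSum₃, splitSum, bsum_zero]
  · intro p q r _ p' _ r' _
    exact one_of_ne_nil (by simp)

end Conv

end MarkedRing

section RingIdentities

variable {K : Type*} [Field K] {V V' : Type*} [AddCommGroup V] [Module K V]
  [AddCommGroup V'] [Module K V'] {B : List (V × ℤ) → List (List (V' × ℤ))}
  {R : Type w} [Ring R] [Algebra K R] (lt : ℤ → V' →ₗ[K] R)

namespace Conv

theorem pull_wordC_eq (hB : IsCoalg.{w} B) : pull hB (wordC lt) =
    1 + pull hB (letterC lt oneLetter) * pull hB (wordC lt) := by
  conv_lhs => rw [wordC_eq, map_add, map_mul, map_one]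

theorem pull_wordC_eq' (hB : IsCoalg.{w} B) : pull hB (wordC lt) =
    1 + pull hB (wordC lt) * pull hB (letterC lt oneLetter) := by
  conv_lhs => rw [wordC_eq', map_add, map_mul, map_one]

theorem eq_mul_of_inv {S : Type*} [Ring S] {a x y b : S} (ha : a = 1 + a * x) (hy : y = x * y + b) :
    y = a * b := by
  have h1 : a * b = a * y - a * x * y := by
    rw [eq_sub_of_add_eq' hy.symm]; noncomm_ring
  have h2 : a * x = a - 1 := eq_sub_of_add_eq' ha.symm
  rw [h1, h2]; noncomm_ring

theorem insL_pull_wordC (hB : IsCoalg.{w} B) (σ : V × ℤ → V × ℤ) (k : List (V × ℤ) → V × ℤ) :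
    ins (fun _ => 1) idBlocks σ k (pull hB (wordC lt)) =
      comap σ (pull hB (wordC lt)) *
        (ins (fun _ => 1) idBlocks σ k (pull hB (letterC lt oneLetter)) * pull hB (wordC lt)) := by
  refine eq_mul_of_inv (x := comap σ (pull hB (letterC lt oneLetter))) ?_ ?_
  · rw [← map_mul, ← map_one (comap σ), ← map_add, ← pull_wordC_eq']
  · conv_lhs => rw [pull_wordC_eq]
    rw [show (1 + pull hB (letterC lt oneLetter) * pull hB (wordC lt) : Conv (V × ℤ) R) =
      ⟨fun l => (1 : Conv (V × ℤ) R) l + (pull hB (letterC lt oneLetter) * pull hB (wordC lt)) l⟩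
      from rfl]
    have := ins_one_mul isCoalg_idBlocks σ k (pull hB (letterC lt oneLetter)) (pull hB (wordC lt))
    rw [pull_id, pull_id] at this
    rw [← this]
    have h1 := ins_one (R := R) (B := idBlocks) (fun _ => 1) σ k
    refine ext' fun l => ?_
    have h2 := insOp_add (fun _ => 1) idBlocks σ k (1 : Conv (V × ℤ) R).toFun
      (pull hB (letterC lt oneLetter) * pull hB (wordC lt)).toFun l
    have h3 : insOp (fun _ => 1) idBlocks σ k (1 : Conv (V × ℤ) R).toFun l = 0 :=
      congrArg (fun f : Conv (V × ℤ) R => f l) h1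
    rw [h3, zero_add] at h2
    exact h2

theorem insH_pull_wordC (hB : IsCoalg.{w} B) (σ : V × ℤ → V × ℤ) (k : List (V × ℤ) → V × ℤ) :
    ins cnt idBlocks σ k (pull hB (wordC lt)) =
      comap σ (pull hB (wordC lt)) *
        (ins cnt idBlocks σ k (pull hB (letterC lt oneLetter)) * pull hB (wordC lt) +
        ins (fun _ => 1) idBlocks σ k (pull hB (letterC lt oneLetter)) *
          weight cnt (pull hB (wordC lt))) := by
  refine eq_mul_of_inv (x := comap σ (pull hB (letterC lt oneLetter))) ?_ ?_
  · rw [← map_mul, ← map_one (comap σ), ← map_add, ← pull_wordC_eq']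
  · conv_lhs => rw [pull_wordC_eq]
    rw [show (1 + pull hB (letterC lt oneLetter) * pull hB (wordC lt) : Conv (V × ℤ) R) =
      ⟨fun l => (1 : Conv (V × ℤ) R) l + (pull hB (letterC lt oneLetter) * pull hB (wordC lt)) l⟩
      from rfl]
    have := ins_weight_mul isCoalg_idBlocks cnt_append σ k (pull hB (letterC lt oneLetter))
      (pull hB (wordC lt))
    rw [pull_id, pull_id, add_assoc] at this
    rw [← this]
    have h1 := ins_one (R := R) (B := idBlocks) cnt σ k
    refine ext' fun l => ?_
    have h2 := insOp_add cnt idBlocks σ k (1 : Conv (V × ℤ) R).toFun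
      (pull hB (letterC lt oneLetter) * pull hB (wordC lt)).toFun l
    have h3 : insOp cnt idBlocks σ k (1 : Conv (V × ℤ) R).toFun l = 0 :=
      congrArg (fun f : Conv (V × ℤ) R => f l) h1
    rw [h3, zero_add] at h2
    exact h2

theorem comap_letterC {σ : V → V} {σ' : V' →ₗ[K] V'} {s : R →+* R}
    (hs : ∀ n v, s (lt n v) = lt n (σ' v)) {k : List (V × ℤ) → V'} {ε : ℤ}
    (hk : ∀ l, k (l.map (mapLetter σ)) = ε • σ' (k l)) :
    comap (mapLetter σ) (letterC lt k) = ε • mapRing s (letterC lt k) := by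
  refine ext' fun l => ?_
  rw [comap_apply, zsmul_apply, mapRing_apply, letterC_apply, letterC_apply, hs, hk, map_zsmul,
    cnt_map]

variable {lt}

section Commutator

variable {P : List (V × ℤ) → Prop} {σ : V → V} {σ' ς : V' →ₗ[K] V'} {s z : R →+* R}
    {μ : List (V × ℤ) → V} {μ' : List (V' × ℤ) → V'} {ψ : List (V × ℤ) → V'} {ε : ℤ}

theorem ins_markedLetter_wordC (hB : IsMarked.{w} K B) (c : List (V × ℤ) → ℤ)
    {ς : V' →ₗ[K] V'} {z : R →+* R} (hz : ∀ n v, z (lt n v) = lt n (ς v))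
    (ψ : List (V × ℤ) → V') :
    ins c B (mapLetter ς) (markedLetter ψ) (wordC lt) =
      mapRing z (pull hB.toIsCoalg (wordC lt)) * letterC lt ψ *
        weight c (pull hB.toIsCoalg (wordC lt)) := by
  rw [ins_wordC lt hB, comap_wordC lt hz, pull_mapRing]

theorem letterC_sub_zsmul (k k' : List (V × ℤ) → V') (ε : ℤ) :
    letterC lt (fun l => k l - ε • k' l) = letterC lt k - ε • letterC lt k' := by
  refine ext' fun l => ?_
  rw [sub_apply, zsmul_apply, letterC_apply, letterC_apply, letterC_apply, map_sub, map_zsmul]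

theorem weight_sub (c : List (V × ℤ) → ℤ) (f g : Conv (V × ℤ) R) :
    weight c (f - g) = weight c f - weight c g :=
  ext' fun l => smul_sub (c l) (f l) (g l)

theorem van_insH_insL (hP : IsInfix P) (hB : IsMarked.{w} K B)
    (hs : ∀ n v, s (lt n v) = lt n (σ' v)) (hz : ∀ n v, z (lt n v) = lt n (ς v))
    (hsz : ∀ r, s (z r) = z (s r)) (hε : ε = 1 ∨ ε = -1)
    (hσB : comap (mapLetter σ) (pull hB.toIsCoalg (wordC lt)) =
      mapRing s (pull hB.toIsCoalg (wordC lt)))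
    (hψ : ∀ l, ψ (l.map (mapLetter σ)) = ε • σ' (ψ l))
    (hμ' : ∀ l, μ' (l.map (mapLetter ς)) = ε • ς (μ' l))
    (hrel : Van P (pull hB.toIsCoalg (letterC lt μ') - ins (fun _ => 1) idBlocks (mapLetter σ)
      (markedLetter μ) (pull hB.toIsCoalg (letterC lt oneLetter)))) :
    Van P (ins cnt B (mapLetter ς) (markedLetter ψ)
        (ins (fun _ => 1) idBlocks (mapLetter σ') (markedLetter μ') (wordC lt)) -
      ε • ins (fun _ => 1) idBlocks (mapLetter σ) (markedLetter μ)
        (ins cnt B (mapLetter ς) (markedLetter ψ) (wordC lt)) -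
      ins (fun _ => 1) B (mapLetter (ς ∘ₗ σ')) (markedLetter (insH B ς ψ μ')) (wordC lt) -
      ins cnt B (mapLetter (ς ∘ₗ σ')) (markedLetter fun l =>
        insL B ς ψ μ' l - ε • insL idBlocks σ μ ψ l) (wordC lt)) := by
  have hI : IsMarked.{w} K (idBlocks : List (V' × ℤ) → _) := isMarked_idBlocks
  have hJ : IsMarked.{w} K (idBlocks : List (V × ℤ) → _) := isMarked_idBlocks
  have hc := hB.toIsCoalg
  have hsz' : ∀ f : Conv (V × ℤ) R, mapRing s (mapRing z f) = mapRing z (mapRing s f) :=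
    fun f => ext' fun l => hsz (f l)
  have hsz'' : ∀ f : Conv (V' × ℤ) R, mapRing s (mapRing z f) = mapRing z (mapRing s f) :=
    fun f => ext' fun l => hsz (f l)
  have hzs : ∀ n v, z.comp s (lt n v) = lt n ((ς ∘ₗ σ') v) := fun n v => by simp [hs, hz]
  have e1 : ins (fun _ => 1) idBlocks (mapLetter σ') (markedLetter μ') (wordC lt) =
      mapRing s (wordC lt) * letterC lt μ' * wordC lt := by
    rw [ins_markedLetter_wordC hI _ hs, pull_id, weight_one]
  have hcomp : ∀ f : Conv (V × ℤ) R, mapRing (z.comp s) f = mapRing z (mapRing s f) := fun _ => rfl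
  have hcz : comap (mapLetter ς) (mapRing s (wordC lt)) = mapRing s (mapRing z (wordC lt)) := by
    rw [← comap_wordC lt hz]; rfl
  have hcs : comap (mapLetter σ) (mapRing z (pull hc (wordC lt))) =
      mapRing z (mapRing s (pull hc (wordC lt))) := by
    rw [← hσB]; rfl
  have hD := insL_pull_wordC lt hc (mapLetter σ) (markedLetter μ)
  rw [e1, ins_markedLetter_wordC hB _ hz, ins_markedLetter_wordC hB _ hzs,
    ins_markedLetter_wordC hB _ hzs, hcomp, weight_one, letterC_sub_zsmul,
    ins_weight_mul hc cnt_append, ins_weight_mul hc cnt_append, ins_one_mul hc,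
    ins_mapRing, ins_mapRing, ins_markedLetter_wordC hB _ hz, ins_markedLetter_wordC hB _ hz,
    weight_one, ins_letterC lt hB, ins_letterC lt hB,
    ins_one_mul isCoalg_idBlocks, ins_one_mul isCoalg_idBlocks, pull_id, pull_id, pull_id,
    pull_id, ins_mapRing, ins_weight hJ, hD, ins_letterC lt hJ, map_mul, map_mul, hcz,
    pull_mapRing, pull_mapRing, hcs, hσB, comap_letterC lt hz hμ']
  have hv : Van P (ε • (mapRing z (mapRing s (pull hc (wordC lt))) *
      mapRing z (pull hc (letterC lt μ') - ins (fun _ => 1) idBlocks (mapLetter σ)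
        (markedLetter μ) (pull hc (letterC lt oneLetter))) *
      (mapRing z (pull hc (wordC lt)) * letterC lt ψ * weight cnt (pull hc (wordC lt)))) +
      mapRing z (mapRing s (pull hc (wordC lt))) * mapRing s (letterC lt ψ) *
        weight cnt (mapRing s (pull hc (wordC lt)) *
          (pull hc (letterC lt μ') - ins (fun _ => 1) idBlocks (mapLetter σ)
            (markedLetter μ) (pull hc (letterC lt oneLetter))) * pull hc (wordC lt))) :=
    ((((hrel.mapRing z).mul_left hP _).mul_right hP _).zsmul ε).add
      ((((hrel.mul_left hP _).mul_right hP _).weight cnt).mul_left hP _)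
  refine cast (congrArg _ ?_) hv
  change _ = _ - _ - mapRing z (mapRing s (pull hc (wordC lt))) *
    letterC lt (insOp cnt B (mapLetter ς) (markedLetter ψ) μ') * pull hc (wordC lt) -
    mapRing z (mapRing s (pull hc (wordC lt))) *
      (letterC lt (insOp (fun _ => 1) B (mapLetter ς) (markedLetter ψ) μ') -
        ε • letterC lt (insOp (fun _ => 1) idBlocks (mapLetter σ) (markedLetter μ) ψ)) * _
  simp only [map_mul, map_zsmul, hcs, hsz', comap_letterC lt hs hψ, weight_cnt_mul, map_sub,
    weight_sub, weight_mapRing, pull_mapRing]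
  generalize mapRing z (mapRing s (pull hc (wordC lt))) = a₁
  generalize mapRing z (pull hc (wordC lt)) = a₂
  generalize mapRing s (weight cnt (pull hc (wordC lt))) = a₄
  generalize weight cnt (pull hc (wordC lt)) = a₃
  generalize letterC lt (insOp cnt B (mapLetter ς) (markedLetter ψ) μ') = a₅
  generalize letterC lt (insOp (fun _ => 1) B (mapLetter ς) (markedLetter ψ) μ') = a₆
  generalize mapRing s (letterC lt ψ) = a₇
  generalize letterC lt (insOp (fun _ => 1) idBlocks (mapLetter σ) (markedLetter μ) ψ) = a₈
  generalize ins (fun _ => 1) idBlocks (mapLetter σ) (markedLetter μ)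
    (pull hc (letterC lt oneLetter)) = a₉
  generalize pull hc (letterC lt μ') = b₁
  generalize mapRing s (pull hc (wordC lt)) = b₂
  generalize pull hc (wordC lt) = b₃
  rcases hε with rfl | rfl <;> simp only [one_smul, neg_smul] <;> noncomm_ring

theorem van_insL_insL (hP : IsInfix P) (hB : IsMarked.{w} K B)
    (hs : ∀ n v, s (lt n v) = lt n (σ' v)) (hz : ∀ n v, z (lt n v) = lt n (ς v))
    (hsz : ∀ r, s (z r) = z (s r)) (hε : ε = 1 ∨ ε = -1)
    (hσB : comap (mapLetter σ) (pull hB.toIsCoalg (wordC lt)) =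
      mapRing s (pull hB.toIsCoalg (wordC lt)))
    (hψ : ∀ l, ψ (l.map (mapLetter σ)) = ε • σ' (ψ l))
    (hμ' : ∀ l, μ' (l.map (mapLetter ς)) = ε • ς (μ' l))
    (hrel : Van P (pull hB.toIsCoalg (letterC lt μ') - ins (fun _ => 1) idBlocks (mapLetter σ)
      (markedLetter μ) (pull hB.toIsCoalg (letterC lt oneLetter)))) :
    Van P (ins (fun _ => 1) B (mapLetter ς) (markedLetter ψ)
        (ins (fun _ => 1) idBlocks (mapLetter σ') (markedLetter μ') (wordC lt)) -
      ε • ins (fun _ => 1) idBlocks (mapLetter σ) (markedLetter μ)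
        (ins (fun _ => 1) B (mapLetter ς) (markedLetter ψ) (wordC lt)) -
      ins (fun _ => 1) B (mapLetter (ς ∘ₗ σ')) (markedLetter fun l =>
        insL B ς ψ μ' l - ε • insL idBlocks σ μ ψ l) (wordC lt)) := by
  have hI : IsMarked.{w} K (idBlocks : List (V' × ℤ) → _) := isMarked_idBlocks
  have hJ : IsMarked.{w} K (idBlocks : List (V × ℤ) → _) := isMarked_idBlocks
  have hc := hB.toIsCoalg
  have hsz' : ∀ f : Conv (V × ℤ) R, mapRing s (mapRing z f) = mapRing z (mapRing s f) :=
    fun f => ext' fun l => hsz (f l)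
  have hzs : ∀ n v, z.comp s (lt n v) = lt n ((ς ∘ₗ σ') v) := fun n v => by simp [hs, hz]
  have e1 : ins (fun _ => 1) idBlocks (mapLetter σ') (markedLetter μ') (wordC lt) =
      mapRing s (wordC lt) * letterC lt μ' * wordC lt := by
    rw [ins_markedLetter_wordC hI _ hs, pull_id, weight_one]
  have hcomp : ∀ f : Conv (V × ℤ) R, mapRing (z.comp s) f = mapRing z (mapRing s f) := fun _ => rfl
  have hcz : comap (mapLetter ς) (mapRing s (wordC lt)) = mapRing s (mapRing z (wordC lt)) := by
    rw [← comap_wordC lt hz]; rfl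
  have hcs : comap (mapLetter σ) (mapRing z (pull hc (wordC lt))) =
      mapRing z (mapRing s (pull hc (wordC lt))) := by
    rw [← hσB]; rfl
  have hD := insL_pull_wordC lt hc (mapLetter σ) (markedLetter μ)
  rw [e1, ins_markedLetter_wordC hB _ hz, weight_one, ins_markedLetter_wordC hB _ hzs, hcomp,
    weight_one, letterC_sub_zsmul, ins_one_mul hc, ins_one_mul hc,
    ins_mapRing, ins_markedLetter_wordC hB _ hz, weight_one, ins_letterC lt hB,
    ins_one_mul isCoalg_idBlocks, ins_one_mul isCoalg_idBlocks, pull_id, pull_id,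
    ins_mapRing, hD, ins_letterC lt hJ, map_mul, map_mul, hcz,
    pull_mapRing, pull_mapRing, hcs, hσB, comap_letterC lt hz hμ']
  have hv : Van P (ε • (mapRing z (mapRing s (pull hc (wordC lt))) *
      mapRing z (pull hc (letterC lt μ') - ins (fun _ => 1) idBlocks (mapLetter σ)
        (markedLetter μ) (pull hc (letterC lt oneLetter))) *
      (mapRing z (pull hc (wordC lt)) * letterC lt ψ * pull hc (wordC lt))) +
      mapRing z (mapRing s (pull hc (wordC lt))) * mapRing s (letterC lt ψ) *
        (mapRing s (pull hc (wordC lt)) *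
          (pull hc (letterC lt μ') - ins (fun _ => 1) idBlocks (mapLetter σ)
            (markedLetter μ) (pull hc (letterC lt oneLetter))) * pull hc (wordC lt))) :=
    ((((hrel.mapRing z).mul_left hP _).mul_right hP _).zsmul ε).add
      (((hrel.mul_left hP _).mul_right hP _).mul_left hP _)
  refine cast (congrArg _ ?_) hv
  change _ = _ - _ - mapRing z (mapRing s (pull hc (wordC lt))) *
      (letterC lt (insOp (fun _ => 1) B (mapLetter ς) (markedLetter ψ) μ') -
        ε • letterC lt (insOp (fun _ => 1) idBlocks (mapLetter σ) (markedLetter μ) ψ)) * _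
  simp only [map_mul, map_zsmul, hcs, hsz', comap_letterC lt hs hψ, map_sub, pull_mapRing, pull_id]
  generalize mapRing z (mapRing s (pull hc (wordC lt))) = a₁
  generalize mapRing z (pull hc (wordC lt)) = a₂
  generalize letterC lt (insOp (fun _ => 1) B (mapLetter ς) (markedLetter ψ) μ') = a₆
  generalize mapRing s (letterC lt ψ) = a₇
  generalize letterC lt (insOp (fun _ => 1) idBlocks (mapLetter σ) (markedLetter μ) ψ) = a₈
  generalize ins (fun _ => 1) idBlocks (mapLetter σ) (markedLetter μ)
    (pull hc (letterC lt oneLetter)) = a₉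
  generalize pull hc (letterC lt μ') = b₁
  generalize mapRing s (pull hc (wordC lt)) = b₂
  generalize pull hc (wordC lt) = b₃
  rcases hε with rfl | rfl <;> simp only [one_smul, neg_smul] <;> noncomm_ring

theorem van_pull_insL (hP : IsInfix P) (hB : IsMarked.{w} K B)
    (hs : ∀ n v, s (lt n v) = lt n (σ' v))
    (hσB : comap (mapLetter σ) (pull hB.toIsCoalg (wordC lt)) =
      mapRing s (pull hB.toIsCoalg (wordC lt)))
    (hrel : Van P (pull hB.toIsCoalg (letterC lt μ') - ins (fun _ => 1) idBlocks (mapLetter σ)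
      (markedLetter μ) (pull hB.toIsCoalg (letterC lt oneLetter)))) :
    Van P (pull hB.toIsCoalg (ins (fun _ => 1) idBlocks (mapLetter σ') (markedLetter μ')
        (wordC lt)) -
      ins (fun _ => 1) idBlocks (mapLetter σ) (markedLetter μ)
        (pull hB.toIsCoalg (wordC lt))) := by
  have hI : IsMarked.{w} K (idBlocks : List (V' × ℤ) → _) := isMarked_idBlocks
  rw [ins_markedLetter_wordC hI _ hs, pull_id, weight_one, insL_pull_wordC, hσB, map_mul, map_mul,
    pull_mapRing]
  have := ((hrel.mul_left hP (mapRing s (pull hB.toIsCoalg (wordC lt)))).mul_right hP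
    (pull hB.toIsCoalg (wordC lt)))
  rwa [mul_sub, sub_mul, mul_assoc _ (ins _ _ _ _ _)] at this

variable {k : List (V × ℤ) → V} {k' : List (V' × ℤ) → V'}

theorem insH_pull_wordC_eq (hB : IsMarked.{w} K B) (hz : ∀ n v, z (lt n v) = lt n (ς v))
    (hςB : comap (mapLetter σ) (pull hB.toIsCoalg (wordC lt)) =
      mapRing z (pull hB.toIsCoalg (wordC lt))) :
    ins cnt idBlocks (mapLetter σ) (markedLetter k) (pull hB.toIsCoalg (wordC lt)) =
      ins (fun _ => 1) B (mapLetter ς) (markedLetter (insH idBlocks σ k (bsum B oneLetter)))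
        (wordC lt) +
      ins cnt B (mapLetter ς) (markedLetter (insL idBlocks σ k (bsum B oneLetter)))
        (wordC lt) := by
  have hJ : IsMarked.{w} K (idBlocks : List (V × ℤ) → _) := isMarked_idBlocks
  rw [insH_pull_wordC, hςB, pull_letterC lt hB, ins_letterC lt hJ, ins_letterC lt hJ,
    ins_markedLetter_wordC hB _ hz, ins_markedLetter_wordC hB _ hz, weight_one, mul_add,
    ← mul_assoc, ← mul_assoc]
  rfl

theorem insL_pull_wordC_eq (hB : IsMarked.{w} K B) (hz : ∀ n v, z (lt n v) = lt n (ς v))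
    (hςB : comap (mapLetter σ) (pull hB.toIsCoalg (wordC lt)) =
      mapRing z (pull hB.toIsCoalg (wordC lt))) :
    ins (fun _ => 1) idBlocks (mapLetter σ) (markedLetter k) (pull hB.toIsCoalg (wordC lt)) =
      ins (fun _ => 1) B (mapLetter ς) (markedLetter (insL idBlocks σ k (bsum B oneLetter)))
        (wordC lt) := by
  have hJ : IsMarked.{w} K (idBlocks : List (V × ℤ) → _) := isMarked_idBlocks
  rw [insL_pull_wordC, hςB, pull_letterC lt hB, ins_letterC lt hJ,
    ins_markedLetter_wordC hB _ hz, weight_one, ← mul_assoc]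
  rfl

theorem pull_ins_wordC (hB : IsMarked.{w} K B) (hz : ∀ n v, z (lt n v) = lt n (ς v)) :
    pull hB.toIsCoalg (ins cnt idBlocks (mapLetter ς) (markedLetter k') (wordC lt)) =
      ins cnt B (mapLetter ς) (markedLetter (bsum B k')) (wordC lt) := by
  have hI : IsMarked.{w} K (idBlocks : List (V' × ℤ) → _) := isMarked_idBlocks
  rw [ins_markedLetter_wordC hI _ hz, ins_markedLetter_wordC hB _ hz, pull_id, map_mul, map_mul,
    pull_mapRing, pull_letterC lt hB, pull_weight hB]

theorem pull_insL_wordC (hB : IsMarked.{w} K B) (hz : ∀ n v, z (lt n v) = lt n (ς v)) :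
    pull hB.toIsCoalg (ins (fun _ => 1) idBlocks (mapLetter ς) (markedLetter k') (wordC lt)) =
      ins (fun _ => 1) B (mapLetter ς) (markedLetter (bsum B k')) (wordC lt) := by
  have hI : IsMarked.{w} K (idBlocks : List (V' × ℤ) → _) := isMarked_idBlocks
  rw [ins_markedLetter_wordC hI _ hz, ins_markedLetter_wordC hB _ hz, pull_id, map_mul, map_mul,
    pull_mapRing, pull_letterC lt hB, weight_one, weight_one]

end Commutator

end Conv

end RingIdentities

section Transfer

theorem parts_map {α β : Type*} (σ : α → β) (l : List α) :
    parts (l.map σ) = (parts l).map (List.map (List.map σ)) := by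
  induction l with
  | nil => rfl
  | cons a l ih =>
    simp only [List.map_cons, parts, ih, List.flatMap_map, List.map_flatMap]
    congr 1
    funext P
    cases P <;> simp

/-- Compatibility of a decomposition into blocks with operators on the letters. -/
def Equivar {A A' : Type*} (B : List A → List (List A')) (σ : A → A) (σ' : A' → A') : Prop :=
  ∀ l, B (l.map σ) = (B l).map (List.map σ')

theorem Equivar.bsum {A A' M : Type*} [AddCommGroup M] {B : List A → List (List A')} {σ : A → A}
    {σ' : A' → A'} (h : Equivar B σ σ') (f : List A' → M) (l : List A) :
    bsum B f (l.map σ) = bsum B (fun P => f (P.map σ')) l := by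
  simp [_root_.bsum, h l, Function.comp_def]

theorem equivar_idBlocks {A : Type*} (σ : A → A) : Equivar idBlocks σ σ := fun _ => rfl

theorem equivar_partsBlocks {A A' : Type*} {F : List A → A'} {σ : A → A} {σ' : A' → A'}
    (h : ∀ l, F (l.map σ) = σ' (F l)) : Equivar (partsBlocks F) σ σ' := fun l => by
  simp only [partsBlocks, parts_map, List.map_map]
  refine List.map_congr_left fun P _ => ?_
  simp [h]

variable {K : Type u} [Field K] {V : Type*} {V' : Type v} [AddCommGroup V] [Module K V]
  [AddCommGroup V'] [Module K V'] {M : Type*} [AddCommGroup M] [Module K M]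
  {B : List (V × ℤ) → List (List (V' × ℤ))}

/-- The action of an operator on the letters of the universal words. -/
def letterHom (σ : V' →ₗ[K] V') : TensorAlgebra K (ℤ →₀ V') →ₐ[K] TensorAlgebra K (ℤ →₀ V') :=
  TensorAlgebra.lift K (TensorAlgebra.ι K ∘ₗ Finsupp.mapRange.linearMap σ)

theorem letterHom_univLetter (σ : V' →ₗ[K] V') (n : ℤ) (x : V') :
    letterHom σ (univLetter K V' n x) = univLetter K V' n (σ x) := by
  simp [letterHom, univLetter]

theorem letterHom_comm {σ ς : V' →ₗ[K] V'} (h : ∀ x, ς (σ x) = σ (ς x))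
    (r : TensorAlgebra K (ℤ →₀ V')) : letterHom σ (letterHom ς r) = letterHom ς (letterHom σ r) := by
  have : (letterHom σ).comp (letterHom ς) = (letterHom ς).comp (letterHom σ) := by
    refine TensorAlgebra.hom_ext (LinearMap.ext fun x => ?_)
    simp only [letterHom, LinearMap.comp_apply, AlgHom.toLinearMap_apply, AlgHom.comp_apply,
      TensorAlgebra.lift_ι_apply]
    congr 1
    ext n
    simp [h]
  exact DFunLike.congr_fun this r

section

open Conv

theorem Equivar.comap_pull (hB : IsCoalg.{max u v} B) {σ : V → V} {σ' : V' →ₗ[K] V'}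
    (h : Equivar B (mapLetter σ) (mapLetter σ')) :
    comap (mapLetter σ) (pull hB (wordC (univLetter K V'))) =
      mapRing (letterHom σ' : TensorAlgebra K (ℤ →₀ V') →+* _)
        (pull hB (wordC (univLetter K V'))) := by
  rw [← pull_mapRing, ← comap_wordC (univLetter K V') (σ := σ')
    (s := (letterHom σ' : TensorAlgebra K (ℤ →₀ V') →+* _)) (letterHom_univLetter σ')]
  exact ext' fun l => h.bsum _ l

variable {P : List (V × ℤ) → Prop} {σ : V → V} {σ' ς : V' →ₗ[K] V'}
    {μ : List (V × ℤ) → V} {μ' : List (V' × ℤ) → V'} {ψ : List (V × ℤ) → V'} {ε : ℤ}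

theorem van_letterC_sub (hB : IsMarked.{max u v} K B)
    (hrel : ∀ l, P l → bsum B μ' l = insL idBlocks σ μ (bsum B oneLetter) l) :
    Van P (pull hB.toIsCoalg (letterC (univLetter K V') μ') - ins (fun _ => 1) idBlocks
      (mapLetter σ) (markedLetter μ) (pull hB.toIsCoalg (letterC (univLetter K V') oneLetter))) := by
  have hJ : IsMarked.{max u v} K (idBlocks : List (V × ℤ) → _) := isMarked_idBlocks
  rw [pull_letterC _ hB, pull_letterC _ hB, ins_letterC _ hJ]
  intro l hl
  rw [Conv.sub_apply, letterC_apply, letterC_apply, hrel l hl]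
  exact sub_self _

theorem insH_insL_eq (hP : IsInfix P) (hB : IsMarked.{max u v} K B)
    (hςσ : ∀ x, ς (σ' x) = σ' (ς x)) (hε : ε = 1 ∨ ε = -1)
    (hσB : Equivar B (mapLetter σ) (mapLetter σ'))
    (hψ : ∀ l, ψ (l.map (mapLetter σ)) = ε • σ' (ψ l))
    (hμ' : ∀ l, μ' (l.map (mapLetter ς)) = ε • ς (μ' l))
    (hrel : ∀ l, P l → bsum B μ' l = insL idBlocks σ μ (bsum B oneLetter) l)
    {f : List (V' × ℤ) → M} (hf : FML K f) {l : List (V × ℤ)} (hl : P l) :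
    insH B ς ψ (insL idBlocks σ' μ' f) l - ε • insL idBlocks σ μ (insH B ς ψ f) l =
      insL B (ς ∘ₗ σ') (insH B ς ψ μ') f l +
      insH B (ς ∘ₗ σ') (fun l => insL B ς ψ μ' l - ε • insL idBlocks σ μ ψ l) f l := by
  obtain ⟨L, hL⟩ := exists_eq_algWord hf
  obtain rfl : f = fun l => L (wordC (univLetter K V') l) := funext hL
  have h := van_insH_insL hP hB (letterHom_univLetter σ') (letterHom_univLetter ς)
    (letterHom_comm hςσ) hε (hσB.comap_pull hB.toIsCoalg) hψ hμ' (van_letterC_sub hB hrel) l hl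
  rw [sub_sub, Conv.sub_apply, sub_eq_zero] at h
  have := congrArg L h
  simp only [Conv.sub_apply, Conv.add_apply, Conv.zsmul_apply, map_sub, map_add, map_zsmul,
    ins_apply, map_insOp] at this
  exact this

theorem insL_insL_eq (hP : IsInfix P) (hB : IsMarked.{max u v} K B)
    (hςσ : ∀ x, ς (σ' x) = σ' (ς x)) (hε : ε = 1 ∨ ε = -1)
    (hσB : Equivar B (mapLetter σ) (mapLetter σ'))
    (hψ : ∀ l, ψ (l.map (mapLetter σ)) = ε • σ' (ψ l))
    (hμ' : ∀ l, μ' (l.map (mapLetter ς)) = ε • ς (μ' l))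
    (hrel : ∀ l, P l → bsum B μ' l = insL idBlocks σ μ (bsum B oneLetter) l)
    {f : List (V' × ℤ) → M} (hf : FML K f) {l : List (V × ℤ)} (hl : P l) :
    insL B ς ψ (insL idBlocks σ' μ' f) l - ε • insL idBlocks σ μ (insL B ς ψ f) l =
      insL B (ς ∘ₗ σ') (fun l => insL B ς ψ μ' l - ε • insL idBlocks σ μ ψ l) f l := by
  obtain ⟨L, hL⟩ := exists_eq_algWord hf
  obtain rfl : f = fun l => L (wordC (univLetter K V') l) := funext hL
  have h := van_insL_insL hP hB (letterHom_univLetter σ') (letterHom_univLetter ς)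
    (letterHom_comm hςσ) hε (hσB.comap_pull hB.toIsCoalg) hψ hμ' (van_letterC_sub hB hrel) l hl
  rw [Conv.sub_apply, sub_eq_zero] at h
  have := congrArg L h
  simp only [Conv.sub_apply, Conv.zsmul_apply, map_sub, map_zsmul, ins_apply, map_insOp] at this
  exact this

theorem bsum_insL_eq (hP : IsInfix P) (hB : IsMarked.{max u v} K B)
    (hσB : Equivar B (mapLetter σ) (mapLetter σ'))
    (hrel : ∀ l, P l → bsum B μ' l = insL idBlocks σ μ (bsum B oneLetter) l)
    {f : List (V' × ℤ) → M} (hf : FML K f) {l : List (V × ℤ)} (hl : P l) :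
    bsum B (insL idBlocks σ' μ' f) l = insL idBlocks σ μ (bsum B f) l := by
  obtain ⟨L, hL⟩ := exists_eq_algWord hf
  obtain rfl : f = fun l => L (wordC (univLetter K V') l) := funext hL
  have h := van_pull_insL hP hB (letterHom_univLetter σ') (hσB.comap_pull hB.toIsCoalg)
    (van_letterC_sub hB hrel) l hl
  rw [Conv.sub_apply, sub_eq_zero] at h
  have := congrArg L h
  simp only [pull_apply, ins_apply, map_insOp, map_bsum] at this
  exact this

variable {k : List (V × ℤ) → V} {k' : List (V' × ℤ) → V'}

theorem insH_bsum_eq (hB : IsMarked.{max u v} K B) (hσB : Equivar B (mapLetter σ) (mapLetter ς))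
    {f : List (V' × ℤ) → M} (hf : FML K f) (l : List (V × ℤ)) :
    insH idBlocks σ k (bsum B f) l =
      insL B ς (insH idBlocks σ k (bsum B oneLetter)) f l +
      insH B ς (insL idBlocks σ k (bsum B oneLetter)) f l := by
  obtain ⟨L, hL⟩ := exists_eq_algWord hf
  obtain rfl : f = fun l => L (wordC (univLetter K V') l) := funext hL
  have h := insH_pull_wordC_eq (k := k) hB (letterHom_univLetter ς) (hσB.comap_pull hB.toIsCoalg)
  have := congrArg (fun g => L (g.toFun l)) h
  simp only [Conv.add_apply, map_add, ins_apply, map_insOp, pull_apply, map_bsum] at this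
  exact this

theorem insL_bsum_eq (hB : IsMarked.{max u v} K B) (hσB : Equivar B (mapLetter σ) (mapLetter ς))
    {f : List (V' × ℤ) → M} (hf : FML K f) (l : List (V × ℤ)) :
    insL idBlocks σ k (bsum B f) l =
      insL B ς (insL idBlocks σ k (bsum B oneLetter)) f l := by
  obtain ⟨L, hL⟩ := exists_eq_algWord hf
  obtain rfl : f = fun l => L (wordC (univLetter K V') l) := funext hL
  have h := insL_pull_wordC_eq (k := k) hB (letterHom_univLetter ς) (hσB.comap_pull hB.toIsCoalg)
  have := congrArg (fun g => L (g.toFun l)) h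
  simp only [ins_apply, map_insOp, pull_apply, map_bsum] at this
  exact this

theorem bsum_insH_eq (hB : IsMarked.{max u v} K B) {f : List (V' × ℤ) → M} (hf : FML K f)
    (l : List (V × ℤ)) :
    bsum B (insH idBlocks ς k' f) l = insH B ς (bsum B k') f l := by
  obtain ⟨L, hL⟩ := exists_eq_algWord hf
  obtain rfl : f = fun l => L (wordC (univLetter K V') l) := funext hL
  have h := pull_ins_wordC (k' := k') hB (letterHom_univLetter ς)
  have := congrArg (fun g => L (g.toFun l)) h
  simp only [ins_apply, map_insOp, pull_apply, map_bsum] at this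
  exact this

theorem bsum_insL_eq_insL (hB : IsMarked.{max u v} K B) {f : List (V' × ℤ) → M} (hf : FML K f)
    (l : List (V × ℤ)) :
    bsum B (insL idBlocks ς k' f) l = insL B ς (bsum B k') f l := by
  obtain ⟨L, hL⟩ := exists_eq_algWord hf
  obtain rfl : f = fun l => L (wordC (univLetter K V') l) := funext hL
  have h := pull_insL_wordC (k' := k') hB (letterHom_univLetter ς)
  have := congrArg (fun g => L (g.toFun l)) h
  simp only [ins_apply, map_insOp, pull_apply, map_bsum] at this
  exact this

end

/-! ### Additivity in the inserted function -/

theorem insOp_letter_add (c : List (V × ℤ) → ℤ) (ς : V' → V') (k₁ k₂ : List (V × ℤ) → V')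
    {f : List (V' × ℤ) → M} (hf : FML K f) (l : List (V × ℤ)) :
    insOp c B (mapLetter ς) (markedLetter fun q => k₁ q + k₂ q) f l =
      insOp c B (mapLetter ς) (markedLetter k₁) f l +
      insOp c B (mapLetter ς) (markedLetter k₂) f l := by
  simp only [insOp, splitSum₃, ← splitSum_add, ← smul_add, ← bsum_add, (hf _ _ _).map_add]

theorem insOp_letter_congr {c : List (V × ℤ) → ℤ} {ς : V' → V'} {k₁ k₂ : List (V × ℤ) → V'}
    {f : List (V' × ℤ) → M} {l : List (V × ℤ)}
    (h : ∀ p q r, p ++ (q ++ r) = l → k₁ q = k₂ q) :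
    insOp c B (mapLetter ς) (markedLetter k₁) f l =
      insOp c B (mapLetter ς) (markedLetter k₂) f l := by
  simp only [insOp, splitSum₃]
  refine splitSum_congr fun p s hs => splitSum_congr fun q r hr => ?_
  rw [markedLetter, markedLetter, h p q r (by rw [hr, hs])]

end Transfer

namespace GradingDatum

variable {Y : Type uY} [AddCommGroup Y] (G : GradingDatum Y)

theorem parity_fromInt_one : G.parity (G.fromInt 1) = 1 := by
  have h01 : ∀ x : ZMod 2, x = 0 ∨ x = 1 := by decide
  refine (h01 _).resolve_left fun h => G.comp_ne_zero ?_
  exact AddMonoidHom.ext_int (by simpa using h)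

/-- The sign `(-1)^r`. -/
def sg (r : Y) : ℤ := if G.parity r = 0 then 1 else -1

theorem sg_eq (r : Y) : G.sg r = 1 ∨ G.sg r = -1 := by
  unfold sg; split_ifs <;> simp

theorem sg_zero : G.sg 0 = 1 := by simp [sg]

theorem sg_add (r s : Y) : G.sg (r + s) = G.sg r * G.sg s := by
  simp only [sg, map_add]
  generalize G.parity r = x
  generalize G.parity s = y
  revert x y
  decide

theorem sg_mul_self (r : Y) : G.sg r * G.sg r = 1 := by
  rcases G.sg_eq r with h | h <;> simp [h]

theorem sg_fromInt_one : G.sg (G.fromInt 1) = -1 := by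
  simp [sg, parity_fromInt_one]

end GradingDatum

namespace GQuiver

variable {K : Type uK} [Field K] {Y : Type uY} [AddCommGroup Y] {G : GradingDatum Y}
  {Q : GQuiver.{uK, uY, uO, uH} K Y} {M : Type*} [AddCommGroup M] [Module K M]

theorem sgn_inc (X Z : Q.Ob) (d : Y) (a : Q.Hom X Z d) :
    Q.sgn G (Q.inc X Z d a) = G.sg (d - G.fromInt 1) • Q.inc X Z d a := by
  have h : Q.sgn G (Q.inc X Z d a) = Q.inc X Z d
      ((if G.parity d = 1 then LinearMap.id else -LinearMap.id : Q.Hom X Z d →ₗ[K] _) a) := by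
    simp only [sgn, inc, DirectSum.lmap_lof]
  have h2 : G.parity (d - G.fromInt 1) = 0 ↔ G.parity d = 1 := by
    rw [map_sub, G.parity_fromInt_one, sub_eq_zero]
  rw [h, GradingDatum.sg]
  simp only [h2]
  split_ifs <;> simp

theorem sgn_sgn (x : Q.Tot) : Q.sgn G (Q.sgn G x) = x := by
  suffices h : Q.sgn G ∘ₗ Q.sgn G = LinearMap.id from LinearMap.congr_fun h x
  refine DirectSum.linearMap_ext _ fun l => LinearMap.ext fun a => ?_
  change Q.sgn G (Q.sgn G (Q.inc l.src l.tgt l.deg a)) = Q.inc l.src l.tgt l.deg a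
  rw [sgn_inc, map_zsmul, sgn_inc, smul_smul, G.sg_mul_self, one_smul]

/-- The operator that describes the signs in cyclic rotations of words of total degree `r`. -/
def twist (Q : GQuiver.{uK, uY, uO, uH} K Y) (G : GradingDatum Y) (r : Y) : Q.Tot →ₗ[K] Q.Tot :=
  if G.parity r = 0 then Q.sgn G else LinearMap.id

/-- The operator `(-1)^{r ⬝ |a|'}`. -/
def koszul (Q : GQuiver.{uK, uY, uO, uH} K Y) (G : GradingDatum Y) (r : Y) : Q.Tot →ₗ[K] Q.Tot :=
  if G.parity r = 0 then LinearMap.id else Q.sgn G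

theorem twist_add (r c : Y) (x : Q.Tot) :
    Q.twist G (r + c) x = Q.koszul G c (Q.twist G r x) := by
  have h01 : ∀ x : ZMod 2, x = 0 ∨ x = 1 := by decide
  have h11 : (1 + 1 : ZMod 2) = 0 := by decide
  rcases h01 (G.parity r) with h | h <;> rcases h01 (G.parity c) with h' | h' <;>
    simp [twist, koszul, h, h', h11, sgn_sgn]

theorem koszul_sgn (r : Y) (x : Q.Tot) : Q.koszul G r (Q.sgn G x) = Q.sgn G (Q.koszul G r x) := by
  unfold koszul; split_ifs <;> simp

@[simp] theorem koszul_zero : Q.koszul G 0 = LinearMap.id := by simp [koszul]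

theorem koszul_fromInt_one : Q.koszul G (G.fromInt 1) = Q.sgn G := by
  simp [koszul, G.parity_fromInt_one]

namespace IsPath

theorem cast {X Z : Q.Ob} {r s : Y} {l : List Q.Tot} (h : Q.IsPath G X Z r l) (e : r = s) :
    Q.IsPath G X Z s l := e ▸ h

theorem append {X W Z : Q.Ob} {r s : Y} {p q : List Q.Tot} (hp : Q.IsPath G X W r p)
    (hq : Q.IsPath G W Z s q) : Q.IsPath G X Z (r + s) (p ++ q) := by
  induction hp with
  | nil => simpa using hq
  | cons a _ ih => rw [add_assoc]; exact .cons a (ih hq)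

theorem of_append {X Z : Q.Ob} {r : Y} {p q : List Q.Tot} (h : Q.IsPath G X Z r (p ++ q)) :
    ∃ W s t, Q.IsPath G X W s p ∧ Q.IsPath G W Z t q ∧ s + t = r := by
  induction p generalizing X r with
  | nil => exact ⟨X, 0, r, .nil X, h, zero_add r⟩
  | cons b p ih =>
    cases h with
    | cons a h =>
      obtain ⟨W, s, t, hs, ht, rfl⟩ := ih h
      exact ⟨W, _, t, .cons a hs, ht, add_assoc _ _ _⟩

theorem single (X Z : Q.Ob) (d : Y) (a : Q.Hom X Z d) :
    Q.IsPath G X Z (d - G.fromInt 1) [Q.inc X Z d a] := by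
  simpa using IsPath.cons (G := G) a (.nil Z)

theorem exists_of_single {X Z : Q.Ob} {r : Y} {x : Q.Tot} (h : Q.IsPath G X Z r [x]) :
    ∃ a : Q.Hom X Z (r + G.fromInt 1), x = Q.inc X Z (r + G.fromInt 1) a := by
  cases h with
  | @cons _ _ _ d r' l a h =>
    cases h
    obtain h : d - G.fromInt 1 + 0 + G.fromInt 1 = d := by abel
    rw [h]
    exact ⟨a, rfl⟩

theorem cons' {X W Z : Q.Ob} {r s : Y} {x : Q.Tot} {l : List Q.Tot} (h : Q.IsPath G X W r [x])
    (hl : Q.IsPath G W Z s l) : Q.IsPath G X Z (r + s) (x :: l) := append h hl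

theorem of_cons {X Z : Q.Ob} {r : Y} {x : Q.Tot} {l : List Q.Tot} (h : Q.IsPath G X Z r (x :: l)) :
    ∃ W s t, Q.IsPath G X W s [x] ∧ Q.IsPath G W Z t l ∧ s + t = r :=
  of_append (p := [x]) h

theorem single_zero (X Z : Q.Ob) (r : Y) : Q.IsPath G X Z r [0] := by
  simpa using (single (G := G) X Z (r + G.fromInt 1) 0)

theorem single_smul {X Z : Q.Ob} {r : Y} {x : Q.Tot} (h : Q.IsPath G X Z r [x]) (c : K) :
    Q.IsPath G X Z r [c • x] := by
  obtain ⟨a, rfl⟩ := h.exists_of_single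
  rw [← map_smul]
  exact (single _ _ _ _).cast (by abel)

theorem single_add {X Z : Q.Ob} {r : Y} {x y : Q.Tot} (h : Q.IsPath G X Z r [x])
    (h' : Q.IsPath G X Z r [y]) : Q.IsPath G X Z r [x + y] := by
  obtain ⟨a, rfl⟩ := h.exists_of_single
  obtain ⟨b, rfl⟩ := h'.exists_of_single
  rw [← map_add]
  exact (single _ _ _ _).cast (by abel)

theorem single_zsmul {X Z : Q.Ob} {r : Y} {x : Q.Tot} (h : Q.IsPath G X Z r [x]) (n : ℤ) :
    Q.IsPath G X Z r [n • x] := by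
  simpa [Int.cast_smul_eq_zsmul] using h.single_smul (n : K)

theorem single_sub {X Z : Q.Ob} {r : Y} {x y : Q.Tot} (h : Q.IsPath G X Z r [x])
    (h' : Q.IsPath G X Z r [y]) : Q.IsPath G X Z r [x - y] := by
  simpa [sub_eq_add_neg] using h.single_add (h'.single_zsmul (-1))

theorem single_sum {X Z : Q.Ob} {r : Y} {ι : Type*} (S : Finset ι) {x : ι → Q.Tot}
    (h : ∀ i ∈ S, Q.IsPath G X Z r [x i]) : Q.IsPath G X Z r [∑ i ∈ S, x i] := by
  classical
  induction S using Finset.induction_on with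
  | empty => exact single_zero X Z r
  | insert i S hi ih =>
    rw [sum_insert hi]
    exact (h i (by simp)).single_add (ih fun j hj => h j (by simp [hj]))

theorem sgn_single {X Z : Q.Ob} {r : Y} {x : Q.Tot} (h : Q.IsPath G X Z r [x]) :
    Q.sgn G x = G.sg r • x := by
  obtain ⟨a, rfl⟩ := h.exists_of_single
  rw [sgn_inc]
  congr 2
  abel

theorem map_sgn {X Z : Q.Ob} {r : Y} {l : List Q.Tot} (h : Q.IsPath G X Z r l) :
    Q.IsPath G X Z r (l.map (Q.sgn G)) := by
  induction h with
  | nil => exact .nil _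
  | cons a h ih =>
    refine cons' ?_ ih
    rw [(single _ _ _ a).sgn_single]
    exact (single _ _ _ a).single_zsmul _

theorem map_twist (c : Y) {X Z : Q.Ob} {r : Y} {l : List Q.Tot} (h : Q.IsPath G X Z r l) :
    Q.IsPath G X Z r (l.map (Q.twist G c)) := by
  unfold twist
  split_ifs
  · exact h.map_sgn
  · simpa using h

theorem map_koszul (c : Y) {X Z : Q.Ob} {r : Y} {l : List Q.Tot} (h : Q.IsPath G X Z r l) :
    Q.IsPath G X Z r (l.map (Q.koszul G c)) := by
  unfold koszul
  split_ifs
  · simpa using h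
  · exact h.map_sgn

theorem fml_map_sgn {l : List (Q.Tot × ℤ)} {X Z : Q.Ob} {r : Y}
    (h : Q.IsPath G X Z r (l.map Prod.fst)) {f : List (Q.Tot × ℤ) → M} (hf : FML K f) :
    f (l.map (mapLetter (Q.sgn G))) = G.sg r • f l := by
  induction l generalizing X r f with
  | nil => cases h; simp [G.sg_zero]
  | cons a l ih =>
    obtain ⟨W, s, t, ha, hl, rfl⟩ := of_cons (by simpa using h)
    have h1 := ih hl (hf.cons (mapLetter (Q.sgn G) a))
    simp only [List.map_cons]
    rw [h1]
    have h2 : mapLetter (Q.sgn G) a = (G.sg s • a.1, a.2) := by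
      rw [← ha.sgn_single]; rfl
    rw [h2, G.sg_add, mul_comm, mul_smul]
    congr 1
    exact map_zsmul ((hf [] l a.2).mk' _) (G.sg s) a.1

theorem word_map_sgn {l : List Q.Tot} {X Z : Q.Ob} {r : Y} (h : Q.IsPath G X Z r l) :
    word K (l.map (Q.sgn G)) = G.sg r • word K l := by
  have hf : FML K fun m : List (Q.Tot × ℤ) => word K (m.map Prod.fst) := fun p q n => by
    simpa using IsML.word (p.map Prod.fst) (q.map Prod.fst)
  have := fml_map_sgn (l := l.map fun x => (x, (0 : ℤ))) (by simpa [Function.comp_def] using h) hf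
  simpa [Function.comp_def] using this

end IsPath

/-! ### Rotations -/

theorem evenPart_inc (X Z : Q.Ob) (d : Y) (a : Q.Hom X Z d) :
    Q.evenPart G (Q.inc X Z d a) = if G.parity d = 1 then Q.inc X Z d a else 0 := by
  have h : Q.evenPart G (Q.inc X Z d a) = Q.inc X Z d
      ((if G.parity d = 1 then LinearMap.id else 0 : Q.Hom X Z d →ₗ[K] _) a) := by
    simp only [evenPart, inc, DirectSum.lmap_lof]
  rw [h]; split_ifs <;> simp

theorem oddPart_inc (X Z : Q.Ob) (d : Y) (a : Q.Hom X Z d) :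
    Q.oddPart G (Q.inc X Z d a) = if G.parity d = 1 then 0 else Q.inc X Z d a := by
  have h : Q.oddPart G (Q.inc X Z d a) = Q.inc X Z d
      ((if G.parity d = 1 then 0 else LinearMap.id : Q.Hom X Z d →ₗ[K] _) a) := by
    simp only [oddPart, inc, DirectSum.lmap_lof]
  rw [h]; split_ifs <;> simp

theorem t_word {X Z : Q.Ob} {r : Y} {p : List Q.Tot} {x : Q.Tot}
    (h : Q.IsPath G X Z r (p ++ [x])) : Q.t G (word K (p ++ [x])) = word K (Q.twist G r x :: p) := by
  have h01 : ∀ x : ZMod 2, x = 0 ∨ x = 1 := by decide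
  have h11 : (1 + 1 : ZMod 2) = 0 := by decide
  obtain ⟨W, s, t, hp, hx, rfl⟩ := h.of_append
  have hw (y : Q.Tot) : word K (-y :: p) = -word K (y :: p) := by simp [word]
  have e : Q.t G (word K (p ++ [x])) = word K (Q.evenPart G x :: p) +
      word K (Q.oddPart G x :: p.map (Q.sgn G)) := by
    rw [GQuiver.t, linExt_word, rotateFun, splitSum_concat, splitSum_eq_right]
    · simp [onOne]
    · intro u v _ hv
      obtain ⟨b, v, rfl⟩ := List.exists_cons_of_ne_nil hv
      cases v <;> rfl
  have hz (l : List Q.Tot) : word K ((0 : Q.Tot) :: l) = 0 := by simp [word]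
  have hc (y : Q.Tot) : word K (y :: p.map (Q.sgn G)) = G.sg s • word K (y :: p) := by
    have := hp.word_map_sgn
    simp only [word, List.map_cons, List.prod_cons] at this ⊢
    rw [this, mul_smul_comm]
  rw [e]
  have hsgn := hx.sgn_single
  obtain ⟨a, rfl⟩ := hx.exists_of_single
  have hd : G.parity (t + G.fromInt 1) = G.parity t + 1 := by
    rw [map_add, G.parity_fromInt_one]
  rw [evenPart_inc, oddPart_inc, hd, twist, map_add, hc]
  rcases h01 (G.parity s) with h | h <;> rcases h01 (G.parity t) with h' | h' <;>
    simp [h, h', hz, hsgn, hw, h11, GradingDatum.sg]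

theorem t_pow_word {X : Q.Ob} {r : Y} (m z : List Q.Tot) (h : Q.IsPath G X X r (m ++ z)) :
    ((Q.t G) ^ z.length) (word K (m ++ z)) = word K (z.map (Q.twist G r) ++ m) := by
  induction z using List.reverseRecOn generalizing X m with
  | nil => simp
  | append_singleton z x ih =>
    rw [← List.append_assoc] at h
    rw [List.length_append, List.length_singleton, pow_succ, Module.End.mul_apply,
      ← List.append_assoc, t_word h]
    obtain ⟨W, s, t, hp, hx, rfl⟩ := h.of_append
    have h' : Q.IsPath G W W (s + t) ((Q.twist G (s + t) x :: m) ++ z) := by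
      rw [add_comm]
      exact IsPath.cons' (by simpa [add_comm] using hx.map_twist (s + t)) hp
    have := ih _ h'
    simp only [List.cons_append] at this
    rw [this]
    simp

theorem brace_word (P : ℕ → List Q.Tot → M) (hP : ∀ i, IsML K (P i)) {X : Q.Ob} {r : Y}
    {a : Q.Tot} {l : List Q.Tot} (h : Q.IsPath G X X r (a :: l)) :
    Q.brace G P hP (word K (a :: l)) =
      splitSum (fun m z => P z.length (z.map (Q.twist G r) ++ a :: m)) l := by
  have e0 : Q.brace G P hP (word K (a :: l)) = Q.braceFun G P hP (a :: l) := linExt_word _ _ _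
  rw [e0, braceFun, List.length_cons, splitSum, ← sum_range_reflect]
  refine sum_congr rfl fun i hi => ?_
  have hi' : i ≤ l.length := Nat.lt_succ_iff.mp (mem_range.mp hi)
  have e : a :: l = (a :: l.take i) ++ l.drop i := by simp
  have hl : l.length + 1 - 1 - i = (l.drop i).length := by simp
  rw [hl]
  conv_lhs => rw [e]
  rw [t_pow_word _ _ (e ▸ h), linExt_word]

/-! ### Operations on chains that are represented by multilinear functions of marked words -/

/-- Mark no letter. -/
def unmarked (l : List Q.Tot) : List (Q.Tot × ℤ) := l.map fun x => (x, 0)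

/-- The sum of a function over all cyclic rotations of `a :: l`, where `a` is marked. -/
def cycSum (τ : Q.Tot → Q.Tot) (f : List (Q.Tot × ℤ) → M) (a : Q.Tot) (l : List Q.Tot) : M :=
  splitSum (fun m z => f (unmarked (z.map τ) ++ (a, 1) :: unmarked m)) l

/-- The words in which one letter is marked. -/
def OneMark (l : List (Q.Tot × ℤ)) : Prop :=
  ∃ z a m, l = unmarked z ++ (a, 1) :: unmarked m

theorem OneMark.cnt {l : List (Q.Tot × ℤ)} (h : OneMark l) : cnt l = 1 := by
  obtain ⟨z, a, m, rfl⟩ := h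
  simp [_root_.cnt, unmarked, Function.comp_def]

/-- Marked words that are closed paths. -/
def IsClosed (G : GradingDatum Y) (l : List (Q.Tot × ℤ)) : Prop :=
  ∃ X r, Q.IsPath G X X r (l.map Prod.fst)

/-- The operation `T` on chains is the sum of a function of marked words over all cyclic
rotations of a word `a₀,…,aₛ`, where `a₀` is marked. -/
def Rep (G : GradingDatum Y) (T : Q.T →ₗ[K] M) (f : List (Q.Tot × ℤ) → M) : Prop :=
  ∀ X r a l, Q.IsPath G X X r (a :: l) → T (word K (a :: l)) = cycSum (Q.twist G r) f a l

theorem isPath_rotate {X : Q.Ob} {r : Y} {a : Q.Tot} {m z : List Q.Tot}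
    (h : Q.IsPath G X X r (a :: (m ++ z))) :
    ∃ W, Q.IsPath G W W r (z.map (Q.twist G r) ++ a :: m) := by
  obtain ⟨W, s, t, h1, h2, rfl⟩ := IsPath.of_append (p := a :: m) h
  exact ⟨W, ((h2.map_twist _).append h1).cast (add_comm _ _)⟩

theorem cycSum_congr {X : Q.Ob} {r : Y} {a : Q.Tot} {l : List Q.Tot}
    (h : Q.IsPath G X X r (a :: l)) {f g : List (Q.Tot × ℤ) → M}
    (hfg : ∀ l, OneMark l → IsClosed G l → f l = g l) :
    cycSum (Q.twist G r) f a l = cycSum (Q.twist G r) g a l := by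
  refine splitSum_congr fun m z hmz => hfg _ ⟨_, _, _, rfl⟩ ?_
  obtain ⟨W, hW⟩ := isPath_rotate (hmz ▸ h)
  exact ⟨W, r, by simpa [unmarked, Function.comp_def] using hW⟩

theorem Rep.congr {T : Q.T →ₗ[K] M} {f g : List (Q.Tot × ℤ) → M} (hT : Rep G T f)
    (hfg : ∀ l, OneMark l → IsClosed G l → f l = g l) : Rep G T g := fun X r a l h =>
  (hT X r a l h).trans (cycSum_congr h hfg)

theorem Rep.add {T T' : Q.T →ₗ[K] M} {f g : List (Q.Tot × ℤ) → M} (hT : Rep G T f)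
    (hT' : Rep G T' g) : Rep G (T + T') fun l => f l + g l := fun X r a l h => by
  rw [LinearMap.add_apply, hT X r a l h, hT' X r a l h]
  exact (splitSum_add _ _ _).symm

theorem Rep.sub {T T' : Q.T →ₗ[K] M} {f g : List (Q.Tot × ℤ) → M} (hT : Rep G T f)
    (hT' : Rep G T' g) : Rep G (T - T') fun l => f l - g l := fun X r a l h => by
  rw [LinearMap.sub_apply, hT X r a l h, hT' X r a l h]
  exact (splitSum_sub _ _ _).symm

theorem Rep.comp {N : Type*} [AddCommGroup N] [Module K N] {T : Q.T →ₗ[K] M}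
    {f : List (Q.Tot × ℤ) → M} (L : M →ₗ[K] N) (hT : Rep G T f) :
    Rep G (L ∘ₗ T) fun l => L (f l) := fun X r a l h => by
  rw [LinearMap.comp_apply, hT X r a l h]
  exact map_splitSum L _ _

theorem Rep.eq {T T' : Q.T →ₗ[K] M} {f g : List (Q.Tot × ℤ) → M} (hT : Rep G T f)
    (hT' : Rep G T' g) (hfg : ∀ l, OneMark l → IsClosed G l → f l = g l) {X : Q.Ob} {r : Y}
    {a : Q.Tot} {l : List Q.Tot} (h : Q.IsPath G X X r (a :: l)) :
    T (word K (a :: l)) = T' (word K (a :: l)) := by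
  rw [hT X r a l h, hT' X r a l h, cycSum_congr h hfg]

theorem rep_brace {P : ℕ → List Q.Tot → M} {hP : ∀ i, IsML K (P i)}
    {f : List (Q.Tot × ℤ) → M}
    (h : ∀ z a m X r, Q.IsPath G X X r (z ++ a :: m) →
      P z.length (z ++ a :: m) = f (unmarked z ++ (a, 1) :: unmarked m)) :
    Rep G (Q.brace G P hP) f := fun X r a l hl => by
  rw [brace_word _ _ hl]
  refine splitSum_congr fun m z hmz => ?_
  obtain ⟨W, hW⟩ := isPath_rotate (hmz ▸ hl)
  rw [← h _ _ _ _ _ hW, List.length_map]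

end GQuiver

section FMLUniverse

variable {K : Type u} [Field K] {V : Type*} {V' : Type v} [AddCommGroup V] [Module K V]
  [AddCommGroup V'] [Module K V'] {M : Type*} [AddCommGroup M] [Module K M]
  {B : List (V × ℤ) → List (List (V' × ℤ))}

theorem IsMarked.fml_bsum (hB : IsMarked.{max u v} K B) {f : List (V' × ℤ) → M} (hf : FML K f) :
    FML K (bsum B f) := by
  obtain ⟨L, hL⟩ := exists_eq_algWord hf
  obtain rfl : f = fun l => L (algWord (univLetter K V') l) := funext hL
  have := (hB.fml (FML.algWord (univLetter K V'))).lcomp L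
  simpa only [map_bsum] using this

theorem IsMarked.bsum_splitSum (hB : IsMarked.{max u v} K B)
    (k : List (V' × ℤ) → List (V' × ℤ) → M) (l : List (V × ℤ)) :
    bsum B (splitSum k) l = splitSum (fun p q => bsum B (fun p' => bsum B (k p') q) p) l := by
  have h := congrArg (Finsupp.linearCombination K fun x : List (V' × ℤ) × List (V' × ℤ) => k x.1 x.2)
    (hB.split (fun p q => Finsupp.single (p, q) (1 : K)) l)
  simpa only [map_bsum, map_splitSum, Finsupp.linearCombination_single, one_smul] using h

theorem IsMarked.fml_insL (hB : IsMarked.{max u v} K B) (ς : V' →ₗ[K] V')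
    {k : List (V × ℤ) → V'} (hk : FML K k) {f : List (V' × ℤ) → M} (hf : FML K f) :
    FML K (insL B ς k f) := by
  obtain ⟨L, hL⟩ := exists_eq_algWord hf
  obtain rfl : f = fun l => L (algWord (univLetter K V') l) := funext hL
  have := (FML.insL hB ς hk (FML.algWord (univLetter K V'))).lcomp L
  simpa only [insL, map_insOp] using this

theorem IsMarked.fml_insH (hB : IsMarked.{max u v} K B) (ς : V' →ₗ[K] V')
    {k : List (V × ℤ) → V'} (hk : FML K k) {f : List (V' × ℤ) → M} (hf : FML K f) :
    FML K (insH B ς k f) := by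
  obtain ⟨L, hL⟩ := exists_eq_algWord hf
  obtain rfl : f = fun l => L (algWord (univLetter K V') l) := funext hL
  have := (FML.insH hB ς hk (FML.algWord (univLetter K V'))).lcomp L
  simpa only [insH, map_insOp] using this

end FMLUniverse

namespace GQuiver

variable {K : Type uK} [Field K] {Y : Type uY} [AddCommGroup Y] {G : GradingDatum Y}
  {Q : GQuiver.{uK, uY, uO, uH} K Y} {Q' : GQuiver.{uK, uY, uO', uH'} K Y}
  {M : Type*} [AddCommGroup M] [Module K M]

/-- No letter is marked. -/
def Unmarked (l : List (Q.Tot × ℤ)) : Prop := ∀ x ∈ l, x.2 = 0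

theorem unmarked_unmarked (l : List Q.Tot) : Unmarked (unmarked l) := by
  intro x hx
  obtain ⟨y, _, rfl⟩ := List.mem_map.mp hx
  rfl

theorem Unmarked.eq {l : List (Q.Tot × ℤ)} (h : Unmarked l) : unmarked (l.map Prod.fst) = l := by
  rw [unmarked, List.map_map]
  conv_rhs => rw [← List.map_id l]
  exact List.map_congr_left fun x hx => Prod.ext rfl (h x hx).symm

theorem Unmarked.cnt {l : List (Q.Tot × ℤ)} (h : Unmarked l) : cnt l = 0 :=
  List.sum_eq_zero fun n hn => by
    obtain ⟨x, hx, rfl⟩ := List.mem_map.mp hn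
    exact h x hx

theorem Unmarked.left {p q : List (Q.Tot × ℤ)} (h : Unmarked (p ++ q)) : Unmarked p :=
  fun x hx => h x (by simp [hx])

theorem Unmarked.right {p q : List (Q.Tot × ℤ)} (h : Unmarked (p ++ q)) : Unmarked q :=
  fun x hx => h x (by simp [hx])

theorem unmarked_map (τ : Q.Tot → Q.Tot) (l : List Q.Tot) :
    unmarked (l.map τ) = (unmarked l).map (mapLetter τ) := by
  simp [unmarked, Function.comp_def]

theorem unmarked_append (p q : List Q.Tot) : unmarked (p ++ q) = unmarked p ++ unmarked q := by
  simp [unmarked]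

theorem unmarked_cons (x : Q.Tot) (q : List Q.Tot) : unmarked (x :: q) = (x, 0) :: unmarked q := rfl

theorem map_fst_unmarked (l : List Q.Tot) : (unmarked l).map Prod.fst = l := by
  simp [unmarked, Function.comp_def]

theorem map_fst_mapLetter (τ : Q.Tot → Q.Tot) (l : List (Q.Tot × ℤ)) :
    (l.map (mapLetter τ)).map Prod.fst = (l.map Prod.fst).map τ := by
  simp [Function.comp_def]

/-- A word with one mark is cut into a part without marks and a part with one mark. -/
theorem OneMark.append {p q : List (Q.Tot × ℤ)} (h : OneMark (p ++ q)) :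
    (Unmarked p ∧ OneMark q) ∨ (OneMark p ∧ Unmarked q) := by
  obtain ⟨z, a, m, h⟩ := h
  rcases List.append_eq_append_iff.mp h with ⟨u, h1, h2⟩ | ⟨u, h1, h2⟩
  · left
    have hp : p.map Prod.fst ++ u.map Prod.fst = z := by
      rw [← List.map_append, ← h1, map_fst_unmarked]
    have hu := unmarked_unmarked z
    rw [h1] at hu
    exact ⟨hu.left, u.map Prod.fst, a, m, by rw [h2, hu.right.eq]⟩
  · rcases u with _ | ⟨x, u⟩
    · left
      rw [List.append_nil] at h1
      exact ⟨h1 ▸ unmarked_unmarked z, [], a, m, by simpa [unmarked] using h2.symm⟩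
    · right
      rw [List.cons_append, List.cons.injEq] at h2
      obtain ⟨rfl, h2⟩ := h2
      have hu := unmarked_unmarked m
      rw [h2] at hu
      exact ⟨⟨z, a, u.map Prod.fst, by rw [h1, hu.left.eq]⟩, hu.right⟩

/-- Marked words in which the letter `x₀` of a rotation is moved around the circle. -/
theorem cycSum_rotate {τ : Q.Tot → Q.Tot} {k : List (Q.Tot × ℤ) → List (Q.Tot × ℤ) → M}
    (hk : ∀ p s, Unmarked s → k p s = 0) (a : Q.Tot) (l : List Q.Tot) :
    cycSum τ (splitSum fun s z => k (z.map (mapLetter τ)) s) a l = cycSum τ (splitSum k) a l := by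
  have h1 (z m : List Q.Tot) :
      splitSum (fun s z => k (z.map (mapLetter τ)) s) (unmarked (z.map τ) ++ (a, 1) :: unmarked m) =
      splitSum (fun m₁ m₂ => k (unmarked (m₂.map τ)) (unmarked (z.map τ) ++ (a, 1) :: unmarked m₁))
        m := by
    rw [splitSum_append_cons, splitSum_eq_zero, zero_add]
    · conv_lhs => rw [show unmarked m = m.map fun x => (x, (0 : ℤ)) from rfl, splitSum_map]
      exact splitSum_congr fun p q _ => by rw [unmarked_map (l := q)]; rfl
    · intro p q h
      exact hk _ _ ((h ▸ unmarked_unmarked (z.map τ)).left)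
  have h2 (z m : List Q.Tot) :
      splitSum k (unmarked (z.map τ) ++ (a, 1) :: unmarked m) =
      splitSum (fun z₁ z₂ => k (unmarked (z₁.map τ)) (unmarked (z₂.map τ) ++ (a, 1) :: unmarked m))
        z := by
    rw [splitSum_append_cons, splitSum_eq_zero (l := unmarked m), add_zero]
    · conv_lhs => rw [unmarked_map, show unmarked z = z.map fun x => (x, (0 : ℤ)) from rfl,
        List.map_map, splitSum_map]
      exact splitSum_congr fun p q _ => by
        simp only [unmarked, List.map_map]; rfl
    · intro p q h
      exact hk _ _ ((h ▸ unmarked_unmarked m).right)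
  simp only [cycSum, h1, h2]
  exact splitSum_assoc (fun m₁ m₂ z => k (unmarked (m₂.map τ))
    (unmarked (z.map τ) ++ (a, 1) :: unmarked m₁)) l

/-- The function of words with marked letters given by a multilinear map. -/
def hat (φ : Q.T →ₗ[K] M) (l : List (Q.Tot × ℤ)) : M := φ (word K (l.map Prod.fst))

theorem fml_word : FML K fun l : List (Q.Tot × ℤ) => word K (l.map Prod.fst) := fun p q n => by
  simpa using IsML.word (p.map Prod.fst) (q.map Prod.fst)

theorem fml_hat (φ : Q.T →ₗ[K] M) : FML K (hat φ) := fml_word.lcomp φ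

/-- Functions of words with values in the letters which shift the total reduced degree by `c`. -/
def Homog (G : GradingDatum Y) (obj : Q.Ob → Q'.Ob) (c : Y) (κ : List (Q.Tot × ℤ) → Q'.Tot) : Prop :=
  ∀ X Z r l, Q.IsPath G X Z r (l.map Prod.fst) → Q'.IsPath G (obj X) (obj Z) (r + c) [κ l]

/-- A decomposition of words into blocks, which sends paths to paths. -/
structure IsFunctorial (G : GradingDatum Y) (obj : Q.Ob → Q'.Ob)
    (B : List (Q.Tot × ℤ) → List (List (Q'.Tot × ℤ))) : Prop extends
    IsMarked.{max uK uY uO' uH'} K B where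
  equivar : Equivar B (mapLetter (Q.sgn G)) (mapLetter (Q'.sgn G))
  isPath : ∀ l X Z r, Q.IsPath G X Z r (l.map Prod.fst) →
    ∀ P ∈ B l, Q'.IsPath G (obj X) (obj Z) r (P.map Prod.fst)
  unmarked : ∀ l, Unmarked l → ∀ P ∈ B l, Unmarked P

theorem isFunctorial_idBlocks :
    IsFunctorial G id (idBlocks : List (Q.Tot × ℤ) → List (List (Q.Tot × ℤ))) where
  __ := isMarked_idBlocks
  equivar := equivar_idBlocks _
  isPath l X Z r h P hP := by
    obtain rfl : P = l := by simpa [idBlocks] using hP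
    exact h
  unmarked l h P hP := by
    obtain rfl : P = l := by simpa [idBlocks] using hP
    exact h

variable {obj : Q.Ob → Q'.Ob} {B : List (Q.Tot × ℤ) → List (List (Q'.Tot × ℤ))}

theorem IsFunctorial.equivar_twist (hB : IsFunctorial G obj B) (c : Y) :
    Equivar B (mapLetter (Q.twist G c)) (mapLetter (Q'.twist G c)) := by
  unfold twist
  split_ifs
  · exact hB.equivar
  · intro l
    have h1 : (mapLetter (LinearMap.id : Q.Tot →ₗ[K] Q.Tot)) = id := rfl
    have h2 : (mapLetter (LinearMap.id : Q'.Tot →ₗ[K] Q'.Tot)) = id := rfl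
    rw [h1, h2, List.map_id]
    simp

theorem Homog.sgn {c : Y} {κ : List (Q.Tot × ℤ) → Q'.Tot} (hκ : Homog G obj c κ) (hf : FML K κ)
    {X Z : Q.Ob} {r : Y} {l : List (Q.Tot × ℤ)} (h : Q.IsPath G X Z r (l.map Prod.fst)) :
    κ (l.map (mapLetter (Q.sgn G))) = G.sg c • Q'.sgn G (κ l) := by
  rw [h.fml_map_sgn hf, (hκ X Z r l h).sgn_single, smul_smul, G.sg_add, mul_comm, mul_assoc,
    G.sg_mul_self, mul_one]

/-- The operation on words that applies `κ` to an initial part, and `B` to the rest. -/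
def lead (B : List (Q.Tot × ℤ) → List (List (Q'.Tot × ℤ))) (κ : List (Q.Tot × ℤ) → Q'.Tot) :
    List (Q.Tot × ℤ) → Q'.T :=
  splitSum fun q r => bsum B (fun r' => word K (κ q :: r'.map Prod.fst)) r

theorem Rep.comp_lead (hB : IsFunctorial G obj B) {T₁ : Q'.T →ₗ[K] M}
    {ω : List (Q'.Tot × ℤ) → M} (hω : FML K ω) (h₁ : Rep G T₁ ω) {T₂ : Q.T →ₗ[K] Q'.T} {c : Y}
    {κ : List (Q.Tot × ℤ) → Q'.Tot} (hκ : Homog G obj c κ) (hu : ∀ q, Unmarked q → κ q = 0)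
    (h₂ : Rep G T₂ (lead B κ)) : Rep G (T₁ ∘ₗ T₂) (insL B (Q'.koszul G c) κ ω) := by
  intro X r a l hl
  have hω0 : ∀ p q n, ω (p ++ (0, n) :: q) = 0 := fun p q n => (hω p q n).map_zero
  set H : List (Q.Tot × ℤ) → List (Q.Tot × ℤ) → List (Q.Tot × ℤ) → M := fun p q m =>
    bsum B (fun p' => bsum B (fun r' =>
      ω (p'.map (mapLetter (Q'.koszul G c)) ++ markedLetter κ q :: r')) m) p with hH
  have hH0 : ∀ p q m, Unmarked q → H p q m = 0 := fun p q m hq => by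
    simp only [hH, markedLetter, hu q hq, hω0, bsum_zero]
  have key : ∀ y, OneMark y → (∃ X, Q.IsPath G X X r (y.map Prod.fst)) → T₁ (lead B κ y) =
      splitSum (fun s z => splitSum (H (z.map (mapLetter (Q.twist G r)))) s) y := by
    intro y hy hp
    obtain ⟨X, hp⟩ := hp
    rw [splitSum_assoc (fun q m z => H (z.map (mapLetter (Q.twist G r))) q m), lead,
      map_splitSum T₁]
    refine splitSum_congr fun q s hqs => ?_
    subst hqs
    rw [map_bsum T₁]
    rcases hy.append with ⟨hq, -⟩ | ⟨hq, hs⟩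
    · rw [splitSum_eq_zero fun p q' _ => hH0 _ _ _ hq, hu q hq]
      exact (bsum_congr fun P _ => by simp [word]).trans (bsum_zero _ _)
    · have h1 : bsum B (fun r' => T₁ (word K (κ q :: r'.map Prod.fst))) s =
          bsum B (splitSum fun m z => ω (z.map (mapLetter (Q'.twist G (r + c))) ++
            markedLetter κ q :: m)) s := by
        refine bsum_congr fun P hP => ?_
        obtain ⟨W, s₁, s₂, hq', hs', rfl⟩ := IsPath.of_append (by simpa using hp)
        have hP' : Q'.IsPath G (obj X) (obj X) (s₁ + s₂ + c) (κ q :: P.map Prod.fst) :=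
          ((hκ _ _ _ _ hq').cons' (hB.isPath _ _ _ _ hs' P hP)).cast (by abel)
        rw [h₁ _ _ _ _ hP', cycSum]
        conv_rhs => rw [← (hB.unmarked s hs P hP).eq, show unmarked (P.map Prod.fst) =
          (P.map Prod.fst).map fun x => (x, (0 : ℤ)) from rfl, splitSum_map]
        refine splitSum_congr fun p q' _ => ?_
        rw [markedLetter, hq.cnt, unmarked_map]
        rfl
      rw [h1, hB.toIsMarked.bsum_splitSum]
      refine splitSum_congr fun m z _ => ?_
      rw [bsum_comm, hH]
      dsimp only
      rw [(hB.equivar_twist r).bsum]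
      refine bsum_congr fun P _ => bsum_congr fun P' _ => ?_
      congr 2
      rw [List.map_map]
      refine List.map_congr_left fun x _ => ?_
      exact Prod.ext (twist_add _ _ _) rfl
  rw [LinearMap.comp_apply, h₂ X r a l hl, cycSum, map_splitSum T₁]
  refine (splitSum_congr fun m z hmz => key _ ⟨_, _, _, rfl⟩ ?_).trans
    (cycSum_rotate (τ := Q.twist G r) (k := fun p => splitSum (H p)) ?_ a l) |>.trans ?_
  · obtain ⟨W, hW⟩ := isPath_rotate (hmz ▸ hl)
    exact ⟨W, by simpa [unmarked, Function.comp_def] using hW⟩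
  · intro p s hs
    exact splitSum_eq_zero fun q m h => hH0 _ _ _ (h ▸ hs).left
  · simp only [cycSum, insL, insOp, splitSum₃, one_smul, hH]

end GQuiver

namespace GQuiver

variable {K : Type uK} [Field K] {Y : Type uY} [AddCommGroup Y] {G : GradingDatum Y}
  {Q : GQuiver.{uK, uY, uO, uH} K Y} {Q' : GQuiver.{uK, uY, uO', uH'} K Y}
  {M : Type*} [AddCommGroup M] [Module K M]

/-! ### The operations as functions of marked words -/

theorem cnt_take (z : List Q.Tot) (a : Q.Tot) (m : List Q.Tot) (n : ℕ) :
    cnt ((unmarked z ++ (a, 1) :: unmarked m).take n) = if z.length < n then 1 else 0 := by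
  have h0 (l : List Q.Tot) (n : ℕ) : cnt ((unmarked l).take n) = 0 :=
    Unmarked.cnt fun x hx => unmarked_unmarked l x (List.mem_of_mem_take hx)
  have hl : (unmarked z).length = z.length := by simp [unmarked]
  rw [List.take_append, cnt_append, h0, hl, zero_add]
  split_ifs with h
  · obtain ⟨j, hj⟩ : ∃ j, n - z.length = j + 1 := ⟨n - z.length - 1, by omega⟩
    rw [hj, List.take_succ_cons, cnt_cons, h0]
    rfl
  · rw [show n - z.length = 0 by omega]
    rfl

theorem cnt_left {z : List Q.Tot} {a : Q.Tot} {m : List Q.Tot} {p q : List (Q.Tot × ℤ)}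
    (h : p ++ q = unmarked z ++ (a, 1) :: unmarked m) :
    cnt p = if z.length < p.length then 1 else 0 := by
  rw [← cnt_take z a m, ← h, List.take_left']
  rfl

theorem cnt_middle {z : List Q.Tot} {a : Q.Tot} {m : List Q.Tot} {p q r : List (Q.Tot × ℤ)}
    (h : p ++ (q ++ r) = unmarked z ++ (a, 1) :: unmarked m) :
    cnt q = if p.length ≤ z.length ∧ z.length < p.length + q.length then 1 else 0 := by
  have h1 := cnt_left h
  have h2 := cnt_left (p := p ++ q) (q := r) (by rw [List.append_assoc, h])
  rw [cnt_append, List.length_append] at h2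
  split_ifs at h1 h2 ⊢ <;> omega

theorem unmarked_mark_map_fst (z : List Q.Tot) (a : Q.Tot) (m : List Q.Tot) :
    (unmarked z ++ (a, 1) :: unmarked m).map Prod.fst = z ++ a :: m := by
  simp [map_fst_unmarked]

theorem word_zsmul_cons (n : ℤ) (x : Q.Tot) (l : List Q.Tot) :
    word K (n • x :: l) = n • word K (x :: l) :=
  map_zsmul ((IsML.word (K := K) [] l).mk' _) n x

theorem rep_bOuter (μ : Q.Cochain) :
    Rep G (Q.brace G (bOuter μ) (bOuter_isML μ))
      (lead idBlocks fun l => cnt l • hat μ l) := by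
  refine rep_brace fun z a m _ _ _ => ?_
  rw [← unmarked_mark_map_fst z a m, bOuter, lead, splitSum_map]
  refine splitSum_congr fun p q h => ?_
  rw [bsum_idBlocks, word_zsmul_cons, cnt_left h, List.length_map, hat]
  split_ifs <;> simp

theorem rep_bOneOne (μ φ : Q.Cochain) :
    Rep G (bOneOne G μ φ) (lead idBlocks (insH idBlocks (Q.sgn G) (hat φ) (hat μ))) := by
  refine rep_brace fun z a m _ _ _ => ?_
  have hw (s : List (Q.Tot × ℤ)) (k : List (Q.Tot × ℤ) → List (Q.Tot × ℤ) → Q.Tot)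
      (y : List (Q.Tot × ℤ)) : word K (splitSum k y :: s.map Prod.fst) =
      splitSum (fun p q => word K (k p q :: s.map Prod.fst)) y :=
    map_splitSum ((IsML.word (K := K) [] (s.map Prod.fst)).mk' _) k y
  rw [← unmarked_mark_map_fst z a m, bOneOneFun, splitSum₄, lead]
  simp only [splitSum₃, splitSum_map, bsum_idBlocks, insH, insOp, hw]
  rw [splitSum_assoc (fun p y s => splitSum (fun q r => word K (cnt r •
    hat μ (p.map (mapLetter (Q.sgn G)) ++ markedLetter (hat φ) q :: r) :: s.map Prod.fst)) y)]
  refine splitSum_congr fun p t h₁ => ?_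
  rw [splitSum_assoc (fun q r s => word K (cnt r •
    hat μ (p.map (mapLetter (Q.sgn G)) ++ markedLetter (hat φ) q :: r) :: s.map Prod.fst))]
  refine splitSum_congr fun q t' h₂ => splitSum_congr fun r s h₃ => ?_
  have h : (p ++ q) ++ (r ++ s) = unmarked z ++ (a, 1) :: unmarked m := by
    rw [List.append_assoc, h₃, h₂, h₁]
  rw [word_zsmul_cons, cnt_middle h]
  simp only [List.length_map, List.length_append, hat, List.map_append, List.map_cons,
    map_fst_mapLetter]
  split_ifs <;> simp

/-- The function `(a₀,…,aₛ) ↦ e[a₀|…|aₛ]` of marked words. -/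
def unitWord (e : Q.Ob → Q.Tot) (l : List (Q.Tot × ℤ)) : Q.T := hat (prependUnit e) l

theorem rep_connesB (e : Q.Ob → Q.Tot) : Rep G (connesB G e) (unitWord e) :=
  rep_brace fun z a m _ _ _ => by rw [unitWord, hat, unmarked_mark_map_fst]

theorem rep_connesBOneOne (e : Q.Ob → Q.Tot) (φ : Q.Cochain) :
    Rep G (connesBOneOne G e φ) (insH idBlocks (Q.sgn G) (hat φ) (unitWord e)) := by
  refine rep_brace fun z a m _ _ _ => ?_
  rw [← unmarked_mark_map_fst z a m, connesBOneOneFun]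
  simp only [splitSum₃, splitSum_map, bsum_idBlocks, insH, insOp]
  refine splitSum_congr fun p t h₁ => splitSum_congr fun q r h₂ => ?_
  have h : (p ++ q) ++ (r ++ []) = unmarked z ++ (a, 1) :: unmarked m := by
    rw [List.append_nil, List.append_assoc, h₂, h₁]
  have hlen := congrArg List.length h
  rw [cnt_middle h]
  simp only [List.length_map, List.length_append, unitWord, hat, List.map_append, List.map_cons,
    map_fst_mapLetter, unmarked, List.length_cons, List.length_nil] at hlen ⊢
  by_cases hz : p.length + q.length ≤ z.length
  · rw [if_pos hz, if_pos ⟨hz, by omega⟩, one_smul]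
  · rw [if_neg hz, if_neg fun h => hz h.1, zero_smul]

theorem rep_pushforward (F : Q.T →ₗ[K] Q'.Tot) :
    Rep G (pushforward G F) (lead (partsBlocks (markedLetter (hat F))) fun l => cnt l • hat F l) := by
  refine rep_brace fun z a m _ _ _ => ?_
  rw [← unmarked_mark_map_fst z a m, pushforwardFun, lead, splitSum_map]
  refine splitSum_congr fun p q h => ?_
  rw [bsum_partsBlocks, cnt_left h, List.length_map, hat, parts_map, List.map_map]
  split_ifs
  · simp only [one_smul]
    congr 1
    refine List.map_congr_left fun P _ => ?_
    simp [Function.comp_def, hat]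
  · refine (List.sum_eq_zero fun x hx => ?_).symm
    obtain ⟨P, -, rfl⟩ := List.mem_map.mp hx
    simp [word]

/-! ### The Hochschild differential -/

theorem Homog.weight {obj : Q.Ob → Q'.Ob} {c : Y} {κ : List (Q.Tot × ℤ) → Q'.Tot}
    (hκ : Homog G obj c κ) (w : List (Q.Tot × ℤ) → ℤ) : Homog G obj c fun l => w l • κ l :=
  fun X Z r l h => (hκ X Z r l h).single_zsmul _

theorem bInner_cons (μ : Q.Cochain) (a : Q.Tot) (l : List Q.Tot) :
    bInner G μ (a :: l) = splitSum (fun p s => splitSum (fun q t =>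
      word K (Q.sgn G a :: (p.map (Q.sgn G) ++ μ (word K q) :: t))) s) l := by
  rw [bInner, splitSum₃, splitSum_cons, splitSum_eq_zero fun p q _ => if_neg (by simp), zero_add]
  refine splitSum_congr fun p s _ => splitSum_congr fun q t _ => ?_
  rw [if_pos (by simp)]
  simp

/-- The terms of the Hochschild differential in which `a₀` is not an input of `μ`. -/
def innerB (G : GradingDatum Y) (μ : Q.Cochain) : Q.T →ₗ[K] Q.T :=
  linExt (bInner G μ) (bInner_isML G μ)

/-- The terms of the Hochschild differential in which `a₀` is an input of `μ`. -/
def outerB (G : GradingDatum Y) (μ : Q.Cochain) : Q.T →ₗ[K] Q.T :=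
  Q.brace G (bOuter μ) (bOuter_isML μ)

theorem hochschildB_eq (μ : Q.Cochain) : hochschildB G μ = outerB G μ + innerB G μ := rfl

theorem innerB_cons (μ : Q.Cochain) (a : Q.Tot) (l : List Q.Tot) :
    innerB G μ (word K (a :: l)) =
      splitSum (fun p s => splitSum (fun q t =>
        word K (Q.sgn G a :: (p.map (Q.sgn G) ++ μ (word K q) :: t))) s) l :=
  (linExt_word _ _ _).trans (bInner_cons μ a l)

/-- Insertions on the left of the mark. -/
def insLeft (G : GradingDatum Y) (μ : Q.Cochain) (ω : List (Q.Tot × ℤ) → M) (τ : Q.Tot → Q.Tot)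
    (a : Q.Tot) (m p q t : List Q.Tot) : M :=
  ω ((unmarked ((p.map τ).map (Q.sgn G)) ++ (μ (word K (q.map τ)), 0) :: unmarked (t.map τ)) ++
      (a, 1) :: unmarked m)

/-- Insertions on the right of the mark. -/
def insRight (G : GradingDatum Y) (μ : Q.Cochain) (ω : List (Q.Tot × ℤ) → M) (τ : Q.Tot → Q.Tot)
    (a : Q.Tot) (p q t z : List Q.Tot) : M :=
  ω (unmarked ((z.map τ).map (Q.sgn G)) ++ (Q.sgn G a, 1) ::
      unmarked (p.map (Q.sgn G) ++ μ (word K q) :: t))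

theorem insL_unmarked_append_cons {ω : List (Q.Tot × ℤ) → M} (hω : FML K ω) (μ : Q.Cochain)
    (τ : Q.Tot → Q.Tot) (a : Q.Tot) (m z : List Q.Tot) :
    insL idBlocks (Q.sgn G) (fun l => (1 - cnt l) • hat μ l) ω
      (unmarked (z.map τ) ++ (a, 1) :: unmarked m) =
      splitSum (fun p s => splitSum (fun q t => insLeft G μ ω τ a m p q t) s) z +
        splitSum (fun p s => splitSum (fun q t => insRight G μ ω τ a p q t z) s) m := by
  have hω0 : ∀ p q n, ω (p ++ (0, n) :: q) = 0 := fun p q n => (hω p q n).map_zero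
  have hun (k : List (Q.Tot × ℤ) → List (Q.Tot × ℤ) → M) (z : List Q.Tot) :
      splitSum k (unmarked z) = splitSum (fun p q => k (unmarked p) (unmarked q)) z :=
    splitSum_map _ _ _
  have hcu (l : List Q.Tot) : cnt (unmarked l) = 0 := (unmarked_unmarked l).cnt
  simp only [insL, insOp, splitSum₃, one_smul, bsum_idBlocks, splitSum_append_cons, hun,
    splitSum_map, markedLetter, cnt_append, cnt_cons, hcu, insLeft, insRight]
  simp [hω0, hat, map_fst_unmarked, ← unmarked_map, unmarked_append, unmarked_cons, splitSum]

theorem coe_twist_add_one (r : Y) :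
    ⇑(Q.twist G (r + G.fromInt 1)) = fun x => Q.sgn G (Q.twist G r x) :=
  funext fun x => by rw [twist_add, koszul_fromInt_one]

theorem insLeft_eq {ω : List (Q.Tot × ℤ) → M} (hω : FML K ω) {μ : Q.Cochain}
    (hμ : Homog G id (G.fromInt 1) (hat μ)) {X : Q.Ob} {r : Y} {a : Q.Tot} {p₁ p₂ q t : List Q.Tot}
    (hl : Q.IsPath G X X r (a :: (p₁ ++ (p₂ ++ (q ++ t))))) :
    ω (unmarked (((p₂.map (Q.sgn G)) ++ μ (word K q) :: t).map (Q.twist G (r + G.fromInt 1))) ++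
        (Q.sgn G a, 1) :: unmarked (p₁.map (Q.sgn G))) =
      insLeft G μ ω (Q.twist G r) a p₁ p₂ q t := by
  obtain ⟨W₁, c₀, d₁, h₀, h₁, rfl⟩ := IsPath.of_cons hl
  obtain ⟨W₂, c₁, d₂, hp₁, h₂, rfl⟩ := h₁.of_append
  obtain ⟨W₃, c₂, d₃, hp₂, h₃, rfl⟩ := h₂.of_append
  obtain ⟨W₄, c₃, c₄, hq, ht, rfl⟩ := h₃.of_append
  have hμq := hμ _ _ _ (unmarked q) (by rwa [map_fst_unmarked])
  simp only [hat, map_fst_unmarked, id] at hμq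
  have hμs : μ (word K (q.map (Q.sgn G))) = -Q.sgn G (μ (word K q)) := by
    have := hμ.sgn (fml_hat μ) (l := unmarked q) (by rwa [map_fst_unmarked])
    simpa only [hat, map_fst_mapLetter, map_fst_unmarked, G.sg_fromInt_one, neg_smul, one_smul]
      using this
  have hn (p q : List (Q.Tot × ℤ)) (x : Q.Tot) : ω (p ++ (-x, 0) :: q) = -ω (p ++ (x, 0) :: q) :=
    map_neg ((hω p q 0).mk' _) x
  generalize hr : c₀ + (c₁ + (c₂ + (c₃ + c₄))) = r
  have hwp (b : Q.Tot) (p : List Q.Tot) (hb : Q.IsPath G X W₁ c₀ [b]) (hp : Q.IsPath G W₁ W₂ c₁ p) :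
      ω ((unmarked p₂ ++ (Q.sgn G (μ (word K q)), 0) :: unmarked (t.map (Q.sgn G))) ++
        (Q.sgn G b, 1) :: unmarked (p.map (Q.sgn G))) = -G.sg r •
      ω ((unmarked (p₂.map (Q.sgn G)) ++ (μ (word K q), 0) :: unmarked t) ++
        (b, 1) :: unmarked p) := by
    have h := (hp₂.map_sgn.append (hμq.cons' ht)).append (hb.append hp)
    have hs := IsPath.fml_map_sgn (r := r + G.fromInt 1) (X := W₂) (Z := W₂)
      (l := (unmarked (p₂.map (Q.sgn G)) ++ (μ (word K q), 0) :: unmarked t) ++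
        (b, 1) :: unmarked p) (IsPath.cast (r := c₂ + (c₃ + G.fromInt 1 + c₄) + (c₀ + c₁))
          (by simpa [map_fst_unmarked] using h) (by rw [← hr]; abel)) hω
    rw [G.sg_add, G.sg_fromInt_one, mul_neg_one] at hs
    rw [← hs]
    simp only [List.map_append, List.map_cons, ← unmarked_map, Prod.map_apply, id, List.map_map,
      Function.comp_def, sgn_sgn, List.map_id']
  have h01 : ∀ x : ZMod 2, x = 0 ∨ x = 1 := by decide
  simp only [insLeft, List.map_append, List.map_cons, List.map_map, Function.comp_def,
    coe_twist_add_one, unmarked_append, unmarked_cons]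
  rcases h01 (G.parity r) with h | h
  · have e1 : Q.twist G r = Q.sgn G := if_pos h
    have e2 : G.sg r = 1 := if_pos h
    have hs := hwp (Q.sgn G a) (p₁.map (Q.sgn G)) h₀.map_sgn hp₁.map_sgn
    simp only [e1, e2, sgn_sgn, hμs, List.map_id', List.map_map, Function.comp_def, neg_smul,
      one_smul, List.append_assoc, List.cons_append, hn] at hs ⊢
    exact (neg_eq_iff_eq_neg.mpr hs).symm
  · have e1 : Q.twist G r = LinearMap.id := if_neg (by simp [h])
    have e2 : G.sg r = -1 := if_neg (by simp [h])
    have hs := hwp a p₁ h₀ hp₁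
    rw [e2, neg_neg, one_smul] at hs
    simpa [e1, sgn_sgn] using hs

theorem Rep.comp_innerB {T₁ : Q.T →ₗ[K] M} {ω : List (Q.Tot × ℤ) → M} (hω : FML K ω)
    (h₁ : Rep G T₁ ω) {μ : Q.Cochain} (hμ : Homog G id (G.fromInt 1) (hat μ)) :
    Rep G (T₁ ∘ₗ innerB G μ)
      (insL idBlocks (Q.sgn G) (fun l => (1 - cnt l) • hat μ l) ω) := by
  intro X r a l hl
  have hT : ∀ p s, p ++ s = l → T₁ (splitSum (fun q t =>
      word K (Q.sgn G a :: (p.map (Q.sgn G) ++ μ (word K q) :: t))) s) =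
      splitSum (fun p₁ p₂ => splitSum (fun q t => insLeft G μ ω (Q.twist G r) a p₁ p₂ q t) s) p +
      splitSum (fun t z => splitSum (fun q t => insRight G μ ω (Q.twist G r) a p q t z) t) s := by
    intro p s hps
    rw [map_splitSum T₁, splitSum_assoc (fun q t z => insRight G μ ω (Q.twist G r) a p q t z),
      splitSum_comm, ← splitSum_add]
    refine splitSum_congr fun q t hqt => ?_
    have hpath : Q.IsPath G X X (r + G.fromInt 1)
        (Q.sgn G a :: (p.map (Q.sgn G) ++ μ (word K q) :: t)) := by
      rw [← hps, ← hqt] at hl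
      obtain ⟨W₁, c₀, d₁, h₀, h₁, rfl⟩ := IsPath.of_cons hl
      obtain ⟨W₂, c₁, d₂, hp₁, h₂, rfl⟩ := h₁.of_append
      obtain ⟨W₄, c₃, c₄, hq, ht, rfl⟩ := h₂.of_append
      have hμq := hμ _ _ _ (unmarked q) (by rwa [map_fst_unmarked])
      simp only [hat, map_fst_unmarked, id] at hμq
      exact (h₀.map_sgn.cons' (hp₁.map_sgn.append (hμq.cons' ht))).cast (by abel)
    rw [h₁ _ _ _ _ hpath, cycSum, splitSum_append_cons, splitSum_map]
    congr 1
    · refine splitSum_congr fun p₁ p₂ hp => insLeft_eq (X := X) hω hμ ?_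
      rwa [← List.append_assoc, hp, hqt, hps]
    · refine splitSum_congr fun t z _ => ?_
      simp only [insRight, List.map_map, Function.comp_def, coe_twist_add_one]
  rw [LinearMap.comp_apply, innerB_cons, map_splitSum T₁, splitSum_congr hT]
  simp only [cycSum, insL_unmarked_append_cons hω]
  rw [splitSum_add, splitSum_add,
    splitSum_assoc (fun p₁ p₂ s => splitSum (fun q t => insLeft G μ ω (Q.twist G r) a p₁ p₂ q t) s),
    splitSum_assoc (fun p t z => splitSum (fun q t => insRight G μ ω (Q.twist G r) a p q t z) t)]

theorem Rep.comp_hochschildB {T₁ : Q.T →ₗ[K] M} {ω : List (Q.Tot × ℤ) → M} (hω : FML K ω)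
    (h₁ : Rep G T₁ ω) {μ : Q.Cochain} (hμ : Homog G id (G.fromInt 1) (hat μ)) :
    Rep G (T₁ ∘ₗ hochschildB G μ) (insL idBlocks (Q.sgn G) (hat μ) ω) := by
  have ho : Rep G (T₁ ∘ₗ outerB G μ)
      (insL idBlocks (Q.sgn G) (fun l => cnt l • hat μ l) ω) := by
    have h := Rep.comp_lead (c := G.fromInt 1) (isFunctorial_idBlocks) hω h₁
      (hμ.weight cnt) (fun l hl => by rw [hl.cnt, zero_smul]) (rep_bOuter (G := G) μ)
    rwa [koszul_fromInt_one] at h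
  have hi := Rep.comp_innerB hω h₁ hμ
  rw [hochschildB_eq, LinearMap.comp_add]
  refine (ho.add hi).congr fun l _ _ => ?_
  refine (insOp_letter_add _ _ (fun l => cnt l • hat μ l) (fun l => (1 - cnt l) • hat μ l) hω l).symm.trans
    (insOp_letter_congr fun p q r _ => ?_)
  rw [← add_smul, add_sub_cancel, one_smul]

end GQuiver

namespace Conv

variable {K : Type*} [Field K] {V V' : Type*} [AddCommGroup V] [Module K V]
  [AddCommGroup V'] [Module K V'] {B : List (V × ℤ) → List (List (V' × ℤ))}
  {R : Type w} [Ring R] [Algebra K R] {lt : ℤ → V' →ₗ[K] R}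
  {ς : V' →ₗ[K] V'} {z : R →+* R}

theorem pull_comap_letterC_oneLetter (hB : IsCoalg.{w} B) (hz : ∀ n v, z (lt n v) = lt n (ς v)) :
    pull hB (comap (mapLetter ς) (letterC lt oneLetter)) =
      mapRing z (pull hB (letterC lt oneLetter)) := by
  have hk : ∀ l : List (V' × ℤ), oneLetter (l.map (mapLetter ς)) = (1 : ℤ) • ς (oneLetter l) := by
    intro l
    match l with
    | [] => simp [oneLetter]
    | [a] => simp [oneLetter]
    | _ :: _ :: _ => simp [oneLetter]
  rw [comap_letterC lt hz hk, one_smul, pull_mapRing]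

theorem ins_letterC_oneLetter (hB : IsMarked.{w} K B) (hz : ∀ n v, z (lt n v) = lt n (ς v))
    (ψ : List (V × ℤ) → V') :
    ins (fun _ => 1) B (mapLetter ς) (markedLetter ψ) (letterC lt oneLetter) = letterC lt ψ := by
  have hc := hB.toIsCoalg
  have h1 := congrArg (ins (fun _ => 1) B (mapLetter ς) (markedLetter ψ)) (wordC_eq lt)
  have hadd : ins (fun _ => 1) B (mapLetter ς) (markedLetter ψ)
      (1 + letterC lt oneLetter * wordC lt) = ins (fun _ => 1) B (mapLetter ς) (markedLetter ψ)
      (letterC lt oneLetter * wordC lt) := by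
    refine ext' fun l => ?_
    have := insOp_add (fun _ => 1) B (mapLetter ς) (markedLetter ψ) (1 : Conv (V' × ℤ) R).toFun
      (letterC lt oneLetter * wordC lt).toFun l
    have h0 := congrArg (fun f => f.toFun l)
      (ins_one (R := R) (B := B) (fun _ => 1) (mapLetter ς) (markedLetter ψ))
    rw [ins_apply, ins_apply]
    refine this.trans ?_
    rw [add_eq_right]
    exact h0
  rw [hadd, ins_one_mul hc, ins_markedLetter_wordC hB _ hz, weight_one,
    pull_comap_letterC_oneLetter hc hz] at h1
  have h2 := pull_wordC_eq (lt := lt) hc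
  have h3 := pull_wordC_eq' (lt := lt) hc
  have h4 := congrArg (mapRing z) h2
  rw [map_add, map_mul, map_one] at h4
  generalize ins (fun _ => 1) B (mapLetter ς) (markedLetter ψ) (letterC lt oneLetter) = I at *
  generalize pull hc (wordC lt) = Φ at *
  generalize pull hc (letterC lt oneLetter) = X at *
  generalize letterC lt ψ = Ψ at *
  generalize mapRing z Φ = Φ' at *
  generalize mapRing z X = X' at *
  have h5 : I * Φ = Ψ * Φ := by
    have : Φ' * Ψ * Φ = (1 + X' * Φ') * Ψ * Φ := by rw [← h4]
    rw [this] at h1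
    calc I * Φ = (1 + X' * Φ') * Ψ * Φ - X' * (Φ' * Ψ * Φ) := by
            rw [h1, this]; noncomm_ring
      _ = Ψ * Φ := by noncomm_ring
  have h6 : Φ * (1 - X) = 1 := by
    calc Φ * (1 - X) = Φ - Φ * X := by noncomm_ring
      _ = 1 := by nth_rewrite 1 [h3]; noncomm_ring
  calc I = I * (Φ * (1 - X)) := by rw [h6, mul_one]
    _ = I * Φ * (1 - X) := by rw [mul_assoc]
    _ = Ψ * (Φ * (1 - X)) := by rw [h5, mul_assoc]
    _ = Ψ := by rw [h6, mul_one]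

theorem ins_leading (hB : IsMarked.{w} K B) (hz : ∀ n v, z (lt n v) = lt n (ς v))
    (ψ : List (V × ℤ) → V') :
    ins (fun _ => 1) B (mapLetter ς) (markedLetter ψ)
        (weight cnt (letterC lt oneLetter) * wordC lt) =
      weight cnt (mapRing z (pull hB.toIsCoalg (letterC lt oneLetter))) *
        ins (fun _ => 1) B (mapLetter ς) (markedLetter ψ) (wordC lt) +
      weight cnt (letterC lt ψ) * pull hB.toIsCoalg (wordC lt) := by
  have hw (f : Conv (V' × ℤ) R) : comap (mapLetter ς) (weight cnt f) =
      weight cnt (comap (mapLetter ς) f) := by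
    refine ext' fun l => ?_
    have : cnt (l.map (mapLetter ς)) = cnt l := by simp [cnt, Function.comp_def]
    change cnt (l.map (mapLetter ς)) • f (l.map (mapLetter ς)) = cnt l • f (l.map (mapLetter ς))
    rw [this]
  rw [ins_one_mul hB.toIsCoalg, ins_weight hB, ins_letterC_oneLetter hB hz, hw, pull_weight hB,
    pull_comap_letterC_oneLetter _ hz]

theorem letterC_mul_pull_wordC (hB : IsMarked.{w} K B) (hz : ∀ n v, z (lt n v) = lt n (ς v))
    (ψ : List (V × ℤ) → V') :
    letterC lt ψ * pull hB.toIsCoalg (wordC lt) -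
        ins cnt B (mapLetter ς) (markedLetter ψ) (wordC lt) +
        (mapRing z (pull hB.toIsCoalg (letterC lt oneLetter)) *
          ins cnt B (mapLetter ς) (markedLetter ψ) (wordC lt) +
        weight cnt (mapRing z (pull hB.toIsCoalg (letterC lt oneLetter))) *
          ins (fun _ => 1) B (mapLetter ς) (markedLetter ψ) (wordC lt)) =
      ins (fun _ => 1) B (mapLetter ς) (markedLetter ψ)
        (weight cnt (letterC lt oneLetter) * wordC lt) +
      (letterC lt ψ * pull hB.toIsCoalg (wordC lt) -
        weight cnt (letterC lt ψ * pull hB.toIsCoalg (wordC lt))) := by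
  have hc := hB.toIsCoalg
  have h4 := congrArg (mapRing z) (pull_wordC_eq (lt := lt) hc)
  rw [map_add, map_mul, map_one] at h4
  rw [ins_leading hB hz, weight_cnt_mul, ins_markedLetter_wordC hB cnt hz]
  generalize ins (fun _ => 1) B (mapLetter ς) (markedLetter ψ) (wordC lt) = J at *
  generalize mapRing z (pull hc (wordC lt)) = Φ' at *
  generalize mapRing z (pull hc (letterC lt oneLetter)) = X' at *
  have : Φ' * letterC lt ψ * weight cnt (pull hc (wordC lt)) =
      (1 + X' * Φ') * letterC lt ψ * weight cnt (pull hc (wordC lt)) := by rw [← h4]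
  nth_rewrite 1 [this]
  noncomm_ring

theorem ins_weight_letterC (hB : IsMarked.{w} K B) :
    ins (fun _ => 1) B id (markedLetter fun l => cnt l • bsum B oneLetter l) (wordC lt) =
      weight cnt (pull hB.toIsCoalg (wordC lt)) := by
  have hc := hB.toIsCoalg
  have h := ins_markedLetter_wordC (lt := lt) hB (fun _ => 1) (ς := LinearMap.id)
    (z := RingHom.id R) (fun _ _ => rfl) (fun l => cnt l • bsum B oneLetter l)
  have e : letterC lt (fun l : List (V × ℤ) => cnt l • bsum B oneLetter l) =
      weight cnt (pull hc (letterC lt oneLetter)) := by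
    rw [pull_letterC lt hB]
    exact ext' fun l => map_zsmul (lt (cnt l)) _ _
  rw [e, weight_one] at h
  refine h.trans ?_
  have h1 := congrArg (weight cnt) (pull_wordC_eq (lt := lt) hc)
  have h2 : weight cnt (1 : Conv (V × ℤ) R) = 0 := by
    refine ext' fun l => ?_
    rcases l with _ | ⟨a, l⟩
    · simp [weight_apply, cnt]
    · rw [weight_apply, one_of_ne_nil (by simp), smul_zero]; rfl
  have hadd (f g : Conv (V × ℤ) R) : weight cnt (f + g) = weight cnt f + weight cnt g :=
    ext' fun l => smul_add _ _ _
  have h3 := pull_wordC_eq' (lt := lt) hc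
  rw [hadd, h2, zero_add, weight_cnt_mul] at h1
  have : mapRing (RingHom.id R) (pull hc (wordC lt)) = pull hc (wordC lt) := rfl
  rw [this, mul_assoc]
  exact (eq_mul_of_inv h3 (h1.trans (add_comm _ _))).symm

end Conv

section FMLUniverse

theorem insOp_sub {A A' M : Type*} [AddCommGroup M] (c : List A → ℤ) (B : List A → List (List A'))
    (ς : A' → A') (ψ : List A → A') (f g : List A' → M) (l : List A) :
    insOp c B ς ψ (fun P => f P - g P) l = insOp c B ς ψ f l - insOp c B ς ψ g l := by
  rw [eq_sub_iff_add_eq, ← insOp_add]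
  simp only [sub_add_cancel]

variable {K : Type u} [Field K] {V : Type*} {V' : Type v} [AddCommGroup V] [Module K V]
  [AddCommGroup V'] [Module K V'] {M : Type*} [AddCommGroup M] [Module K M]
  {B : List (V × ℤ) → List (List (V' × ℤ))}

open Conv in
theorem insL_cnt_smul (hB : IsMarked.{max u v} K B) {f : List (V' × ℤ) → M} (hf : FML K f)
    (l : List (V × ℤ)) :
    insL B (LinearMap.id : V' →ₗ[K] V') (fun l => cnt l • bsum B oneLetter l) f l =
      cnt l • bsum B f l := by
  obtain ⟨L, hL⟩ := exists_eq_algWord hf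
  obtain rfl : f = fun l => L (wordC (univLetter K V') l) := funext hL
  have h := congrArg (fun g => L (g.toFun l)) (ins_weight_letterC (lt := univLetter K V') hB)
  refine Eq.trans ?_ (h.trans ?_)
  · rw [ins_apply, map_insOp]
    rfl
  · rw [weight_apply, map_zsmul, pull_apply, map_bsum]

end FMLUniverse

namespace GQuiver

variable {K : Type uK} [Field K] {Y : Type uY} [AddCommGroup Y] {G : GradingDatum Y}
  {Q : GQuiver.{uK, uY, uO, uH} K Y} {Q' : GQuiver.{uK, uY, uO', uH'} K Y}
  {M : Type*} [AddCommGroup M] [Module K M]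

theorem cycSum_congr_degree {X : Q.Ob} {r : Y} {a : Q.Tot} {l : List Q.Tot}
    (h : Q.IsPath G X X r (a :: l)) {f g : List (Q.Tot × ℤ) → M}
    (hfg : ∀ l, OneMark l → (∃ W, Q.IsPath G W W r (l.map Prod.fst)) → f l = g l) :
    cycSum (Q.twist G r) f a l = cycSum (Q.twist G r) g a l := by
  refine splitSum_congr fun m z hmz => hfg _ ⟨_, _, _, rfl⟩ ?_
  obtain ⟨W, hW⟩ := isPath_rotate (hmz ▸ h)
  exact ⟨W, by simpa [unmarked, Function.comp_def] using hW⟩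

theorem cycSum_add (τ : Q.Tot → Q.Tot) (f g : List (Q.Tot × ℤ) → M) (a : Q.Tot) (l : List Q.Tot) :
    cycSum τ (fun w => f w + g w) a l = cycSum τ f a l + cycSum τ g a l := splitSum_add _ _ _

theorem cycSum_sub (τ : Q.Tot → Q.Tot) (f g : List (Q.Tot × ℤ) → M) (a : Q.Tot) (l : List Q.Tot) :
    cycSum τ (fun w => f w - g w) a l = cycSum τ f a l - cycSum τ g a l := splitSum_sub _ _ _

theorem cycSum_zsmul (n : ℤ) (τ : Q.Tot → Q.Tot) (f : List (Q.Tot × ℤ) → M) (a : Q.Tot)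
    (l : List Q.Tot) : cycSum τ (fun w => n • f w) a l = n • cycSum τ f a l := splitSum_zsmul _ _ _

theorem IsPath.fml_map_twist_twist {p s : List (Q.Tot × ℤ)} {X Z : Q.Ob} {r : Y}
    (h : Q.IsPath G X Z r ((p ++ s).map Prod.fst))
    {k : List (Q.Tot × ℤ) → List (Q.Tot × ℤ) → M}
    (h₁ : ∀ s, FML K fun p => k p s) (h₂ : ∀ p, FML K (k p)) :
    k (p.map (mapLetter (Q.twist G r))) (s.map (mapLetter (Q.twist G r))) = k p s := by
  unfold twist
  split_ifs with h0
  · obtain ⟨W, c, d, hp, hs, rfl⟩ := IsPath.of_append (by simpa using h)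
    rw [hp.fml_map_sgn (h₁ _), hs.fml_map_sgn (h₂ _), smul_smul, ← G.sg_add, GradingDatum.sg,
      if_pos h0, one_smul]
  · have : (mapLetter (LinearMap.id : Q.Tot →ₗ[K] Q.Tot)) = id := rfl
    rw [this, List.map_id, List.map_id]

/-- Cyclic invariance: a final part of a word can be moved to the front. -/
theorem cycSum_rotate_fml {k : List (Q.Tot × ℤ) → List (Q.Tot × ℤ) → M}
    (h₁ : ∀ s, FML K fun p => k p s) (h₂ : ∀ p, FML K (k p)) {X : Q.Ob} {r : Y} {a : Q.Tot}
    {l : List Q.Tot} (h : Q.IsPath G X X r (a :: l)) :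
    cycSum (Q.twist G r) (splitSum fun s z => k (z.map (mapLetter (Q.twist G r))) s) a l =
      cycSum (Q.twist G r) (splitSum k) a l := by
  set τ := Q.twist G r
  have hcnt (z : List (Q.Tot × ℤ)) : cnt (z.map (mapLetter τ)) = cnt z := by
    simp [cnt, Function.comp_def]
  have e1 : cycSum τ (splitSum fun s z => cnt s • k (z.map (mapLetter τ)) s) a l =
      cycSum τ (splitSum fun p s => cnt s • k p s) a l :=
    cycSum_rotate (k := fun p s => cnt s • k p s) (fun p s hs => by rw [hs.cnt, zero_smul]) a l
  have e2 : cycSum τ (splitSum fun s z => cnt z • k (z.map (mapLetter τ)) s) a l =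
      cycSum τ (splitSum fun p s => cnt p • k p s) a l := by
    refine (cycSum_rotate (k := fun p s => cnt s • k (s.map (mapLetter τ)) p)
      (fun p s hs => by rw [hs.cnt, zero_smul]) a l).symm.trans ?_
    refine cycSum_congr_degree h fun w _ hw => splitSum_congr fun p s hps => ?_
    obtain ⟨W, hW⟩ := hw
    exact congrArg (cnt p • ·) (IsPath.fml_map_twist_twist (hps ▸ hW) h₁ h₂)
  have e3 : ∀ k' : List (Q.Tot × ℤ) → List (Q.Tot × ℤ) → M, cycSum τ (splitSum k') a l =
      cycSum τ (splitSum fun p s => cnt p • k' p s) a l +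
        cycSum τ (splitSum fun p s => cnt s • k' p s) a l := by
    intro k'
    rw [← cycSum_add]
    refine cycSum_congr_degree h fun w hw _ => ?_
    rw [← splitSum_add]
    refine splitSum_congr fun p s hps => ?_
    rw [← add_smul, ← cnt_append, hps, hw.cnt, one_smul]
  rw [e3, e3 k, e1, e2, add_comm]

/-! ### Words with a distinguished first or last letter -/

/-- The function `(a₀,…,aₛ) ↦ a₀[a₁|…|aₛ]` of marked words in which `a₀` is marked. -/
def leadingWord : List (Q.Tot × ℤ) → Q.T
  | [] => 0
  | x :: l => x.2 • word K (x.1 :: l.map Prod.fst)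

theorem fml_leadingWord : FML K (leadingWord : List (Q.Tot × ℤ) → Q.T) := fun p q n => by
  match p with
  | [] =>
    have := (fml_word (K := K) [] q n).zsmul' n
    simpa [leadingWord] using this
  | b :: p =>
    have := (fml_word (K := K) (b :: p) q n).zsmul' b.2
    simpa [leadingWord] using this

theorem rep_leadingWord : Rep G (LinearMap.id : Q.T →ₗ[K] Q.T) leadingWord := fun X r a l _ => by
  rw [cycSum, splitSum_eq_right]
  · simp [leadingWord, map_fst_unmarked, show unmarked ([] : List Q.Tot) = [] from rfl]
  · intro p q _ hq
    obtain ⟨b, q, rfl⟩ := List.exists_cons_of_ne_nil hq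
    simp [leadingWord, unmarked]

theorem wordC_ι (l : List (Q.Tot × ℤ)) :
    Conv.wordC (fun _ => TensorAlgebra.ι K) l = word K (l.map Prod.fst) := by
  change (List.map _ l).prod = _
  rw [word, List.map_map]
  rfl

theorem leadingWord_eq (l : List (Q.Tot × ℤ)) :
    (Conv.weight cnt (Conv.letterC (fun _ => TensorAlgebra.ι K) Conv.oneLetter) *
      Conv.wordC (fun _ => TensorAlgebra.ι K) : Conv (Q.Tot × ℤ) Q.T) l = leadingWord l := by
  rw [Conv.mul_apply]
  rcases l with _ | ⟨x, l⟩
  · simp [splitSum_nil, Conv.weight_apply, cnt, leadingWord]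
  · rw [splitSum_cons, splitSum_eq_left]
    · simp [Conv.weight_apply, Conv.letterC_apply, Conv.oneLetter, cnt, leadingWord, wordC_ι, word, mul_assoc]
    · intro p q _ hp
      obtain ⟨b, p, rfl⟩ := List.exists_cons_of_ne_nil hp
      simp [Conv.weight_apply, Conv.letterC_apply, Conv.oneLetter]

variable {B : List (Q.Tot × ℤ) → List (List (Q'.Tot × ℤ))}

theorem lead_sub_insH (hB : IsMarked.{max uK uY uO' uH'} K B) (ς : Q'.Tot →ₗ[K] Q'.Tot)
    (ψ : List (Q.Tot × ℤ) → Q'.Tot) {l : List (Q.Tot × ℤ)} (hl : cnt l = 1) :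
    lead B ψ l - insH B ς ψ (fun w => word K (w.map Prod.fst)) l +
      splitSum (fun z s =>
        insH B ς ψ (fun w => word K (ς (bsum B Conv.oneLetter z) :: w.map Prod.fst)) s +
        cnt z • insL B ς ψ (fun w => word K (ς (bsum B Conv.oneLetter z) :: w.map Prod.fst)) s) l =
      insL B ς ψ leadingWord l := by
  set lt : ℤ → Q'.Tot →ₗ[K] Q'.T := fun _ => TensorAlgebra.ι K with hlt
  set z : Q'.T →ₐ[K] Q'.T := TensorAlgebra.lift K (TensorAlgebra.ι K ∘ₗ ς) with hz
  have hz' : ∀ n v, (z : Q'.T →+* Q'.T) (lt n v) = lt n (ς v) := fun n v => by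
    simp [hz, hlt]
  have h := congrArg (fun g => g.toFun l) (Conv.letterC_mul_pull_wordC (lt := lt) hB hz' ψ)
  have hw : (Conv.wordC lt : Conv (Q'.Tot × ℤ) Q'.T).toFun = fun w => word K (w.map Prod.fst) :=
    funext fun w => wordC_ι w
  have hi (c : List (Q.Tot × ℤ) → ℤ) (s : List (Q.Tot × ℤ)) :
      Conv.ins c B (mapLetter ς) (markedLetter ψ) (Conv.wordC lt) s =
        insOp c B (mapLetter ς) (markedLetter ψ) (fun w => word K (w.map Prod.fst)) s :=
    congrArg (fun f => insOp c B (mapLetter ς) (markedLetter ψ) f s) hw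
  have hl' : (Conv.weight cnt (Conv.letterC lt Conv.oneLetter) * Conv.wordC lt :
      Conv (Q'.Tot × ℤ) Q'.T).toFun = leadingWord := funext fun w => leadingWord_eq w
  have e1 : (Conv.letterC lt ψ * Conv.pull hB.toIsCoalg (Conv.wordC lt)) l = lead B ψ l := by
    rw [Conv.mul_apply, lead]
    refine splitSum_congr fun p q _ => ?_
    rw [Conv.pull_apply, Conv.letterC_apply]
    refine (map_bsum (LinearMap.mulLeft K (lt (cnt p) (ψ p))) _ _ _).trans ?_
    exact bsum_congr fun P _ => congrArg (lt (cnt p) (ψ p) * ·) (wordC_ι P)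
  have hX (p : List (Q.Tot × ℤ)) :
      Conv.mapRing (z : Q'.T →+* Q'.T) (Conv.pull hB.toIsCoalg (Conv.letterC lt Conv.oneLetter)) p =
        TensorAlgebra.ι K (ς (bsum B Conv.oneLetter p)) := by
    rw [Conv.pull_letterC lt hB, Conv.mapRing_apply, Conv.letterC_apply, hz' (cnt p)]
  have e2 : (Conv.mapRing (z : Q'.T →+* Q'.T)
      (Conv.pull hB.toIsCoalg (Conv.letterC lt Conv.oneLetter)) *
        Conv.ins cnt B (mapLetter ς) (markedLetter ψ) (Conv.wordC lt)) l = splitSum (fun p s =>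
      insH B ς ψ (fun w => word K (ς (bsum B Conv.oneLetter p) :: w.map Prod.fst)) s) l := by
    rw [Conv.mul_apply]
    refine splitSum_congr fun p s _ => ?_
    rw [hi, hX]
    exact map_insOp (LinearMap.mulLeft K _) _ _ _ _ _ _
  have e3 : (Conv.weight cnt (Conv.mapRing (z : Q'.T →+* Q'.T)
      (Conv.pull hB.toIsCoalg (Conv.letterC lt Conv.oneLetter))) *
        Conv.ins (fun _ => 1) B (mapLetter ς) (markedLetter ψ) (Conv.wordC lt)) l =
      splitSum (fun p s => cnt p •
      insL B ς ψ (fun w => word K (ς (bsum B Conv.oneLetter p) :: w.map Prod.fst)) s) l := by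
    rw [Conv.mul_apply]
    refine splitSum_congr fun p s _ => ?_
    rw [hi, Conv.weight_apply, hX, smul_mul_assoc]
    exact congrArg (cnt p • ·) (map_insOp (LinearMap.mulLeft K _) _ _ _ _ _ _)
  have e4 : Conv.ins (fun _ => 1) B (mapLetter ς) (markedLetter ψ)
      (Conv.weight cnt (Conv.letterC lt Conv.oneLetter) * Conv.wordC lt) l =
        insL B ς ψ leadingWord l :=
    congrArg (fun f => insOp (fun _ => 1) B (mapLetter ς) (markedLetter ψ) f l) hl'
  have e5 : Conv.weight cnt (Conv.letterC lt ψ * Conv.pull hB.toIsCoalg (Conv.wordC lt)) l =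
      lead B ψ l := by rw [Conv.weight_apply, hl, one_smul, e1]
  simp only [Conv.sub_apply, Conv.add_apply, e1, hi, e2, e3, e4, e5, sub_self, add_zero] at h
  rw [splitSum_add]
  exact h

/-- The rotation that moves the last letter to the front, where `τ` acts on it. -/
def rotWord (τ : Q.Tot → Q.Tot) : List (Q.Tot × ℤ) → Q.T :=
  splitSum fun p s => word K (τ (Conv.oneLetter s) :: p.map Prod.fst)

theorem word_zero_cons (l : List Q.Tot) : word K ((0 : Q.Tot) :: l) = 0 := by simp [word]

theorem oneLetter_eq_zero {V : Type*} [AddCommGroup V] {l : List (V × ℤ)} (h : l.length ≠ 1) :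
    Conv.oneLetter l = 0 := by
  match l with
  | [] => rfl
  | [_] => simp at h
  | _ :: _ :: _ => rfl

theorem insH_rotWord (hB : IsMarked.{max uK uY uO' uH'} K B) (ς τ : Q'.Tot →ₗ[K] Q'.Tot)
    (ψ : List (Q.Tot × ℤ) → Q'.Tot) (l : List (Q.Tot × ℤ)) :
    insH B ς ψ (rotWord τ) l = splitSum (fun s z =>
        insH B ς ψ (fun w => word K (τ (bsum B Conv.oneLetter z) :: w.map Prod.fst)) s +
        cnt z • insL B ς ψ (fun w => word K (τ (bsum B Conv.oneLetter z) :: w.map Prod.fst)) s) l := by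
  have hτ (s : List Q'.Tot) : ∃ L : Q'.Tot →ₗ[K] Q'.T, ∀ x, L x = word K (τ x :: s) :=
    ⟨LinearMap.mulRight K (word K s) ∘ₗ TensorAlgebra.ι K ∘ₗ τ, fun x => rfl⟩
  have key (p q r : List (Q.Tot × ℤ)) :
      cnt r • bsum B (fun p' => bsum B (fun r' =>
        rotWord τ (p'.map (mapLetter ς) ++ markedLetter ψ q :: r')) r) p =
      splitSum (fun r₁ z => (cnt r₁ + cnt z) • bsum B (fun p' => bsum B (fun r' =>
        word K (τ (bsum B Conv.oneLetter z) ::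
          (p'.map (mapLetter ς) ++ markedLetter ψ q :: r').map Prod.fst)) r₁) p) r := by
    have e0 : ∀ r₁ z, r₁ ++ z = r → cnt r₁ + cnt z = cnt r := fun r₁ z h => by
      rw [← h, cnt_append]
    rw [splitSum_congr fun r₁ z h => by rw [e0 r₁ z h], splitSum_zsmul]
    by_cases hr : cnt r = 0
    · rw [hr, zero_smul, zero_smul]
    congr 1
    rw [← bsum_splitSum B (fun p' r₁ z => bsum B (fun r' =>
        word K (τ (bsum B Conv.oneLetter z) ::
          (p'.map (mapLetter ς) ++ markedLetter ψ q :: r').map Prod.fst)) r₁)]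
    refine bsum_congr fun p' _ => ?_
    have h1 : ∀ r₁ z, bsum B (fun r' => word K (τ (bsum B Conv.oneLetter z) ::
          (p'.map (mapLetter ς) ++ markedLetter ψ q :: r').map Prod.fst)) r₁ =
        bsum B (fun r' => bsum B (fun z' => word K (τ (Conv.oneLetter z') ::
          (p'.map (mapLetter ς) ++ markedLetter ψ q :: r').map Prod.fst)) z) r₁ := fun r₁ z =>
      bsum_congr fun P _ => by
        obtain ⟨L, hL⟩ := hτ ((p'.map (mapLetter ς) ++ markedLetter ψ q :: P).map Prod.fst)
        simp only [← hL]
        exact map_bsum L _ _ _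
    simp only [h1]
    rw [← hB.bsum_splitSum]
    refine bsum_congr fun r' hr' => ?_
    have hne : r' ≠ [] := by
      rintro rfl
      exact hr ((hB.cnt_eq r [] hr').symm.trans rfl)
    rw [rotWord, splitSum_append_cons, splitSum_eq_zero, zero_add]
    intro u₁ u₂ _
    rw [oneLetter_eq_zero, map_zero, word_zero_cons]
    have := List.length_pos_of_ne_nil hne
    simp only [List.length_append, List.length_cons]
    omega
  simp only [insH, insL, insOp, splitSum₃, one_smul, key]
  set k : List (Q.Tot × ℤ) → List (Q.Tot × ℤ) → List (Q.Tot × ℤ) → List (Q.Tot × ℤ) → Q'.T :=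
    fun p q r₁ z => bsum B (fun p' => bsum B (fun r' => word K (τ (bsum B Conv.oneLetter z) ::
      (p'.map (mapLetter ς) ++ markedLetter ψ q :: r').map Prod.fst)) r₁) p
  calc splitSum (fun p u => splitSum (fun q r => splitSum (fun r₁ z =>
        (cnt r₁ + cnt z) • k p q r₁ z) r) u) l
      = splitSum (fun p u => splitSum (fun t z => splitSum (fun q r₁ =>
        (cnt r₁ + cnt z) • k p q r₁ z) t) u) l :=
        splitSum_congr fun p u _ => (splitSum_assoc _ _).symm
    _ = splitSum (fun s z => splitSum (fun p t => splitSum (fun q r₁ =>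
        (cnt r₁ + cnt z) • k p q r₁ z) t) s) l := (splitSum_assoc (fun p t z =>
          splitSum (fun q r₁ => (cnt r₁ + cnt z) • k p q r₁ z) t) l).symm
    _ = _ := by
      refine splitSum_congr fun s z _ => ?_
      simp only [add_smul, splitSum_add, splitSum_zsmul]
      rfl

variable {obj : Q.Ob → Q'.Ob}

theorem IsFunctorial.bsum_oneLetter_map_twist (hB : IsFunctorial G obj B) (r : Y)
    (l : List (Q.Tot × ℤ)) : bsum B Conv.oneLetter (l.map (mapLetter (Q.twist G r))) =
      Q'.twist G r (bsum B Conv.oneLetter l) := by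
  rw [(hB.equivar_twist r).bsum, map_bsum]
  refine bsum_congr fun P _ => ?_
  match P with
  | [] => simp [Conv.oneLetter]
  | [_] => rfl
  | _ :: _ :: _ => simp [Conv.oneLetter]

theorem fml_oneLetter : FML K (Conv.oneLetter : List (Q.Tot × ℤ) → Q.Tot) := by
  intro p q n
  by_cases hpq : p.length + q.length = 0
  · obtain ⟨hp, hq⟩ : p = [] ∧ q = [] := by
      constructor <;> exact List.eq_nil_of_length_eq_zero (by omega)
    subst hp hq
    exact IsLinearMap.mk (fun _ _ => rfl) fun _ _ => rfl
  · have : ∀ x : Q.Tot, Conv.oneLetter (p ++ (x, n) :: q) = 0 := fun x =>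
      oneLetter_eq_zero (by simp only [List.length_append, List.length_cons]; omega)
    simp only [this]
    exact isLinearMap_zero

/-- Insertions of a letter in words and in rotated words. -/
theorem cycSum_insL_leadingWord (hB : IsFunctorial G obj B) {ψ : List (Q.Tot × ℤ) → Q'.Tot}
    (hψ : FML K ψ) (c : Y) {X : Q.Ob} {r : Y} {a : Q.Tot} {l : List Q.Tot}
    (h : Q.IsPath G X X r (a :: l)) :
    cycSum (Q.twist G r) (splitSum fun m z => bsum B (fun m' =>
        word K (ψ (z.map (mapLetter (Q.twist G r))) :: m'.map Prod.fst)) m) a l -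
      cycSum (Q.twist G r) (insH B (Q'.koszul G c) ψ fun w =>
        word K (w.map Prod.fst) - rotWord (Q'.twist G (r + c)) w) a l =
      cycSum (Q.twist G r) (insL B (Q'.koszul G c) ψ leadingWord) a l := by
  have hX := hB.toIsMarked.fml_bsum fml_oneLetter
  have hcons (x : Q'.Tot) : FML K fun w : List (Q'.Tot × ℤ) => word K (x :: w.map Prod.fst) := by
    simpa using (fml_word (K := K) (Q := Q')).cons (x, 0)
  have hlin (s : List Q'.Tot) : ∃ L : Q'.Tot →ₗ[K] Q'.T, ∀ x, L x = word K (x :: s) :=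
    ⟨LinearMap.mulRight K (word K s) ∘ₗ TensorAlgebra.ι K, fun x => rfl⟩
  have e1 : cycSum (Q.twist G r) (splitSum fun m z => bsum B (fun m' =>
        word K (ψ (z.map (mapLetter (Q.twist G r))) :: m'.map Prod.fst)) m) a l =
      cycSum (Q.twist G r) (lead B ψ) a l := by
    refine cycSum_rotate_fml (k := fun p s => bsum B (fun m' => word K (ψ p :: m'.map Prod.fst)) s)
      (fun s => ?_) (fun p => hB.toIsMarked.fml_bsum (hcons _)) h
    refine FML.bsum (f := fun P w => word K (ψ w :: P.map Prod.fst)) (fun P => ?_) s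
    obtain ⟨L, hL⟩ := hlin (P.map Prod.fst)
    simp only [← hL]
    exact hψ.lcomp L
  have e2 : cycSum (Q.twist G r) (insH B (Q'.koszul G c) ψ (rotWord (Q'.twist G (r + c)))) a l =
      cycSum (Q.twist G r) (splitSum fun z s =>
        insH B (Q'.koszul G c) ψ (fun w => word K (Q'.koszul G c (bsum B Conv.oneLetter z) ::
          w.map Prod.fst)) s + cnt z • insL B (Q'.koszul G c) ψ (fun w =>
            word K (Q'.koszul G c (bsum B Conv.oneLetter z) :: w.map Prod.fst)) s) a l := by
    rw [← cycSum_rotate_fml _ _ h]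
    · refine splitSum_congr fun m z _ => ?_
      rw [insH_rotWord hB.toIsMarked]
      refine splitSum_congr fun s z _ => ?_
      rw [hB.bsum_oneLetter_map_twist, ← twist_add]
      have : cnt (z.map (mapLetter (Q.twist G r))) = cnt z := by simp [cnt, Function.comp_def]
      rw [this]
    · intro s
      have hk (c' : List (Q.Tot × ℤ) → ℤ) : FML K fun p => insOp c' B (mapLetter (Q'.koszul G c))
          (markedLetter ψ) (fun w => word K (Q'.koszul G c (bsum B Conv.oneLetter p) ::
            w.map Prod.fst)) s := by
        have := (hX.lcomp (Q'.koszul G c)).lcomp (LinearMap.mulRight K (insOp c' B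
          (mapLetter (Q'.koszul G c)) (markedLetter ψ) (fun w => word K (w.map Prod.fst)) s) ∘ₗ
            TensorAlgebra.ι K)
        refine (congrArg (FML K) (funext fun p => ?_)).mp this
        exact map_insOp (LinearMap.mulLeft K (TensorAlgebra.ι K (Q'.koszul G c
          (bsum B Conv.oneLetter p)))) _ _ _ _ _ _
      exact (hk _).add (hk _).weight
    · intro p
      exact (hB.toIsMarked.fml_insH _ hψ (hcons _)).add
        ((hB.toIsMarked.fml_insL _ hψ (hcons _)).zsmul _)
  have e3 : cycSum (Q.twist G r) (insH B (Q'.koszul G c) ψ fun w =>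
        word K (w.map Prod.fst) - rotWord (Q'.twist G (r + c)) w) a l =
      cycSum (Q.twist G r) (insH B (Q'.koszul G c) ψ fun w => word K (w.map Prod.fst)) a l -
      cycSum (Q.twist G r) (insH B (Q'.koszul G c) ψ (rotWord (Q'.twist G (r + c)))) a l := by
    rw [← cycSum_sub]
    exact splitSum_congr fun m z _ => insOp_sub _ _ _ _ _ _ _
  rw [e1, e3, e2, ← sub_add, ← cycSum_sub, ← cycSum_add]
  exact cycSum_congr h fun w hw _ => lead_sub_insH hB.toIsMarked _ ψ hw.cnt

end GQuiver

section FMLUniverse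

variable {K : Type u} [Field K] {V : Type*} {V' : Type v} [AddCommGroup V] [Module K V]
  [AddCommGroup V'] [Module K V'] {B : List (V × ℤ) → List (List (V' × ℤ))}

theorem insL_oneLetter (hB : IsMarked.{max u v} K B) {ς : V' →ₗ[K] V'}
    (ψ : List (V × ℤ) → V') (l : List (V × ℤ)) : insL B ς ψ Conv.oneLetter l = ψ l := by
  have h := Conv.ins_letterC_oneLetter (R := TensorAlgebra K V') (lt := fun _ => TensorAlgebra.ι K)
    (ς := ς) (z := (TensorAlgebra.lift K (TensorAlgebra.ι K ∘ₗ ς) : _ →ₐ[K] TensorAlgebra K V'))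
    hB (by simp) ψ
  rw [Conv.ins_letterC _ hB] at h
  exact TensorAlgebra.ι_leftInverse.injective (congrArg (fun f => f.toFun l) h)

end FMLUniverse

namespace GQuiver

variable {K : Type uK} [Field K] {Y : Type uY} [AddCommGroup Y] {G : GradingDatum Y}
  {Q : GQuiver.{uK, uY, uO, uH} K Y} {Q' : GQuiver.{uK, uY, uO', uH'} K Y}
  {M : Type*} [AddCommGroup M] [Module K M]

/-! ### Marked words that are paths -/

/-- Marked words that are paths. -/
def OnPath (G : GradingDatum Y) (l : List (Q.Tot × ℤ)) : Prop :=
  ∃ X Z r, Q.IsPath G X Z r (l.map Prod.fst)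

theorem IsClosed.onPath {l : List (Q.Tot × ℤ)} (h : IsClosed G l) : OnPath G l := by
  obtain ⟨X, r, h⟩ := h
  exact ⟨X, X, r, h⟩

theorem isInfix_onPath : IsInfix (OnPath G : List (Q.Tot × ℤ) → Prop) where
  left p q h := by
    obtain ⟨X, Z, r, h⟩ := h
    obtain ⟨W, s, t, h1, h2, -⟩ := IsPath.of_append (by simpa using h)
    exact ⟨_, _, _, h1⟩
  right p q h := by
    obtain ⟨X, Z, r, h⟩ := h
    obtain ⟨W, s, t, h1, h2, -⟩ := IsPath.of_append (by simpa using h)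
    exact ⟨_, _, _, h2⟩

theorem IsPath.single_list_sum {X Z : Q.Ob} {r : Y} (S : List Q.Tot)
    (h : ∀ x ∈ S, Q.IsPath G X Z r [x]) : Q.IsPath G X Z r [S.sum] := by
  induction S with
  | nil => exact single_zero X Z r
  | cons x S ih =>
    rw [List.sum_cons]
    exact (h x (by simp)).single_add (ih fun y hy => h y (by simp [hy]))

theorem IsPath.single_bsum {A A' : Type*} {X Z : Q.Ob} {r : Y} {B : List A → List (List A')}
    {f : List A' → Q.Tot} {l : List A} (h : ∀ P ∈ B l, Q.IsPath G X Z r [f P]) :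
    Q.IsPath G X Z r [bsum B f l] := by
  refine IsPath.single_list_sum _ fun x hx => ?_
  obtain ⟨P, hP, rfl⟩ := List.mem_map.mp hx
  exact h P hP

theorem IsPath.single_splitSum {A : Type*} {X Z : Q.Ob} {r : Y} {k : List A → List A → Q.Tot}
    {l : List A} (h : ∀ p q, p ++ q = l → Q.IsPath G X Z r [k p q]) :
    Q.IsPath G X Z r [splitSum k l] :=
  IsPath.single_sum _ fun _ _ => h _ _ (List.take_append_drop _ _)

variable {obj : Q.Ob → Q'.Ob} {B : List (Q.Tot × ℤ) → List (List (Q'.Tot × ℤ))}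

theorem Homog.isPath_insert (hB : IsFunctorial G obj B) {c c' : Y} {k : List (Q.Tot × ℤ) → Q'.Tot}
    (hk : Homog G obj c k) {X Z : Q.Ob} {r : Y} {p q s : List (Q.Tot × ℤ)}
    (h : Q.IsPath G X Z r ((p ++ (q ++ s)).map Prod.fst)) {p' s' : List (Q'.Tot × ℤ)}
    (hp : p' ∈ B p) (hs : s' ∈ B s) :
    Q'.IsPath G (obj X) (obj Z) (r + c)
      ((p'.map (mapLetter (Q'.koszul G c')) ++ markedLetter k q :: s').map Prod.fst) := by
  obtain ⟨W, r₁, r₂, h1, h2, rfl⟩ := IsPath.of_append (by simpa using h)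
  obtain ⟨W', r₃, r₄, h3, h4, rfl⟩ := IsPath.of_append (by simpa using h2)
  have := ((hB.isPath _ _ _ _ h1 _ hp).map_koszul c').append
    ((hk _ _ _ _ h3).cons' (hB.isPath _ _ _ _ h4 _ hs))
  rw [List.map_append, map_fst_mapLetter]
  exact this.cast (by abel)

theorem Homog.insOp (hB : IsFunctorial G obj B) {c c₁ c' : Y} (w : List (Q.Tot × ℤ) → ℤ)
    {k : List (Q.Tot × ℤ) → Q'.Tot} (hk : Homog G obj c k) {f : List (Q'.Tot × ℤ) → Q'.Tot}
    (hf : Homog G id c₁ f) :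
    Homog G obj (c + c₁) (insOp w B (mapLetter (Q'.koszul G c')) (markedLetter k) f) :=
  fun X Z r l h => by
  unfold _root_.insOp splitSum₃
  refine IsPath.single_splitSum fun p u hu => IsPath.single_splitSum fun q s hs => ?_
  refine IsPath.single_zsmul (IsPath.single_bsum fun P hP => IsPath.single_bsum fun P' hP' => ?_) _
  rw [← add_assoc]
  exact hf _ _ _ _ (hk.isPath_insert hB (by rwa [hs, hu]) hP hP')

theorem Homog.bsum (hB : IsFunctorial G obj B) {c : Y} {f : List (Q'.Tot × ℤ) → Q'.Tot}
    (hf : Homog G id c f) : Homog G obj c (_root_.bsum B f) := fun _ _ _ l h =>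
  IsPath.single_bsum fun P hP => hf _ _ _ _ (hB.isPath l _ _ _ h P hP)

theorem homog_oneLetter : Homog G id 0 (Conv.oneLetter : List (Q.Tot × ℤ) → Q.Tot) :=
  fun _ _ _ l h => by
  rw [add_zero]
  match l with
  | [_] => exact h
  | [] => exact IsPath.single_zero _ _ _
  | _ :: _ :: _ => exact IsPath.single_zero _ _ _

/-- Compatibility of insertions with operators on the letters. -/
theorem insOp_map_mapLetter {V V' V'' : Type*} [AddCommGroup V] [Module K V] [AddCommGroup V']
    [Module K V'] [AddCommGroup V''] [Module K V''] {B : List (V × ℤ) → List (List (V' × ℤ))}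
    {σ : V →ₗ[K] V} {σ' ς : V' →ₗ[K] V'} {σ'' : V'' →ₗ[K] V''} {w : List (V × ℤ) → ℤ}
    (hw : ∀ l, w (l.map (mapLetter σ)) = w l) (hσB : Equivar B (mapLetter σ) (mapLetter σ'))
    (hςσ : ∀ x, ς (σ' x) = σ' (ς x)) {ε ε' : ℤ} {k : List (V × ℤ) → V'}
    (hk : ∀ l, k (l.map (mapLetter σ)) = ε • σ' (k l)) {f : List (V' × ℤ) → V''} (hf : FML K f)
    (hfσ : ∀ l, f (l.map (mapLetter σ')) = ε' • σ'' (f l)) (l : List (V × ℤ)) :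
    insOp w B (mapLetter ς) (markedLetter k) f (l.map (mapLetter σ)) =
      (ε * ε') • σ'' (insOp w B (mapLetter ς) (markedLetter k) f l) := by
  have hn (p r : List (V' × ℤ)) (m : ℤ) (x : V') :
      f (p ++ (ε • x, m) :: r) = ε • f (p ++ (x, m) :: r) := map_zsmul ((hf p r m).mk' _) ε x
  simp only [insOp, splitSum₃, splitSum_map, map_splitSum, ← splitSum_zsmul, hw]
  refine splitSum_congr fun p u _ => splitSum_congr fun q r _ => ?_
  rw [map_zsmul, smul_comm _ (w r)]
  congr 1
  rw [hσB.bsum, map_bsum, ← bsum_zsmul]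
  refine bsum_congr fun P _ => ?_
  rw [hσB.bsum, map_bsum, ← bsum_zsmul]
  refine bsum_congr fun P' _ => ?_
  have e : (P.map (mapLetter σ')).map (mapLetter ς) = (P.map (mapLetter ς)).map (mapLetter σ') := by
    simp [hςσ]
  have e2 : cnt (q.map (mapLetter σ)) = cnt q := by simp [cnt, Function.comp_def]
  rw [e, markedLetter, hk, hn, mul_smul, ← hfσ]
  congr 2
  simp [e2]

/-! ### Strictly unital structures -/

/-- Structure maps that satisfy the `A∞` relations, with strict units `e`. -/
structure IsStrict (G : GradingDatum Y) (μ : Q.Cochain) (e : Q.Ob → Q.Tot) : Prop where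
  homog : Homog G id (G.fromInt 1) (hat μ)
  map_sgn : ∀ l, hat μ (l.map (mapLetter (Q.sgn G))) = (-1 : ℤ) • Q.sgn G (hat μ l)
  rel : ∀ l, OnPath G l → insL idBlocks (Q.sgn G) (hat μ) (hat μ) l = 0
  isPath_unit : ∀ X, Q.IsPath G X X (-G.fromInt 1) [e X]
  unit_left : ∀ X Z r a, Q.IsPath G X Z r [a] → μ (word K [e X, a]) = a
  unit_right : ∀ X Z r a, Q.IsPath G X Z r [a] → μ (word K [a, e Z]) = -Q.sgn G a
  unit_zero : ∀ p X q, p.length + q.length ≠ 1 → μ (word K (p ++ e X :: q)) = 0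

/-- Infinitesimal deformations of structure maps. -/
structure IsDeformation (G : GradingDatum Y) (μ φ : Q.Cochain) : Prop where
  homog : Homog G id (G.fromInt 1) (hat φ)
  map_sgn : ∀ l, hat φ (l.map (mapLetter (Q.sgn G))) = (-1 : ℤ) • Q.sgn G (hat φ l)
  rel : ∀ l, OnPath G l → insL idBlocks (Q.sgn G) (hat φ) (hat μ) l +
    insL idBlocks (Q.sgn G) (hat μ) (hat φ) l = 0

/-- The letters of a word lose their marks. -/
abbrev unmarkLetter (x : Q.Tot × ℤ) : Q.Tot × ℤ := (x.1, 0)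

/-- A decomposition into blocks given by a strictly unital `A∞` functor. -/
structure IsStrictMorphism (G : GradingDatum Y) (obj : Q.Ob → Q'.Ob)
    (B : List (Q.Tot × ℤ) → List (List (Q'.Tot × ℤ))) (μ : Q.Cochain) (μ' : Q'.Cochain)
    (e : Q.Ob → Q.Tot) (e' : Q'.Ob → Q'.Tot) : Prop extends IsFunctorial G obj B where
  equivar_unmark : Equivar B unmarkLetter unmarkLetter
  rel : ∀ l, OnPath G l → bsum B (hat μ') l =
    insL idBlocks (Q.sgn G) (hat μ) (bsum B Conv.oneLetter) l
  unit : ∀ p X n m, bsum B (algWord (univLetter K Q'.Tot)) (p ++ (e X, n) :: m) =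
    bsum B (algWord (univLetter K Q'.Tot)) p * univLetter K Q'.Tot n (e' (obj X)) *
      bsum B (algWord (univLetter K Q'.Tot)) m

theorem algWord_append {R V : Type*} [AddCommGroup V] [Module K V] [Ring R] [Algebra K R]
    (lt : ℤ → V →ₗ[K] R) (p q : List (V × ℤ)) :
    algWord lt (p ++ q) = algWord lt p * algWord lt q := by
  simp [algWord]

theorem algWord_cons {R V : Type*} [AddCommGroup V] [Module K V] [Ring R] [Algebra K R]
    (lt : ℤ → V →ₗ[K] R) (x : V × ℤ) (q : List (V × ℤ)) :
    algWord lt (x :: q) = lt x.2 x.1 * algWord lt q := by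
  simp [algWord]

variable {μ : Q.Cochain} {μ' : Q'.Cochain} {e : Q.Ob → Q.Tot} {e' : Q'.Ob → Q'.Tot}

theorem bsum_append_cons_of_algWord {x : Q.Tot} {x' : Q'.Tot} {n : ℤ} {p m : List (Q.Tot × ℤ)}
    (h : bsum B (algWord (univLetter K Q'.Tot)) (p ++ (x, n) :: m) =
      bsum B (algWord (univLetter K Q'.Tot)) p * univLetter K Q'.Tot n x' *
        bsum B (algWord (univLetter K Q'.Tot)) m) {f : List (Q'.Tot × ℤ) → M} (hf : FML K f) :
    bsum B f (p ++ (x, n) :: m) =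
      bsum B (fun p' => bsum B (fun m' => f (p' ++ (x', n) :: m')) m) p := by
  obtain ⟨L, hL⟩ := exists_eq_algWord hf
  obtain rfl : f = fun l => L (algWord (univLetter K Q'.Tot) l) := funext hL
  replace h := congrArg L h
  rw [map_bsum L] at h
  rw [h]
  simp only [← map_bsum L]
  congr 1
  simp only [algWord_append, algWord_cons]
  have h1 (y : TensorAlgebra K (ℤ →₀ Q'.Tot)) : bsum B (fun m' => y *
      (univLetter K Q'.Tot n x' * algWord (univLetter K Q'.Tot) m')) m =
      y * (univLetter K Q'.Tot n x' * bsum B (algWord (univLetter K Q'.Tot)) m) := by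
    rw [← mul_assoc]
    simp only [← mul_assoc]
    exact (map_bsum (AddMonoidHom.mulLeft (y * _)) B _ m).symm
  simp only [h1]
  rw [mul_assoc]
  exact map_bsum (AddMonoidHom.mulRight _) B _ p

theorem IsStrictMorphism.bsum_unit (hB : IsStrictMorphism G obj B μ μ' e e')
    {f : List (Q'.Tot × ℤ) → M} (hf : FML K f) (p : List (Q.Tot × ℤ)) (X : Q.Ob) (n : ℤ)
    (m : List (Q.Tot × ℤ)) : bsum B f (p ++ (e X, n) :: m) =
      bsum B (fun p' => bsum B (fun m' => f (p' ++ (e' (obj X), n) :: m')) m) p :=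
  bsum_append_cons_of_algWord (hB.unit p X n m) hf

theorem isStrictMorphism_idBlocks (μ : Q.Cochain) (e : Q.Ob → Q.Tot) :
    IsStrictMorphism G id idBlocks μ μ e e where
  __ := isFunctorial_idBlocks
  equivar_unmark := equivar_idBlocks _
  rel l _ := by
    rw [bsum_idBlocks]
    have : bsum idBlocks (Conv.oneLetter : List (Q.Tot × ℤ) → Q.Tot) = Conv.oneLetter :=
      funext fun l => bsum_idBlocks _ _
    rw [this]
    exact (insL_oneLetter isMarked_idBlocks (ς := Q.sgn G) (hat μ) l).symm
  unit p X n m := by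
    simp only [bsum_idBlocks, algWord_append, algWord_cons, mul_assoc]
    rfl

end GQuiver

theorem IsCoalg.bsum_eq_ite {A A' M : Type*} [AddCommGroup M] {B : List A → List (List A')}
    (hB : IsCoalg.{u} B) {f : List A' → M} (hf : ∀ P, P ≠ [] → f P = 0) (l : List A)
    [Decidable (l = [])] : bsum B f l = if l = [] then f [] else 0 := by
  split_ifs with h
  · rw [h, hB.bsum_nil]
  · exact (bsum_congr fun P hP => hf P fun h' => hB.ne_nil l h (h' ▸ hP)).trans (bsum_zero B l)

namespace GQuiver

variable {K : Type uK} [Field K] {Y : Type uY} [AddCommGroup Y] {G : GradingDatum Y}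
  {Q : GQuiver.{uK, uY, uO, uH} K Y} {Q' : GQuiver.{uK, uY, uO', uH'} K Y}
  {M : Type*} [AddCommGroup M] [Module K M]

/-- Two operations agree on chains. -/
def CycEq (G : GradingDatum Y) (T T' : Q.T →ₗ[K] M) : Prop :=
  ∀ X r a l, Q.IsPath G X X r (a :: l) → T (word K (a :: l)) = T' (word K (a :: l))

theorem Rep.cycEq {T T' : Q.T →ₗ[K] M} {f g : List (Q.Tot × ℤ) → M} (hT : Rep G T f)
    (hT' : Rep G T' g) (hfg : ∀ l, OneMark l → IsClosed G l → f l = g l) : CycEq G T T' :=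
  fun _ _ _ _ h => hT.eq hT' hfg h

theorem CycEq.apply {T T' : Q.T →ₗ[K] M} (h : CycEq G T T') {y : Y} {x : Q.T}
    (hx : x ∈ Q.chains G y) : T x = T' x := by
  refine LinearMap.eqOn_span (f := T) (g := T') ?_ hx
  rintro _ ⟨X, l, hl, hp, rfl⟩
  obtain ⟨a, l, rfl⟩ := List.exists_cons_of_ne_nil hl
  exact h X _ a l hp

variable {obj : Q.Ob → Q'.Ob} {B : List (Q.Tot × ℤ) → List (List (Q'.Tot × ℤ))}
  {μ : Q.Cochain} {μ' : Q'.Cochain} {e : Q.Ob → Q.Tot} {e' : Q'.Ob → Q'.Tot}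

theorem bsum_oneLetter_homog (hB : IsFunctorial G obj B) :
    Homog G obj 0 (bsum B Conv.oneLetter) := Homog.bsum hB homog_oneLetter

theorem Rep.comp_morphism (hB : IsFunctorial G obj B) {T₁ : Q'.T →ₗ[K] M}
    {ω : List (Q'.Tot × ℤ) → M} (hω : FML K ω) (h₁ : Rep G T₁ ω) {F : Q.T →ₗ[K] Q'.T}
    (hF : Rep G F (lead B fun l => cnt l • bsum B Conv.oneLetter l)) :
    Rep G (T₁ ∘ₗ F) (bsum B ω) := by
  have h := Rep.comp_lead hB hω h₁ ((bsum_oneLetter_homog hB).weight cnt)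
    (fun q hq => by rw [hq.cnt, zero_smul]) hF
  rw [koszul_zero] at h
  refine h.congr fun l hl _ => ?_
  rw [insL_cnt_smul hB.toIsMarked hω, hl.cnt, one_smul]

theorem fml_insL_id (μ : Q.Cochain) {ω : List (Q.Tot × ℤ) → M} (hω : FML K ω) :
    FML K (insL idBlocks (Q.sgn G) (hat μ) ω) :=
  (isMarked_idBlocks (K := K) (V := Q.Tot)).fml_insL _ (fml_hat μ) hω

theorem rep_hochschildB (hμ : Homog G id (G.fromInt 1) (hat μ)) :
    Rep G (hochschildB G μ) (insL idBlocks (Q.sgn G) (hat μ) leadingWord) :=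
  rep_leadingWord.comp_hochschildB fml_leadingWord hμ

/-- Functors induce chain maps for the Hochschild differential. -/
theorem IsStrictMorphism.hochschildB_comp (hB : IsStrictMorphism G obj B μ μ' e e')
    (hμ : IsStrict G μ e) (hμ' : IsStrict G μ' e') {F : Q.T →ₗ[K] Q'.T}
    (hF : Rep G F (lead B fun l => cnt l • bsum B Conv.oneLetter l)) :
    CycEq G (hochschildB G μ' ∘ₗ F) (F ∘ₗ hochschildB G μ) := by
  have h1 := (rep_hochschildB hμ'.homog).comp_morphism hB.toIsFunctorial
    (fml_insL_id μ' fml_leadingWord) hF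
  have h2 := (rep_leadingWord (G := G) (Q := Q')).comp_morphism hB.toIsFunctorial
    fml_leadingWord hF
  exact h1.cycEq (h2.comp_hochschildB (hB.toIsMarked.fml_bsum fml_leadingWord) hμ.homog)
    fun l _ hl => bsum_insL_eq isInfix_onPath hB.toIsMarked hB.equivar hB.rel fml_leadingWord
      hl.onPath

/-! ### Chains that start with a unit -/

theorem prependUnit_word {X Z : Q.Ob} {r : Y} {a : Q.Tot} {l : List Q.Tot}
    (h : Q.IsPath G X Z r (a :: l)) (e : Q.Ob → Q.Tot) :
    prependUnit e (word K (a :: l)) = word K (e X :: a :: l) := by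
  obtain ⟨W, s, t, ha, -, -⟩ := IsPath.of_cons h
  obtain ⟨a, rfl⟩ := ha.exists_of_single
  have h1 : unitTensor e (Q.inc X W (s + G.fromInt 1) a) =
      TensorAlgebra.ι K (e X) * TensorAlgebra.ι K (Q.inc X W (s + G.fromInt 1) a) := by
    unfold unitTensor inc
    rw [DirectSum.toModule_lof]
    rfl
  rw [prependUnit, linExt_word, prependUnitFun, h1, mul_assoc]
  rfl

theorem unitWord_eq {X Z : Q.Ob} {r : Y} {l : List (Q.Tot × ℤ)} (hl : l ≠ [])
    (h : Q.IsPath G X Z r (l.map Prod.fst)) (e : Q.Ob → Q.Tot) :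
    unitWord e l = word K (e X :: l.map Prod.fst) := by
  obtain ⟨a, l, rfl⟩ := List.exists_cons_of_ne_nil hl
  exact prependUnit_word h e

theorem fml_unitWord (e : Q.Ob → Q.Tot) : FML K (unitWord e) := fml_hat _

theorem OneMark.ne_nil {l : List (Q.Tot × ℤ)} (h : OneMark l) : l ≠ [] := by
  rintro rfl
  simpa [cnt] using h.cnt

/-- The value of an operation on a chain that starts with a unit. -/
theorem Rep.apply_unit {T : Q.T →ₗ[K] Q'.T} {κ : List (Q.Tot × ℤ) → Q'.Tot}
    (hT : Rep G T (lead B κ)) (hu : ∀ q, Unmarked q → κ q = 0) {X : Q.Ob} {r : Y} {x : Q.Tot}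
    {y : List Q.Tot} (hx : Q.IsPath G X X (-G.fromInt 1) [x]) (hy : Q.IsPath G X X r y) :
    T (word K (x :: y)) = splitSum (fun m z => splitSum (fun m₁ m₂ => bsum B (fun P =>
      word K (κ (unmarked (z.map (Q.twist G (r - G.fromInt 1))) ++ (x, 1) :: unmarked m₁) ::
        P.map Prod.fst)) (unmarked m₂)) m) y := by
  have h : Q.IsPath G X X (r - G.fromInt 1) (x :: y) := (hx.cons' hy).cast (by abel)
  rw [hT _ _ _ _ h, cycSum]
  refine splitSum_congr fun m z _ => ?_
  rw [lead, splitSum_append_cons, splitSum_eq_zero, zero_add]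
  · conv_lhs => rw [show unmarked m = m.map fun x => (x, (0 : ℤ)) from rfl, splitSum_map]
    rfl
  · intro p q hpq
    rw [hu p (by have := unmarked_unmarked (z.map (Q.twist G (r - G.fromInt 1)));
                 rw [← hpq] at this; exact this.left)]
    exact (bsum_congr fun P _ => word_zero_cons _).trans (bsum_zero _ _)

theorem map_unmarkLetter (l : List (Q.Tot × ℤ)) : l.map unmarkLetter = unmarked (l.map Prod.fst) := by
  simp [unmarked]

theorem IsStrictMorphism.bsum_unmarked (hB : IsStrictMorphism G obj B μ μ' e e')
    (f : List Q'.Tot → M) (l : List (Q.Tot × ℤ)) :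
    bsum B (fun P => f (P.map Prod.fst)) (unmarked (l.map Prod.fst)) =
      bsum B (fun P => f (P.map Prod.fst)) l := by
  rw [← map_unmarkLetter, hB.equivar_unmark.bsum]
  exact bsum_congr fun P _ => by rw [map_unmarkLetter, map_fst_unmarked]

open Classical in
theorem IsStrictMorphism.bsum_oneLetter_unit (hB : IsStrictMorphism G obj B μ μ' e e')
    (p : List (Q.Tot × ℤ)) (X : Q.Ob) (n : ℤ) (m : List (Q.Tot × ℤ)) :
    bsum B Conv.oneLetter (p ++ (e X, n) :: m) = if p = [] ∧ m = [] then e' (obj X) else 0 := by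
  rw [hB.bsum_unit fml_oneLetter]
  have h1 (p' : List (Q'.Tot × ℤ)) (hp : p' ≠ []) :
      bsum B (fun m' => Conv.oneLetter (p' ++ (e' (obj X), n) :: m')) m = 0 := by
    refine (bsum_congr fun m' _ => oneLetter_eq_zero ?_).trans (bsum_zero B m)
    have := List.length_pos_of_ne_nil hp
    simp only [List.length_append, List.length_cons]
    omega
  have h2 (m' : List (Q'.Tot × ℤ)) (hm : m' ≠ []) :
      Conv.oneLetter ([] ++ (e' (obj X), n) :: m') = 0 := by
    refine oneLetter_eq_zero ?_
    have := List.length_pos_of_ne_nil hm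
    simp only [List.nil_append, List.length_cons]
    omega
  rw [hB.toIsCoalg.bsum_eq_ite h1, hB.toIsCoalg.bsum_eq_ite h2, ite_and]
  rfl

theorem unmarked_eq_nil {l : List Q.Tot} : unmarked l = [] ↔ l = [] := List.map_eq_nil_iff

theorem IsStrictMorphism.apply_unitWord (hB : IsStrictMorphism G obj B μ μ' e e')
    (hμ : IsStrict G μ e) {F : Q.T →ₗ[K] Q'.T}
    (hF : Rep G F (lead B fun l => cnt l • bsum B Conv.oneLetter l))
    {l : List (Q.Tot × ℤ)} (hl : l ≠ []) (hc : IsClosed G l) :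
    F (unitWord e l) = bsum B (unitWord e') l := by
  classical
  obtain ⟨X, r, hp⟩ := hc
  rw [unitWord_eq hl hp, hF.apply_unit (fun q hq => by rw [hq.cnt, zero_smul])
    (hμ.isPath_unit X) hp]
  rw [splitSum_eq_right, splitSum_eq_left]
  · have h1 : ∀ P ∈ B l, unitWord e' P = word K (e' (obj X) :: P.map Prod.fst) := fun P hP =>
      unitWord_eq (fun h => hB.toIsCoalg.ne_nil l hl (h ▸ hP)) (hB.isPath _ _ _ _ hp P hP) e'
    rw [bsum_congr h1, hB.bsum_unmarked (fun P => word K (_ :: P))]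
    refine bsum_congr fun P _ => ?_
    rw [hB.bsum_oneLetter_unit, if_pos ⟨rfl, rfl⟩]
    simp [cnt, show unmarked ([] : List Q.Tot) = [] from rfl]
  · intro m₁ m₂ _ hm
    refine (bsum_congr fun P _ => ?_).trans (bsum_zero _ _)
    rw [hB.bsum_oneLetter_unit, if_neg (fun h => hm (unmarked_eq_nil.mp h.2)), smul_zero,
      word_zero_cons]
  · intro m z _ hz
    refine splitSum_eq_zero fun m₁ m₂ _ => (bsum_congr fun P _ => ?_).trans (bsum_zero _ _)
    rw [hB.bsum_oneLetter_unit, if_neg (fun h => hz (by simpa [unmarked] using h.1)), smul_zero,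
      word_zero_cons]

/-- Functors induce chain maps for the Connes differential. -/
theorem IsStrictMorphism.connesB_comp (hB : IsStrictMorphism G obj B μ μ' e e')
    (hμ : IsStrict G μ e) {F : Q.T →ₗ[K] Q'.T}
    (hF : Rep G F (lead B fun l => cnt l • bsum B Conv.oneLetter l)) :
    CycEq G (connesB G e' ∘ₗ F) (F ∘ₗ connesB G e) :=
  ((rep_connesB e').comp_morphism hB.toIsFunctorial (fml_unitWord e') hF).cycEq
    ((rep_connesB e).comp F) fun _ hl hc => (hB.apply_unitWord hμ hF hl.ne_nil hc).symm

theorem word_neg_cons (x : Q.Tot) (l : List Q.Tot) : word K (-x :: l) = -word K (x :: l) := by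
  simp [word]

theorem IsStrict.map_unit (hμ : IsStrict G μ e) {X : Q.Ob} {p q : List Q.Tot} {r s : Y}
    (hp : ∃ W, Q.IsPath G W X r p) (hq : ∃ W, Q.IsPath G X W s q) :
    hat μ (unmarked p ++ (e X, 1) :: unmarked q) =
      (if p = [] then Conv.oneLetter (unmarked q) else 0) -
        (if q = [] then Q.sgn G (Conv.oneLetter (unmarked p)) else 0) := by
  rw [hat, unmarked_mark_map_fst]
  match p, q with
  | [], [] => simpa [Conv.oneLetter, unmarked] using hμ.unit_zero [] X [] (by simp)
  | [], [a] =>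
    obtain ⟨W, hq⟩ := hq
    simpa [Conv.oneLetter, unmarked] using hμ.unit_left _ _ _ _ hq
  | [a], [] =>
    obtain ⟨W, hp⟩ := hp
    simpa [Conv.oneLetter, unmarked] using hμ.unit_right _ _ _ _ hp
  | [], a :: b :: q => simpa [Conv.oneLetter, unmarked] using hμ.unit_zero [] X (a :: b :: q) (by simp)
  | a :: b :: p, [] => simpa [Conv.oneLetter, unmarked] using hμ.unit_zero (a :: b :: p) X [] (by simp)
  | a :: p, b :: q =>
    rw [hμ.unit_zero _ _ _ (by simp only [List.length_cons]; omega)]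
    simp

theorem rep_outerB (μ : Q.Cochain) : Rep G (outerB G μ) (lead idBlocks fun l => cnt l • hat μ l) :=
  rep_bOuter μ

theorem word_sub_cons (x y : Q.Tot) (l : List Q.Tot) :
    word K ((x - y) :: l) = word K (x :: l) - word K (y :: l) := by
  simp [word, sub_mul]

theorem oneLetter_unmarked_map (τ : Q.Tot →ₗ[K] Q.Tot) (l : List Q.Tot) :
    Conv.oneLetter (unmarked (l.map τ)) = τ (Conv.oneLetter (unmarked l)) := by
  match l with
  | [] => simp [Conv.oneLetter, unmarked]
  | [_] => rfl
  | _ :: _ :: _ => simp [Conv.oneLetter, unmarked]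

theorem oneLetter_unmarked (l : List (Q.Tot × ℤ)) :
    Conv.oneLetter (unmarked (l.map Prod.fst)) = Conv.oneLetter l := by
  match l with
  | [] => rfl
  | [_] => rfl
  | _ :: _ :: _ => rfl

/-- The Hochschild differential of a chain that starts with a unit. -/
theorem IsStrict.hochschildB_unitWord (hμ : IsStrict G μ e) {X : Q.Ob} {r : Y}
    {l : List (Q.Tot × ℤ)} (hl : l ≠ []) (h : Q.IsPath G X X r (l.map Prod.fst)) :
    hochschildB G μ (unitWord e l) = word K (l.map Prod.fst) - rotWord (Q.twist G r) l -
      insL idBlocks (Q.sgn G) (hat μ) (unitWord e) l := by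
  rw [unitWord_eq hl h, hochschildB_eq, LinearMap.add_apply, innerB_cons]
  have hi : splitSum (fun p s => splitSum (fun q t => word K (Q.sgn G (e X) ::
      (p.map (Q.sgn G) ++ μ (word K q) :: t))) s) (l.map Prod.fst) =
      -insL idBlocks (Q.sgn G) (hat μ) (unitWord e) l := by
    rw [insL, insOp, splitSum₃, splitSum_map, ← splitSum_neg]
    refine splitSum_congr fun p u hu => ?_
    rw [splitSum_map, ← splitSum_neg]
    refine splitSum_congr fun q t ht => ?_
    have hins := Homog.isPath_insert isFunctorial_idBlocks hμ.homog (c' := G.fromInt 1)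
      (p := p) (q := q) (s := t) (p' := p) (s' := t) (by rwa [ht, hu]) (by simp [idBlocks])
      (by simp [idBlocks])
    rw [koszul_fromInt_one] at hins
    rw [one_smul, bsum_idBlocks, bsum_idBlocks, unitWord_eq (by simp) hins]
    have he : Q.sgn G (e X) = -e X := by
      rw [(hμ.isPath_unit X).sgn_single]
      have : G.sg (-G.fromInt 1) = -1 := by
        have h1 := G.sg_add (-G.fromInt 1) (G.fromInt 1)
        rw [neg_add_cancel, G.sg_zero, G.sg_fromInt_one] at h1
        linarith
      rw [this, neg_smul, one_smul]
    rw [he, word_neg_cons, List.map_append, map_fst_mapLetter]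
    simp [hat]
  have ho : outerB G μ (word K (e X :: l.map Prod.fst)) =
      word K (l.map Prod.fst) - rotWord (Q.twist G r) l := by
    rw [Rep.apply_unit (rep_outerB μ) (fun q hq => by rw [hq.cnt, zero_smul]) (hμ.isPath_unit X) h]
    have h1 : ∀ m z, m ++ z = l.map Prod.fst → splitSum (fun m₁ m₂ => bsum idBlocks (fun P =>
        word K ((cnt (unmarked (z.map (Q.twist G (r - G.fromInt 1))) ++ (e X, 1) :: unmarked m₁) •
          hat μ (unmarked (z.map (Q.twist G (r - G.fromInt 1))) ++ (e X, 1) :: unmarked m₁)) ::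
            P.map Prod.fst)) (unmarked m₂)) m =
        splitSum (fun m₁ m₂ => if z = [] then word K (Conv.oneLetter (unmarked m₁) :: m₂) else 0) m -
        splitSum (fun m₁ m₂ => if m₁ = [] then
          word K (Q.twist G r (Conv.oneLetter (unmarked z)) :: m₂) else 0) m := by
      intro m z hmz
      rw [← splitSum_sub]
      refine splitSum_congr fun m₁ m₂ hm => ?_
      rw [← hmz, ← hm, List.append_assoc] at h
      obtain ⟨W₁, c₁, d₁, hm₁, h', -⟩ := h.of_append
      obtain ⟨W₂, c₂, d₂, hm₂, hz, -⟩ := h'.of_append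
      rw [(OneMark.cnt ⟨_, _, _, rfl⟩ : cnt (_ ++ (e X, 1) :: unmarked m₁) = 1), one_smul,
        hμ.map_unit ⟨_, hz.map_twist _⟩ ⟨_, hm₁⟩, bsum_idBlocks, map_fst_unmarked,
        word_sub_cons, oneLetter_unmarked_map, ← koszul_fromInt_one, ← twist_add, sub_add_cancel]
      congr 1
      · simp only [List.map_eq_nil_iff]
        split_ifs
        · rfl
        · exact word_zero_cons _
      · split_ifs
        · rfl
        · exact word_zero_cons _
    rw [splitSum_congr h1, splitSum_sub, splitSum_eq_right]
    · congr 1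
      · obtain ⟨a, l, rfl⟩ := List.exists_cons_of_ne_nil hl
        simp only [if_pos, List.map_cons]
        rw [splitSum_cons, splitSum_eq_left]
        · simp [Conv.oneLetter, unmarked, word_zero_cons]
        · intro p q _ hp
          rw [oneLetter_eq_zero, word_zero_cons]
          have := List.length_pos_of_ne_nil hp
          simp only [unmarked, List.length_map, List.length_cons]
          omega
      · rw [rotWord, splitSum_map]
        refine splitSum_congr fun p q _ => ?_
        rw [splitSum_eq_left fun m₁ m₂ _ hm => if_neg hm, if_pos rfl, oneLetter_unmarked]
    · intro p q _ hq
      simp [hq, splitSum]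
  rw [ho, hi, ← sub_eq_add_neg]

end GQuiver

namespace GQuiver

variable {K : Type uK} [Field K] {Y : Type uY} [AddCommGroup Y] {G : GradingDatum Y}
  {Q : GQuiver.{uK, uY, uO, uH} K Y} {Q' : GQuiver.{uK, uY, uO', uH'} K Y}
  {M : Type*} [AddCommGroup M] [Module K M]
  {obj : Q.Ob → Q'.Ob} {B : List (Q.Tot × ℤ) → List (List (Q'.Tot × ℤ))}
  {μ : Q.Cochain} {μ' : Q'.Cochain} {e : Q.Ob → Q.Tot} {e' : Q'.Ob → Q'.Tot}

open Classical in
theorem IsStrictMorphism.insH_unit (hB : IsStrictMorphism G obj B μ μ' e e')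
    (hμ' : IsStrict G μ' e') {ψ : Q.T →ₗ[K] Q'.Tot} {c : Y} (hψ : Homog G obj c (hat ψ))
    {W X : Q.Ob} {s : Y} {z : List Q.Tot} (hz : Q.IsPath G W X s z) (m : List Q.Tot) :
    insH B (Q'.koszul G c) (hat ψ) (hat μ') (unmarked z ++ (e X, 1) :: unmarked m) =
      if m = [] then -Q'.sgn G (hat ψ (unmarked z)) else 0 := by
  have h0 (p q r : List (Q'.Tot × ℤ)) (x : Q'.Tot × ℤ) (h : p ≠ [] ∨ q ≠ [] ∨ r ≠ []) :
      hat μ' (p ++ x :: (q ++ (e' (obj X), 1) :: r)) = 0 := by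
    have := hμ'.unit_zero (p.map Prod.fst ++ x.1 :: q.map Prod.fst) (obj X) (r.map Prod.fst) (by
      have h1 : ∀ l : List (Q'.Tot × ℤ), l ≠ [] → 0 < l.length := fun l => List.length_pos_of_ne_nil
      simp only [List.length_append, List.length_cons, List.length_map]
      rcases h with h | h | h <;> have := h1 _ h <;> omega)
    simpa [hat] using this
  have hval (p q u : List (Q.Tot × ℤ)) : bsum B (fun p' => bsum B (fun r' =>
      hat μ' (p'.map (mapLetter (Q'.koszul G c)) ++ markedLetter (hat ψ) q :: r'))
        (u ++ (e X, 1) :: unmarked m)) p =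
      if p = [] then if u = [] then if m = [] then hat μ' [markedLetter (hat ψ) q, (e' (obj X), 1)]
        else 0 else 0 else 0 := by
    have h1 (p' : List (Q'.Tot × ℤ)) : bsum B (fun r' =>
        hat μ' (p'.map (mapLetter (Q'.koszul G c)) ++ markedLetter (hat ψ) q :: r'))
          (u ++ (e X, 1) :: unmarked m) = bsum B (fun u' => bsum B (fun m' =>
            hat μ' (p'.map (mapLetter (Q'.koszul G c)) ++ markedLetter (hat ψ) q ::
              (u' ++ (e' (obj X), 1) :: m'))) (unmarked m)) u :=
      hB.bsum_unit (((fml_hat μ').append_left _).cons _) _ _ _ _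
    simp only [h1]
    rw [hB.toIsCoalg.bsum_eq_ite, hB.toIsCoalg.bsum_eq_ite, hB.toIsCoalg.bsum_eq_ite]
    · simp only [unmarked_eq_nil]
      rfl
    · exact fun P hP => h0 _ _ _ _ (.inr (.inr hP))
    · exact fun P hP => (bsum_congr fun P' _ => h0 _ _ _ _ (.inr (.inl hP))).trans (bsum_zero _ _)
    · exact fun P hP => (bsum_congr fun P' _ => (bsum_congr fun P'' _ =>
        h0 _ _ _ _ (.inl (by simpa using hP))).trans (bsum_zero _ _)).trans (bsum_zero _ _)
  have hcm (m₁ m₂ : List (Q.Tot × ℤ)) (h : m₁ ++ m₂ = unmarked m) : cnt m₂ = 0 :=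
    (show Unmarked m₂ from (h ▸ unmarked_unmarked m).right).cnt
  rw [insH, insOp, splitSum₃, splitSum_append_cons, splitSum_eq_zero (l := unmarked m), add_zero]
  · rw [splitSum_eq_left]
    · rw [splitSum_append_cons, splitSum_eq_zero (l := unmarked m), add_zero, splitSum_eq_right]
      · rw [hval, if_pos rfl, if_pos rfl]
        have : cnt ([] ++ (e X, (1 : ℤ)) :: unmarked m) = 1 := OneMark.cnt ⟨[], e X, m, rfl⟩
        rw [this, one_smul]
        split_ifs
        · have hp := hψ W X s (unmarked z) (by rwa [map_fst_unmarked])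
          simpa [hat] using hμ'.unit_right _ _ _ _ hp
        · rfl
      · intro q u _ hu
        rw [hval, if_pos rfl, if_neg hu, smul_zero]
      · intro m₁ m₂ h
        rw [hcm m₁ m₂ h, zero_smul]
    · intro p u _ hp
      rw [splitSum_append_cons, splitSum_eq_zero, splitSum_eq_zero, add_zero]
      · intro m₁ m₂ h
        rw [hcm m₁ m₂ h, zero_smul]
      · intro q u _
        rw [hval, if_neg hp, smul_zero]
  · intro m₁ m₂ h
    refine splitSum_eq_zero fun q r hr => ?_
    rw [hcm (m₁ ++ q) r (by rw [List.append_assoc, hr, h]), zero_smul]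

theorem koszul_add_one (c : Y) :
    Q.koszul G (c + G.fromInt 1) = Q.koszul G c ∘ₗ Q.sgn G := by
  have h01 : ∀ x : ZMod 2, x = 0 ∨ x = 1 := by decide
  have h11 : (1 + 1 : ZMod 2) = 0 := by decide
  ext1 x
  rcases h01 (G.parity c) with h | h <;>
    simp [koszul, h, h11, G.parity_fromInt_one, LinearMap.ext_iff, sgn_sgn]

theorem Homog.sub {c : Y} {κ κ' : List (Q.Tot × ℤ) → Q'.Tot} (h : Homog G obj c κ)
    (h' : Homog G obj c κ') : Homog G obj c fun l => κ l - κ' l :=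
  fun X Z r l hl => (h X Z r l hl).single_sub (h' X Z r l hl)

theorem insH_of_unmarked {V V' : Type*} {A : Type*} [AddCommGroup A] {B : List (V × ℤ) →
    List (List (V' × ℤ))} {ς : V' → V'} {k : List (V × ℤ) → V'} {f : List (V' × ℤ) → A}
    {l : List (V × ℤ)} (h : ∀ x ∈ l, x.2 = 0) : insH B ς k f l = 0 := by
  unfold insH insOp splitSum₃
  refine splitSum_eq_zero fun p u hu => splitSum_eq_zero fun q r hr => ?_
  have : cnt r = 0 := List.sum_eq_zero fun n hn => by
    obtain ⟨x, hx, rfl⟩ := List.mem_map.mp hn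
    exact h x (by rw [← hu, ← hr]; simp [hx])
  exact (congrArg (· • _) this).trans (zero_smul _ _)

theorem insOp_letter_sub {V V' : Type*} [AddCommGroup V] [Module K V] [AddCommGroup V']
    [Module K V'] {B : List (V × ℤ) → List (List (V' × ℤ))} (w : List (V × ℤ) → ℤ) (ς : V' → V')
    (k₁ k₂ : List (V × ℤ) → V') {f : List (V' × ℤ) → M} (hf : FML K f) (l : List (V × ℤ)) :
    insOp w B (mapLetter ς) (markedLetter fun q => k₁ q - k₂ q) f l =
      insOp w B (mapLetter ς) (markedLetter k₁) f l -
      insOp w B (mapLetter ς) (markedLetter k₂) f l := by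
  rw [eq_sub_iff_add_eq, ← insOp_letter_add _ _ _ _ hf]
  simp only [sub_add_cancel]

theorem IsStrict.map_koszul (hμ : IsStrict G μ e) (c : Y) (l : List (Q.Tot × ℤ)) :
    hat μ (l.map (mapLetter (Q.koszul G c))) = G.sg c • Q.koszul G c (hat μ l) := by
  unfold koszul GradingDatum.sg
  split_ifs
  · have : (mapLetter (LinearMap.id : Q.Tot →ₗ[K] Q.Tot)) = id := rfl
    rw [this, List.map_id, one_smul]
    rfl
  · exact hμ.map_sgn l

/-- The homotopies for the Connes differential. -/
theorem IsStrictMorphism.cycEq_homotopy (hB : IsStrictMorphism G obj B μ μ' e e')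
    (hμ : IsStrict G μ e) (hμ' : IsStrict G μ' e') {ψ : Q.T →ₗ[K] Q'.Tot} {c : Y}
    (hψ : Homog G obj c (hat ψ))
    (hψσ : ∀ l, hat ψ (l.map (mapLetter (Q.sgn G))) = G.sg c • Q'.sgn G (hat ψ l))
    {κ : List (Q.Tot × ℤ) → Q'.Tot} (hκh : Homog G obj (c + G.fromInt 1) κ)
    (hκu : ∀ q, Unmarked q → κ q = 0) (hκe : ∀ z X m, κ (unmarked z ++ (e X, 1) :: unmarked m) = 0)
    {H₀ H₁ L R : Q.T →ₗ[K] Q'.T}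
    (h₀ : Rep G H₀ (lead B fun l => insH B (Q'.koszul G c) (hat ψ) (hat μ') l - κ l))
    (h₁ : Rep G H₁ (insH B (Q'.koszul G c) (hat ψ) (unitWord e')))
    (hL : Rep G L (insL B (Q'.koszul G c) (hat ψ) leadingWord))
    (hR : Rep G R fun l => insL B (Q'.koszul G (c + G.fromInt 1)) κ (unitWord e') l +
      insH B (Q'.koszul G (c + G.fromInt 1)) (fun l => insL B (Q'.koszul G c) (hat ψ) (hat μ') l -
        G.sg c • insL idBlocks (Q.sgn G) (hat μ) (hat ψ) l) (unitWord e') l) :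
    CycEq G (hochschildB G μ' ∘ₗ H₁ + G.sg c • H₁ ∘ₗ hochschildB G μ +
      connesB G e' ∘ₗ H₀ + G.sg c • H₀ ∘ₗ connesB G e) (-L - R) := by
  classical
  intro X r a l h
  have hpre := fml_unitWord (K := K) e'
  have hIpre : FML K (insH B (Q'.koszul G c) (hat ψ) (unitWord e')) :=
    hB.toIsMarked.fml_insH _ (fml_hat ψ) hpre
  have e1 : hochschildB G μ' (H₁ (word K (a :: l))) =
      cycSum (Q.twist G r) (insH B (Q'.koszul G c) (hat ψ) fun w =>
        word K (w.map Prod.fst) - rotWord (Q'.twist G (r + c)) w) a l -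
      cycSum (Q.twist G r) (insH B (Q'.koszul G c) (hat ψ)
        (insL idBlocks (Q'.sgn G) (hat μ') (unitWord e'))) a l := by
    refine ((h₁.comp (hochschildB G μ')) X r a l h).trans ?_
    rw [← cycSum_sub]
    refine cycSum_congr_degree h fun w _ hw => ?_
    obtain ⟨W, hW⟩ := hw
    refine (map_insOp (hochschildB G μ') _ _ _ _ _ w).trans
      (Eq.trans (insOp_congr fun p q s hw p' hp' s' hs' => ?_) (insOp_sub _ _ _ _ _ _ w))
    exact hμ'.hochschildB_unitWord (by simp)
      (hψ.isPath_insert hB.toIsFunctorial (hw ▸ hW) hp' hs')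
  have e2 := (h₁.comp_hochschildB hIpre hμ.homog) X r a l h
  have e3 := ((rep_connesB e').comp_lead hB.toIsFunctorial hpre
    ((Homog.insOp hB.toIsFunctorial cnt hψ hμ'.homog).sub hκh)
    (fun q hq => by rw [hκu q hq, sub_zero]; exact insH_of_unmarked hq) h₀) X r a l h
  have e4 : H₀ (connesB G e (word K (a :: l))) = -G.sg c • cycSum (Q.twist G r)
      (splitSum fun m z => bsum B (fun m' =>
        word K (hat ψ (z.map (mapLetter (Q.twist G r))) :: m'.map Prod.fst)) m) a l := by
    refine (((rep_connesB e).comp H₀) X r a l h).trans ?_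
    rw [← cycSum_zsmul]
    refine cycSum_congr_degree h fun w hw hW => ?_
    obtain ⟨W, hW⟩ := hW
    have hzero : ∀ q, Unmarked q → insH B (Q'.koszul G c) (hat ψ) (hat μ') q - κ q = 0 :=
      fun q hq => by rw [hκu q hq, sub_zero]; exact insH_of_unmarked hq
    rw [unitWord_eq hw.ne_nil hW, h₀.apply_unit hzero (hμ.isPath_unit W) hW, ← splitSum_zsmul,
      splitSum_map]
    refine splitSum_congr fun m z hmz => ?_
    obtain ⟨W', c₁, c₂, hm, hz, -⟩ := IsPath.of_append (p := m.map Prod.fst) (q := z.map Prod.fst)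
      (by rwa [← List.map_append, hmz])
    have hsgn : ∀ x, Q.twist G (r - G.fromInt 1) x = Q.sgn G (Q.twist G r x) := fun x => by
      have := twist_add (G := G) (r - G.fromInt 1) (G.fromInt 1) x
      rw [sub_add_cancel, koszul_fromInt_one] at this
      rw [this, sgn_sgn]
    have hψz : hat ψ (unmarked ((z.map Prod.fst).map (Q.twist G (r - G.fromInt 1)))) =
        G.sg c • Q'.sgn G (hat ψ (z.map (mapLetter (Q.twist G r)))) := by
      rw [← hψσ, hat, hat, map_fst_unmarked, map_fst_mapLetter, map_fst_mapLetter, List.map_map,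
        List.map_map, List.map_map]
      congr 2
      exact List.map_congr_left fun x _ => hsgn _
    rw [splitSum_eq_left]
    · have hl (P : List (Q'.Tot × ℤ)) : word K ((insH B (Q'.koszul G c) (hat ψ) (hat μ')
          (unmarked ((z.map Prod.fst).map (Q.twist G (r - G.fromInt 1))) ++
            (e W, 1) :: unmarked []) - κ (unmarked ((z.map Prod.fst).map
              (Q.twist G (r - G.fromInt 1))) ++ (e W, 1) :: unmarked [])) :: P.map Prod.fst) =
          -G.sg c • word K (hat ψ (z.map (mapLetter (Q.twist G r))) :: P.map Prod.fst) := by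
        rw [hB.insH_unit hμ' hψ (hz.map_twist _), if_pos rfl, hκe, sub_zero, hψz, map_zsmul,
          sgn_sgn, ← neg_smul, word_zsmul_cons]
      simp only [hl]
      rw [bsum_zsmul, hB.bsum_unmarked (fun P => word K (_ :: P))]
    · intro m₁ m₂ _ hm₁
      refine (bsum_congr fun P _ => ?_).trans (bsum_zero _ _)
      rw [hB.insH_unit hμ' hψ (hz.map_twist _), if_neg hm₁, hκe, sub_zero, word_zero_cons]
  have e5 := cycSum_insL_leadingWord hB.toIsFunctorial (fml_hat ψ) c h
  have e6 : cycSum (Q.twist G r) (insH B (Q'.koszul G c) (hat ψ)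
        (insL idBlocks (Q'.sgn G) (hat μ') (unitWord e'))) a l -
      G.sg c • cycSum (Q.twist G r) (insL idBlocks (Q.sgn G) (hat μ)
        (insH B (Q'.koszul G c) (hat ψ) (unitWord e'))) a l =
      cycSum (Q.twist G r) (insL B (Q'.koszul G (c + G.fromInt 1))
        (insH B (Q'.koszul G c) (hat ψ) (hat μ')) (unitWord e')) a l +
      cycSum (Q.twist G r) (insH B (Q'.koszul G (c + G.fromInt 1)) (fun l =>
        insL B (Q'.koszul G c) (hat ψ) (hat μ') l -
          G.sg c • insL idBlocks (Q.sgn G) (hat μ) (hat ψ) l) (unitWord e')) a l := by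
    rw [← cycSum_zsmul, ← cycSum_sub, ← cycSum_add]
    refine cycSum_congr h fun w _ hw => ?_
    rw [koszul_add_one]
    exact insH_insL_eq isInfix_onPath hB.toIsMarked (koszul_sgn c) (G.sg_eq c) hB.equivar hψσ
      (hμ'.map_koszul c) hB.rel hpre hw.onPath
  have e7 : cycSum (Q.twist G r) (insL B (Q'.koszul G (c + G.fromInt 1)) (fun l =>
        insH B (Q'.koszul G c) (hat ψ) (hat μ') l - κ l) (unitWord e')) a l =
      cycSum (Q.twist G r) (insL B (Q'.koszul G (c + G.fromInt 1))
        (insH B (Q'.koszul G c) (hat ψ) (hat μ')) (unitWord e')) a l -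
      cycSum (Q.twist G r) (insL B (Q'.koszul G (c + G.fromInt 1)) κ (unitWord e')) a l := by
    rw [← cycSum_sub]
    exact splitSum_congr fun m z _ => insOp_letter_sub _ _ _ _ hpre _
  have e8 := hR X r a l h
  rw [cycSum_add] at e8
  simp only [LinearMap.add_apply, LinearMap.smul_apply, LinearMap.comp_apply, LinearMap.sub_apply,
    LinearMap.neg_apply] at e2 e3 ⊢
  rw [e1, e2, e3.trans e7, e4, e8, hL X r a l h, ← e5, smul_smul, mul_neg, G.sg_mul_self,
    sub_eq_iff_eq_add.mp e6]
  rw [neg_smul, one_smul]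
  abel

end GQuiver

namespace GQuiver

variable {K : Type uK} [Field K] {Y : Type uY} [AddCommGroup Y] {G : GradingDatum Y}
  {Q : GQuiver.{uK, uY, uO, uH} K Y} {Q' : GQuiver.{uK, uY, uO', uH'} K Y}
  {M : Type*} [AddCommGroup M] [Module K M]
  {obj : Q.Ob → Q'.Ob} {B : List (Q.Tot × ℤ) → List (List (Q'.Tot × ℤ))}
  {μ φ : Q.Cochain} {μ' φ' : Q'.Cochain} {e : Q.Ob → Q.Tot} {e' : Q'.Ob → Q'.Tot}

/-! ### Deformations -/

theorem OnPath.middle {p q r l : List (Q.Tot × ℤ)} (h : OnPath G l) (hl : p ++ (q ++ r) = l) :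
    OnPath G q :=
  isInfix_onPath.left q r (isInfix_onPath.right p (q ++ r) (hl ▸ h))

theorem koszul_fromInt_two : Q.koszul G (G.fromInt 1 + G.fromInt 1) = LinearMap.id := by
  have h11 : (1 + 1 : ZMod 2) = 0 := by decide
  simp [koszul, G.parity_fromInt_one, h11]

theorem cnt_map_mapLetter {V V' : Type*} (σ : V → V') (l : List (V × ℤ)) :
    cnt (l.map (mapLetter σ)) = cnt l := by simp [cnt, Function.comp_def]

theorem homog_insH (hB : IsFunctorial G obj B) {c c₁ c' : Y} {k : List (Q.Tot × ℤ) → Q'.Tot}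
    (hk : Homog G obj c k) {f : List (Q'.Tot × ℤ) → Q'.Tot} (hf : Homog G id c₁ f) :
    Homog G obj (c + c₁) (insH B (Q'.koszul G c') k f) := Homog.insOp hB cnt hk hf

theorem homog_insH_id (hμ : Homog G id (G.fromInt 1) (hat μ))
    (hφ : Homog G id (G.fromInt 1) (hat φ)) :
    Homog G id (G.fromInt 1 + G.fromInt 1) (insH idBlocks (Q.sgn G) (hat φ) (hat μ)) := by
  have := homog_insH (c' := G.fromInt 1) isFunctorial_idBlocks hφ hμ
  rwa [koszul_fromInt_one] at this

theorem Rep.comp_bOneOne (hμ : Homog G id (G.fromInt 1) (hat μ))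
    (hφ : Homog G id (G.fromInt 1) (hat φ)) {T : Q.T →ₗ[K] M} {ω : List (Q.Tot × ℤ) → M}
    (hω : FML K ω) (hT : Rep G T ω) : Rep G (T ∘ₗ bOneOne G μ φ)
      (insL idBlocks (LinearMap.id : Q.Tot →ₗ[K] Q.Tot)
        (insH idBlocks (Q.sgn G) (hat φ) (hat μ)) ω) := by
  have := hT.comp_lead isFunctorial_idBlocks hω (homog_insH_id hμ hφ)
    (fun q hq => insH_of_unmarked hq) (rep_bOneOne μ φ)
  rwa [koszul_fromInt_two] at this

theorem mapLetter_id : mapLetter (LinearMap.id : Q.Tot →ₗ[K] Q.Tot) = id := rfl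

theorem sgn_comp_sgn : Q.sgn G ∘ₗ Q.sgn G = LinearMap.id := LinearMap.ext sgn_sgn

theorem insOp_zero_of_path {c : Y} {w : List (Q.Tot × ℤ) → ℤ}
    (hB : IsFunctorial G obj B) {c' : Y} {k : List (Q.Tot × ℤ) → Q'.Tot} (hk : Homog G obj c k)
    {f : List (Q'.Tot × ℤ) → M} (hf : ∀ l, OnPath G l → f l = 0) {l : List (Q.Tot × ℤ)}
    (hl : OnPath G l) : insOp w B (mapLetter (Q'.koszul G c')) (markedLetter k) f l = 0 := by
  obtain ⟨X, Z, r, hl⟩ := hl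
  unfold insOp splitSum₃
  refine splitSum_eq_zero fun p u hu => splitSum_eq_zero fun q s hs => ?_
  refine (congrArg (w s • ·) ((bsum_congr fun p' hp => (bsum_congr fun s' hs' => ?_).trans
    (bsum_zero B s)).trans (bsum_zero B p))).trans (smul_zero _)
  exact hf _ ⟨_, _, _, hk.isPath_insert hB (by rwa [hs, hu]) hp hs'⟩

theorem insOp_letter_zero {V V' : Type*} [AddCommGroup V] [Module K V] [AddCommGroup V']
    [Module K V'] {B : List (V × ℤ) → List (List (V' × ℤ))} {w : List (V × ℤ) → ℤ} {ς : V' → V'}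
    {k : List (V × ℤ) → V'} {f : List (V' × ℤ) → M} (hf : FML K f) {l : List (V × ℤ)}
    (h : ∀ p q r, p ++ (q ++ r) = l → k q = 0) :
    insOp w B (mapLetter ς) (markedLetter k) f l = 0 := by
  unfold insOp splitSum₃
  refine splitSum_eq_zero fun p u hu => splitSum_eq_zero fun q s hs => ?_
  refine (congrArg (w s • ·) ((bsum_congr fun p' hp => (bsum_congr fun s' hs' => ?_).trans
    (bsum_zero B s)).trans (bsum_zero B p))).trans (smul_zero _)
  rw [markedLetter, h p q s (by rw [hs, hu])]
  exact (hf _ _ _).map_zero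

theorem IsDeformation.rel' (hφ : IsDeformation G μ φ) {l : List (Q.Tot × ℤ)} (hl : OnPath G l) :
    insL idBlocks (Q.sgn G) (hat φ) (hat μ) l -
      (-1 : ℤ) • insL idBlocks (Q.sgn G) (hat μ) (hat φ) l = 0 := by
  rw [neg_smul, one_smul, sub_neg_eq_add, hφ.rel l hl]

/-- The operation `bOneOne` commutes with the Hochschild differential. -/
theorem IsDeformation.hochschildB_comp_bOneOne (hφ : IsDeformation G μ φ) (hμ : IsStrict G μ e) :
    CycEq G (hochschildB G μ ∘ₗ bOneOne G μ φ) (bOneOne G μ φ ∘ₗ hochschildB G μ) := by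
  have hI : IsMarked.{max uK uY uO uH} K (idBlocks : List (Q.Tot × ℤ) → _) := isMarked_idBlocks
  have hS := isStrictMorphism_idBlocks (G := G) μ e
  set κ := insH idBlocks (Q.sgn G) (hat φ) (hat μ) with hκdef
  have hκ : FML K κ := hI.fml_insH _ (fml_hat φ) (fml_hat μ)
  have hω := fml_leadingWord (K := K) (Q := Q)
  have h1 := Rep.comp_bOneOne hμ.homog hφ.homog (fml_insL_id μ hω) (rep_hochschildB hμ.homog)
  have h2 := (Rep.comp_bOneOne hμ.homog hφ.homog hω rep_leadingWord).comp_hochschildB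
    (hI.fml_insL _ hκ hω) hμ.homog
  have hκσ (l : List (Q.Tot × ℤ)) : κ (l.map (mapLetter (Q.sgn G))) = (1 : ℤ) • Q.sgn G (κ l) :=
    insOp_map_mapLetter (cnt_map_mapLetter _) (equivar_idBlocks _) (fun _ => rfl) hφ.map_sgn
      (fml_hat μ) hμ.map_sgn l
  have hκrel (l : List (Q.Tot × ℤ)) (hl : OnPath G l) :
      insL idBlocks (LinearMap.id : Q.Tot →ₗ[K] Q.Tot) κ (hat μ) l -
        (1 : ℤ) • insL idBlocks (Q.sgn G) (hat μ) κ l = 0 := by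
    have h := insH_insL_eq isInfix_onPath hI (σ' := Q.sgn G) (ς := Q.sgn G) (fun _ => rfl)
      (.inr rfl) (equivar_idBlocks _) hφ.map_sgn hμ.map_sgn hS.rel (fml_hat μ) hl
    have h0 := insOp_zero_of_path (w := cnt) (c' := G.fromInt 1) isFunctorial_idBlocks hφ.homog
      hμ.rel hl
    rw [koszul_fromInt_one] at h0
    have hz : insH idBlocks (LinearMap.id : Q.Tot →ₗ[K] Q.Tot)
        (fun l => insL idBlocks (Q.sgn G) (hat φ) (hat μ) l -
          (-1 : ℤ) • insL idBlocks (Q.sgn G) (hat μ) (hat φ) l) (hat μ) l = 0 :=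
      insOp_letter_zero (fml_hat μ) fun p q r h => hφ.rel' (hl.middle h)
    rw [sgn_comp_sgn, hz, add_zero] at h
    unfold insH at h
    rw [h0, zero_sub, neg_smul, one_smul, neg_neg] at h
    rw [one_smul, sub_eq_zero]
    exact h.symm
  refine h1.cycEq h2 fun l _ hc => ?_
  have h := insL_insL_eq isInfix_onPath hI (σ' := Q.sgn G) (ς := LinearMap.id) (fun _ => rfl)
    (.inl rfl) (equivar_idBlocks _) hκσ (fun l => by rw [mapLetter_id, List.map_id, one_smul]; rfl)
    hS.rel hω hc.onPath
  have hz : insL idBlocks (LinearMap.id ∘ₗ Q.sgn G : Q.Tot →ₗ[K] Q.Tot)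
      (fun l => insL idBlocks (LinearMap.id : Q.Tot →ₗ[K] Q.Tot) κ (hat μ) l -
        (1 : ℤ) • insL idBlocks (Q.sgn G) (hat μ) κ l) leadingWord l = 0 :=
    insOp_letter_zero hω fun p q r h => hκrel q (hc.onPath.middle h)
  rw [hz, one_smul, sub_eq_zero] at h
  exact h

/-- The operations `bOneOne` and `connesBOneOne` of a deformation. -/
theorem IsDeformation.cycEq_oneOne (hφ : IsDeformation G μ φ) (hμ : IsStrict G μ e) :
    CycEq G (bOneOne G μ φ ∘ₗ connesB G e - connesB G e ∘ₗ bOneOne G μ φ +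
      connesBOneOne G e φ ∘ₗ hochschildB G μ - hochschildB G μ ∘ₗ connesBOneOne G e φ)
      (hochschildB G φ) := by
  have hS := isStrictMorphism_idBlocks (G := G) μ e
  have h := hS.cycEq_homotopy hμ hμ (c := G.fromInt 1) (ψ := φ) (κ := fun _ => 0)
    (H₀ := bOneOne G μ φ) (H₁ := connesBOneOne G e φ) (L := hochschildB G φ) (R := 0)
    hφ.homog (by rw [G.sg_fromInt_one]; exact hφ.map_sgn) (fun X Z r l _ => IsPath.single_zero _ _ _)
    (fun _ _ => rfl) (fun _ _ _ => rfl)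
    (by rw [koszul_fromInt_one]; simpa only [sub_zero] using rep_bOneOne μ φ)
    (by rw [koszul_fromInt_one]; exact rep_connesBOneOne e φ)
    (by rw [koszul_fromInt_one]; exact rep_hochschildB hφ.homog)
    (fun X r a l h => by
      refine (splitSum_eq_zero (l := l) fun m z hmz => ?_).symm
      obtain ⟨W, hW⟩ := isPath_rotate (hmz ▸ h)
      refine (congrArg₂ (· + ·) (insOp_letter_zero (fml_unitWord e) fun _ _ _ _ => rfl)
        (insOp_letter_zero (fml_unitWord e) fun p q s hs => ?_)).trans (add_zero 0)
      rw [koszul_fromInt_one, G.sg_fromInt_one]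
      refine hφ.rel' (OnPath.middle (l := _) ⟨W, W, r, ?_⟩ hs)
      rwa [unmarked_mark_map_fst])
  intro X r a l hp
  have := h X r a l hp
  simp only [G.sg_fromInt_one, neg_smul, one_smul, LinearMap.add_apply, LinearMap.sub_apply,
    LinearMap.neg_apply, LinearMap.comp_apply, sub_zero] at this ⊢
  rw [← neg_eq_iff_eq_neg] at this
  rw [← this]
  abel

end GQuiver

namespace GQuiver

variable {K : Type uK} [Field K] {Y : Type uY} [AddCommGroup Y] {G : GradingDatum Y}
  {Q : GQuiver.{uK, uY, uO, uH} K Y} {Q' : GQuiver.{uK, uY, uO', uH'} K Y}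
  {M : Type*} [AddCommGroup M] [Module K M]
  {obj : Q.Ob → Q'.Ob} {B : List (Q.Tot × ℤ) → List (List (Q'.Tot × ℤ))}
  {μ φ : Q.Cochain} {μ' φ' : Q'.Cochain} {e : Q.Ob → Q.Tot} {e' : Q'.Ob → Q'.Tot}
  {ψ : Q.T →ₗ[K] Q'.Tot}

/-! ### Deformations of functors -/

/-- Infinitesimal deformations of a functor, along with deformations `φ` and `φ'` of the structure
maps of its source and target. -/
structure IsDeformationMorphism (G : GradingDatum Y) (obj : Q.Ob → Q'.Ob)
    (B : List (Q.Tot × ℤ) → List (List (Q'.Tot × ℤ))) (μ φ : Q.Cochain) (μ' φ' : Q'.Cochain)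
    (ψ : Q.T →ₗ[K] Q'.Tot) : Prop where
  homog : Homog G obj 0 (hat ψ)
  map_sgn : ∀ l, hat ψ (l.map (mapLetter (Q.sgn G))) = Q'.sgn G (hat ψ l)
  rel : ∀ l, OnPath G l →
    bsum B (hat φ') l + insL B (LinearMap.id : Q'.Tot →ₗ[K] Q'.Tot) (hat ψ) (hat μ') l =
      insL idBlocks (Q.sgn G) (hat μ) (hat ψ) l +
        insL idBlocks (Q.sgn G) (hat φ) (bsum B Conv.oneLetter) l

theorem insOp_congr_path {c : Y} {w : List (Q.Tot × ℤ) → ℤ}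
    (hB : IsFunctorial G obj B) {c' : Y} {k : List (Q.Tot × ℤ) → Q'.Tot} (hk : Homog G obj c k)
    {f g : List (Q'.Tot × ℤ) → M} (hf : ∀ l, OnPath G l → f l = g l) {l : List (Q.Tot × ℤ)}
    (hl : OnPath G l) : insOp w B (mapLetter (Q'.koszul G c')) (markedLetter k) f l =
      insOp w B (mapLetter (Q'.koszul G c')) (markedLetter k) g l := by
  obtain ⟨X, Z, r, hl⟩ := hl
  exact insOp_congr fun p q s h p' hp s' hs =>
    hf _ ⟨_, _, _, hk.isPath_insert hB (h ▸ hl) hp hs⟩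

/-- The part of the first homotopy that involves the deformation of the source. -/
def sourceTerm (G : GradingDatum Y) (B : List (Q.Tot × ℤ) → List (List (Q'.Tot × ℤ)))
    (φ : Q.Cochain) : List (Q.Tot × ℤ) → Q'.Tot :=
  insH idBlocks (Q.sgn G) (hat φ) (bsum B Conv.oneLetter)

/-- The Taylor coefficient of the first homotopy for a deformation of a functor. -/
def homotopyTerm (G : GradingDatum Y) (B : List (Q.Tot × ℤ) → List (List (Q'.Tot × ℤ)))
    (φ : Q.Cochain) (μ' : Q'.Cochain) (ψ : Q.T →ₗ[K] Q'.Tot) (l : List (Q.Tot × ℤ)) : Q'.Tot :=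
  insH B (LinearMap.id : Q'.Tot →ₗ[K] Q'.Tot) (hat ψ) (hat μ') l - sourceTerm G B φ l

theorem fml_bsum_oneLetter (hB : IsFunctorial G obj B) :
    FML K (bsum B Conv.oneLetter) :=
  hB.toIsMarked.fml_bsum fml_oneLetter

theorem bsum_oneLetter_map_sgn (hB : IsFunctorial G obj B) (l : List (Q.Tot × ℤ)) :
    bsum B Conv.oneLetter (l.map (mapLetter (Q.sgn G))) =
      (1 : ℤ) • Q'.sgn G (bsum B Conv.oneLetter l) := by
  rw [hB.equivar.bsum, one_smul, map_bsum]
  refine bsum_congr fun P _ => ?_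
  match P with
  | [] => exact (map_zero _).symm
  | [_] => rfl
  | _ :: _ :: _ => exact (map_zero _).symm

theorem homog_sourceTerm (hB : IsFunctorial G obj B) (hφ : Homog G id (G.fromInt 1) (hat φ)) :
    Homog G obj (G.fromInt 1) (sourceTerm G B φ) := fun X Z r l hl => by
  unfold sourceTerm insH insOp splitSum₃
  refine IsPath.single_splitSum fun p u hu => IsPath.single_splitSum fun q s hs => ?_
  refine IsPath.single_zsmul (IsPath.single_bsum fun P hP => IsPath.single_bsum fun P' hP' => ?_) _
  have h := hφ.isPath_insert isFunctorial_idBlocks (c' := G.fromInt 1) (p := p) (q := q)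
    (by rwa [hs, hu]) hP hP'
  rw [koszul_fromInt_one] at h
  have h' := bsum_oneLetter_homog hB _ _ _ _ h
  rwa [add_zero] at h'

theorem homog_homotopyTerm (hB : IsFunctorial G obj B) (hφ : Homog G id (G.fromInt 1) (hat φ))
    (hμ' : Homog G id (G.fromInt 1) (hat μ')) (hψ : Homog G obj 0 (hat ψ)) :
    Homog G obj (G.fromInt 1) (homotopyTerm G B φ μ' ψ) := by
  refine Homog.sub (fun X Z r l hl => ?_) (homog_sourceTerm hB hφ)
  have h := homog_insH (c' := 0) hB hψ hμ' X Z r l hl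
  rwa [koszul_zero, zero_add] at h

theorem homotopyTerm_of_unmarked {q : List (Q.Tot × ℤ)} (hq : Unmarked q) :
    homotopyTerm G B φ μ' ψ q = 0 := by
  rw [homotopyTerm, sourceTerm, insH_of_unmarked hq, insH_of_unmarked hq, sub_zero]

variable (hB : IsStrictMorphism G obj B μ μ' e e') (hμ : IsStrict G μ e) (hμ' : IsStrict G μ' e')
  (hφ : IsDeformation G μ φ) (hφ' : IsDeformation G μ' φ')
  (hψ : IsDeformationMorphism G obj B μ φ μ' φ' ψ)

theorem equivar_mapLetter_id {V V' : Type*} [AddCommGroup V] [Module K V] [AddCommGroup V']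
    [Module K V'] (B : List (V × ℤ) → List (List (V' × ℤ))) :
    Equivar B (mapLetter (LinearMap.id : V →ₗ[K] V)) (mapLetter (LinearMap.id : V' →ₗ[K] V')) :=
  fun l => by
    rw [show mapLetter (LinearMap.id : V →ₗ[K] V) = id from rfl,
      show mapLetter (LinearMap.id : V' →ₗ[K] V') = id from rfl, List.map_id,
      show List.map (id : V' × ℤ → V' × ℤ) = id from funext List.map_id, List.map_id]

include hB hμ hμ' hφ hφ' hψ in
theorem IsDeformationMorphism.homotopyTerm_rel {l : List (Q.Tot × ℤ)} (hl : OnPath G l) :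
    insL B (Q'.sgn G) (homotopyTerm G B φ μ' ψ) (hat μ') l +
      insL idBlocks (Q.sgn G) (hat μ) (homotopyTerm G B φ μ' ψ) l =
    bsum B (insH idBlocks (Q'.sgn G) (hat φ') (hat μ')) l -
      insL idBlocks (LinearMap.id : Q.Tot →ₗ[K] Q.Tot)
        (insH idBlocks (Q.sgn G) (hat φ) (hat μ)) (bsum B Conv.oneLetter) l := by
  have hF := hB.toIsFunctorial
  have hX := fml_bsum_oneLetter hF
  have hI : IsMarked.{max uK uY uO uH} K (idBlocks : List (Q.Tot × ℤ) → _) := isMarked_idBlocks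
  have hS := isStrictMorphism_idBlocks (G := G) μ e
  have h1 := insH_insL_eq isInfix_onPath hB.toIsMarked (σ' := Q'.sgn G) (ς := LinearMap.id) (ε := 1)
    (fun _ => rfl) (.inl rfl) hB.equivar (fun l => (hψ.map_sgn l).trans (one_smul _ _).symm)
    (fun l => by rw [mapLetter_id, List.map_id, one_smul]; rfl) hB.rel (fml_hat μ') hl
  have h2 : insH B (LinearMap.id : Q'.Tot →ₗ[K] Q'.Tot) (hat ψ)
      (insL idBlocks (Q'.sgn G) (hat μ') (hat μ')) l = 0 := by
    have := insOp_zero_of_path (w := cnt) (c' := 0) hF hψ.homog hμ'.rel hl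
    rwa [koszul_zero] at this
  have h3 : insH B (Q'.sgn G) (fun l => insL B (LinearMap.id : Q'.Tot →ₗ[K] Q'.Tot) (hat ψ)
        (hat μ') l - (1 : ℤ) • insL idBlocks (Q.sgn G) (hat μ) (hat ψ) l) (hat μ') l =
      insH B (Q'.sgn G) (insL idBlocks (Q.sgn G) (hat φ) (bsum B Conv.oneLetter)) (hat μ') l -
        insH B (Q'.sgn G) (bsum B (hat φ')) (hat μ') l := by
    refine (insOp_letter_congr fun p q r h => ?_).trans
      (insOp_letter_sub _ _ _ _ (fml_hat μ') l)
    rw [one_smul, sub_eq_sub_iff_add_eq_add, add_comm, hψ.rel q (hl.middle h), add_comm]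
  rw [h2, LinearMap.id_comp, h3] at h1
  have h4 := insH_bsum_eq (k := hat φ) hB.toIsMarked hB.equivar (fml_hat μ') l
  have h5 : insH idBlocks (Q.sgn G) (hat φ) (bsum B (hat μ')) l =
      insH idBlocks (Q.sgn G) (hat φ) (insL idBlocks (Q.sgn G) (hat μ) (bsum B Conv.oneLetter)) l := by
    have := insOp_congr_path (w := cnt) (c' := G.fromInt 1) isFunctorial_idBlocks hφ.homog hB.rel hl
    rwa [koszul_fromInt_one] at this
  have h6 := insH_insL_eq isInfix_onPath hI (σ' := Q.sgn G) (ς := Q.sgn G) (ε := -1) (fun _ => rfl)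
    (.inr rfl) (equivar_idBlocks _) hφ.map_sgn hμ.map_sgn hS.rel hX hl
  have h7 : insH idBlocks (LinearMap.id : Q.Tot →ₗ[K] Q.Tot)
      (fun l => insL idBlocks (Q.sgn G) (hat φ) (hat μ) l -
        (-1 : ℤ) • insL idBlocks (Q.sgn G) (hat μ) (hat φ) l) (bsum B Conv.oneLetter) l = 0 :=
    insOp_letter_zero hX fun p q r h => hφ.rel' (hl.middle h)
  rw [sgn_comp_sgn, h7, add_zero] at h6
  have h8 : insL B (Q'.sgn G) (homotopyTerm G B φ μ' ψ) (hat μ') l =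
      insL B (Q'.sgn G) (insH B (LinearMap.id : Q'.Tot →ₗ[K] Q'.Tot) (hat ψ) (hat μ')) (hat μ') l -
        insL B (Q'.sgn G) (sourceTerm G B φ) (hat μ') l :=
    insOp_letter_sub _ _ _ _ (fml_hat μ') l
  have h9 : insL idBlocks (Q.sgn G) (hat μ) (homotopyTerm G B φ μ' ψ) l =
      insL idBlocks (Q.sgn G) (hat μ)
        (insH B (LinearMap.id : Q'.Tot →ₗ[K] Q'.Tot) (hat ψ) (hat μ')) l -
      insL idBlocks (Q.sgn G) (hat μ) (sourceTerm G B φ) l := insOp_sub _ _ _ _ _ _ l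
  rw [h8, h9, bsum_insH_eq hB.toIsMarked (fml_hat μ')]
  unfold sourceTerm
  rw [h5] at h4
  rw [neg_smul, one_smul, sub_neg_eq_add] at h6
  rw [one_smul] at h1
  generalize insL B (Q'.sgn G) (insH B (LinearMap.id : Q'.Tot →ₗ[K] Q'.Tot) (hat ψ) (hat μ'))
    (hat μ') l = a1 at *
  generalize insL idBlocks (Q.sgn G) (hat μ)
    (insH B (LinearMap.id : Q'.Tot →ₗ[K] Q'.Tot) (hat ψ) (hat μ')) l = a2 at *
  generalize insL B (Q'.sgn G) (insH idBlocks (Q.sgn G) (hat φ) (bsum B Conv.oneLetter)) (hat μ') l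
    = a3 at *
  generalize insL idBlocks (Q.sgn G) (hat μ)
    (insH idBlocks (Q.sgn G) (hat φ) (bsum B Conv.oneLetter)) l = a4 at *
  rw [h4, ← eq_sub_iff_add_eq'] at h6
  rw [h6]
  rw [sub_eq_iff_eq_add, ← sub_eq_iff_eq_add', sub_eq_iff_eq_add, eq_comm, add_eq_zero_iff_eq_neg]
    at h1
  rw [h1]
  abel

include hB hμ hμ' hφ hφ' hψ in
/-- Functors commute with the operations `bOneOne` up to homotopy. -/
theorem IsDeformationMorphism.bOneOne_comp {F H₀ : Q.T →ₗ[K] Q'.T}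
    (hF : Rep G F (lead B fun l => cnt l • bsum B Conv.oneLetter l))
    (h₀ : Rep G H₀ (lead B (homotopyTerm G B φ μ' ψ))) :
    CycEq G (hochschildB G μ' ∘ₗ H₀ + H₀ ∘ₗ hochschildB G μ)
      (bOneOne G μ' φ' ∘ₗ F - F ∘ₗ bOneOne G μ φ) := by
  have hBF := hB.toIsFunctorial
  have hw := fml_leadingWord (K := K) (Q := Q')
  have hrep := rep_leadingWord (G := G) (Q := Q')
  have hκ := homog_homotopyTerm hBF hφ.homog hμ'.homog hψ.homog
  have hI' : IsMarked.{max uK uY uO' uH'} K (idBlocks : List (Q'.Tot × ℤ) → _) := isMarked_idBlocks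
  have hκf : FML K (homotopyTerm G B φ μ' ψ) :=
    (hB.toIsMarked.fml_insH LinearMap.id (fml_hat ψ) (fml_hat μ')).sub
      ((isMarked_idBlocks (K := K) (V := Q.Tot)).fml_insH _ (fml_hat φ) (fml_bsum_oneLetter hBF))
  have h1 := (rep_hochschildB hμ'.homog).comp_lead hBF (fml_insL_id μ' hw) hκ
    (fun q hq => homotopyTerm_of_unmarked hq) h₀
  have h2 := (hrep.comp_lead hBF hw hκ (fun q hq => homotopyTerm_of_unmarked hq)
    h₀).comp_hochschildB (hB.toIsMarked.fml_insL _ hκf hw) hμ.homog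
  have h3 := (Rep.comp_bOneOne hμ'.homog hφ'.homog hw hrep).comp_morphism hBF
    (hI'.fml_insL _ (hI'.fml_insH _ (fml_hat φ') (fml_hat μ')) hw) hF
  have h4 := Rep.comp_bOneOne hμ.homog hφ.homog (hB.toIsMarked.fml_bsum hw)
    (hrep.comp_morphism hBF hw hF)
  refine (h1.add h2).cycEq (h3.sub h4) fun l _ hc => ?_
  have hσ (l : List (Q.Tot × ℤ)) : homotopyTerm G B φ μ' ψ (l.map (mapLetter (Q.sgn G))) =
      (-1 : ℤ) • Q'.sgn G (homotopyTerm G B φ μ' ψ l) := by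
    have e1 : insH B (LinearMap.id : Q'.Tot →ₗ[K] Q'.Tot) (hat ψ) (hat μ')
        (l.map (mapLetter (Q.sgn G))) = (1 * -1 : ℤ) • Q'.sgn G
          (insH B (LinearMap.id : Q'.Tot →ₗ[K] Q'.Tot) (hat ψ) (hat μ') l) :=
      insOp_map_mapLetter (ς := LinearMap.id) (cnt_map_mapLetter _) hB.equivar (fun _ => rfl)
        (fun l => (hψ.map_sgn l).trans (one_smul _ _).symm) (fml_hat μ') hμ'.map_sgn l
    have e2 : sourceTerm G B φ (l.map (mapLetter (Q.sgn G))) = (-1 * 1 : ℤ) • Q'.sgn G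
        (sourceTerm G B φ l) :=
      insOp_map_mapLetter (cnt_map_mapLetter _) (equivar_idBlocks _) (fun _ => rfl) hφ.map_sgn
        (fml_bsum_oneLetter hBF) (bsum_oneLetter_map_sgn hBF) l
    rw [homotopyTerm, e1, e2, homotopyTerm, map_sub, smul_sub, one_mul, mul_one]
  have h5 := insL_insL_eq isInfix_onPath hB.toIsMarked (σ' := Q'.sgn G) (ς := Q'.sgn G) (ε := -1)
    (fun _ => rfl) (.inr rfl) hB.equivar hσ hμ'.map_sgn hB.rel hw hc.onPath
  have h6 := insL_bsum_eq (k := insH idBlocks (Q.sgn G) (hat φ) (hat μ)) hB.toIsMarked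
    (equivar_mapLetter_id (K := K) B) hw l
  rw [koszul_fromInt_one]
  rw [neg_smul, one_smul, sub_neg_eq_add] at h5
  refine h5.trans ?_
  rw [bsum_insL_eq_insL hB.toIsMarked hw, h6, sgn_comp_sgn]
  refine (insOp_letter_congr fun p q r h => ?_).trans (insOp_letter_sub _ _ _ _ hw l)
  rw [neg_smul, one_smul, sub_neg_eq_add]
  exact hψ.homotopyTerm_rel hB hμ hμ' hφ hφ' (hc.onPath.middle h)

include hB in
theorem IsStrictMorphism.sourceTerm_unit (z : List Q.Tot) (X : Q.Ob) (m : List Q.Tot) :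
    sourceTerm G B φ (unmarked z ++ (e X, 1) :: unmarked m) = 0 := by
  classical
  unfold sourceTerm insH insOp splitSum₃
  refine splitSum_eq_zero fun p u hu => splitSum_eq_zero fun q r hr => ?_
  subst hr
  rw [← List.append_assoc] at hu
  have hcase (t : List (Q.Tot × ℤ)) : cnt (t ++ (e X, 1) :: unmarked m) • bsum idBlocks (fun p' =>
      bsum idBlocks (fun r' => bsum B Conv.oneLetter (p'.map (mapLetter (Q.sgn G)) ++
        markedLetter (hat φ) q :: r')) (t ++ (e X, 1) :: unmarked m)) p = 0 := by
    have := hB.bsum_oneLetter_unit (p.map (mapLetter (Q.sgn G)) ++ markedLetter (hat φ) q :: t) X 1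
      (unmarked m)
    rw [if_neg (by simp), List.append_assoc, List.cons_append] at this
    rw [bsum_idBlocks, bsum_idBlocks, this, smul_zero]
  rcases List.append_eq_append_iff.mp hu with ⟨a, -, rfl⟩ | ⟨c, -, h⟩
  · exact hcase a
  · match c, h with
    | [], h =>
      obtain rfl : r = _ := h.symm
      exact hcase []
    | _ :: c, h =>
      have : Unmarked r := fun x hx => unmarked_unmarked m x (by
        rw [(List.cons.inj h).2]; exact List.mem_append_right c hx)
      exact (congrArg (· • _) this.cnt).trans (zero_smul _ _)

include hB hμ hμ' hφ hφ' hψ in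
/-- Functors commute with the operations `connesBOneOne` up to homotopy. -/
theorem IsDeformationMorphism.connesBOneOne_comp {F H₀ H₁ L : Q.T →ₗ[K] Q'.T}
    (hF : Rep G F (lead B fun l => cnt l • bsum B Conv.oneLetter l))
    (h₀ : Rep G H₀ (lead B (homotopyTerm G B φ μ' ψ)))
    (h₁ : Rep G H₁ (insH B (LinearMap.id : Q'.Tot →ₗ[K] Q'.Tot) (hat ψ) (unitWord e')))
    (hL : Rep G L (insL B (LinearMap.id : Q'.Tot →ₗ[K] Q'.Tot) (hat ψ) leadingWord)) :
    CycEq G (hochschildB G μ' ∘ₗ H₁ + H₁ ∘ₗ hochschildB G μ + connesB G e' ∘ₗ H₀ +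
      H₀ ∘ₗ connesB G e) (-L - (F ∘ₗ connesBOneOne G e φ - connesBOneOne G e' φ' ∘ₗ F)) := by
  have hBF := hB.toIsFunctorial
  have hu := fml_unitWord (K := K) e'
  have h1 := (rep_connesBOneOne (G := G) e' φ').comp_morphism hBF
    ((isMarked_idBlocks (K := K) (V := Q'.Tot)).fml_insH _ (fml_hat φ') hu) hF
  have h2 := (rep_connesBOneOne (G := G) e φ).comp F
  have hsg : G.sg 0 = 1 := by simp [GradingDatum.sg]
  have hR := (h2.sub h1).congr
    (g := fun l => insL B (Q'.koszul G (0 + G.fromInt 1)) (sourceTerm G B φ) (unitWord e') l +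
      insH B (Q'.koszul G (0 + G.fromInt 1)) (fun l => insL B (Q'.koszul G 0) (hat ψ) (hat μ') l -
        G.sg 0 • insL idBlocks (Q.sgn G) (hat μ) (hat ψ) l) (unitWord e') l) fun l _ hc => by
    have e1 : F (insH idBlocks (Q.sgn G) (hat φ) (unitWord e) l) =
        insH idBlocks (Q.sgn G) (hat φ) (bsum B (unitWord e')) l := by
      refine (map_insOp F _ _ _ _ _ l).trans (insOp_congr fun p q r h p' hp r' hr => ?_)
      refine hB.apply_unitWord hμ hF (by simp) ?_
      obtain ⟨X, s, hX⟩ := hc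
      have := hφ.homog.isPath_insert isFunctorial_idBlocks (c' := G.fromInt 1) (h ▸ hX) hp hr
      rw [koszul_fromInt_one] at this
      exact ⟨_, _, this⟩
    have e2 := insH_bsum_eq (k := hat φ) hB.toIsMarked hB.equivar hu l
    rw [e1, e2, bsum_insH_eq hB.toIsMarked hu, zero_add, koszul_fromInt_one, koszul_zero, hsg,
      add_sub_assoc]
    refine congrArg (_ + ·) ((insOp_letter_sub _ _ _ _ hu l).symm.trans
      (insOp_letter_congr fun p q r h => ?_))
    rw [one_smul, eq_comm, sub_eq_sub_iff_add_eq_add, add_comm, hψ.rel q (hc.onPath.middle h),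
      add_comm]
  have h := hB.cycEq_homotopy hμ hμ' (c := 0) (κ := sourceTerm G B φ) hψ.homog
    (by rw [hsg]; exact fun l => (hψ.map_sgn l).trans (one_smul _ _).symm)
    (by rw [zero_add]; exact homog_sourceTerm hBF hφ.homog) (fun q hq => insH_of_unmarked hq)
    (fun z X m => hB.sourceTerm_unit z X m) (by rw [koszul_zero]; exact h₀)
    (by rw [koszul_zero]; exact h₁) (by rw [koszul_zero]; exact hL) hR
  rwa [hsg, one_smul, one_smul] at h

end GQuiver

theorem parts_flatten {A : Type*} (l : List A) : ∀ P ∈ parts l, P.flatten = l := by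
  induction l with
  | nil => simp [parts]
  | cons a l ih =>
    intro P hP
    simp only [parts, List.mem_flatMap] at hP
    obtain ⟨P', hP', hP⟩ := hP
    have := ih _ hP'
    rcases P' with _ | ⟨b, P'⟩
    · simp at hP this; simp [hP, this]
    · simp at hP this
      rcases hP with rfl | rfl <;> simp [this]

theorem bsum_partsBlocks_oneLetter {V V' : Type*} [AddCommGroup V'] {k : List (V × ℤ) → V'}
    (hk : k [] = 0) (l : List (V × ℤ)) :
    bsum (partsBlocks (markedLetter k)) Conv.oneLetter l = k l := by
  rcases l with _ | ⟨a, l⟩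
  · simp [hk, Conv.oneLetter]
  · rw [bsum_partsBlocks_cons, splitSum_eq_right]
    · simp [Conv.oneLetter, markedLetter]
    · intro p q _ hq
      obtain ⟨b, q, rfl⟩ := List.exists_cons_of_ne_nil hq
      rw [bsum_partsBlocks_cons]
      exact splitSum_eq_zero fun _ _ _ => bsum_zero _ _

namespace GQuiver

variable {K : Type uK} [Field K] {Y : Type uY} [AddCommGroup Y] {G : GradingDatum Y}
  {Q : GQuiver.{uK, uY, uO, uH} K Y} {Q' : GQuiver.{uK, uY, uO', uH'} K Y}
  {M : Type*} [AddCommGroup M] [Module K M]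

/-! ### Operations with prescribed representing functions -/

/-- The operation on chains which is the sum of a function of marked words over all cyclic rotations
of a chain. -/
def cyc (G : GradingDatum Y) (f : List (Q.Tot × ℤ) → M) (hf : FML K f) : Q.T →ₗ[K] M :=
  Q.brace G (fun i l => f (l.mapIdx fun j x => (x, if j = i then 1 else 0))) fun i p q => by
    simpa only [List.mapIdx_append, List.mapIdx_cons] using hf _ _ _

theorem rep_cyc (f : List (Q.Tot × ℤ) → M) (hf : FML K f) : Rep G (cyc G f hf) f :=
  rep_brace fun z a m _ _ _ => by
    have h1 : z.mapIdx (fun j x => (x, if j = z.length then (1 : ℤ) else 0)) = unmarked z := by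
      apply List.ext_getElem
      · simp [unmarked]
      · intro i hi _
        have : i ≠ z.length := by simp at hi; omega
        simp [unmarked, this]
    have h2 : m.mapIdx (fun j x => (x, if j + 1 + z.length = z.length then (1 : ℤ) else 0)) =
        unmarked m := by
      apply List.ext_getElem
      · simp [unmarked]
      · intro i hi _
        have : i + 1 + z.length ≠ z.length := by omega
        simp [unmarked]
    simp only [List.mapIdx_append, List.mapIdx_cons, zero_add, if_true, h1, h2]

/-! ### The decomposition into blocks that is given by a functor -/

/-- Properties of the structure maps of strictly unital `A∞` functors. -/
structure IsStrictFunctor (G : GradingDatum Y) (obj : Q.Ob → Q'.Ob) (F : Q.T →ₗ[K] Q'.Tot)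
    (μ : Q.Cochain) (μ' : Q'.Cochain) (e : Q.Ob → Q.Tot) (e' : Q'.Ob → Q'.Tot) : Prop where
  map_one : F 1 = 0
  homog : Homog G obj 0 (hat F)
  map_sgn : ∀ l, hat F (l.map (mapLetter (Q.sgn G))) = Q'.sgn G (hat F l)
  rel : ∀ l, OnPath G l → ((parts (l.map Prod.fst)).map fun P =>
    μ' (word K (P.map fun m => F (word K m)))).sum = insertSum Q G F μ (l.map Prod.fst)
  unit : ∀ X, F (word K [e X]) = e' (obj X)
  unit_zero : ∀ p X q, p ≠ [] ∨ q ≠ [] → F (word K (p ++ e X :: q)) = 0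

/-- The decomposition of words into blocks, with a functor applied to each block. -/
abbrev functorBlocks (F : Q.T →ₗ[K] Q'.Tot) : List (Q.Tot × ℤ) → List (List (Q'.Tot × ℤ)) :=
  partsBlocks (markedLetter (hat F))

variable {obj : Q.Ob → Q'.Ob} {F : Q.T →ₗ[K] Q'.Tot} {μ : Q.Cochain} {μ' : Q'.Cochain}
  {e : Q.Ob → Q.Tot} {e' : Q'.Ob → Q'.Tot}

theorem IsStrictFunctor.bsum_oneLetter (h : IsStrictFunctor G obj F μ μ' e e')
    (l : List (Q.Tot × ℤ)) : bsum (functorBlocks F) Conv.oneLetter l = hat F l :=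
  bsum_partsBlocks_oneLetter h.map_one l

theorem IsStrictFunctor.isFunctorial (h : IsStrictFunctor G obj F μ μ' e e') :
    IsFunctorial G obj (functorBlocks F) where
  toIsMarked := isMarked_partsBlocks (fml_hat F)
  equivar := equivar_partsBlocks fun l => by
    rw [markedLetter, h.map_sgn, cnt_map_mapLetter]; rfl
  isPath l X Z r hl P hP := by
    simp only [partsBlocks, List.mem_map] at hP
    obtain ⟨P, hP, rfl⟩ := hP
    have := parts_flatten l P hP
    subst this
    clear hP
    induction P generalizing X r with
    | nil => cases hl; exact .nil _
    | cons p P ih =>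
      obtain ⟨W, s, t, h1, h2, rfl⟩ := IsPath.of_append (p := p.map Prod.fst) (by simpa using hl)
      exact ((h.homog _ _ _ _ h1).cast (add_zero s)).cons'
        (ih _ _ (by rw [List.map_flatten]; exact h2))
  unmarked l hl P hP := by
    simp only [partsBlocks, List.mem_map] at hP
    obtain ⟨P, hP, rfl⟩ := hP
    intro x hx
    obtain ⟨p, hp, rfl⟩ := List.mem_map.mp hx
    exact Unmarked.cnt fun y hy => hl y (by
      rw [← parts_flatten l P hP]; exact List.mem_flatten.mpr ⟨p, hp, hy⟩)

theorem IsStrictFunctor.rep_pushforward (h : IsStrictFunctor G obj F μ μ' e e') :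
    Rep G (pushforward G F)
      (lead (functorBlocks F) fun l => cnt l • bsum (functorBlocks F) Conv.oneLetter l) := by
  simp only [h.bsum_oneLetter]
  exact GQuiver.rep_pushforward F

theorem bsum_algWord_unit (hu : ∀ X, F (word K [e X]) = e' (obj X))
    (hu₀ : ∀ p X q, p ≠ [] ∨ q ≠ [] → F (word K (p ++ e X :: q)) = 0) (p : List (Q.Tot × ℤ)) (X : Q.Ob) (n : ℤ) (m : List (Q.Tot × ℤ)) :
    bsum (functorBlocks F) (algWord (univLetter K Q'.Tot)) (p ++ (e X, n) :: m) =
      bsum (functorBlocks F) (algWord (univLetter K Q'.Tot)) p *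
        univLetter K Q'.Tot n (e' (obj X)) *
        bsum (functorBlocks F) (algWord (univLetter K Q'.Tot)) m := by
  have hcons (x : Q'.Tot × ℤ) (l : List (Q.Tot × ℤ)) :
      bsum (functorBlocks F) (fun P => algWord (univLetter K Q'.Tot) (x :: P)) l =
        univLetter K Q'.Tot x.2 x.1 * bsum (functorBlocks F) (algWord (univLetter K Q'.Tot)) l := by
    rw [← AddMonoidHom.coe_mulLeft, map_bsum]
    refine bsum_congr fun P _ => ?_
    simp [algWord]
  have hz (p q : List (Q.Tot × ℤ)) (hpq : p ≠ [] ∨ q ≠ []) : hat F (p ++ (e X, n) :: q) = 0 := by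
    simpa [hat] using hu₀ (p.map Prod.fst) X (q.map Prod.fst) (by simpa using hpq)
  have h1 : hat F [(e X, n)] = e' (obj X) := hu X
  have hstep (l : List (Q.Tot × ℤ)) (a : Q.Tot × ℤ) :
      bsum (functorBlocks F) (algWord (univLetter K Q'.Tot)) (a :: l) = splitSum (fun p q =>
        univLetter K Q'.Tot (cnt (a :: p)) (hat F (a :: p)) *
          bsum (functorBlocks F) (algWord (univLetter K Q'.Tot)) q) l := by
    rw [bsum_partsBlocks_cons]
    exact splitSum_congr fun p q _ => hcons _ _
  induction hn : p.length using Nat.strong_induction_on generalizing p with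
  | _ k ih =>
    subst hn
    rcases p with _ | ⟨a, p⟩
    · rw [List.nil_append, hstep, splitSum_eq_left]
      · rw [h1]
        simp [algWord]
      · intro q r _ hq
        rw [show (e X, n) :: q = [] ++ (e X, n) :: q from rfl, hz _ _ (.inr hq), map_zero, zero_mul]
    · rw [List.cons_append, hstep, hstep, splitSum_append_cons, splitSum_eq_zero (l := m), add_zero]
      · have hmul (x : TensorAlgebra K (ℤ →₀ Q'.Tot)) (f : List (Q.Tot × ℤ) → List (Q.Tot × ℤ) →
            TensorAlgebra K (ℤ →₀ Q'.Tot)) (l) :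
            splitSum f l * x = splitSum (fun p q => f p q * x) l :=
          map_splitSum (AddMonoidHom.mulRight x) f l
        rw [hmul, hmul]
        refine splitSum_congr fun q r hqr => ?_
        rw [ih r.length (by simp [← hqr]) r rfl]
        simp only [mul_assoc]
      · intro q r _
        have := hz (a :: (p : List _)) q (.inl (by simp))
        rw [List.cons_append] at this
        rw [this, map_zero, zero_mul]

theorem IsStrictFunctor.isStrictMorphism (h : IsStrictFunctor G obj F μ μ' e e') :
    IsStrictMorphism G obj (functorBlocks F) μ μ' e e' where
  toIsFunctorial := h.isFunctorial
  equivar_unmark := equivar_partsBlocks fun l => by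
    rw [markedLetter, map_unmarkLetter]
    refine Prod.ext ?_ (unmarked_unmarked _).cnt
    simp [hat, map_fst_unmarked]
  rel l hl := by
    have := h.rel l hl
    rw [funext h.bsum_oneLetter, bsum_partsBlocks, insL, insOp]
    rw [parts_map, List.map_map, insertSum, splitSum₃, splitSum_map] at this
    simp only [splitSum_map] at this
    refine Eq.trans ?_ (this.trans ?_)
    · congr 1
      refine List.map_congr_left fun P _ => ?_
      simp [hat, Function.comp_def]
    · simp [splitSum₃, hat, markedLetter, mapLetter, Function.comp_def]
  unit := bsum_algWord_unit h.unit h.unit_zero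

end GQuiver

/-! ### Derivations of coefficients -/

section Derivations

variable {k : Type*} {K : Type*} [Field k] [Field K] [Algebra k K] (v : Derivation k K K)
  {M N : Type*} [AddCommGroup M] [Module K M] [AddCommGroup N] [Module K N] {ι κ : Type*}
  (b : Module.Basis ι K M) (c : Module.Basis κ K N)

theorem coeffDer_smul (a : K) (x : M) :
    coeffDer v b (a • x) = v a • x + a • coeffDer v b x := by
  apply b.repr.injective
  ext i
  simp [coeffDer, mul_comm, add_comm]

@[simp]
theorem coeffDer_basis (i : ι) : coeffDer v b (b i) = 0 := by
  apply b.repr.injective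
  simp [coeffDer]

theorem coeffDer_mem_span {S : Set ι} {x : M} (hx : x ∈ Submodule.span K (b '' S)) :
    coeffDer v b x ∈ Submodule.span K (b '' S) := by
  rw [b.mem_span_image] at hx ⊢
  refine subset_trans ?_ hx
  have : b.repr (coeffDer v b x) = Finsupp.mapRange v (map_zero v) (b.repr x) := by
    simp [coeffDer]
  rw [this]
  exact_mod_cast Finsupp.support_mapRange

/-- An additive map `E` with `E (a • x) = v a • T x + a • E x` is determined by its values on a
basis. -/
theorem eq_of_semilinear {T : M →ₗ[K] N} {E E' : M →+ N}
    (hE : ∀ a x, E (a • x) = v a • T x + a • E x) (hE' : ∀ a x, E' (a • x) = v a • T x + a • E' x)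
    (h : ∀ i, E (b i) = E' (b i)) (x : M) : E x = E' x := by
  induction b.mem_span x using Submodule.span_induction with
  | mem x hx => obtain ⟨i, rfl⟩ := hx; exact h i
  | zero => rw [map_zero, map_zero]
  | add x y _ _ hx hy => rw [map_add, map_add, hx, hy]
  | smul a x _ hx => rw [hE, hE', hx]

theorem coeffDer_apply (T : M →ₗ[K] N) (x : M) :
    coeffDer v c (T x) = matrixDer v b c T x + T (coeffDer v b x) := by
  refine eq_of_semilinear v b (T := T) (E := (coeffDer v c).comp T.toAddMonoidHom)
    (E' := (matrixDer v b c T).toAddMonoidHom + T.toAddMonoidHom.comp (coeffDer v b))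
    (fun a x => ?_) (fun a x => ?_) (fun i => ?_) x
  · simp [coeffDer_smul]
  · simp [coeffDer_smul, smul_add]; abel
  · simp [matrixDer]

end Derivations

namespace HomBases

variable {k : Type*} {K : Type uK} [Field k] [Field K] [Algebra k K] (v : Derivation k K K)
  {Y : Type uY} [AddCommGroup Y] {Q : GQuiver.{uK, uY, uO, uH} K Y} (𝓑 : HomBases Q)

theorem tot_apply (t : Label Q.Ob Y) (i : 𝓑.idx t.src t.tgt t.deg) :
    𝓑.tot ⟨t, i⟩ = Q.inc t.src t.tgt t.deg (𝓑.basis t.src t.tgt t.deg i) := by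
  simp [tot, DFinsupp.basis, GQuiver.inc]
  rfl

theorem words_apply (w : FreeMonoid (Σ l : Label Q.Ob Y, 𝓑.idx l.src l.tgt l.deg)) :
    𝓑.words w = word K (w.toList.map 𝓑.tot) := by
  rw [words, Module.Basis.tensorAlgebra, Module.Basis.map_apply]
  have h : FreeAlgebra.basisFreeMonoid K _ w =
      (w.toList.map (FreeAlgebra.ι K)).prod := by
    have h' : FreeAlgebra.basisFreeMonoid K _ w =
      FreeAlgebra.equivMonoidAlgebraFreeMonoid.symm (MonoidAlgebra.single w (1 : K)) := by
      simp [FreeAlgebra.basisFreeMonoid]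
    rw [h']
    refine (MonoidAlgebra.lift_single _ w (1 : K)).trans ?_
    rw [one_smul, FreeMonoid.lift_apply]
  rw [h, AlgEquiv.toLinearEquiv_apply, map_list_prod, List.map_map, word, List.map_map]
  congr 2
  ext x
  simp

theorem coeffDer_inc (X Z : Q.Ob) (y : Y) (a : Q.Hom X Z y) :
    coeffDer v 𝓑.tot (Q.inc X Z y a) = Q.inc X Z y (coeffDer v (𝓑.basis X Z y) a) := by
  refine eq_of_semilinear v (𝓑.basis X Z y) (T := Q.inc X Z y)
    (E := (coeffDer v 𝓑.tot).comp (Q.inc X Z y).toAddMonoidHom)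
    (E' := (Q.inc X Z y).toAddMonoidHom.comp (coeffDer v (𝓑.basis X Z y)))
    (fun a x => ?_) (fun a x => ?_) (fun i => ?_) a
  · simp [coeffDer_smul]
  · simp [coeffDer_smul]
  · simp [← 𝓑.tot_apply ⟨X, Z, y⟩ i]

theorem coeffDer_mul (x y : Q.T) : coeffDer v 𝓑.words (x * y) =
    coeffDer v 𝓑.words x * y + x * coeffDer v 𝓑.words y := by
  have h (i) (y : Q.T) : coeffDer v 𝓑.words (𝓑.words i * y) =
      𝓑.words i * coeffDer v 𝓑.words y := by
    refine eq_of_semilinear v 𝓑.words (T := LinearMap.mulLeft K (𝓑.words i))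
      (E := (coeffDer v 𝓑.words).comp (AddMonoidHom.mulLeft (𝓑.words i)))
      (E' := (AddMonoidHom.mulLeft (𝓑.words i)).comp (coeffDer v 𝓑.words))
      (fun a x => ?_) (fun a x => ?_) (fun j => ?_) y
    · simp [coeffDer_smul]
    · simp [coeffDer_smul, mul_add]
    · have : 𝓑.words i * 𝓑.words j = 𝓑.words (i * j) := by
        simp [words_apply, word]
      simp [this]
  refine eq_of_semilinear v 𝓑.words (T := LinearMap.mulRight K y)
    (E := (coeffDer v 𝓑.words).comp (AddMonoidHom.mulRight y))
    (E' := (AddMonoidHom.mulRight y).comp (coeffDer v 𝓑.words) +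
      AddMonoidHom.mulRight (coeffDer v 𝓑.words y))
    (fun a x => ?_) (fun a x => ?_) (fun j => ?_) x
  · simp [coeffDer_smul]
  · simp [coeffDer_smul, add_mul]; abel
  · simp [h]

theorem coeffDer_ι (x : Q.Tot) :
    coeffDer v 𝓑.words (TensorAlgebra.ι K x) = TensorAlgebra.ι K (coeffDer v 𝓑.tot x) := by
  refine eq_of_semilinear v 𝓑.tot (T := TensorAlgebra.ι K)
    (E := (coeffDer v 𝓑.words).comp (TensorAlgebra.ι K).toAddMonoidHom)
    (E' := (TensorAlgebra.ι K).toAddMonoidHom.comp (coeffDer v 𝓑.tot))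
    (fun a x => ?_) (fun a x => ?_) (fun i => ?_) x
  · simp [coeffDer_smul]
  · simp [coeffDer_smul]
  · have : TensorAlgebra.ι K (𝓑.tot i) = 𝓑.words (FreeMonoid.of i) := by
      simp [words_apply, word]
    simp [this]

theorem coeffDer_word_cons (x : Q.Tot) (l : List Q.Tot) : coeffDer v 𝓑.words (word K (x :: l)) =
    word K (coeffDer v 𝓑.tot x :: l) + TensorAlgebra.ι K x * coeffDer v 𝓑.words (word K l) := by
  rw [word, List.map_cons, List.prod_cons, coeffDer_mul, coeffDer_ι]
  rfl

theorem coeffDer_word_of_const {l : List Q.Tot} (hl : ∀ x ∈ l, coeffDer v 𝓑.tot x = 0) :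
    coeffDer v 𝓑.words (word K l) = 0 := by
  induction l with
  | nil =>
    have : word K ([] : List Q.Tot) = 𝓑.words 1 := by rw [words_apply]; rfl
    rw [this, coeffDer_basis]
  | cons x l ih =>
    rw [coeffDer_word_cons, hl x (by simp), ih fun y hy => hl y (by simp [hy]), mul_zero, add_zero]
    simp [word]

theorem coeffDer_word_insert {p r : List Q.Tot} (hp : ∀ x ∈ p, coeffDer v 𝓑.tot x = 0)
    (hr : ∀ x ∈ r, coeffDer v 𝓑.tot x = 0) (x : Q.Tot) :
    coeffDer v 𝓑.words (word K (p ++ x :: r)) = word K (p ++ coeffDer v 𝓑.tot x :: r) := by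
  induction p with
  | nil => rw [List.nil_append, coeffDer_word_cons, coeffDer_word_of_const v 𝓑 hr, mul_zero,
      add_zero]; rfl
  | cons y p ih =>
    rw [List.cons_append, coeffDer_word_cons, ih fun y hy => hp y (by simp [hy]), hp y (by simp)]
    simp [word]

end HomBases

namespace GQuiver

variable {K : Type uK} [Field K] {Y : Type uY} [AddCommGroup Y] {G : GradingDatum Y}
  {Q : GQuiver.{uK, uY, uO, uH} K Y} {Q' : GQuiver.{uK, uY, uO', uH'} K Y}
  {M : Type*} [AddCommGroup M] [Module K M]

/-! ### Words with prescribed labels -/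

/-- Homogeneous morphisms with a given source, target and degree. -/
def IsLetter (t : Label Q.Ob Y) (x : Q.Tot) : Prop := ∃ a, x = Q.inc t.src t.tgt t.deg a

/-- Words of homogeneous morphisms with given sources, targets and degrees. -/
abbrev Labelled (L : List (Label Q.Ob Y)) (l : List Q.Tot) : Prop := List.Forall₂ IsLetter L l

/-- Composability of a sequence of labels. -/
abbrev Composable (L : List (Label Q.Ob Y)) : Prop := L.IsChain fun s t => s.tgt = t.src

theorem _root_.IsML.eq_zero_of_labelled {f : List Q.Tot → M} (hf : IsML K f) (𝓑 : HomBases Q)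
    {L : List (Label Q.Ob Y)}
    (h : ∀ l, Labelled L l → (∀ x ∈ l, x ∈ Set.range 𝓑.tot) → f l = 0) {l : List Q.Tot}
    (hl : Labelled L l) : f l = 0 := by
  suffices H : ∀ (L₂ : List (Label Q.Ob Y)) (q : List Q.Tot), Labelled L₂ q →
      ∀ (L₁ : List (Label Q.Ob Y)) (p : List Q.Tot), Labelled L₁ p →
      (∀ x ∈ p, x ∈ Set.range 𝓑.tot) → L₁ ++ L₂ = L → f (p ++ q) = 0 from
    H L l hl [] [] .nil (by simp) rfl
  intro L₂ q hq
  induction hq with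
  | nil =>
    rintro L₁ p hp hb rfl
    rw [List.append_nil] at h ⊢
    exact h p hp hb
  | @cons t x L₂ q hx _ ih =>
    rintro L₁ p hp hb rfl
    obtain ⟨a, rfl⟩ := hx
    have : (hf p q).mk' _ ∘ₗ Q.inc t.src t.tgt t.deg = 0 := by
      refine (𝓑.basis t.src t.tgt t.deg).ext fun i => ?_
      have := ih (L₁ ++ [t]) (p ++ [Q.inc t.src t.tgt t.deg (𝓑.basis t.src t.tgt t.deg i)])
        (List.rel_append hp (.cons ⟨_, rfl⟩ .nil)) (by
          intro y hy
          rcases List.mem_append.mp hy with hy | hy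
          · exact hb y hy
          · rw [List.mem_singleton.mp hy, ← 𝓑.tot_apply]; exact ⟨_, rfl⟩) (by simp)
      simpa using this
    exact LinearMap.congr_fun this a

theorem _root_.IsML.eq_zero_of_forall_labelled {f : List Q.Tot → M} (hf : IsML K f)
    (h : ∀ L l, Labelled L l → f l = 0) (l : List Q.Tot) : f l = 0 := by
  suffices H : ∀ (q : List Q.Tot) (L : List (Label Q.Ob Y)) (p : List Q.Tot), Labelled L p →
      f (p ++ q) = 0 from H l [] [] .nil
  intro q
  induction q with
  | nil => intro L p hp; rw [List.append_nil]; exact h L p hp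
  | cons x q ih =>
    intro L p hp
    induction x using DirectSum.induction_on with
    | zero => exact (hf p q).map_zero
    | of t a =>
      have := ih (L ++ [t]) (p ++ [Q.inc t.src t.tgt t.deg a])
        (List.rel_append hp (.cons ⟨a, rfl⟩ .nil))
      rwa [List.append_assoc] at this
    | add x y hx hy => rw [(hf p q).map_add, hx, hy, add_zero]

theorem IsPath.exists_labels {X Z : Q.Ob} {r : Y} {l : List Q.Tot} (h : Q.IsPath G X Z r l) :
    ∃ L, Labelled L l ∧ ∀ l', Labelled L l' → Q.IsPath G X Z r l' := by
  induction h with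
  | nil X => exact ⟨[], .nil, fun l' hl' => by cases hl'; exact .nil X⟩
  | @cons X W Z d r l a h ih =>
    obtain ⟨L, hL, hL'⟩ := ih
    refine ⟨⟨X, W, d⟩ :: L, .cons ⟨a, rfl⟩ hL, fun l' hl' => ?_⟩
    cases hl' with
    | cons hx hl' =>
      obtain ⟨a', rfl⟩ := hx
      exact .cons a' (hL' _ hl')

/-- A multilinear function on paths with values in a submodule for words in basis elements has
values in this submodule. -/
theorem _root_.IsML.mem_of_isPath {f : List Q.Tot → M} (hf : IsML K f) (𝓑 : HomBases Q)
    {N : Submodule K M} {X Z : Q.Ob} {r : Y}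
    (h : ∀ l, Q.IsPath G X Z r l → (∀ x ∈ l, x ∈ Set.range 𝓑.tot) → f l ∈ N) {l : List Q.Tot}
    (hl : Q.IsPath G X Z r l) : f l ∈ N := by
  obtain ⟨L, hL, hL'⟩ := hl.exists_labels
  rw [← Submodule.Quotient.mk_eq_zero, ← Submodule.mkQ_apply]
  exact (hf.lcomp N.mkQ).eq_zero_of_labelled 𝓑 (fun l' h' hb => by
    rw [Submodule.mkQ_apply, Submodule.Quotient.mk_eq_zero]
    exact h l' (hL' l' h') hb) hL

theorem _root_.IsML.eq_zero_of_isPath {f : List Q.Tot → M} (hf : IsML K f) (𝓑 : HomBases Q)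
    {X Z : Q.Ob} {r : Y}
    (h : ∀ l, Q.IsPath G X Z r l → (∀ x ∈ l, x ∈ Set.range 𝓑.tot) → f l = 0) {l : List Q.Tot}
    (hl : Q.IsPath G X Z r l) : f l = 0 :=
  (Submodule.mem_bot K).mp (hf.mem_of_isPath 𝓑 (fun l h' hb => (Submodule.mem_bot K).mpr (h l h' hb))
    hl)

theorem Composable.exists_isPath {t : Label Q.Ob Y} {L : List (Label Q.Ob Y)}
    (hL : Composable (t :: L)) {l : List Q.Tot} (hl : Labelled (t :: L) l) :
    ∃ Z r, Q.IsPath G t.src Z r l := by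
  induction L generalizing t l with
  | nil =>
    obtain _ | ⟨⟨a, rfl⟩, hl⟩ := hl
    cases hl
    exact ⟨t.tgt, _, IsPath.single _ _ _ a⟩
  | cons s L ih =>
    obtain _ | ⟨⟨a, rfl⟩, hl⟩ := hl
    obtain ⟨h1, h2⟩ := List.isChain_cons_cons.mp hL
    obtain ⟨Z, r, h⟩ := ih h2 hl
    rw [← h1] at h
    exact ⟨Z, _, .cons a h⟩

theorem exists_of_not_composable {L : List (Label Q.Ob Y)} (hL : ¬ Composable L) {l : List Q.Tot}
    (hl : Labelled L l) : ∃ (p q : List Q.Tot) (s t : Label Q.Ob Y) (a : Q.Hom s.src s.tgt s.deg)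
      (b : Q.Hom t.src t.tgt t.deg), s.tgt ≠ t.src ∧
      l = p ++ Q.inc s.src s.tgt s.deg a :: Q.inc t.src t.tgt t.deg b :: q := by
  induction L generalizing l with
  | nil => exact absurd List.IsChain.nil hL
  | cons s L ih =>
    obtain _ | ⟨hx, hl⟩ := hl
    by_cases h : Composable L
    · match L, hl with
      | [], _ => exact absurd (List.IsChain.singleton s) hL
      | t :: L, .cons ⟨b, hb⟩ hl =>
        obtain ⟨a, rfl⟩ := hx
        subst hb
        exact ⟨[], _, s, t, a, b, fun h' => hL (List.isChain_cons_cons.mpr ⟨h', h⟩), rfl⟩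
    · obtain ⟨p, q, s, t, a, b, hst, rfl⟩ := ih h hl
      exact ⟨_ :: p, q, s, t, a, b, hst, rfl⟩

/-! ### Homogeneous operations -/

theorem isPath_singleton_iff {X Z : Q.Ob} {r : Y} {x : Q.Tot} :
    Q.IsPath G X Z r [x] ↔ x ∈ LinearMap.range (Q.inc X Z (r + G.fromInt 1)) := by
  refine ⟨fun h => ?_, ?_⟩
  · obtain ⟨a, rfl⟩ := h.exists_of_single
    exact ⟨a, rfl⟩
  · rintro ⟨a, rfl⟩
    exact (IsPath.single _ _ _ a).cast (by abel)

/-- Families of multilinear operations that shift the total reduced degree by `c` and vanish on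
words which are not composable. -/
structure IsOperation (G : GradingDatum Y) (obj : Q.Ob → Q'.Ob) (c : Y) (T : Q.T →ₗ[K] Q'.Tot) :
    Prop where
  map_one : T 1 = 0
  homog : Homog G obj c (hat T)
  not_composable : ∀ (p q : List Q.Tot) (s t : Label Q.Ob Y) (a : Q.Hom s.src s.tgt s.deg)
    (b : Q.Hom t.src t.tgt t.deg), s.tgt ≠ t.src →
      T (word K (p ++ Q.inc s.src s.tgt s.deg a :: Q.inc t.src t.tgt t.deg b :: q)) = 0

variable {obj : Q.Ob → Q'.Ob} {c : Y} {T : Q.T →ₗ[K] Q'.Tot}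

theorem IsOperation.isPath (hT : IsOperation G obj c T) {X Z : Q.Ob} {r : Y} {l : List Q.Tot}
    (h : Q.IsPath G X Z r l) : Q'.IsPath G (obj X) (obj Z) (r + c) [T (word K l)] := by
  have := hT.homog X Z r (unmarked l) (by rwa [map_fst_unmarked])
  rwa [hat, map_fst_unmarked] at this

theorem IsOperation.map_sgn (hT : IsOperation G obj c T) (l : List (Q.Tot × ℤ)) :
    hat T (l.map (mapLetter (Q.sgn G))) = G.sg c • Q'.sgn G (hat T l) := by
  have hf : IsML K fun l : List Q.Tot => T (word K (l.map (Q.sgn G))) +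
      (-(G.sg c • Q'.sgn G) : Q'.Tot →ₗ[K] Q'.Tot) (T (word K l)) :=
    ((IsML.word.map (Q.sgn G)).lcomp T).add ((IsML.word.lcomp T).lcomp _)
  have := hf.eq_zero_of_forall_labelled (fun L l hl => ?_) (l.map Prod.fst)
  · rw [hat, map_fst_mapLetter, ← sub_eq_zero, sub_eq_add_neg]
    exact this
  by_cases hL : Composable L
  · match L, hl with
    | [], .nil =>
      have : T (word K []) = 0 := hT.map_one
      rw [List.map_nil, this, map_zero, add_zero]
    | t :: L, hl =>
      obtain ⟨Z, r, h⟩ := hL.exists_isPath (G := G) hl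
      have h1 := (hT.isPath h).sgn_single
      rw [h.word_map_sgn, map_zsmul, LinearMap.neg_apply, LinearMap.smul_apply, h1, smul_smul,
        G.sg_add, mul_comm (G.sg r), ← mul_assoc, G.sg_mul_self, one_mul, add_neg_cancel]
  · obtain ⟨p, q, s, t, a, b, hst, rfl⟩ := exists_of_not_composable hL hl
    rw [hT.not_composable _ _ _ _ _ _ hst, map_zero, add_zero]
    have := hT.not_composable (p.map (Q.sgn G)) (q.map (Q.sgn G)) s t (G.sg (s.deg - G.fromInt 1) • a)
      (G.sg (t.deg - G.fromInt 1) • b) hst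
    simpa [sgn_inc] using this

variable {k : Type*} [Field k] [Algebra k K] (v : Derivation k K K) (𝓑 : HomBases Q)
  (𝓑' : HomBases Q')

theorem coeffDer_of_mem_range {x : Q.Tot} (hx : x ∈ Set.range 𝓑.tot) : coeffDer v 𝓑.tot x = 0 := by
  obtain ⟨i, rfl⟩ := hx
  exact coeffDer_basis v _ i

theorem coeffDer_of_const (T : Q.T →ₗ[K] Q'.Tot) {l : List Q.Tot}
    (hl : ∀ x ∈ l, coeffDer v 𝓑.tot x = 0) :
    coeffDer v 𝓑'.tot (T (word K l)) = matrixDer v 𝓑.words 𝓑'.tot T (word K l) := by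
  rw [coeffDer_apply v 𝓑.words, 𝓑.coeffDer_word_of_const v hl, map_zero, add_zero]

theorem IsPath.coeffDer_single {X Z : Q.Ob} {r : Y} {x : Q.Tot} (h : Q.IsPath G X Z r [x]) :
    Q.IsPath G X Z r [coeffDer v 𝓑.tot x] := by
  obtain ⟨a, rfl⟩ := h.exists_of_single
  rw [𝓑.coeffDer_inc]
  exact (IsPath.single _ _ _ _).cast (by abel)

theorem IsOperation.matrixDer (hT : IsOperation G obj c T) :
    IsOperation G obj c (matrixDer v 𝓑.words 𝓑'.tot T) where
  map_one := by
    have := coeffDer_of_const v 𝓑 𝓑' T (l := []) (by simp)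
    rw [show word K ([] : List Q.Tot) = 1 from rfl, hT.map_one, map_zero] at this
    exact this.symm
  homog X Z r l hl := by
    rw [isPath_singleton_iff]
    refine (IsML.word.lcomp (_root_.matrixDer v 𝓑.words 𝓑'.tot T)).mem_of_isPath 𝓑
      (fun l hl hb => ?_) hl
    rw [← coeffDer_of_const v 𝓑 𝓑' T fun x hx => coeffDer_of_mem_range v 𝓑 (hb x hx),
      ← isPath_singleton_iff]
    exact (hT.isPath hl).coeffDer_single v 𝓑'
  not_composable p q s t a b hst := by
    have hf : IsML K fun l => _root_.matrixDer v 𝓑.words 𝓑'.tot T (word K l) :=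
      IsML.word.lcomp (_root_.matrixDer v 𝓑.words 𝓑'.tot T)
    refine (hf.append_right (Q.inc s.src s.tgt s.deg a :: Q.inc t.src t.tgt t.deg b ::
      q)).eq_zero_of_forall_labelled (fun L₁ p hp => ?_) p
    refine (((hf.append_left p).cons (Q.inc s.src s.tgt s.deg a)).cons
      (Q.inc t.src t.tgt t.deg b)).eq_zero_of_forall_labelled (fun L₂ q hq => ?_) q
    refine hf.eq_zero_of_labelled 𝓑 (L := L₁ ++ s :: t :: L₂) (fun l hl hb => ?_)
      (List.rel_append hp (.cons ⟨a, rfl⟩ (.cons ⟨b, rfl⟩ hq)))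
    have hc : ¬ Composable (L₁ ++ s :: t :: L₂) := fun h =>
      hst (List.isChain_cons_cons.mp (List.isChain_split.mp h).2).1
    rw [← coeffDer_of_const v 𝓑 𝓑' T fun x hx => coeffDer_of_mem_range v 𝓑 (hb x hx)]
    obtain ⟨p', q', s', t', a', b', hst', rfl⟩ := exists_of_not_composable hc hl
    rw [hT.not_composable _ _ _ _ _ _ hst', map_zero]

end GQuiver

/-- There is a choice of bases. -/
def HomBases.some {K : Type uK} [Field K] {Y : Type uY} (Q : GQuiver.{uK, uY, uO, uH} K Y) :
    HomBases Q where
  idx X Z y := Module.Basis.ofVectorSpaceIndex K (Q.Hom X Z y)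
  basis X Z y := Module.Basis.ofVectorSpace K (Q.Hom X Z y)

namespace GQuiver

variable {K : Type uK} [Field K] {Y : Type uY} [AddCommGroup Y] {G : GradingDatum Y}
  {Q : GQuiver.{uK, uY, uO, uH} K Y} {Q' : GQuiver.{uK, uY, uO', uH'} K Y}
  {M : Type*} [AddCommGroup M] [Module K M]

/-! ### Adjoining units -/

theorem ofPlus_inc (X Z : Q.Ob) (y : Y) (a : Q.plus.Hom X Z y) :
    Q.ofPlus (Q.plus.inc X Z y a) = Q.inc X Z y a.1 :=
  DirectSum.lmap_lof _ _ _

theorem toPlus_inc (X Z : Q.Ob) (y : Y) (a : Q.Hom X Z y) :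
    Q.toPlus (Q.inc X Z y a) = Q.plus.inc X Z y (a, 0) :=
  DirectSum.lmap_lof _ _ _

theorem ofPlus_toPlus (x : Q.Tot) : Q.ofPlus (Q.toPlus x) = x := by
  induction x using DirectSum.induction_on with
  | zero => simp
  | of t a => exact (congrArg Q.ofPlus (toPlus_inc _ _ _ a)).trans (ofPlus_inc _ _ _ _)
  | add x y hx hy => rw [map_add, map_add, hx, hy]

@[simp]
theorem ofPlus_ePlus (X : Q.Ob) : Q.ofPlus (Q.ePlus X) = 0 := by
  rw [ePlus, ofPlus_inc, map_zero]

theorem ePlusCoeff_inc (X Z : Q.Ob) (y : Y) (a : Q.plus.Hom X Z y) :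
    Q.ePlusCoeff (Q.plus.inc X Z y a) =
      Finsupp.single X (Finsupp.linearCombination K (fun _ => (1 : K)) a.2) := by
  unfold ePlusCoeff inc
  rw [DirectSum.toModule_lof]
  rfl

theorem ePlusCoeff_ePlus (X : Q.Ob) : Q.ePlusCoeff (Q.ePlus X) = Finsupp.single X 1 := by
  rw [ePlus, ePlusCoeff_inc]
  simp

theorem ePlusCoeff_toPlus (x : Q.Tot) : Q.ePlusCoeff (Q.toPlus x) = 0 := by
  induction x using DirectSum.induction_on with
  | zero => simp
  | of t a =>
    refine (congrArg Q.ePlusCoeff (toPlus_inc _ _ _ a)).trans ?_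
    rw [ePlusCoeff_inc]
    simp
  | add x y hx hy => rw [map_add, map_add, hx, hy, add_zero]

theorem toPlus_sgn (x : Q.Tot) : Q.toPlus (Q.sgn G x) = Q.plus.sgn G (Q.toPlus x) := by
  induction x using DirectSum.induction_on with
  | zero => simp
  | of t a =>
    have h1 := sgn_inc (G := G) (Q := Q) t.src t.tgt t.deg a
    have h2 := sgn_inc (G := G) (Q := Q.plus) t.src t.tgt t.deg (a, 0)
    change Q.toPlus (Q.sgn G (Q.inc t.src t.tgt t.deg a)) =
      Q.plus.sgn G (Q.toPlus (Q.inc t.src t.tgt t.deg a))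
    rw [h1, map_zsmul, toPlus_inc, h2]
  | add x y hx hy => simp only [map_add, hx, hy]

open Classical in
theorem srcPart_inc (W X Z : Q.Ob) (y : Y) (a : Q.Hom X Z y) :
    Q.srcPart W (Q.inc X Z y a) = if X = W then Q.inc X Z y a else 0 := by
  refine (DirectSum.lmap_lof _ _ _).trans ?_
  dsimp only
  split_ifs <;> simp [inc]

open Classical in
theorem tgtPart_inc (W X Z : Q.Ob) (y : Y) (a : Q.Hom X Z y) :
    Q.tgtPart W (Q.inc X Z y a) = if Z = W then Q.inc X Z y a else 0 := by
  refine (DirectSum.lmap_lof _ _ _).trans ?_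
  dsimp only
  split_ifs <;> simp [inc]

theorem wordsOfPlus_word (l : List Q.plus.Tot) :
    Q.wordsOfPlus (word K l) = word K (l.map Q.ofPlus) := by
  rw [word, map_list_prod, word, List.map_map, List.map_map]
  congr 1
  refine List.map_congr_left fun x _ => ?_
  simp [wordsOfPlus]

theorem μPlus_word (μ : Q.Cochain) (l : List Q.plus.Tot) : μPlus G μ (word K l) =
    Q.toPlus (μ (word K (l.map Q.ofPlus))) + onTwo (fun a b => Q.unitProduct G a b) l := by
  rw [μPlus, LinearMap.add_apply, linExt_word, LinearMap.comp_apply, LinearMap.comp_apply,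
    AlgHom.toLinearMap_apply, wordsOfPlus_word]

theorem FPlus_word (obj : Q.Ob → Q'.Ob) (F : Q.T →ₗ[K] Q'.Tot) (l : List Q.plus.Tot) :
    FPlus obj F (word K l) = Q'.toPlus (F (word K (l.map Q.ofPlus))) +
      onOne (Finsupp.linearCombination K (fun X : Q.Ob => Q'.ePlus (obj X)) ∘ₗ Q.ePlusCoeff) l := by
  rw [FPlus, LinearMap.add_apply, linExt_word, LinearMap.comp_apply, LinearMap.comp_apply,
    AlgHom.toLinearMap_apply, wordsOfPlus_word]

theorem word_eq_zero {p q : List Q.Tot} : word K (p ++ 0 :: q) = 0 :=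
  (IsML.word (K := K) p q).map_zero

theorem isPath_ePlus (X : Q.Ob) : Q.plus.IsPath G X X (-G.fromInt 1) [Q.ePlus X] :=
  (IsPath.single (Q := Q.plus) X X 0 _).cast (zero_sub _)

theorem ePlus_ne_zero (X : Q.Ob) : Q.ePlus X ≠ 0 := fun h => by
  have := ePlusCoeff_ePlus X
  rw [h, map_zero] at this
  exact one_ne_zero (Finsupp.single_eq_zero.mp this.symm)

theorem inc_ne_zero_unique {s t : Label Q.Ob Y} {a : Q.Hom s.src s.tgt s.deg}
    {b : Q.Hom t.src t.tgt t.deg} (h : Q.inc s.src s.tgt s.deg a = Q.inc t.src t.tgt t.deg b)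
    (ha : Q.inc s.src s.tgt s.deg a ≠ 0) : s = t := by
  by_contra hst
  refine ha ?_
  have h1 := congrArg (fun x : Q.Tot => x s) h
  have h2 : (Q.inc t.src t.tgt t.deg b) s = 0 := DirectSum.of_eq_of_ne _ _ _ hst
  have h3 : (Q.inc s.src s.tgt s.deg a) s = a := DirectSum.of_eq_same _ _
  dsimp only at h1
  rw [h2, h3] at h1
  rw [h1, map_zero]

theorem isPath_ePlus_iff {W X Z : Q.Ob} {r : Y} (h : Q.plus.IsPath G W Z r [Q.ePlus X]) :
    W = X ∧ Z = X ∧ r = -G.fromInt 1 := by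
  obtain ⟨a, ha⟩ := h.exists_of_single
  have := inc_ne_zero_unique (Q := Q.plus) (s := ⟨X, X, 0⟩) (t := ⟨W, Z, r + G.fromInt 1⟩) ha
    (ePlus_ne_zero X)
  simp only [Label.mk.injEq] at this
  exact ⟨this.1.symm, this.2.1.symm, eq_neg_of_add_eq_zero_left this.2.2.symm⟩

theorem sgn_ePlus (X : Q.Ob) : Q.plus.sgn G (Q.ePlus X) = -Q.ePlus X := by
  have h : G.sg (-G.fromInt 1) = -1 := by
    have := G.sg_add (-G.fromInt 1) (G.fromInt 1)
    rw [neg_add_cancel, G.sg_zero, G.sg_fromInt_one] at this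
    omega
  rw [(isPath_ePlus (G := G) X).sgn_single, h, neg_smul, one_smul]

/-- Decomposition of the letters of a path in the quiver with adjoined units. -/
theorem exists_eq_toPlus_add {X Z : Q.Ob} {y : Y} (a : Q.plus.Hom X Z y) :
    Q.plus.inc X Z y a = Q.toPlus (Q.inc X Z y a.1) ∨ (X = Z ∧ y = 0 ∧
      ∃ c : K, Q.plus.inc X Z y a = Q.toPlus (Q.inc X Z y a.1) + c • Q.ePlus X) := by
  rw [toPlus_inc]
  by_cases h : X = Z ∧ y = 0
  · obtain ⟨rfl, rfl⟩ := h
    refine .inr ⟨rfl, rfl, a.2 ⟨⟨rfl, rfl⟩⟩, ?_⟩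
    rw [ePlus, ← map_smul, ← map_add]
    congr 1
    refine Prod.ext ?_ (Finsupp.ext fun i => ?_)
    · simp
    · obtain ⟨⟨_, _⟩⟩ := i
      simp
  · left
    congr 1
    refine Prod.ext rfl (Finsupp.ext fun i => absurd i.down h)

theorem isPath_map_ofPlus {X Z : Q.plus.Ob} {r : Y} {l : List Q.plus.Tot}
    (h : Q.plus.IsPath G X Z r l) : Q.IsPath G X Z r (l.map Q.ofPlus) := by
  induction h with
  | nil X => exact IsPath.nil (Q := Q) X
  | cons a _ ih => rw [List.map_cons, ofPlus_inc]; exact IsPath.cons (Q := Q) _ ih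

theorem isPath_map_toPlus {X Z : Q.Ob} {r : Y} {l : List Q.Tot}
    (h : Q.IsPath G X Z r l) : Q.plus.IsPath G X Z r (l.map Q.toPlus) := by
  induction h with
  | nil X => exact IsPath.nil (Q := Q.plus) X
  | cons a _ ih => rw [List.map_cons, toPlus_inc]; exact IsPath.cons (Q := Q.plus) _ ih

theorem _root_.HomBases.plus_basis_inl (𝓑 : HomBases Q) (X Z : Q.Ob) (y : Y) (i : 𝓑.idx X Z y) :
    𝓑.plus.basis X Z y ⟨.inl i⟩ = (𝓑.basis X Z y i, 0) := by
  refine (Module.Basis.reindex_apply _ _ _).trans (Prod.ext ?_ ?_)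
  · exact Module.Basis.prod_apply_inl_fst _ _ i
  · exact Module.Basis.prod_apply_inl_snd _ _ i

theorem _root_.HomBases.plus_basis_inr (𝓑 : HomBases Q) (X Z : Q.Ob) (y : Y)
    (h : PLift (X = Z ∧ y = 0)) :
    𝓑.plus.basis X Z y ⟨.inr h⟩ = (0, Finsupp.single h 1) := by
  refine (Module.Basis.reindex_apply _ _ _).trans (Prod.ext ?_ ?_)
  · exact Module.Basis.prod_apply_inr_fst _ _ h
  · refine (Module.Basis.prod_apply_inr_snd _ _ h).trans ?_
    exact congrFun Finsupp.coe_basisSingleOne h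

theorem mem_range_plus_tot (𝓑 : HomBases Q) {x : Q.plus.Tot} (hx : x ∈ Set.range 𝓑.plus.tot) :
    (∃ i, x = Q.toPlus (𝓑.tot i)) ∨ ∃ X, x = Q.ePlus X := by
  obtain ⟨⟨t, i⟩, rfl⟩ := hx
  rw [HomBases.tot_apply]
  rcases i with ⟨i | ⟨h⟩⟩
  · refine .inl ⟨⟨t, i⟩, ?_⟩
    rw [HomBases.tot_apply, toPlus_inc]
    exact congrArg _ (𝓑.plus_basis_inl _ _ _ i)
  · obtain ⟨X, Z, y⟩ := t
    dsimp only at h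
    obtain ⟨h₁, h₂⟩ := h
    subst h₁ h₂
    refine .inr ⟨X, ?_⟩
    exact congrArg _ (𝓑.plus_basis_inr X X 0 _)

theorem toPlus_or_ePlus (𝓑 : HomBases Q) {l : List Q.plus.Tot}
    (hl : ∀ x ∈ l, x ∈ Set.range 𝓑.plus.tot) :
    (l.map Q.ofPlus).map Q.toPlus = l ∨ ∃ p X q, l = p ++ Q.ePlus X :: q := by
  by_cases h : ∃ X, Q.ePlus X ∈ l
  · obtain ⟨X, hX⟩ := h
    obtain ⟨p, q, rfl⟩ := List.append_of_mem hX
    exact .inr ⟨p, X, q, rfl⟩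
  · left
    rw [List.map_map]
    conv_rhs => rw [← List.map_id l]
    refine List.map_congr_left fun x hx => ?_
    rcases mem_range_plus_tot 𝓑 (hl x hx) with ⟨i, rfl⟩ | ⟨X, rfl⟩
    · simp [ofPlus_toPlus]
    · exact absurd ⟨X, hx⟩ h

/-! ### The structure maps on words with units -/

theorem unitProduct_apply (a b : Q.plus.Tot) : Q.unitProduct G a b =
    Finsupp.linearCombination K (fun X : Q.Ob => Q.plus.srcPart X) (Q.ePlusCoeff a) b +
    Finsupp.linearCombination K
      (fun X : Q.Ob => -(Q.plus.sgn G ∘ₗ Q.toPlus ∘ₗ Q.ofPlus ∘ₗ Q.plus.tgtPart X))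
        (Q.ePlusCoeff b) a := rfl

theorem onTwo_of_length {A : Type*} {f : A → A → M} {l : List A} (hl : l.length ≠ 2) :
    onTwo f l = 0 := by
  match l, hl with
  | [], _ => rfl
  | [_], _ => rfl
  | _ :: _ :: _ :: _, _ => rfl

theorem onOne_of_length {A : Type*} {f : A → M} {l : List A} (hl : l.length ≠ 1) :
    onOne f l = 0 := by
  match l, hl with
  | [], _ => rfl
  | _ :: _ :: _, _ => rfl

theorem μPlus_unit_left (μ : Q.Cochain) {X Z : Q.Ob} {r : Y} {a : Q.plus.Tot}
    (ha : Q.plus.IsPath G X Z r [a]) : μPlus G μ (word K [Q.ePlus X, a]) = a := by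
  obtain ⟨a, rfl⟩ := ha.exists_of_single
  have h1 : word K [(0 : Q.Tot), Q.ofPlus (Q.plus.inc X Z (r + G.fromInt 1) a)] = 0 :=
    word_eq_zero (p := [])
  have h2 (W : Q.Ob) : Q.ofPlus (Q.plus.tgtPart W (Q.ePlus X)) = 0 := by
    rw [ePlus, tgtPart_inc]
    split_ifs
    · exact ofPlus_ePlus X
    · exact map_zero _
  rw [μPlus_word, List.map_cons, List.map_singleton, ofPlus_ePlus, h1, map_zero, map_zero, zero_add,
    onTwo, unitProduct_apply, ePlusCoeff_ePlus, Finsupp.linearCombination_single, one_smul,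
    srcPart_inc, if_pos rfl, ePlusCoeff_inc, Finsupp.linearCombination_single, LinearMap.smul_apply,
    LinearMap.neg_apply, LinearMap.comp_apply, LinearMap.comp_apply, LinearMap.comp_apply, h2,
    map_zero, map_zero, neg_zero, smul_zero, add_zero]

theorem μPlus_unit_right (μ : Q.Cochain) {X Z : Q.Ob} {r : Y} {a : Q.plus.Tot}
    (ha : Q.plus.IsPath G X Z r [a]) :
    μPlus G μ (word K [a, Q.ePlus Z]) = -Q.plus.sgn G a := by
  classical
  obtain ⟨a, rfl⟩ := ha.exists_of_single
  have h1 : word K [Q.ofPlus (Q.plus.inc X Z (r + G.fromInt 1) a), 0] = 0 :=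
    word_eq_zero (p := [_])
  rw [μPlus_word, List.map_cons, List.map_singleton, ofPlus_ePlus, h1, map_zero, map_zero, zero_add,
    onTwo, unitProduct_apply, ePlusCoeff_ePlus, Finsupp.linearCombination_single, one_smul,
    LinearMap.neg_apply, LinearMap.comp_apply, LinearMap.comp_apply, LinearMap.comp_apply,
    tgtPart_inc, if_pos rfl, ofPlus_inc]
  rcases exists_eq_toPlus_add a with h | ⟨rfl, -, c, h⟩
  · rw [h, ePlusCoeff_toPlus, map_zero, LinearMap.zero_apply, zero_add]
  · rw [h, map_add, map_smul, ePlusCoeff_toPlus, zero_add, ePlusCoeff_ePlus, map_smul,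
      Finsupp.linearCombination_single, one_smul, LinearMap.smul_apply, map_add, map_smul, sgn_ePlus,
      ePlus, srcPart_inc, if_pos rfl, smul_neg, neg_add, neg_neg, add_comm]

theorem μPlus_unit_zero (μ : Q.Cochain) (p : List Q.plus.Tot) (X : Q.Ob) (q : List Q.plus.Tot)
    (h : p.length + q.length ≠ 1) : μPlus G μ (word K (p ++ Q.ePlus X :: q)) = 0 := by
  rw [μPlus_word, List.map_append, List.map_cons, ofPlus_ePlus, word_eq_zero, map_zero, map_zero,
    zero_add, onTwo_of_length]
  simp only [List.length_append, List.length_cons]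
  omega

theorem μPlus_toPlus (μ : Q.Cochain) (l : List Q.Tot) :
    μPlus G μ (word K (l.map Q.toPlus)) = Q.toPlus (μ (word K l)) := by
  have h1 : (l.map Q.toPlus).map Q.ofPlus = l := by
    rw [List.map_map]
    conv_rhs => rw [← List.map_id l]
    exact List.map_congr_left fun x _ => ofPlus_toPlus x
  rw [μPlus_word, h1, add_eq_left]
  match l with
  | [] => rfl
  | [_] => rfl
  | [a, b] =>
    simp [onTwo, unitProduct_apply, ePlusCoeff_toPlus]
  | _ :: _ :: _ :: _ => rfl

theorem isOperation_μPlus {μ : Q.Cochain} (hμ : IsOperation G id (G.fromInt 1) μ) :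
    IsOperation G id (G.fromInt 1) (μPlus G μ) where
  map_one := by
    have := μPlus_toPlus (G := G) μ []
    rwa [List.map_nil, show word K ([] : List Q.Tot) = 1 from rfl, hμ.map_one, map_zero] at this
  homog X Z r l hl := by
    rw [isPath_singleton_iff]
    refine (IsML.word.lcomp (μPlus G μ)).mem_of_isPath (HomBases.some Q).plus (fun l hl hb => ?_) hl
    rw [← isPath_singleton_iff]
    rcases toPlus_or_ePlus _ hb with h | ⟨p, W, q, rfl⟩
    · rw [← h, μPlus_toPlus]
      exact isPath_map_toPlus (hμ.isPath (isPath_map_ofPlus hl))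
    · by_cases hpq : p.length + q.length = 1
      · obtain ⟨V, s, t, h1, h2, rfl⟩ := hl.of_append
        obtain ⟨V', s', t', h3, h4, rfl⟩ := h2.of_cons
        obtain ⟨rfl, rfl, rfl⟩ := isPath_ePlus_iff h3
        rcases p with _ | ⟨a, p⟩
        · obtain ⟨a, rfl⟩ := List.length_eq_one_iff.mp (by simpa using hpq)
          cases h1
          rw [List.nil_append, μPlus_unit_left μ h4]
          exact h4.cast (by abel)
        · obtain ⟨rfl, rfl⟩ : p = [] ∧ q = [] := by
            constructor <;> refine List.eq_nil_of_length_eq_zero ?_ <;>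
              simp only [List.length_cons] at hpq <;> omega
          cases h4
          rw [List.singleton_append, μPlus_unit_right μ h1, h1.sgn_single, ← neg_smul]
          exact (h1.single_zsmul _).cast (by abel)
      · rw [μPlus_unit_zero μ p W q hpq]
        exact IsPath.single_zero _ _ _
  not_composable p q s t a b hst := by
    classical
    rw [μPlus_word, List.map_append, List.map_cons, List.map_cons, ofPlus_inc, ofPlus_inc,
      hμ.not_composable _ _ s t _ _ hst, map_zero, zero_add]
    match p, q with
    | _ :: _, _ =>
      refine onTwo_of_length ?_
      simp only [List.length_append, List.length_cons]
      omega
    | [], _ :: _ => exact onTwo_of_length (by simp)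
    | [], [] =>
      have h1 (x : Q.plus.Tot) (hx : Q.plus.srcPart s.src x = 0 ∨ s.src ≠ s.tgt) :
          Finsupp.linearCombination K (fun X : Q.Ob => Q.plus.srcPart X)
            (Q.ePlusCoeff (Q.plus.inc s.src s.tgt s.deg a)) x = 0 := by
        rcases exists_eq_toPlus_add a with h | ⟨h', -, c, h⟩
        · rw [h, ePlusCoeff_toPlus, map_zero, LinearMap.zero_apply]
        · rw [ePlusCoeff_inc, Finsupp.linearCombination_single, LinearMap.smul_apply,
            hx.resolve_right (not_not.mpr h'), smul_zero]
      have h2 : Finsupp.linearCombination K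
          (fun X : Q.Ob => -(Q.plus.sgn G ∘ₗ Q.toPlus ∘ₗ Q.ofPlus ∘ₗ Q.plus.tgtPart X))
          (Q.ePlusCoeff (Q.plus.inc t.src t.tgt t.deg b)) (Q.plus.inc s.src s.tgt s.deg a) = 0 := by
        rw [ePlusCoeff_inc, Finsupp.linearCombination_single, LinearMap.smul_apply,
          LinearMap.neg_apply, LinearMap.comp_apply, LinearMap.comp_apply, LinearMap.comp_apply,
          tgtPart_inc, if_neg hst]
        simp
      rw [List.nil_append, onTwo, unitProduct_apply, h1, h2, add_zero]
      by_cases h : s.src = s.tgt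
      · exact .inl (by rw [srcPart_inc, if_neg (fun h' => hst (h.symm.trans h'.symm))])
      · exact .inr h

theorem FPlus_unit (obj : Q.Ob → Q'.Ob) (F : Q.T →ₗ[K] Q'.Tot) (X : Q.Ob) :
    FPlus obj F (word K [Q.ePlus X]) = Q'.ePlus (obj X) := by
  have h1 : word K [(0 : Q.Tot)] = 0 := word_eq_zero (p := [])
  rw [FPlus_word, List.map_singleton, ofPlus_ePlus, h1, map_zero, map_zero, zero_add, onOne]
  simp [ePlusCoeff_ePlus]

theorem FPlus_unit_zero (obj : Q.Ob → Q'.Ob) (F : Q.T →ₗ[K] Q'.Tot) (p : List Q.plus.Tot) (X : Q.Ob)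
    (q : List Q.plus.Tot) (h : p ≠ [] ∨ q ≠ []) :
    FPlus obj F (word K (p ++ Q.ePlus X :: q)) = 0 := by
  rw [FPlus_word, List.map_append, List.map_cons, ofPlus_ePlus, word_eq_zero, map_zero, map_zero,
    zero_add, onOne_of_length]
  rcases h with h | h <;> have := List.length_pos_of_ne_nil h <;>
    simp only [List.length_append, List.length_cons] <;> omega

theorem FPlus_toPlus (obj : Q.Ob → Q'.Ob) (F : Q.T →ₗ[K] Q'.Tot) (l : List Q.Tot) :
    FPlus obj F (word K (l.map Q.toPlus)) = Q'.toPlus (F (word K l)) := by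
  have h1 : (l.map Q.toPlus).map Q.ofPlus = l := by
    rw [List.map_map]
    conv_rhs => rw [← List.map_id l]
    exact List.map_congr_left fun x _ => ofPlus_toPlus x
  rw [FPlus_word, h1, add_eq_left]
  match l with
  | [] => rfl
  | [a] => simp [onOne, ePlusCoeff_toPlus]
  | _ :: _ :: _ => rfl

theorem isOperation_FPlus {obj : Q.Ob → Q'.Ob} {F : Q.T →ₗ[K] Q'.Tot} (hF : IsOperation G obj 0 F) :
    IsOperation G (Q := Q.plus) (Q' := Q'.plus) obj 0 (FPlus obj F) where
  map_one := by
    have := FPlus_toPlus obj F []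
    rwa [List.map_nil, show word K ([] : List Q.Tot) = 1 from rfl, hF.map_one, map_zero] at this
  homog X Z r l hl := by
    rw [isPath_singleton_iff]
    refine (IsML.word.lcomp (FPlus obj F)).mem_of_isPath (HomBases.some Q).plus
      (fun l hl hb => ?_) hl
    rw [← isPath_singleton_iff]
    rcases toPlus_or_ePlus _ hb with h | ⟨p, W, q, rfl⟩
    · rw [← h, FPlus_toPlus]
      exact isPath_map_toPlus (hF.isPath (isPath_map_ofPlus hl))
    · by_cases hpq : p ≠ [] ∨ q ≠ []
      · rw [FPlus_unit_zero obj F p W q hpq]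
        exact IsPath.single_zero _ _ _
      · obtain ⟨rfl, rfl⟩ : p = [] ∧ q = [] := by simpa using hpq
        obtain ⟨rfl, rfl, rfl⟩ := isPath_ePlus_iff hl
        rw [List.nil_append, FPlus_unit, add_zero]
        exact isPath_ePlus _
  not_composable p q s t a b hst := by
    rw [FPlus_word, List.map_append, List.map_cons, List.map_cons, ofPlus_inc, ofPlus_inc,
      hF.not_composable _ _ s t _ _ hst, map_zero, zero_add, onOne_of_length]
    simp only [List.length_append, List.length_cons]
    omega

end GQuiver

theorem bsum_partsBlocks_of_single {A A' M : Type*} [AddCommGroup M] {F : List A → A'}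
    {f : List A' → M} (hf : ∀ P, P.length ≠ 1 → f P = 0) {l : List A} (hl : l ≠ []) :
    bsum (partsBlocks F) f l = f [F l] := by
  obtain ⟨a, l, rfl⟩ := List.exists_cons_of_ne_nil hl
  rw [bsum_partsBlocks_cons, splitSum_eq_right, bsum_partsBlocks_nil]
  intro p q _ hq
  obtain ⟨b, q, rfl⟩ := List.exists_cons_of_ne_nil hq
  rw [bsum_partsBlocks_cons]
  exact splitSum_eq_zero fun _ _ _ => (bsum_congr fun P _ => hf _ (by simp)).trans (bsum_zero _ _)

namespace GQuiver

variable {K : Type uK} [Field K] {Y : Type uY} [AddCommGroup Y] {G : GradingDatum Y}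
  {Q : GQuiver.{uK, uY, uO, uH} K Y} {Q' : GQuiver.{uK, uY, uO', uH'} K Y}
  {M : Type*} [AddCommGroup M] [Module K M]
  {obj : Q.Ob → Q'.Ob} {μ : Q.Cochain} {μ' : Q'.Cochain} {F : Q.T →ₗ[K] Q'.Tot}
  {e : Q.Ob → Q.Tot}

/-! ### The `A∞` relations with units -/

theorem IsOperation.map_sgn_word {c : Y} (hF : IsOperation G obj c F) (l : List Q.Tot) :
    F (word K (l.map (Q.sgn G))) = G.sg c • Q'.sgn G (F (word K l)) := by
  have := hF.map_sgn (unmarked l)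
  rwa [hat, hat, map_fst_mapLetter, map_fst_unmarked] at this

/-- Strict units. -/
structure IsStrictUnit (G : GradingDatum Y) (μ : Q.Cochain) (e : Q.Ob → Q.Tot) : Prop where
  isPath_unit : ∀ X, Q.IsPath G X X (-G.fromInt 1) [e X]
  unit_left : ∀ X Z r a, Q.IsPath G X Z r [a] → μ (word K [e X, a]) = a
  unit_right : ∀ X Z r a, Q.IsPath G X Z r [a] → μ (word K [a, e Z]) = -Q.sgn G a
  unit_zero : ∀ p X q, p.length + q.length ≠ 1 → μ (word K (p ++ e X :: q)) = 0

theorem IsStrictUnit.insertSum_unit (he : IsStrictUnit G μ e)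
    (f : Q.T →ₗ[K] M) {W X Z : Q.Ob} {r s : Y} {p q : List Q.Tot} (hp : Q.IsPath G W X r p)
    (hq : Q.IsPath G X Z s q) : insertSum Q G f μ (p ++ e X :: q) =
      splitSum (fun p₁ p₂ => splitSum (fun a b =>
        f (word K (p₁.map (Q.sgn G) ++ μ (word K a) :: (b ++ e X :: q)))) p₂) p +
      ((if q = [] then 0 else f (word K (p.map (Q.sgn G) ++ q))) -
        if p = [] then 0 else f (word K (p.map (Q.sgn G) ++ q))) +
      splitSum (fun q₁ q₂ => splitSum (fun a b =>
        f (word K ((p ++ e X :: q₁).map (Q.sgn G) ++ μ (word K a) :: b))) q₂) q := by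
  classical
  have hzero (p' q' : List Q.Tot) (x : Q.Tot) (hx : x = 0) : f (word K (p' ++ x :: q')) = 0 := by
    rw [hx, word_eq_zero, map_zero]
  set S : List Q.Tot → List Q.Tot → M := fun p₁ p₂ => splitSum (fun q₁ q₂ =>
    f (word K (p₁.map (Q.sgn G) ++ μ (word K (p₂ ++ e X :: q₁)) :: q₂))) q with hS
  have hS0 (p₁ : List Q.Tot) :
      S p₁ [] = if q = [] then 0 else f (word K (p₁.map (Q.sgn G) ++ q)) := by
    have h1 : μ (word K [e X]) = 0 := he.unit_zero [] X [] (by simp)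
    rcases q with _ | ⟨b, q⟩
    · rw [if_pos rfl]
      exact (splitSum_nil _).trans (hzero _ _ _ h1)
    · rw [if_neg (by simp)]
      refine (splitSum_cons _ b q).trans ?_
      rw [splitSum_eq_left]
      · rw [List.nil_append, List.nil_append, hzero _ _ _ h1, zero_add]
        obtain ⟨V, s, t, hb, -, -⟩ := hq.of_cons
        rw [he.unit_left _ _ _ _ hb]
      · intro q₁ q₂ _ hq₁
        refine hzero _ _ _ (he.unit_zero [] X (b :: q₁) ?_)
        have := List.length_pos_of_ne_nil hq₁
        simp only [List.length_nil, List.length_cons]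
        omega
  have hS2 (p₁ p₂ : List Q.Tot) (h : 2 ≤ p₂.length) : S p₁ p₂ = 0 :=
    splitSum_eq_zero fun q₁ q₂ _ => hzero _ _ _ (he.unit_zero p₂ X q₁ (by omega))
  have hmid : splitSum S p = (if q = [] then 0 else f (word K (p.map (Q.sgn G) ++ q))) -
      if p = [] then 0 else f (word K (p.map (Q.sgn G) ++ q)) := by
    rcases p.eq_nil_or_concat with rfl | ⟨p, a, rfl⟩
    · rw [splitSum_nil, hS0, if_pos (rfl : ([] : List Q.Tot) = []), sub_zero]
    · rw [List.concat_eq_append] at hp ⊢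
      obtain ⟨V, s, t, -, ha, -⟩ := hp.of_append
      rw [splitSum_append_cons, splitSum_nil, hS0, splitSum_eq_right, if_neg (by simp : p ++ [a] ≠ []),
        add_comm, sub_eq_add_neg]
      · refine congrArg₂ (· + ·) rfl ?_
        refine (splitSum_eq_left fun q₁ q₂ _ hq₁ =>
          hzero _ _ _ (he.unit_zero ([] ++ [a]) X q₁ ?_)).trans ?_
        · have := List.length_pos_of_ne_nil hq₁
          simp only [List.nil_append, List.length_singleton]
          omega
        · rw [List.nil_append, List.singleton_append, he.unit_right _ _ _ _ ha, List.map_append,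
            List.append_assoc, ← neg_one_smul K (Q.sgn G a)]
          have := ((IsML.word (K := K) (p.map (Q.sgn G)) q).mk' _).map_smul (-1) (Q.sgn G a)
          simp only [IsLinearMap.mk'_apply] at this
          rw [this, map_smul, neg_one_smul]
          rfl
      · intro p₁ p₂ _ hp₂
        refine hS2 _ _ ?_
        have := List.length_pos_of_ne_nil hp₂
        simp only [List.length_append, List.length_singleton]
        omega
  rw [insertSum, splitSum₃, splitSum_append_cons]
  refine congrArg₂ (· + ·) ?_ rfl
  rw [← hmid, ← splitSum_add]
  exact splitSum_congr fun p₁ p₂ _ => splitSum_append_cons _ _ _ _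

theorem IsStrictUnit.insertSum_unit_eq_zero (he : IsStrictUnit G μ e)
    (hμ : IsOperation G id (G.fromInt 1) μ) {W X Z : Q.Ob} {r s : Y} {p q : List Q.Tot}
    (hp : Q.IsPath G W X r p) (hq : Q.IsPath G X Z s q) :
    insertSum Q G μ μ (p ++ e X :: q) = 0 := by
  have he0 (x y : List Q.Tot) (h : x.length + y.length ≠ 1) :
      μ (word K (x ++ Q.sgn G (e X) :: y)) = 0 := by
    have := ((IsML.word (K := K) x y).mk' _).map_smul (G.sg (-G.fromInt 1) : K) (e X)
    simp only [IsLinearMap.mk'_apply, Int.cast_smul_eq_zsmul] at this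
    rw [(he.isPath_unit X).sgn_single, this, map_zsmul, he.unit_zero _ _ _ h, smul_zero]
  rw [he.insertSum_unit μ hp hq]
  have h1 : splitSum (fun p₁ p₂ => splitSum (fun a b =>
      μ (word K (p₁.map (Q.sgn G) ++ μ (word K a) :: (b ++ e X :: q)))) p₂) p =
        if q = [] then μ (word K (p.map (Q.sgn G) ++ q)) else 0 := by
    have h0 (x y : List Q.Tot) (z : Q.Tot) (h : x.length + y.length + q.length ≠ 0) :
        μ (word K (x ++ z :: (y ++ e X :: q))) = 0 := by
      have := he.unit_zero (x ++ z :: y) X q (by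
        simp only [List.length_append, List.length_cons]; omega)
      simpa using this
    split_ifs with hq0
    · subst hq0
      rw [splitSum_eq_left, splitSum_eq_right]
      · have := he.unit_right _ _ _ _ (hμ.isPath hp)
        rw [List.append_nil, hμ.map_sgn_word, G.sg_fromInt_one, neg_smul, one_smul, ← this]
        rfl
      · intro a b _ hb
        refine h0 _ _ _ ?_
        have := List.length_pos_of_ne_nil hb
        omega
      · intro p₁ p₂ _ hp₁
        refine splitSum_eq_zero fun a b _ => h0 _ _ _ ?_
        have := List.length_pos_of_ne_nil hp₁
        rw [List.length_map]
        omega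
    · have := List.length_pos_of_ne_nil hq0
      exact splitSum_eq_zero fun _ _ _ => splitSum_eq_zero fun _ _ _ => h0 _ _ _ (by omega)
  have h2 : splitSum (fun q₁ q₂ => splitSum (fun a b =>
      μ (word K ((p ++ e X :: q₁).map (Q.sgn G) ++ μ (word K a) :: b))) q₂) q =
        if p = [] then -μ (word K (p.map (Q.sgn G) ++ q)) else 0 := by
    have h0 (x y z : List Q.Tot) (w : Q.Tot) (h : x.length + y.length + z.length ≠ 0) :
        μ (word K ((x ++ e X :: y).map (Q.sgn G) ++ w :: z)) = 0 := by
      rw [List.map_append, List.map_cons, List.append_assoc, List.cons_append]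
      refine he0 _ _ ?_
      simp only [List.length_append, List.length_cons, List.length_map]
      omega
    split_ifs with hp0
    · subst hp0
      cases hp
      rw [splitSum_eq_left, splitSum_eq_right]
      · have h3 := he.unit_left _ _ _ _ (hμ.isPath hq)
        have h4 := ((IsML.word (K := K) [] [μ (word K q)]).mk' _).map_smul
          (G.sg (-G.fromInt 1) : K) (e W)
        simp only [IsLinearMap.mk'_apply, Int.cast_smul_eq_zsmul, List.nil_append] at h4
        have h5 : G.sg (-G.fromInt 1) = -1 := by
          have := G.sg_add (-G.fromInt 1) (G.fromInt 1)
          rw [neg_add_cancel, G.sg_zero, G.sg_fromInt_one] at this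
          omega
        rw [List.nil_append, List.map_singleton, List.singleton_append,
          (he.isPath_unit W).sgn_single, h4, map_zsmul, h5]
        exact (neg_smul _ _).trans ((congrArg _ (one_smul _ _)).trans (congrArg _ h3))
      · intro a b _ hb
        refine h0 _ _ _ _ ?_
        have := List.length_pos_of_ne_nil hb
        omega
      · intro q₁ q₂ _ hq₁
        refine splitSum_eq_zero fun a b _ => h0 _ _ _ _ ?_
        have := List.length_pos_of_ne_nil hq₁
        omega
    · have := List.length_pos_of_ne_nil hp0
      exact splitSum_eq_zero fun _ _ _ => splitSum_eq_zero fun _ _ _ => h0 _ _ _ _ (by omega)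
  rw [h1, h2]
  by_cases hp0 : p = [] <;> by_cases hq0 : q = []
  · subst hp0 hq0
    simp
  · simp [hp0, hq0]
  · simp [hp0, hq0]
  · simp [hp0, hq0]

theorem insL_hat (φ : Q.Cochain) (T : Q.T →ₗ[K] M) (l : List (Q.Tot × ℤ)) :
    insL idBlocks (Q.sgn G) (hat φ) (hat T) l = insertSum Q G T φ (l.map Prod.fst) := by
  rw [insertSum, splitSum₃, splitSum_map]
  simp [splitSum_map, insL, insOp, splitSum₃, hat, markedLetter, mapLetter, Function.comp_def]

theorem isStrictUnit_μPlus (μ : Q.Cochain) : IsStrictUnit G (μPlus G μ) Q.ePlus where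
  isPath_unit X := isPath_ePlus (Q := Q) X
  unit_left _ _ _ _ h := μPlus_unit_left μ h
  unit_right _ _ _ _ h := μPlus_unit_right μ h
  unit_zero := μPlus_unit_zero μ

theorem map_toPlus_sgn (l : List Q.Tot) :
    (l.map Q.toPlus).map (Q.plus.sgn G) = (l.map (Q.sgn G)).map Q.toPlus := by
  rw [List.map_map, List.map_map]
  exact List.map_congr_left fun x _ => (toPlus_sgn x).symm

theorem insertSum_toPlus {N : Type*} [AddCommGroup N] [Module K N] {f : Q.T →ₗ[K] M}
    {f' : Q.plus.T →ₗ[K] N} (L : M →ₗ[K] N)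
    (hf : ∀ l, f' (word K (l.map Q.toPlus)) = L (f (word K l))) (l : List Q.Tot) :
    insertSum Q.plus G f' (μPlus G μ) (l.map Q.toPlus) = L (insertSum Q G f μ l) := by
  unfold insertSum splitSum₃
  rw [splitSum_map, map_splitSum L]
  refine splitSum_congr fun p s _ => ?_
  rw [splitSum_map, map_splitSum L]
  refine splitSum_congr fun q r _ => ?_
  dsimp only
  rw [← hf, map_toPlus_sgn, μPlus_toPlus, List.map_append, List.map_cons]

theorem isStrict_μPlus (hμ : IsOperation G id (G.fromInt 1) μ)
    (hrel : ∀ X Z r l, Q.IsPath G X Z r l → insertSum Q G μ μ l = 0) :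
    IsStrict G (μPlus G μ) Q.ePlus where
  homog := (isOperation_μPlus hμ).homog
  map_sgn l := by rw [(isOperation_μPlus hμ).map_sgn, G.sg_fromInt_one]
  rel l hl := by
    obtain ⟨X, Z, r, hl⟩ := hl
    rw [insL_hat]
    refine (IsML.insert₃ G (IsML.word.lcomp (μPlus G μ)) (μPlus G μ)).eq_zero_of_isPath
      (HomBases.some Q).plus (fun l hl hb => ?_) hl
    change insertSum Q.plus G (μPlus G μ) (μPlus G μ) l = 0
    rcases toPlus_or_ePlus _ hb with h | ⟨p, W, q, rfl⟩
    · rw [← h, insertSum_toPlus Q.toPlus (μPlus_toPlus μ), hrel X Z r _ (isPath_map_ofPlus hl),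
        map_zero]
    · obtain ⟨V, s, t, h1, h2, rfl⟩ := hl.of_append
      obtain ⟨V', s', t', h3, h4, rfl⟩ := h2.of_cons
      obtain ⟨rfl, rfl, rfl⟩ := isPath_ePlus_iff h3
      exact (isStrictUnit_μPlus μ).insertSum_unit_eq_zero (isOperation_μPlus hμ) h1 h4
  isPath_unit X := isPath_ePlus (Q := Q) X
  unit_left _ _ _ _ h := μPlus_unit_left μ h
  unit_right _ _ _ _ h := μPlus_unit_right μ h
  unit_zero := μPlus_unit_zero μ

theorem functor_rel_unit {e' : Q'.Ob → Q'.Tot} (he : IsStrictUnit G μ e) (he' : IsStrictUnit G μ' e')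
    (hF : IsOperation G obj 0 F) (hu : ∀ X, F (word K [e X]) = e' (obj X))
    (hu₀ : ∀ p X q, p ≠ [] ∨ q ≠ [] → F (word K (p ++ e X :: q)) = 0)
    {W X Z : Q.Ob} {r s : Y} {p q : List Q.Tot}
    (hp : Q.IsPath G W X r p) (hq : Q.IsPath G X Z s q) :
    bsum (functorBlocks F) (hat μ') (unmarked (p ++ e X :: q)) =
      insertSum Q G F μ (p ++ e X :: q) := by
  have hFe (x y : List Q.Tot) (h : x ≠ [] ∨ y ≠ []) :
      F (word K (x ++ Q.sgn G (e X) :: y)) = 0 := by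
    have := ((IsML.word (K := K) x y).mk' _).map_smul (G.sg (-G.fromInt 1) : K) (e X)
    simp only [IsLinearMap.mk'_apply, Int.cast_smul_eq_zsmul] at this
    rw [(he.isPath_unit X).sgn_single, this, map_zsmul, hu₀ _ _ _ h, smul_zero]
  have hB : IsCoalg.{0} (functorBlocks F) := isCoalg_partsBlocks _
  have hsplit : unmarked (p ++ e X :: q) = unmarked p ++ (e X, 0) :: unmarked q := by
    simp [unmarked]
  have hnil (g : List (Q'.Tot × ℤ) → Q'.Tot) : bsum (functorBlocks F) g (unmarked []) = g [] :=
    bsum_partsBlocks_nil _ g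
  have hne (l : List Q.Tot) (hl : l ≠ []) (P) (hP : P ∈ functorBlocks F (unmarked l)) :
      0 < P.length := List.length_pos_of_ne_nil fun h =>
    hB.ne_nil _ (by simpa [unmarked] using hl) (h ▸ hP)
  have hz (P R : List (Q'.Tot × ℤ)) (h : P.length + R.length ≠ 1) :
      hat μ' (P ++ (e' (obj X), 0) :: R) = 0 := by
    rw [hat, List.map_append, List.map_cons]
    exact he'.unit_zero _ _ _ (by simpa using h)
  rw [he.insertSum_unit F hp hq, hsplit,
    bsum_append_cons_of_algWord (bsum_algWord_unit hu hu₀ (unmarked p) X 0 (unmarked q))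
      (fml_hat μ'), splitSum_eq_zero, splitSum_eq_zero, zero_add, add_zero]
  · by_cases hp0 : p = [] <;> by_cases hq0 : q = []
    · subst hp0 hq0
      rw [hnil, hnil, if_pos rfl, sub_zero]
      exact hz [] [] (by simp)
    · subst hp0
      cases hp
      have hF := hF.isPath hq
      rw [if_neg hq0, if_pos rfl, sub_zero, hnil, functorBlocks,
        bsum_partsBlocks_of_single (fun R hR => hz [] R (by simpa using hR))
          (by simpa [unmarked] using hq0)]
      simpa [hat, markedLetter, unmarked, Function.comp_def] using he'.unit_left _ _ _ _ hF
    · subst hq0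
      cases hq
      have hF' := hF.isPath hp
      rw [if_pos rfl, if_neg hp0, zero_sub, List.append_nil, hF.map_sgn_word, G.sg_zero, one_smul]
      simp only [hnil]
      rw [functorBlocks, bsum_partsBlocks_of_single (fun P hP => hz P [] (by simpa using hP))
        (by simpa [unmarked] using hp0)]
      simpa [hat, markedLetter, unmarked, Function.comp_def] using he'.unit_right _ _ _ _ hF'
    · rw [if_neg hq0, if_neg hp0, sub_self]
      refine (bsum_congr fun P hP => (bsum_congr fun R hR => hz P R ?_).trans
        (bsum_zero _ _)).trans (bsum_zero _ _)
      have := hne p hp0 P hP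
      have := hne q hq0 R hR
      omega
  · refine fun q₁ q₂ _ => splitSum_eq_zero fun a b _ => ?_
    have := hFe (p.map (Q.sgn G)) (q₁.map (Q.sgn G) ++ μ (word K a) :: b) (by simp)
    simpa using this
  · refine fun p₁ p₂ _ => splitSum_eq_zero fun a b _ => ?_
    have := hu₀ (p₁.map (Q.sgn G) ++ μ (word K a) :: b) X q (by simp)
    simpa using this

end GQuiver

namespace GQuiver

variable {K : Type uK} [Field K] {Y : Type uY} [AddCommGroup Y] {G : GradingDatum Y}
  {Q : GQuiver.{uK, uY, uO, uH} K Y} {Q' : GQuiver.{uK, uY, uO', uH'} K Y}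
  {M : Type*} [AddCommGroup M] [Module K M]
  {obj : Q.Ob → Q'.Ob} {μ : Q.Cochain} {μ' : Q'.Cochain} {F : Q.T →ₗ[K] Q'.Tot}

theorem isStrictFunctor_FPlus (hF : IsOperation G obj 0 F)
    (hrel : ∀ X Z r l, Q.IsPath G X Z r l →
      ((parts l).map fun P => μ' (word K (P.map fun m => F (word K m)))).sum =
        insertSum Q G F μ l) :
    IsStrictFunctor G (Q := Q.plus) (Q' := Q'.plus) obj (FPlus obj F) (μPlus G μ) (μPlus G μ')
      Q.ePlus Q'.ePlus where
  map_one := (isOperation_FPlus hF).map_one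
  homog := (isOperation_FPlus hF).homog
  map_sgn l := by rw [(isOperation_FPlus hF).map_sgn, G.sg_zero, one_smul]
  rel l hl := by
    obtain ⟨X, Z, r, hl⟩ := hl
    generalize l.map Prod.fst = l at hl
    rw [← sub_eq_zero]
    have hml : IsML K fun l => ((parts l).map fun P =>
        μPlus G μ' (word K (P.map fun m => FPlus obj F (word K m)))).sum :=
      IsML.parts (IsML.word.lcomp (μPlus G μ')) (IsML.word.lcomp (FPlus obj F))
    have hml' : IsML K fun l => ((parts l).map fun P =>
        μPlus G μ' (word K (P.map fun m => FPlus obj F (word K m)))).sum +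
          -insertSum Q.plus G (FPlus obj F) (μPlus G μ) l :=
      hml.add ((IsML.insert₃ G (IsML.word.lcomp (FPlus obj F)) (μPlus G μ)).lcomp (-LinearMap.id))
    simp only [← sub_eq_add_neg] at hml'
    refine hml'.eq_zero_of_isPath (HomBases.some Q).plus (fun l hl hb => ?_) hl
    rw [sub_eq_zero]
    rcases toPlus_or_ePlus _ hb with h | ⟨p, W, q, rfl⟩
    · rw [← h, insertSum_toPlus Q'.toPlus (FPlus_toPlus obj F), ← hrel X Z r _ (isPath_map_ofPlus hl),
        parts_map, List.map_map, map_list_sum, List.map_map]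
      refine congrArg _ (List.map_congr_left fun P _ => ?_)
      rw [Function.comp_apply, Function.comp_apply, ← μPlus_toPlus, List.map_map, List.map_map]
      congr 3
      funext m
      exact FPlus_toPlus obj F m
    · obtain ⟨V, s, t, h1, h2, rfl⟩ := hl.of_append
      obtain ⟨V', s', t', h3, h4, rfl⟩ := h2.of_cons
      obtain ⟨rfl, rfl, rfl⟩ := isPath_ePlus_iff h3
      rw [← functor_rel_unit (isStrictUnit_μPlus μ) (isStrictUnit_μPlus μ') (isOperation_FPlus hF)
        (FPlus_unit obj F) (FPlus_unit_zero obj F) h1 h4, functorBlocks, bsum_partsBlocks, unmarked,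
        parts_map, List.map_map]
      refine congrArg _ (List.map_congr_left fun P _ => ?_)
      simp [hat, Function.comp_def]
  unit := FPlus_unit obj F
  unit_zero := FPlus_unit_zero obj F

end GQuiver

open GQuiver

variable {K : Type uK} [Field K] {Y : Type uY} [AddCommGroup Y] {G : GradingDatum Y}
  {C : AInfCat.{uK, uY, uO, uH} K G} {D : AInfCat.{uK, uY, uO', uH'} K G}

theorem isPath_of_mem_range {Q : GQuiver.{uK, uY, uO, uH} K Y} {X Z : Q.Ob} {r : Y} {x : Q.Tot}
    (h : x ∈ LinearMap.range (Q.inc X Z (r + G.fromInt 1))) : Q.IsPath G X Z r [x] := by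
  obtain ⟨a, rfl⟩ := h
  exact (IsPath.single _ _ _ _).cast (by abel)

variable (C) in
theorem AInfCat.isOperation : IsOperation G id (G.fromInt 1) C.μ where
  map_one := C.μ_one
  homog X Z r l hl := by
    by_cases h : l = []
    · subst h
      rw [hat, List.map_nil, show word K ([] : List C.Tot) = 1 from rfl, C.μ_one]
      cases hl
      exact IsPath.single_zero _ _ _
    · have := C.μ_mem X Z r _ (by simpa using h) hl
      refine isPath_of_mem_range ?_
      rwa [add_assoc, ← map_add, one_add_one_eq_two]
  not_composable p q s t a b h := C.μ_of_not_composable p q _ _ _ _ _ _ a b h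

theorem AInfFunctor.isOperation (F : AInfFunctor C D) : IsOperation G F.obj 0 F.F where
  map_one := F.F_one
  homog X Z r l hl := by
    by_cases h : l = []
    · subst h
      rw [hat, List.map_nil, show word K ([] : List C.Tot) = 1 from rfl, F.F_one]
      cases hl
      exact IsPath.single_zero _ _ _
    · have := F.F_mem X Z r _ (by simpa using h) hl
      exact isPath_of_mem_range (by rwa [add_zero])
  not_composable p q s t a b h := F.F_of_not_composable p q _ _ _ _ _ _ a b h

variable (C) in
theorem AInfCat.isStrict : IsStrict G (Q := C.plus) (μPlus G C.μ) C.ePlus :=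
  isStrict_μPlus C.isOperation C.μ_μ

theorem AInfFunctor.isStrictFunctor (F : AInfFunctor C D) :
    IsStrictFunctor G (Q := C.plus) (Q' := D.plus) F.obj (FPlus F.obj F.F) (μPlus G C.μ)
      (μPlus G D.μ) C.ePlus D.ePlus :=
  isStrictFunctor_FPlus F.isOperation F.F_μ

namespace Conv

variable {K : Type*} [Field K] {V V' : Type*} [AddCommGroup V] [Module K V]
  [AddCommGroup V'] [Module K V'] {B : List (V × ℤ) → List (List (V' × ℤ))}
  {R : Type w} [Ring R] [Algebra K R] {lt : ℤ → V' →ₗ[K] R}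

theorem derivation_pull (hB : IsMarked.{w} K B) {δ : R →+ R}
    (hδ : ∀ x y, δ (x * y) = δ x * y + x * δ y) {ψ : List (V × ℤ) → V'}
    {P : List (V × ℤ) → Prop} (hP : IsInfix P)
    (h : ∀ l, P l → δ (lt (cnt l) (bsum B oneLetter l)) = lt (cnt l) (ψ l)) {l : List (V × ℤ)}
    (hl : P l) :
    δ (bsum B (wordC lt) l) =
        ins (fun _ => 1) B (mapLetter (LinearMap.id : V' →ₗ[K] V')) (markedLetter ψ) (wordC lt) l ∧
      δ (bsum B (weight cnt (letterC lt oneLetter) * wordC lt : Conv (V' × ℤ) R) l) =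
        ins (fun _ => 1) B (mapLetter (LinearMap.id : V' →ₗ[K] V')) (markedLetter ψ)
          (weight cnt (letterC lt oneLetter) * wordC lt) l := by
  have hc := hB.toIsCoalg
  let D : Conv (V × ℤ) R →+ Conv (V × ℤ) R :=
    { toFun := fun f => ⟨fun l => δ (f l)⟩
      map_zero' := ext' fun l => map_zero δ
      map_add' := fun f g => ext' fun l => map_add δ _ _ }
  have hD (f g : Conv (V × ℤ) R) : D (f * g) = D f * g + f * D g := ext' fun l => by
    change δ ((f * g) l) = _
    rw [add_apply, mul_apply, mul_apply, mul_apply, map_splitSum, ← splitSum_add]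
    exact splitSum_congr fun p q _ => hδ _ _
  have hD1 : D 1 = 0 := by simpa using hD 1 1
  have hz : ∀ n v, (RingHom.id R) (lt n v) = lt n ((LinearMap.id : V' →ₗ[K] V') v) := fun _ _ => rfl
  have h1 := congrArg (pull hc) (wordC_eq lt)
  have h2 := congrArg (pull hc) (wordC_eq' lt)
  have h3 := ins_leading (lt := lt) hB hz ψ
  have h4 := ins_markedLetter_wordC (lt := lt) hB (fun _ => 1) hz ψ
  have hid (f : Conv (V × ℤ) R) : mapRing (RingHom.id R) f = f := rfl
  rw [weight_one] at h4
  rw [hid] at h3 h4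
  rw [h4] at h3 ⊢
  rw [h3]
  have h5 : ∀ l, bsum B (weight cnt (letterC lt oneLetter) * wordC lt : Conv (V' × ℤ) R) l =
      (weight cnt (pull hc (letterC lt oneLetter)) * pull hc (wordC lt)) l := fun l => by
    rw [← pull_weight hB, ← map_mul]
    rfl
  rw [h5, ← pull_apply hc]
  have hv : Van P (D (pull hc (letterC lt oneLetter)) - letterC lt ψ) := fun l hl => by
    rw [sub_apply, sub_eq_zero, letterC_apply, ← h l hl, pull_letterC lt hB]
    rfl
  rw [map_add, map_mul, map_one] at h1 h2
  have hDw (f : Conv (V × ℤ) R) : D (weight cnt f) = weight cnt (D f) :=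
    ext' fun l => map_zsmul δ _ _
  change D _ l = _ ∧ D _ l = _
  rw [hD, hDw]
  generalize pull hc (wordC lt) = W at *
  generalize pull hc (letterC lt oneLetter) = X at *
  have h6 : D W = W * D X * W := by
    have h7 : W * (1 - X) = 1 := by rw [mul_sub, mul_one, sub_eq_iff_eq_add]; exact h2
    have h8 := congrArg D h1
    rw [map_add, hD1, hD, zero_add] at h8
    calc D W = W * (1 - X) * D W := by rw [h7, one_mul]
      _ = W * (D W - X * D W) := by noncomm_ring
      _ = W * (D X * W) := by nth_rewrite 1 [h8]; rw [add_sub_cancel_right]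
      _ = _ := by rw [mul_assoc]
  have hv' : Van P (D W - W * letterC lt ψ * W) := by
    have := (hv.mul_left hP W).mul_right hP W
    rw [h6]
    convert this using 1
    noncomm_ring
  refine ⟨sub_eq_zero.mp (hv' l hl), sub_eq_zero.mp ?_⟩
  have := ((hv'.mul_left hP (weight cnt X)).add ((hv.weight cnt).mul_right hP W)) l hl
  rw [← this, ← sub_apply]
  congr 1
  have hw : weight cnt (D X - letterC lt ψ) = weight cnt (D X) - weight cnt (letterC lt ψ) :=
    ext' fun l => smul_sub _ _ _
  rw [hw]
  noncomm_ring

end Conv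

namespace GQuiver

variable {k : Type*} {K : Type uK} [Field k] [Field K] [Algebra k K] (v : Derivation k K K)
  {Y : Type uY} [AddCommGroup Y] {G : GradingDatum Y}
  {Q : GQuiver.{uK, uY, uO, uH} K Y} {Q' : GQuiver.{uK, uY, uO', uH'} K Y}
  {M : Type*} [AddCommGroup M] [Module K M] {ι : Type*} (c : Module.Basis ι K M)
  (𝓑 : HomBases Q) (𝓑' : HomBases Q') {obj : Q.Ob → Q'.Ob}
  {B : List (Q.Tot × ℤ) → List (List (Q'.Tot × ℤ))} {ψ : Q.T →ₗ[K] Q'.Tot}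

/-! ### Derivatives of operations on words -/

/-- Words of letters with constant coefficients. -/
def IsConst (l : List Q.Tot) : Prop := ∀ x ∈ l, coeffDer v 𝓑.tot x = 0

variable {v 𝓑} in
theorem isConst_of_basis {l : List Q.Tot} (hl : ∀ x ∈ l, x ∈ Set.range 𝓑.tot) : IsConst v 𝓑 l :=
  fun x hx => coeffDer_of_mem_range v 𝓑 (hl x hx)

variable {v 𝓑} in
theorem isConst_append {p q : List Q.Tot} :
    IsConst v 𝓑 (p ++ q) ↔ IsConst v 𝓑 p ∧ IsConst v 𝓑 q := by
  simp [IsConst, or_imp, forall_and]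

theorem coeffDer_sgn (x : Q.Tot) :
    coeffDer v 𝓑.tot (Q.sgn G x) = Q.sgn G (coeffDer v 𝓑.tot x) := by
  refine eq_of_semilinear v 𝓑.tot (T := Q.sgn G)
    (E := (coeffDer v 𝓑.tot).comp (Q.sgn G).toAddMonoidHom)
    (E' := (Q.sgn G).toAddMonoidHom.comp (coeffDer v 𝓑.tot))
    (fun a x => ?_) (fun a x => ?_) (fun ⟨t, i⟩ => ?_) x
  · simp [coeffDer_smul]
  · simp [coeffDer_smul]
  · have := coeffDer_basis v 𝓑.tot ⟨t, i⟩
    simp [this]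
    rw [𝓑.tot_apply, sgn_inc, map_zsmul, ← 𝓑.tot_apply, this, smul_zero]

variable {v 𝓑} in
theorem IsConst.map_sgn {l : List Q.Tot} (hl : IsConst v 𝓑 l) :
    IsConst v 𝓑 (l.map (Q.sgn G)) := fun x hx => by
  obtain ⟨y, hy, rfl⟩ := List.mem_map.mp hx
  rw [coeffDer_sgn, hl y hy, map_zero]

variable {v 𝓑} in
theorem IsConst.map_twist {l : List Q.Tot} (hl : IsConst v 𝓑 l) (r : Y) :
    IsConst v 𝓑 (l.map (Q.twist G r)) := by
  unfold twist
  split_ifs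
  · exact hl.map_sgn
  · simpa using hl

theorem isInfix_isConst : IsInfix fun l : List (Q.Tot × ℤ) => IsConst v 𝓑 (l.map Prod.fst) where
  left p q h := (isConst_append.mp (by rwa [← List.map_append])).1
  right p q h := (isConst_append.mp (by rwa [← List.map_append])).2

section Blocks

variable (hB : IsFunctorial G obj B)
  (hψ : ∀ l, IsConst v 𝓑 (l.map Prod.fst) →
    coeffDer v 𝓑'.tot (bsum B Conv.oneLetter l) = hat ψ l)
  {l : List (Q.Tot × ℤ)} (hl : IsConst v 𝓑 (l.map Prod.fst))

include hB hψ hl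

theorem coeffDer_bsum_leadingWord : coeffDer v 𝓑'.words (bsum B leadingWord l) =
    insL B (LinearMap.id : Q'.Tot →ₗ[K] Q'.Tot) (hat ψ) leadingWord l := by
  have h := (Conv.derivation_pull (lt := fun _ => TensorAlgebra.ι K) hB.toIsMarked
    (𝓑'.coeffDer_mul v) (isInfix_isConst v 𝓑) (ψ := hat ψ)
    (fun l hl => by rw [𝓑'.coeffDer_ι, hψ l hl]) hl).2
  have hw : (Conv.weight cnt (Conv.letterC (fun _ => TensorAlgebra.ι K) Conv.oneLetter) *
      Conv.wordC (fun _ => TensorAlgebra.ι K) : Conv (Q'.Tot × ℤ) Q'.T).toFun = leadingWord :=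
    funext leadingWord_eq
  rw [Conv.ins_apply, hw] at h
  exact h

theorem coeffDer_bsum_hat (T : Q'.T →ₗ[K] M) : coeffDer v c (bsum B (hat T) l) =
    bsum B (hat (matrixDer v 𝓑'.words c T)) l +
      insL B (LinearMap.id : Q'.Tot →ₗ[K] Q'.Tot) (hat ψ) (hat T) l := by
  have h := (Conv.derivation_pull (lt := fun _ => TensorAlgebra.ι K) hB.toIsMarked
    (𝓑'.coeffDer_mul v) (isInfix_isConst v 𝓑) (ψ := hat ψ)
    (fun l hl => by rw [𝓑'.coeffDer_ι, hψ l hl]) hl).1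
  have hw : (Conv.wordC (fun _ => TensorAlgebra.ι K) : Conv (Q'.Tot × ℤ) Q'.T).toFun =
    fun w => word K (w.map Prod.fst) := funext wordC_ι
  rw [Conv.ins_apply, hw] at h
  have hT {N : Type _} [AddCommGroup N] [Module K N] (T : Q'.T →ₗ[K] N) :
    hat T = fun w => T (word K (w.map Prod.fst)) := rfl
  rw [hT T, hT (matrixDer _ _ _ _), ← map_bsum T, coeffDer_apply v 𝓑'.words, map_bsum, h]
  exact congrArg _ (map_insOp T _ _ _ _ _ _)

end Blocks

theorem coeffDer_insertSum (T : Q.T →ₗ[K] M) (μ : Q.Cochain) {l : List Q.Tot}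
    (hl : IsConst v 𝓑 l) : coeffDer v c (insertSum Q G T μ l) =
      insertSum Q G (matrixDer v 𝓑.words c T) μ l +
        insertSum Q G T (matrixDer v 𝓑.words 𝓑.tot μ) l := by
  unfold insertSum splitSum₃
  rw [map_splitSum, ← splitSum_add]
  refine splitSum_congr fun p s h => ?_
  rw [map_splitSum, ← splitSum_add]
  refine splitSum_congr fun q r h' => ?_
  rw [← h, ← h', isConst_append, isConst_append] at hl
  rw [coeffDer_apply v 𝓑.words, 𝓑.coeffDer_word_insert v (hl.1.map_sgn) hl.2.2,
    coeffDer_of_const v 𝓑 𝓑 μ hl.2.1]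

variable {μ : Q.Cochain} {μ' : Q'.Cochain} {e : Q.Ob → Q.Tot} {e' : Q'.Ob → Q'.Tot}
  {F : Q.T →ₗ[K] Q'.Tot}

theorem isML_insertSum (T : Q.T →ₗ[K] M) (μ : Q.Cochain) : IsML K (insertSum Q G T μ) :=
  IsML.insert₃ G (IsML.word.lcomp T) μ

theorem isDeformation_matrixDer (hμ : IsOperation G id (G.fromInt 1) μ) (hs : IsStrict G μ e) :
    IsDeformation G μ (matrixDer v 𝓑.words 𝓑.tot μ) where
  homog := (hμ.matrixDer v 𝓑 𝓑).homog
  map_sgn l := by rw [(hμ.matrixDer v 𝓑 𝓑).map_sgn, G.sg_fromInt_one]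
  rel l hl := by
    obtain ⟨X, Z, r, hl⟩ := hl
    rw [insL_hat, insL_hat]
    refine ((isML_insertSum μ (matrixDer v 𝓑.words 𝓑.tot μ)).add
      (isML_insertSum (G := G) (matrixDer v 𝓑.words 𝓑.tot μ) μ)).eq_zero_of_isPath 𝓑
      (fun l hl hb => ?_) hl
    have := hs.rel (unmarked l) ⟨X, Z, r, by rwa [map_fst_unmarked]⟩
    rw [insL_hat, map_fst_unmarked] at this
    rw [add_comm, ← coeffDer_insertSum v 𝓑.tot 𝓑 μ μ (isConst_of_basis hb), this, map_zero]

theorem fml_of_isML {f : List Q.Tot → M} (hf : IsML K f) :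
    FML K fun l : List (Q.Tot × ℤ) => f (l.map Prod.fst) := fun p q n => by
  simpa using hf (p.map Prod.fst) (q.map Prod.fst)

theorem _root_.FML.eq_zero_of_onPath {f : List (Q.Tot × ℤ) → M} (hf : FML K f)
    (h : ∀ l, OnPath G l → (∀ x ∈ l.map Prod.fst, x ∈ Set.range 𝓑.tot) → f l = 0)
    {l : List (Q.Tot × ℤ)} (hl : OnPath G l) : f l = 0 := by
  obtain ⟨X, Z, r, hl⟩ := hl
  have hml (m : ℕ → ℤ) : IsML K fun w : List Q.Tot => f (w.mapIdx fun i x => (x, m i)) :=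
    fun p q => by simpa only [List.mapIdx_append, List.mapIdx_cons] using hf _ _ _
  have hfst (m : ℕ → ℤ) (w : List Q.Tot) : (w.mapIdx fun i x => (x, m i)).map Prod.fst = w := by
    apply List.ext_getElem <;> simp
  have := (hml fun i => (l[i]?.map Prod.snd).getD 0).eq_zero_of_isPath 𝓑
    (fun w hw hb => h _ ⟨X, Z, r, by rwa [hfst]⟩ (by rwa [hfst])) hl
  convert this
  apply List.ext_getElem <;> simp +contextual

theorem isDeformationMorphism_matrixDer (hF : IsOperation G obj 0 F)
    (hs : IsStrictFunctor G obj F μ μ' e e') :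
    IsDeformationMorphism G obj (functorBlocks F) μ (matrixDer v 𝓑.words 𝓑.tot μ) μ'
      (matrixDer v 𝓑'.words 𝓑'.tot μ') (matrixDer v 𝓑.words 𝓑'.tot F) where
  homog := (hF.matrixDer v 𝓑 𝓑').homog
  map_sgn l := by rw [(hF.matrixDer v 𝓑 𝓑').map_sgn, G.sg_zero, one_smul]
  rel l hl := by
    have hone : bsum (functorBlocks F) Conv.oneLetter = hat F := funext hs.bsum_oneLetter
    have hB := hs.isFunctorial
    have hM := hB.toIsMarked
    rw [hone, insL_hat, insL_hat, ← sub_eq_zero]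
    refine FML.eq_zero_of_onPath 𝓑 (f := fun l => _ - _) (((hM.fml_bsum (fml_hat _)).add
      (hM.fml_insL _ (fml_hat _) (fml_hat _))).sub ((fml_of_isML (isML_insertSum _ _)).add
        (fml_of_isML (isML_insertSum _ _)))) (fun l hl hb => ?_) hl
    have hc := isConst_of_basis (v := v) hb
    rw [sub_eq_zero, ← coeffDer_bsum_hat v 𝓑'.tot 𝓑 𝓑' hB (fun l hl => ?_) hc μ',
      ← coeffDer_insertSum v 𝓑'.tot 𝓑 F μ hc, hs.isStrictMorphism.rel l hl, hone, insL_hat]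
    rw [hone, hat, coeffDer_of_const v 𝓑 𝓑' F hl, hat]

end GQuiver

namespace GQuiver

variable {k : Type*} {K : Type uK} [Field k] [Field K] [Algebra k K] (v : Derivation k K K)
  {Y : Type uY} [AddCommGroup Y] {G : GradingDatum Y}
  {Q : GQuiver.{uK, uY, uO, uH} K Y} {Q' : GQuiver.{uK, uY, uO', uH'} K Y}
  {M : Type*} [AddCommGroup M] [Module K M] {ι : Type*} (c : Module.Basis ι K M)
  (𝓑 : HomBases Q) (𝓑' : HomBases Q') {obj : Q.Ob → Q'.Ob}

/-! ### Derivatives of operations on chains -/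

theorem Rep.of_basis {T : Q.T →ₗ[K] M} {f : List (Q.Tot × ℤ) → M} (hf : FML K f)
    (h : ∀ X r a l, Q.IsPath G X X r (a :: l) → (∀ x ∈ a :: l, x ∈ Set.range 𝓑.tot) →
      T (word K (a :: l)) = cycSum (Q.twist G r) f a l) : Rep G T f := fun X r a l hl => by
  rw [← rep_cyc f hf X r a l hl, ← sub_eq_zero, ← LinearMap.sub_apply]
  have hml : IsML K fun l : List Q.Tot =>
      if l.length ≠ 0 then (T - cyc G f hf) (word K l) else 0 :=
    (IsML.word.lcomp _).iteLength (fun n => n ≠ 0)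
  have := hml.eq_zero_of_isPath 𝓑 (fun l hl hb => ?_) hl
  · simpa using this
  · rcases l with _ | ⟨b, l⟩
    · exact if_neg (by simp)
    · refine (if_pos (by simp)).trans ?_
      rw [LinearMap.sub_apply, h X r b l hl hb, rep_cyc f hf X r b l hl, sub_self]

theorem Rep.matrixDer {T : Q.T →ₗ[K] M} {f g : List (Q.Tot × ℤ) → M} (hT : Rep G T f)
    (hg : FML K g) (h : ∀ l, OneMark l → IsClosed G l → IsConst v 𝓑 (l.map Prod.fst) →
      coeffDer v c (f l) = g l) : Rep G (matrixDer v 𝓑.words c T) g := by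
  refine Rep.of_basis 𝓑 hg fun X r a l hl hb => ?_
  have hc : IsConst v 𝓑 (a :: l) := isConst_of_basis hb
  have h0 := coeffDer_apply v 𝓑.words c T (word K (a :: l))
  rw [𝓑.coeffDer_word_of_const v hc, map_zero, add_zero, hT X r a l hl, cycSum, map_splitSum] at h0
  rw [← h0]
  refine splitSum_congr fun m z hmz => h _ ⟨_, _, _, rfl⟩ ?_ ?_
  · obtain ⟨W, hW⟩ := isPath_rotate (hmz ▸ hl)
    exact ⟨W, r, by simpa [unmarked, Function.comp_def] using hW⟩
  · rw [unmarked_mark_map_fst, isConst_append]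
    subst hmz
    rw [← List.cons_append, isConst_append] at hc
    exact ⟨hc.2.map_twist r, hc.1⟩

theorem coeffDer_leadingWord_insert {p r : List (Q.Tot × ℤ)} (hp : IsConst v 𝓑 (p.map Prod.fst))
    (hr : IsConst v 𝓑 (r.map Prod.fst)) (x : Q.Tot) (n : ℤ) :
    coeffDer v 𝓑.words (leadingWord (p ++ (x, n) :: r)) =
      leadingWord (p ++ (coeffDer v 𝓑.tot x, n) :: r) := by
  have h (m : ℤ) (l : List Q.Tot) : coeffDer v 𝓑.words (m • word K l) =
    m • coeffDer v 𝓑.words (word K l) := map_zsmul _ _ _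
  rcases p with _ | ⟨y, p⟩
  · exact (h _ _).trans (congrArg _ (𝓑.coeffDer_word_insert v (p := []) (by simp) hr x))
  · rw [List.cons_append, List.cons_append, leadingWord, leadingWord, h, List.map_append,
      List.map_cons, ← List.cons_append, List.map_append, List.map_cons]
    exact congrArg _ (𝓑.coeffDer_word_insert v (p := y.1 :: p.map Prod.fst) hp hr x)

theorem matrixDer_hochschildB {μ : Q.Cochain} (hμ : IsOperation G id (G.fromInt 1) μ) :
    CycEq G (matrixDer v 𝓑.words 𝓑.words (hochschildB G μ))
      (hochschildB G (matrixDer v 𝓑.words 𝓑.tot μ)) := by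
  refine ((rep_hochschildB hμ.homog).matrixDer v 𝓑.words 𝓑 (fml_insL_id _ fml_leadingWord)
    fun l _ _ hc => ?_).cycEq (rep_hochschildB (hμ.matrixDer v 𝓑 𝓑).homog) fun _ _ _ => rfl
  unfold insL insOp splitSum₃
  rw [map_splitSum]
  refine splitSum_congr fun p s h => ?_
  rw [map_splitSum]
  refine splitSum_congr fun q r h' => ?_
  rw [← h, ← h', List.map_append, List.map_append, isConst_append, isConst_append] at hc
  simp only [bsum_idBlocks, one_smul]
  rw [markedLetter, coeffDer_leadingWord_insert v 𝓑 _ hc.2.2, hat,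
    coeffDer_of_const v 𝓑 𝓑 μ hc.2.1]
  · rfl
  · rw [map_fst_mapLetter]
    exact hc.1.map_sgn

theorem matrixDer_connesB {e : Q.Ob → Q.Tot} (he : ∀ X, coeffDer v 𝓑.tot (e X) = 0) :
    CycEq G (matrixDer v 𝓑.words 𝓑.words (connesB G e)) 0 := by
  refine ((rep_connesB e).matrixDer v 𝓑.words 𝓑 FML.zero fun l h1 ⟨X, r, hl⟩ hc => ?_).cycEq
    (g := fun _ => 0) (fun X r a l _ => (splitSum_eq_zero fun _ _ _ => rfl).symm) fun _ _ _ => rfl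
  rw [unitWord_eq (by obtain ⟨z, a, m, rfl⟩ := h1; simp) hl]
  refine 𝓑.coeffDer_word_of_const v fun x hx => ?_
  rcases List.mem_cons.mp hx with rfl | hx
  · exact he X
  · exact hc x hx

theorem IsStrictFunctor.rep_pushforward_leadingWord {F : Q.T →ₗ[K] Q'.Tot} {μ : Q.Cochain}
    {μ' : Q'.Cochain} {e : Q.Ob → Q.Tot} {e' : Q'.Ob → Q'.Tot}
    (hs : IsStrictFunctor G obj F μ μ' e e') :
    Rep G (pushforward G F) (bsum (functorBlocks F) leadingWord) :=
  (rep_leadingWord (G := G) (Q := Q')).comp_morphism hs.isFunctorial fml_leadingWord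
    hs.rep_pushforward

theorem IsStrictFunctor.rep_matrixDer_pushforward {F : Q.T →ₗ[K] Q'.Tot} {μ : Q.Cochain}
    {μ' : Q'.Cochain} {e : Q.Ob → Q.Tot} {e' : Q'.Ob → Q'.Tot}
    (hs : IsStrictFunctor G obj F μ μ' e e') :
    Rep G (matrixDer v 𝓑.words 𝓑'.words (pushforward G F))
      (insL (functorBlocks F) (LinearMap.id : Q'.Tot →ₗ[K] Q'.Tot)
        (hat (matrixDer v 𝓑.words 𝓑'.tot F)) leadingWord) :=
  hs.rep_pushforward_leadingWord.matrixDer v 𝓑'.words 𝓑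
    (hs.isFunctorial.toIsMarked.fml_insL _ (fml_hat _) fml_leadingWord)
    fun l _ _ hc => coeffDer_bsum_leadingWord v 𝓑 𝓑' hs.isFunctorial (fun l hl => by
      rw [hs.bsum_oneLetter, hat, coeffDer_of_const v 𝓑 𝓑' F hl, hat]) hc

end GQuiver

section Mem

variable {K A A' M : Type*} [Field K] [AddCommGroup M] [Module K M] {N : Submodule K M}

theorem splitSum_mem {f : List A → List A → M} {l : List A} (h : ∀ p q, p ++ q = l → f p q ∈ N) :
    splitSum f l ∈ N := N.sum_mem fun _ _ => h _ _ (List.take_append_drop _ _)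

theorem bsum_mem {B : List A → List (List A')} {f : List A' → M} {l : List A}
    (h : ∀ P ∈ B l, f P ∈ N) : bsum B f l ∈ N :=
  N.list_sum_mem fun x hx => by obtain ⟨P, hP, rfl⟩ := List.mem_map.mp hx; exact h P hP

end Mem

namespace GQuiver

variable {K : Type uK} [Field K] {Y : Type uY} [AddCommGroup Y] {G : GradingDatum Y}
  {Q : GQuiver.{uK, uY, uO, uH} K Y} {Q' : GQuiver.{uK, uY, uO', uH'} K Y}
  {M : Type*} [AddCommGroup M] [Module K M] {N : Submodule K M}
  {obj : Q.Ob → Q'.Ob} {B : List (Q.Tot × ℤ) → List (List (Q'.Tot × ℤ))}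
  {μ : Q.Cochain} {μ' : Q'.Cochain} {e : Q.Ob → Q.Tot} {e' : Q'.Ob → Q'.Tot}

/-! ### Degenerate chains -/

/-- The span of the words with a unit in positive position, and of the words of length one that
consist of a unit. -/
def degenerateSpan (e : Q.Ob → Q.Tot) : Submodule K Q.T :=
  Submodule.span K ({w | ∃ (a : Q.Tot) (p q : List Q.Tot) (X : Q.Ob),
      w = word K (a :: p ++ e X :: q)} ∪ {w | ∃ X : Q.Ob, w = word K [e X]})

/-- The word contains a multiple of a unit. -/
def HasUnit (e : Q.Ob → Q.Tot) (l : List Q.Tot) : Prop := ∃ X, ∃ n : ℤ, n • e X ∈ l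

theorem HasUnit.of_mem {l : List (Q.Tot × ℤ)} {X : Q.Ob} {n : ℤ} (h : (e X, n) ∈ l) :
    HasUnit e (l.map Prod.fst) :=
  ⟨X, 1, by rw [one_smul]; exact List.mem_map_of_mem (f := Prod.fst) h⟩

/-- The operator multiplies units with integers. -/
def ScalesUnits (e : Q.Ob → Q.Tot) (τ : Q.Tot →ₗ[K] Q.Tot) : Prop :=
  ∀ X, ∃ n : ℤ, τ (e X) = n • e X

theorem scalesUnits_id : ScalesUnits e (LinearMap.id : Q.Tot →ₗ[K] Q.Tot) :=
  fun X => ⟨1, (one_smul ℤ (e X)).symm⟩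

theorem IsStrict.scalesUnits_sgn (h : IsStrict G μ e) : ScalesUnits e (Q.sgn G) :=
  fun X => ⟨_, (h.isPath_unit X).sgn_single⟩

theorem IsStrict.scalesUnits_twist (h : IsStrict G μ e) (r : Y) : ScalesUnits e (Q.twist G r) := by
  unfold twist
  split_ifs
  · exact h.scalesUnits_sgn
  · exact scalesUnits_id

theorem _root_.FML.zsmul_apply {f : List (Q.Tot × ℤ) → M} (hf : FML K f) (p q : List (Q.Tot × ℤ))
    (m n : ℤ) (x : Q.Tot) : f (p ++ (m • x, n) :: q) = m • f (p ++ (x, n) :: q) :=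
  map_zsmul ((hf p q n).mk' _) m x

theorem _root_.FML.zero_apply {f : List (Q.Tot × ℤ) → M} (hf : FML K f) (p q : List (Q.Tot × ℤ))
    (n : ℤ) : f (p ++ (0, n) :: q) = 0 := (hf p q n).map_zero

theorem word_mem_degenerateSpan {l : List Q.Tot} (h : HasUnit e l) (a : Q.Tot) :
    word K (a :: l) ∈ degenerateSpan e := by
  obtain ⟨X, n, hx⟩ := h
  obtain ⟨p, q, rfl⟩ := List.append_of_mem hx
  have := map_zsmul ((IsML.word (K := K) (a :: p) q).mk' _) n (e X)
  simp only [IsLinearMap.mk'_apply, List.cons_append] at this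
  rw [this]
  exact zsmul_mem (Submodule.subset_span (.inl ⟨a, p, q, X, rfl⟩)) n

theorem leadingWord_mem_degenerateSpan {l : List (Q.Tot × ℤ)} {X : Q.Ob} (h : (e X, 0) ∈ l) :
    leadingWord l ∈ degenerateSpan e := by
  rcases l with _ | ⟨x, l⟩
  · simp at h
  · rcases List.mem_cons.mp h with rfl | h
    · rw [leadingWord, zero_smul]
      exact zero_mem _
    · exact zsmul_mem (word_mem_degenerateSpan (.of_mem h) _) _

theorem unitTensor_of_isPath {X Z : Q.Ob} {r : Y} {x : Q.Tot} (h : Q.IsPath G X Z r [x]) :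
    unitTensor e x = word K [e X, x] := by
  rw [← prependUnit_word h e, prependUnit, linExt_word, prependUnitFun]
  exact (mul_one _).symm

theorem unitWord_mem_degenerateSpan (he : ∀ X, Q.IsPath G X X (-G.fromInt 1) [e X])
    {l : List (Q.Tot × ℤ)} (h : HasUnit e (l.map Prod.fst)) : unitWord e l ∈ degenerateSpan e := by
  rw [unitWord, hat, prependUnit, linExt_word]
  generalize l.map Prod.fst = l at h
  rcases l with _ | ⟨a, l⟩
  · exact zero_mem _
  rw [prependUnitFun]
  obtain ⟨X, n, h⟩ := h
  rcases List.mem_cons.mp h with rfl | h'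
  · rw [map_zsmul, unitTensor_of_isPath (he X), smul_mul_assoc]
    refine zsmul_mem ?_ _
    have := word_mem_degenerateSpan (e := e) (l := e X :: l)
      ⟨X, 1, by rw [one_smul]; exact List.mem_cons_self⟩ (e X)
    simpa [word, mul_assoc] using this
  · clear h
    induction a using DirectSum.induction_on with
    | zero => rw [map_zero, zero_mul]; exact zero_mem _
    | of t a =>
      have := unitTensor_of_isPath (e := e) (IsPath.single (G := G) t.src t.tgt t.deg a)
      change unitTensor e (Q.inc t.src t.tgt t.deg a) * word K l ∈ _
      rw [this]
      have := word_mem_degenerateSpan (e := e) (l := Q.inc t.src t.tgt t.deg a :: l)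
        ⟨X, n, List.mem_cons_of_mem _ h'⟩ (e t.src)
      simpa [word, mul_assoc] using this
    | add x y hx hy => rw [map_add, add_mul]; exact add_mem hx hy

theorem IsStrictMorphism.bsum_mem_of_unit (hB : IsStrictMorphism G obj B μ μ' e e')
    {f : List (Q'.Tot × ℤ) → M} (hf : FML K f) {l : List (Q.Tot × ℤ)} {X : Q.Ob} {n : ℤ}
    (hl : (e X, n) ∈ l) (h : ∀ w, (e' (obj X), n) ∈ w → cnt w = cnt l → f w ∈ N) :
    bsum B f l ∈ N := by
  obtain ⟨p, q, rfl⟩ := List.append_of_mem hl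
  rw [hB.bsum_unit hf]
  refine bsum_mem fun p' hp => bsum_mem fun q' hq => h _ (by simp) ?_
  simp [hB.cnt_eq p p' hp, hB.cnt_eq q q' hq]

/-- The operation on chains which is represented by `f` maps degenerate words to `N`. -/
theorem Rep.mem_of_unit {T : Q.T →ₗ[K] M} {f : List (Q.Tot × ℤ) → M} (hT : Rep G T f)
    (hf : FML K f) (hμ : IsStrict G μ e) (h : ∀ l X, OneMark l → (e X, 0) ∈ l → f l ∈ N)
    {a : Q.Tot} {p q : List Q.Tot} {X Z : Q.Ob} {r : Y}
    (hl : Q.IsPath G Z Z r (a :: p ++ e X :: q)) : T (word K (a :: p ++ e X :: q)) ∈ N := by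
  have := hT Z r a (p ++ e X :: q) hl
  rw [List.cons_append, this]
  refine splitSum_mem fun m z hmz => ?_
  rcases List.append_eq_append_iff.mp hmz with ⟨z', rfl, h'⟩ | ⟨z', rfl, h'⟩
  · obtain ⟨n, hn⟩ := hμ.scalesUnits_twist r X
    rw [h', List.map_append, List.map_cons, hn, unmarked_append, unmarked_cons, List.append_assoc,
      List.cons_append, hf.zsmul_apply]
    exact zsmul_mem (h _ X ⟨z'.map (Q.twist G r) ++ e X :: q.map (Q.twist G r), a, m, by
      simp [unmarked]⟩ (by simp)) n
  · rcases z' with _ | ⟨x, z'⟩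
    · rw [List.nil_append] at h'
      obtain ⟨n, hn⟩ := hμ.scalesUnits_twist r X
      rw [← h', List.map_cons, hn, unmarked_cons]
      rw [List.cons_append]
      have := hf.zsmul_apply [] (unmarked (q.map (Q.twist G r)) ++ (a, 1) :: unmarked (p ++ [])) n 0
        (e X)
      rw [List.nil_append, List.nil_append] at this
      rw [this]
      exact zsmul_mem (h _ X ⟨e X :: q.map (Q.twist G r), a, p ++ [], by simp [unmarked]⟩
        (by simp)) n
    · obtain ⟨rfl, rfl⟩ : e X = x ∧ q = z' ++ z := by simpa using h'
      exact h _ X ⟨_, _, _, rfl⟩ (by simp [unmarked])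

end GQuiver

namespace GQuiver

variable {K : Type uK} [Field K] {Y : Type uY} [AddCommGroup Y] {G : GradingDatum Y}
  {Q : GQuiver.{uK, uY, uO, uH} K Y} {Q' : GQuiver.{uK, uY, uO', uH'} K Y}
  {M : Type*} [AddCommGroup M] [Module K M] {N : Submodule K M}
  {obj : Q.Ob → Q'.Ob} {B : List (Q.Tot × ℤ) → List (List (Q'.Tot × ℤ))}
  {μ : Q.Cochain} {μ' : Q'.Cochain} {e : Q.Ob → Q.Tot} {e' : Q'.Ob → Q'.Tot}

/-! ### Operations on degenerate chains -/

theorem fml_lead (hB : IsMarked.{max uK uY uO' uH'} K B) {κ : List (Q.Tot × ℤ) → Q'.Tot}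
    (hκ : FML K κ) : FML K (lead B κ) := by
  refine FML.splitSum (fun r => FML.bsum (fun P => ?_) r) fun q => ?_
  · exact fun p q n => (hκ p q n).lcomp ((IsML.word (K := K) [] (P.map Prod.fst)).mk' _)
  · exact hB.fml_bsum (fml_word.cons (κ q, 0))

/-- The operation vanishes on words that contain a unit. -/
def VanishesOnUnits (e : Q.Ob → Q.Tot) (T : Q.T →ₗ[K] M) : Prop :=
  ∀ p X q, T (word K (p ++ e X :: q)) = 0

theorem VanishesOnUnits.hat {T : Q.T →ₗ[K] M} (hT : VanishesOnUnits e T) {l : List (Q.Tot × ℤ)}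
    {X : Q.Ob} {n : ℤ} (h : (e X, n) ∈ l) : hat T l = 0 := by
  obtain ⟨p, q, rfl⟩ := List.append_of_mem h
  rw [GQuiver.hat, List.map_append, List.map_cons]
  exact hT _ _ _

theorem FML.mem_of_hasUnit {f : List (Q.Tot × ℤ) → M} (hf : FML K f) {p r : List (Q.Tot × ℤ)}
    (h : ∀ l X n, (e X, n) ∈ l → l.length = p.length → f (l ++ r) ∈ N)
    {ς : Q.Tot →ₗ[K] Q.Tot} (hς : ScalesUnits e ς) {X : Q.Ob} {n : ℤ} (hp : (e X, n) ∈ p) :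
    f (p.map (mapLetter ς) ++ r) ∈ N := by
  obtain ⟨p, q, rfl⟩ := List.append_of_mem hp
  obtain ⟨m, hm⟩ := hς X
  rw [List.map_append, List.map_cons, List.append_assoc, List.cons_append]
  change f (_ ++ (ς (e X), n) :: _) ∈ N
  rw [hm, hf.zsmul_apply]
  refine zsmul_mem ?_ m
  have := h (p.map (mapLetter ς) ++ (e X, n) :: q.map (mapLetter ς)) X n (by simp) (by simp)
  rwa [List.append_assoc, List.cons_append] at this

section InsH

variable (hB : IsStrictMorphism G obj B μ μ' e e') {ς : Q'.Tot →ₗ[K] Q'.Tot}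
  (hς : ScalesUnits e' ς) {T : Q.T →ₗ[K] Q'.Tot} (hT : VanishesOnUnits e T)

include hB hς hT

theorem insH_eq_zero {g : List (Q'.Tot × ℤ) → M} (hg : FML K g)
    (hg₀ : ∀ w X n, (e' X, n) ∈ w → 3 ≤ w.length → g w = 0) {l : List (Q.Tot × ℤ)} {X : Q.Ob}
    (hl : (e X, 0) ∈ l) : insH B ς (hat T) g l = 0 := by
  rw [insH, insOp, splitSum₃, ← Submodule.mem_bot K]
  refine splitSum_mem fun p s h => splitSum_mem fun q r h' => ?_
  by_cases hr : cnt r = 0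
  · rw [hr, zero_smul]; exact zero_mem _
  have hne (w : List (Q'.Tot × ℤ)) (hw : cnt w = cnt r) : w ≠ [] := by
    rintro rfl
    exact hr hw.symm
  refine zsmul_mem ?_ _
  rw [← h, ← h', List.mem_append, List.mem_append] at hl
  have hf (r' : List (Q'.Tot × ℤ)) : FML K fun p' : List (Q'.Tot × ℤ) =>
    g (p'.map (mapLetter ς) ++ markedLetter (hat T) q :: r') := (hg.append_right _).map ς
  rcases hl with hl | hl | hl
  · refine hB.bsum_mem_of_unit (FML.bsum hf r) hl fun w hw _ => bsum_mem fun r' hr' => ?_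
    have := List.length_pos_of_ne_nil (hne r' (hB.cnt_eq r r' hr'))
    refine FML.mem_of_hasUnit hg (fun l X n hl hlen => ?_) hς hw
    rw [Submodule.mem_bot]
    refine hg₀ _ X n (List.mem_append_left _ hl) ?_
    have := List.length_pos_of_mem hw
    simp only [List.length_append, List.length_cons]
    omega
  · refine bsum_mem fun p' _ => bsum_mem fun r' _ => ?_
    rw [markedLetter, hT.hat hl, hg.zero_apply]
    exact zero_mem _
  · refine bsum_mem fun p' _ => hB.bsum_mem_of_unit
      ((hg.append_left _).cons _) hl fun w hw hc => ?_
    rw [Submodule.mem_bot]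
    refine hg₀ _ _ _ (List.mem_append_right _ (List.mem_cons_of_mem _ hw)) ?_
    have : 2 ≤ w.length := by
      obtain ⟨w₁, w₂, rfl⟩ := List.append_of_mem hw
      rcases w₁ with _ | ⟨x, w₁⟩
      · rcases w₂ with _ | ⟨x, w₂⟩
        · exact absurd hc.symm hr
        · simp
      · simp only [List.cons_append, List.length_cons, List.length_append]
        omega
    simp only [List.length_append, List.length_cons]
    omega

theorem insH_unitWord_mem (he' : ∀ X, Q'.IsPath G X X (-G.fromInt 1) [e' X])
    {l : List (Q.Tot × ℤ)} {X : Q.Ob} {n : ℤ} (hl : (e X, n) ∈ l) :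
    insH B ς (hat T) (unitWord e') l ∈ degenerateSpan e' := by
  rw [insH, insOp, splitSum₃]
  refine splitSum_mem fun p s h => splitSum_mem fun q r h' => zsmul_mem ?_ _
  rw [← h, ← h', List.mem_append, List.mem_append] at hl
  have hg := fml_unitWord (K := K) e'
  rcases hl with hl | hl | hl
  · refine hB.bsum_mem_of_unit (FML.bsum (fun r' => (hg.append_right _).map ς) r) hl
      fun w hw _ => bsum_mem fun r' _ => FML.mem_of_hasUnit hg (fun l X n hl _ => ?_) hς hw
    exact unitWord_mem_degenerateSpan he' (.of_mem (List.mem_append_left _ hl))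
  · refine bsum_mem fun p' _ => bsum_mem fun r' _ => ?_
    rw [markedLetter, hT.hat hl, hg.zero_apply]
    exact zero_mem _
  · refine bsum_mem fun p' _ => hB.bsum_mem_of_unit
      ((hg.append_left _).cons _) hl fun w hw hc => ?_
    exact unitWord_mem_degenerateSpan he'
      (.of_mem (List.mem_append_right _ (List.mem_cons_of_mem _ hw)))

end InsH

theorem insH_singleton {ς : Q'.Tot →ₗ[K] Q'.Tot} {T : Q.T →ₗ[K] Q'.Tot} (hT : T 1 = 0)
    {g : List (Q'.Tot × ℤ) → M} (hg : FML K g) (x : Q.Tot × ℤ) : insH B ς (hat T) g [x] = 0 := by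
  have h0 : hat T [] = 0 := hT
  have h1 : bsum B (fun p' => bsum B (fun r' => g (p'.map (mapLetter ς) ++ (0, 0) :: r')) [x]) [] =
      0 := (bsum_congr fun p' _ => (bsum_congr fun r' _ => hg.zero_apply _ _ _).trans
        (bsum_zero _ _)).trans (bsum_zero _ _)
  simp [insH, insOp, splitSum₃, splitSum_cons, h0, h1, markedLetter]

theorem lead_mem_degenerateSpan (hB : IsStrictMorphism G obj B μ μ' e e')
    {κ : List (Q.Tot × ℤ) → Q'.Tot} (hκ : ∀ q X, (e X, 0) ∈ q → κ q = 0) {l : List (Q.Tot × ℤ)}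
    {X : Q.Ob} (hl : (e X, 0) ∈ l) : lead B κ l ∈ degenerateSpan e' := by
  refine splitSum_mem fun q r h => ?_
  rw [← h, List.mem_append] at hl
  rcases hl with hl | hl
  · rw [hκ q X hl]
    refine bsum_mem fun P _ => ?_
    rw [word_zero_cons]
    exact zero_mem _
  · exact hB.bsum_mem_of_unit (fml_word.cons (κ q, 0)) hl fun w hw _ =>
      word_mem_degenerateSpan (.of_mem hw) _

theorem lead_singleton {κ : List (Q.Tot × ℤ) → Q'.Tot} (h₀ : κ [] = 0) {x : Q.Tot × ℤ}
    (h₁ : κ [x] = 0) : lead B κ [x] = 0 := by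
  simp [lead, splitSum_cons, h₀, h₁, word_zero_cons, bsum_zero]

theorem IsStrict.apply_of_mem (hμ : IsStrict G μ e) {l : List (Q.Tot × ℤ)} {X : Q.Ob} {n : ℤ}
    (h : (e X, n) ∈ l) (hl : 3 ≤ l.length) : hat μ l = 0 := by
  obtain ⟨p, q, rfl⟩ := List.append_of_mem h
  rw [hat, List.map_append, List.map_cons]
  refine hμ.unit_zero _ _ _ ?_
  simp only [List.length_append, List.length_cons] at hl
  simp only [List.length_map]
  omega

theorem IsStrictMorphism.bsum_oneLetter_of_mem (hB : IsStrictMorphism G obj B μ μ' e e')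
    {l : List (Q.Tot × ℤ)} {X : Q.Ob} {n : ℤ} (h : (e X, n) ∈ l) (hl : 3 ≤ l.length) :
    bsum B Conv.oneLetter l = 0 := by
  obtain ⟨p, q, rfl⟩ := List.append_of_mem h
  rw [hB.bsum_oneLetter_unit, if_neg]
  rintro ⟨rfl, rfl⟩
  simp at hl

variable {φ : Q.Cochain} {ψ : Q.T →ₗ[K] Q'.Tot}

theorem fml_homotopyTerm (hB : IsFunctorial G obj B) :
    FML K (homotopyTerm G B φ μ' ψ) :=
  (hB.toIsMarked.fml_insH _ (fml_hat ψ) (fml_hat μ')).sub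
    ((isMarked_idBlocks (K := K) (V := Q.Tot)).fml_insH _ (fml_hat φ) (fml_bsum_oneLetter hB))

theorem homotopyTerm_of_mem (hB : IsStrictMorphism G obj B μ μ' e e') (hμ : IsStrict G μ e)
    (hμ' : IsStrict G μ' e') (hφ : VanishesOnUnits e φ) (hψ : VanishesOnUnits e ψ)
    {l : List (Q.Tot × ℤ)} {X : Q.Ob} (hl : (e X, 0) ∈ l) : homotopyTerm G B φ μ' ψ l = 0 := by
  rw [homotopyTerm, sourceTerm,
    insH_eq_zero hB scalesUnits_id hψ (fml_hat μ') (fun w X n => hμ'.apply_of_mem) hl,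
    insH_eq_zero (isStrictMorphism_idBlocks (G := G) μ e) hμ.scalesUnits_sgn hφ
      (fml_bsum_oneLetter hB.toIsFunctorial) (fun w X n => hB.bsum_oneLetter_of_mem) hl, sub_zero]

end GQuiver

namespace GQuiver

variable {k : Type*} {K : Type uK} [Field k] [Field K] [Algebra k K] (v : Derivation k K K)
  {Y : Type uY} [AddCommGroup Y] {G : GradingDatum Y}
  {Q : GQuiver.{uK, uY, uO, uH} K Y} {Q' : GQuiver.{uK, uY, uO', uH'} K Y}
  {M : Type*} [AddCommGroup M] [Module K M] {N : Submodule K M}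
  (𝓑 : HomBases Q) (𝓑' : HomBases Q') {obj : Q.Ob → Q'.Ob}
  {μ : Q.Cochain} {e : Q.Ob → Q.Tot} {e' : Q'.Ob → Q'.Tot}

/-! ### Bases of chains -/

theorem _root_.IsML.mem_of_basis {f : List Q.Tot → M} (hf : IsML K f)
    (h : ∀ l, (∀ x ∈ l, x ∈ Set.range 𝓑.tot) → f l ∈ N) (l : List Q.Tot) : f l ∈ N := by
  rw [← Submodule.Quotient.mk_eq_zero, ← Submodule.mkQ_apply]
  refine (hf.lcomp N.mkQ).eq_zero_of_forall_labelled (fun L l hl => ?_) l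
  refine (hf.lcomp N.mkQ).eq_zero_of_labelled 𝓑 (fun l' _ hb => ?_) hl
  rw [Submodule.mkQ_apply, Submodule.Quotient.mk_eq_zero]
  exact h l' hb

theorem _root_.HomBases.exists_words {l : List Q.Tot} (h : ∀ x ∈ l, x ∈ Set.range 𝓑.tot) :
    ∃ w : FreeMonoid _, w.toList.map 𝓑.tot = l := by
  induction l with
  | nil => exact ⟨1, rfl⟩
  | cons x l ih =>
    obtain ⟨i, rfl⟩ := h x (by simp)
    obtain ⟨w, hw⟩ := ih fun y hy => h y (by simp [hy])
    exact ⟨.of i * w, by simp [hw]⟩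

/-- The basis elements of the space of chains of degree `y`. -/
def chainIndex (G : GradingDatum Y) (y : Y) :
    Set (FreeMonoid (Σ l : Label Q.Ob Y, 𝓑.idx l.src l.tgt l.deg)) :=
  {w | w.toList.map 𝓑.tot ≠ [] ∧ ∃ X, Q.IsPath G X X (y - G.fromInt 1) (w.toList.map 𝓑.tot)}

/-- The basis elements of the space of degenerate chains. -/
def degenerateIndex (e : Q.Ob → Q.Tot) :
    Set (FreeMonoid (Σ l : Label Q.Ob Y, 𝓑.idx l.src l.tgt l.deg)) :=
  {w | (∃ a p X q, w.toList.map 𝓑.tot = a :: p ++ e X :: q) ∨ ∃ X, w.toList.map 𝓑.tot = [e X]}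

theorem chains_eq_span (y : Y) :
    Q.chains G y = Submodule.span K (𝓑.words '' chainIndex 𝓑 G y) := by
  refine le_antisymm (Submodule.span_le.mpr ?_) (Submodule.span_le.mpr ?_)
  · rintro _ ⟨X, l, hl, hp, rfl⟩
    have := ((IsML.word (K := K)).iteLength (fun n => n ≠ 0)).mem_of_isPath 𝓑
      (N := Submodule.span K (𝓑.words '' chainIndex 𝓑 G y)) (fun l hl hb => ?_) hp
    · simpa [hl] using this
    · split_ifs with h
      · obtain ⟨w, rfl⟩ := 𝓑.exists_words hb
        exact Submodule.subset_span ⟨w, ⟨by simpa using h, X, hl⟩, 𝓑.words_apply w⟩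
      · exact zero_mem _
  · rintro _ ⟨w, ⟨h, X, hX⟩, rfl⟩
    exact Submodule.subset_span ⟨X, _, h, hX, 𝓑.words_apply w⟩

theorem degenerateSpan_eq_span (he : ∀ X, e X ∈ Set.range 𝓑.tot) :
    degenerateSpan e = Submodule.span K (𝓑.words '' degenerateIndex 𝓑 e) := by
  refine le_antisymm (Submodule.span_le.mpr ?_) (Submodule.span_le.mpr ?_)
  · rintro _ (⟨a, p, q, X, rfl⟩ | ⟨X, rfl⟩)
    · have h₁ := ((IsML.word (K := K)).append_right (e X :: q)).iteLength (fun n => n ≠ 0)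
      have := h₁.mem_of_basis 𝓑
        (N := Submodule.span K (𝓑.words '' degenerateIndex 𝓑 e)) (fun p hp => ?_) (a :: p)
      · simpa using this
      · split_ifs with h
        · have h₂ := (IsML.word (K := K)).append_left (p ++ [e X])
          simp only [List.append_assoc, List.singleton_append] at h₂
          refine h₂.mem_of_basis 𝓑 (fun q hq => ?_) q
          obtain ⟨w, hw⟩ := 𝓑.exists_words (l := p ++ e X :: q) fun x hx => by
            rcases List.mem_append.mp hx with hx | hx
            · exact hp x hx
            · rcases List.mem_cons.mp hx with rfl | hx
              · exact he X
              · exact hq x hx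
          rcases p with _ | ⟨b, p⟩
          · exact absurd rfl h
          · exact Submodule.subset_span ⟨w, .inl ⟨b, p, X, q, hw⟩, by rw [𝓑.words_apply, hw]⟩
        · exact zero_mem _
    · obtain ⟨i, hi⟩ := he X
      exact Submodule.subset_span ⟨.of i, .inr ⟨X, by simp [hi]⟩, by
        rw [𝓑.words_apply]; simp [hi]⟩
  · rintro _ ⟨w, ⟨a, p, X, q, h⟩ | ⟨X, h⟩, rfl⟩
    · exact Submodule.subset_span (.inl ⟨a, p, q, X, by rw [𝓑.words_apply, h]⟩)
    · exact Submodule.subset_span (.inr ⟨X, by rw [𝓑.words_apply, h]⟩)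

theorem coeffDer_mem_chains {y : Y} {x : Q.T} (hx : x ∈ Q.chains G y) :
    coeffDer v 𝓑.words x ∈ Q.chains G y := by
  rw [chains_eq_span 𝓑] at hx ⊢
  exact coeffDer_mem_span v _ hx

theorem coeffDer_mem_degenerateSpan (he : ∀ X, e X ∈ Set.range 𝓑.tot) {x : Q.T}
    (hx : x ∈ degenerateSpan e) : coeffDer v 𝓑.words x ∈ degenerateSpan e := by
  rw [degenerateSpan_eq_span 𝓑 he] at hx ⊢
  exact coeffDer_mem_span v _ hx

theorem Rep.mem_of_mem_degenerateSpan (he : ∀ X, e X ∈ Set.range 𝓑.tot) (hμ : IsStrict G μ e)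
    {T : Q.T →ₗ[K] M} {f : List (Q.Tot × ℤ) → M} (hT : Rep G T f) (hf : FML K f)
    (h : ∀ l X, OneMark l → (e X, 0) ∈ l → f l ∈ N) (h₁ : ∀ X, f [(e X, 1)] ∈ N) {y : Y} {x : Q.T}
    (hx : x ∈ degenerateSpan e) (hx' : x ∈ Q.chains G y) : T x ∈ N := by
  suffices H : x ∈ Submodule.span K (𝓑.words '' (degenerateIndex 𝓑 e ∩ chainIndex 𝓑 G y)) by
    refine Submodule.span_le (p := N.comap T).mpr ?_ H
    rintro _ ⟨w, ⟨⟨a, p, X, q, hw⟩ | ⟨X, hw⟩, -, Z, hZ⟩, rfl⟩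
    · rw [hw] at hZ
      change T _ ∈ N
      rw [𝓑.words_apply, hw]
      exact hT.mem_of_unit hf hμ h hZ
    · change T _ ∈ N
      rw [𝓑.words_apply, hw, hT X _ _ _ (hμ.isPath_unit X)]
      simpa [cycSum, splitSum_cons, unmarked] using h₁ X
  rw [degenerateSpan_eq_span 𝓑 he, 𝓑.words.mem_span_image] at hx
  rw [chains_eq_span 𝓑, 𝓑.words.mem_span_image] at hx'
  rw [𝓑.words.mem_span_image]
  exact Set.subset_inter hx hx'

/-! ### Derivatives of strict operations vanish on units -/

theorem vanishesOnUnits_of_basis {T : Q.T →ₗ[K] M} (h : ∀ p X q, (∀ x ∈ p, x ∈ Set.range 𝓑.tot) →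
    (∀ x ∈ q, x ∈ Set.range 𝓑.tot) → T (word K (p ++ e X :: q)) = 0) : VanishesOnUnits e T := by
  intro p X q
  rw [← Submodule.mem_bot K]
  refine ((IsML.word.lcomp T).append_right (e X :: q)).mem_of_basis 𝓑 (fun p hp => ?_) p
  have := ((IsML.word (K := K)).lcomp T).append_left (p ++ [e X])
  simp only [List.append_assoc, List.singleton_append] at this
  exact this.mem_of_basis 𝓑 (fun q hq => (Submodule.mem_bot K).mpr (h p X q hp hq)) q

theorem IsStrictUnit.apply_left_of_mem_range (hu : IsStrictUnit G μ e)
    (hμ : IsOperation G id (G.fromInt 1) μ) {X : Q.Ob} {x : Q.Tot} (hx : x ∈ Set.range 𝓑.tot) :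
    μ (word K [e X, x]) = x ∨ μ (word K [e X, x]) = 0 := by
  obtain ⟨⟨t, i⟩, rfl⟩ := hx
  rw [𝓑.tot_apply]
  by_cases h : X = t.src
  · subst h
    exact .inl (hu.unit_left _ _ _ _ (IsPath.single _ _ _ _))
  · obtain ⟨a, ha⟩ := (hu.isPath_unit X).exists_of_single
    rw [ha]
    exact .inr (hμ.not_composable [] [] ⟨X, X, _⟩ t a _ h)

theorem IsStrictUnit.apply_right_of_mem_range (hu : IsStrictUnit G μ e)
    (hμ : IsOperation G id (G.fromInt 1) μ) {X : Q.Ob} {x : Q.Tot} (hx : x ∈ Set.range 𝓑.tot) :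
    μ (word K [x, e X]) = -Q.sgn G x ∨ μ (word K [x, e X]) = 0 := by
  obtain ⟨⟨t, i⟩, rfl⟩ := hx
  rw [𝓑.tot_apply]
  by_cases h : t.tgt = X
  · subst h
    exact .inl (hu.unit_right _ _ _ _ (IsPath.single _ _ _ _))
  · obtain ⟨a, ha⟩ := (hu.isPath_unit X).exists_of_single
    rw [ha]
    exact .inr (hμ.not_composable [] [] t ⟨X, X, _⟩ _ a h)

theorem IsStrictUnit.vanishesOnUnits_matrixDer (hu : IsStrictUnit G μ e)
    (hμ : IsOperation G id (G.fromInt 1) μ) (he : ∀ X, e X ∈ Set.range 𝓑.tot) :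
    VanishesOnUnits e (matrixDer v 𝓑.words 𝓑.tot μ) := by
  refine vanishesOnUnits_of_basis 𝓑 fun p X q hp hq => ?_
  have hc : IsConst v 𝓑 (p ++ e X :: q) := isConst_append.mpr ⟨isConst_of_basis hp,
    isConst_of_basis fun x hx => (List.mem_cons.mp hx).elim (fun h => h ▸ he X) (hq x)⟩
  rw [← coeffDer_of_const v 𝓑 𝓑 μ hc]
  by_cases h : p.length + q.length ≠ 1
  · rw [hu.unit_zero p X q h, map_zero]
  rcases p with _ | ⟨x, _ | ⟨x', p⟩⟩
  · obtain ⟨x, rfl⟩ : ∃ x, q = [x] := List.length_eq_one_iff.mp (by simpa using h)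
    rcases hu.apply_left_of_mem_range 𝓑 hμ (X := X) (hq x (by simp)) with h | h
    · rw [List.nil_append, h]
      exact coeffDer_of_mem_range v 𝓑 (hq x (by simp))
    · rw [List.nil_append, h, map_zero]
  · obtain rfl : q = [] := List.length_eq_zero_iff.mp (by simp at h; simpa using h)
    rcases hu.apply_right_of_mem_range 𝓑 hμ (X := X) (hp x (by simp)) with h | h
    · rw [List.singleton_append, h, map_neg, coeffDer_sgn, coeffDer_of_mem_range v 𝓑 (hp x (by simp)),
        map_zero, neg_zero]
    · rw [List.singleton_append, h, map_zero]
  · simp only [List.length_cons] at h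
    omega

theorem vanishesOnUnits_matrixDer {F : Q.T →ₗ[K] Q'.Tot} {μ' : Q'.Cochain}
    (hF : IsStrictFunctor G obj F μ μ' e e') (he : ∀ X, e X ∈ Set.range 𝓑.tot)
    (he' : ∀ X, e' X ∈ Set.range 𝓑'.tot) :
    VanishesOnUnits e (matrixDer v 𝓑.words 𝓑'.tot F) := by
  refine vanishesOnUnits_of_basis 𝓑 fun p X q hp hq => ?_
  have hc : IsConst v 𝓑 (p ++ e X :: q) := isConst_append.mpr ⟨isConst_of_basis hp,
    isConst_of_basis fun x hx => (List.mem_cons.mp hx).elim (fun h => h ▸ he X) (hq x)⟩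
  rw [← coeffDer_of_const v 𝓑 𝓑' F hc]
  by_cases h : p ≠ [] ∨ q ≠ []
  · rw [hF.unit_zero p X q h, map_zero]
  · push Not at h
    obtain ⟨rfl, rfl⟩ := h
    rw [List.nil_append, hF.unit]
    exact coeffDer_of_mem_range v 𝓑' (he' _)

theorem ePlus_mem_range (X : Q.Ob) : Q.ePlus X ∈ Set.range 𝓑.plus.tot := by
  exact ⟨⟨⟨X, X, 0⟩, ⟨.inr ⟨⟨rfl, rfl⟩⟩⟩⟩, (𝓑.plus.tot_apply ⟨X, X, 0⟩ _).trans
    (congrArg _ (𝓑.plus_basis_inr X X 0 _))⟩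

end GQuiver

namespace GQuiver

variable {K : Type uK} [Field K] {Y : Type uY} [AddCommGroup Y] {G : GradingDatum Y}
  {Q : GQuiver.{uK, uY, uO, uH} K Y} {Q' : GQuiver.{uK, uY, uO', uH'} K Y}
  {M : Type*} [AddCommGroup M] [Module K M] {N : Submodule K M} {obj : Q.Ob → Q'.Ob}
  {B : List (Q.Tot × ℤ) → List (List (Q'.Tot × ℤ))} {e : Q.Ob → Q.Tot} {e' : Q'.Ob → Q'.Tot}

/-! ### Degrees of operations on chains -/

theorem word_mem_chains {X : Q.Ob} {r y : Y} {l : List Q.Tot} (hl : l ≠ [])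
    (h : Q.IsPath G X X r l) (hr : r + G.fromInt 1 = y) : word K l ∈ Q.chains G y :=
  Submodule.subset_span ⟨X, l, hl, h.cast (by rw [← hr, add_sub_cancel_right]), rfl⟩

/-- The function of closed paths of reduced degree `r` has values in `N`. -/
def MapsPaths (G : GradingDatum Y) (f : List (Q.Tot × ℤ) → M) (r : Y) (N : Submodule K M) : Prop :=
  ∀ X l, l ≠ [] → Q.IsPath G X X r (l.map Prod.fst) → f l ∈ N

theorem Rep.mem_of_mem_chains {T : Q.T →ₗ[K] M} {f : List (Q.Tot × ℤ) → M} (hT : Rep G T f) {y : Y}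
    (h : MapsPaths G f (y - G.fromInt 1) N) {x : Q.T} (hx : x ∈ Q.chains G y) : T x ∈ N := by
  refine Submodule.span_le (p := N.comap T).mpr ?_ hx
  rintro _ ⟨X, l, hl, hp, rfl⟩
  obtain ⟨a, l, rfl⟩ := List.exists_cons_of_ne_nil hl
  change T _ ∈ N
  rw [hT X _ a l hp]
  refine splitSum_mem fun m z hmz => ?_
  obtain ⟨W, hW⟩ := isPath_rotate (hmz ▸ hp)
  exact h W _ (by simp) (by simpa [unmarked, Function.comp_def] using hW)

theorem mapsPaths_leadingWord {r y : Y} (h : r + G.fromInt 1 = y) :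
    MapsPaths G (leadingWord : List (Q.Tot × ℤ) → Q.T) r (Q.chains G y) := fun X l hl hp => by
  obtain ⟨a, l, rfl⟩ := List.exists_cons_of_ne_nil hl
  exact zsmul_mem (word_mem_chains (by simp) hp h) _

theorem mapsPaths_lead (hB : IsFunctorial G obj B) {κ : List (Q.Tot × ℤ) → Q'.Tot} {c r y : Y}
    (hκ : Homog G obj c κ) (h : r + c + G.fromInt 1 = y) :
    MapsPaths G (lead B κ) r (Q'.chains G y) := fun X l hl hp => by
  refine splitSum_mem fun q s hqs => bsum_mem fun P hP => ?_
  rw [← hqs, List.map_append] at hp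
  obtain ⟨W, r₁, r₂, h1, h2, rfl⟩ := hp.of_append
  refine word_mem_chains (by simp) ((hκ _ _ _ _ h1).cons' (hB.isPath _ _ _ _ h2 P hP)) ?_
  rw [← h]
  abel

theorem mapsPaths_insOp {c c' : Y} {w : List (Q.Tot × ℤ) → ℤ} (hB : IsFunctorial G obj B)
    {κ : List (Q.Tot × ℤ) → Q'.Tot} (hκ : Homog G obj c κ) {g : List (Q'.Tot × ℤ) → M} {r : Y}
    (hg : MapsPaths G g (r + c) N) :
    MapsPaths G (insOp w B (mapLetter (Q'.koszul G c')) (markedLetter κ) g) r N :=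
  fun X l hl hp => by
  unfold insOp splitSum₃
  refine splitSum_mem fun p u hu => splitSum_mem fun q s hs => zsmul_mem (S := Submodule K M) ?_ _
  refine bsum_mem fun P hP => bsum_mem fun P' hP' => hg (obj X) _ (by simp) ?_
  exact hκ.isPath_insert hB (by rwa [hs, hu]) hP hP'

/-- The span of the chains which start with a unit. -/
def unitChains (G : GradingDatum Y) (e : Q.Ob → Q.Tot) : Submodule K Q.T :=
  Submodule.span K {w | ∃ (X : Q.Ob) (r : Y) (l : List Q.Tot), Q.IsPath G X X r (e X :: l) ∧
    w = word K (e X :: l)}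

variable (he : ∀ X, Q.IsPath G X X (-G.fromInt 1) [e X])

include he in
theorem mapsPaths_unitWord (r : Y) :
    MapsPaths G (unitWord e) r (unitChains G e ⊓ Q.chains G r) := fun X l hl hp => by
  rw [unitWord_eq hl hp]
  have := (he X).cons' hp
  exact ⟨Submodule.subset_span ⟨X, _, _, this, rfl⟩, word_mem_chains (by simp) this (by abel)⟩

theorem Rep.mem_of_mem_unitChains {T : Q.T →ₗ[K] M} {f : List (Q.Tot × ℤ) → M} (hT : Rep G T f)
    (h : ∀ l X, (e X, 1) ∈ l → f l ∈ N) {x : Q.T} (hx : x ∈ unitChains G e) : T x ∈ N := by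
  refine Submodule.span_le (p := N.comap T).mpr ?_ hx
  rintro _ ⟨X, r, l, hp, rfl⟩
  change T _ ∈ N
  rw [hT X _ _ l hp]
  exact splitSum_mem fun m z _ => h _ X (by simp)

end GQuiver

namespace GQuiver

variable {K : Type uK} [Field K] {Y : Type uY} [AddCommGroup Y] {G : GradingDatum Y}
  {Q : GQuiver.{uK, uY, uO, uH} K Y} {Q' : GQuiver.{uK, uY, uO', uH'} K Y}
  {M : Type*} [AddCommGroup M] [Module K M] {N : Submodule K M} {obj : Q.Ob → Q'.Ob}
  {B : List (Q.Tot × ℤ) → List (List (Q'.Tot × ℤ))} {e : Q.Ob → Q.Tot} {e' : Q'.Ob → Q'.Tot}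
  {μ φ : Q.Cochain} {μ' : Q'.Cochain}

/-- The operation `T` maps chains to chains, with degree `c`. -/
def HasDegree (G : GradingDatum Y) (T : Q.T →ₗ[K] Q'.T) (c : Y) : Prop :=
  ∀ y x, x ∈ Q.chains G y → T x ∈ Q'.chains G (y + c)

/-- The operation `T` maps degenerate chains to degenerate chains. -/
def MapsDegenerate (G : GradingDatum Y) (e : Q.Ob → Q.Tot) (e' : Q'.Ob → Q'.Tot)
    (T : Q.T →ₗ[K] Q'.T) : Prop :=
  ∀ y x, x ∈ degenerateSpan e → x ∈ Q.chains G y → T x ∈ degenerateSpan e'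

theorem HasDegree.cast {T : Q.T →ₗ[K] Q'.T} {c c' : Y} (h : HasDegree G T c) (hc : c = c') :
    HasDegree G T c' := hc ▸ h

theorem Rep.hasDegree_lead (hB : IsFunctorial G obj B) {T : Q.T →ₗ[K] Q'.T}
    {κ : List (Q.Tot × ℤ) → Q'.Tot} {c : Y} (hκ : Homog G obj c κ) (hT : Rep G T (lead B κ)) :
    HasDegree G T c := fun _ _ hx =>
  hT.mem_of_mem_chains (mapsPaths_lead hB hκ (by abel)) hx

theorem hasDegree_hochschildB (hμ : Homog G id (G.fromInt 1) (hat μ)) :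
    HasDegree G (hochschildB G μ) (G.fromInt 1) := fun y x hx => by
  have hT := rep_hochschildB hμ
  rw [← koszul_fromInt_one] at hT
  exact hT.mem_of_mem_chains (mapsPaths_insOp isFunctorial_idBlocks hμ
    (mapsPaths_leadingWord (by abel))) hx

theorem hasDegree_connesB (he : ∀ X, Q.IsPath G X X (-G.fromInt 1) [e X]) :
    HasDegree G (connesB G e) (-G.fromInt 1) := fun y x hx => by
  have := ((rep_connesB e).mem_of_mem_chains (mapsPaths_unitWord he _) hx).2
  rwa [sub_eq_add_neg] at this

theorem hasDegree_bOneOne (hμ : Homog G id (G.fromInt 1) (hat μ))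
    (hφ : Homog G id (G.fromInt 1) (hat φ)) : HasDegree G (bOneOne G μ φ) (G.fromInt 2) :=
  ((rep_bOneOne μ φ).hasDegree_lead isFunctorial_idBlocks (homog_insH_id hμ hφ)).cast
    (by rw [← map_add, one_add_one_eq_two])

theorem Rep.mem_unitChains_of_insH (he' : ∀ X, Q'.IsPath G X X (-G.fromInt 1) [e' X])
    (hB : IsFunctorial G obj B) {T : Q.T →ₗ[K] Q'.T} {κ : List (Q.Tot × ℤ) → Q'.Tot} {c c' : Y}
    (hκ : Homog G obj c κ) (hT : Rep G T (insH B (Q'.koszul G c') κ (unitWord e'))) {y : Y}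
    {x : Q.T} (hx : x ∈ Q.chains G y) :
    T x ∈ unitChains G e' ⊓ Q'.chains G (y + (c - G.fromInt 1)) :=
  hT.mem_of_mem_chains (mapsPaths_insOp hB hκ (by
    rw [show y - G.fromInt 1 + c = y + (c - G.fromInt 1) by abel]
    exact mapsPaths_unitWord he' _)) hx

theorem connesBOneOne_mem_unitChains (he : ∀ X, Q.IsPath G X X (-G.fromInt 1) [e X])
    (hφ : Homog G id (G.fromInt 1) (hat φ)) {y : Y} {x : Q.T} (hx : x ∈ Q.chains G y) :
    connesBOneOne G e φ x ∈ unitChains G e ⊓ Q.chains G y := by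
  have hT := rep_connesBOneOne (G := G) e φ
  rw [← koszul_fromInt_one] at hT
  simpa using hT.mem_unitChains_of_insH he isFunctorial_idBlocks hφ hx

theorem hasDegree_connesBOneOne (he : ∀ X, Q.IsPath G X X (-G.fromInt 1) [e X])
    (hφ : Homog G id (G.fromInt 1) (hat φ)) : HasDegree G (connesBOneOne G e φ) 0 :=
  fun y x hx => by
  rw [add_zero]
  exact (connesBOneOne_mem_unitChains he hφ hx).2

/-! ### Compositions of operations that insert units -/

theorem connesB_mem_degenerateSpan (he : ∀ X, Q.IsPath G X X (-G.fromInt 1) [e X]) {x : Q.T}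
    (hx : x ∈ unitChains G e) : connesB G e x ∈ degenerateSpan e :=
  (rep_connesB e).mem_of_mem_unitChains
    (fun _ _ h => unitWord_mem_degenerateSpan he (.of_mem h)) hx

theorem connesBOneOne_mem_degenerateSpan (hμ : IsStrict G μ e) (hφ : VanishesOnUnits e φ) {x : Q.T}
    (hx : x ∈ unitChains G e) : connesBOneOne G e φ x ∈ degenerateSpan e :=
  (rep_connesBOneOne e φ).mem_of_mem_unitChains
    (fun _ _ h => insH_unitWord_mem (isStrictMorphism_idBlocks (G := G) μ e) hμ.scalesUnits_sgn hφ
      hμ.isPath_unit h) hx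

/-! ### Operations on degenerate chains -/

variable (𝓑 : HomBases Q) (he : ∀ X, e X ∈ Set.range 𝓑.tot) (hμ : IsStrict G μ e)

include he hμ

theorem mapsDegenerate_insH (hB : IsStrictMorphism G obj B μ μ' e e') (hμ' : IsStrict G μ' e')
    {ς : Q'.Tot →ₗ[K] Q'.Tot} (hς : ScalesUnits e' ς) {ψ : Q.T →ₗ[K] Q'.Tot}
    (hψ : VanishesOnUnits e ψ) {T : Q.T →ₗ[K] Q'.T}
    (hT : Rep G T (insH B ς (hat ψ) (unitWord e'))) : MapsDegenerate G e e' T := fun _ _ hx hx' =>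
  hT.mem_of_mem_degenerateSpan 𝓑 he hμ (hB.toIsMarked.fml_insH _ (fml_hat ψ) (fml_unitWord e'))
    (fun _ _ _ h => insH_unitWord_mem hB hς hψ hμ'.isPath_unit h)
    (fun _ => insH_unitWord_mem hB hς hψ hμ'.isPath_unit (List.mem_singleton_self _)) hx hx'

theorem mapsDegenerate_lead (hB : IsStrictMorphism G obj B μ μ' e e')
    {κ : List (Q.Tot × ℤ) → Q'.Tot} (hκ : FML K κ) (h : ∀ q X, (e X, 0) ∈ q → κ q = 0)
    (h₀ : κ [] = 0) (h₁ : ∀ X, κ [(e X, 1)] = 0) {T : Q.T →ₗ[K] Q'.T} (hT : Rep G T (lead B κ)) :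
    MapsDegenerate G e e' T := fun _ _ hx hx' =>
  hT.mem_of_mem_degenerateSpan 𝓑 he hμ (fml_lead hB.toIsMarked hκ)
    (fun _ _ _ hl => lead_mem_degenerateSpan hB h hl)
    (fun X => by rw [lead_singleton h₀ (h₁ X)]; exact zero_mem _) hx hx'

theorem mapsDegenerate_morphism (hB : IsStrictMorphism G obj B μ μ' e e') {T : Q.T →ₗ[K] Q'.T}
    (hT : Rep G T (bsum B leadingWord)) : MapsDegenerate G e e' T := fun _ _ hx hx' =>
  hT.mem_of_mem_degenerateSpan 𝓑 he hμ (hB.toIsMarked.fml_bsum fml_leadingWord)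
    (fun _ _ _ hl => hB.bsum_mem_of_unit fml_leadingWord hl fun _ hw _ =>
      leadingWord_mem_degenerateSpan hw)
    (fun X => by
      have := hB.bsum_unit fml_leadingWord [] X 1 []
      rw [List.nil_append] at this
      rw [this]
      have h : word K [e' (obj X)] ∈ degenerateSpan e' := Submodule.subset_span (.inr ⟨obj X, rfl⟩)
      simpa [bsum, hB.nil, leadingWord] using h) hx hx'

theorem mapsDegenerate_bOneOne (hφ : VanishesOnUnits e φ) (hφ₁ : φ 1 = 0) :
    MapsDegenerate G e e (bOneOne G μ φ) := by
  have hB := isStrictMorphism_idBlocks (G := G) μ e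
  refine mapsDegenerate_lead 𝓑 he hμ hB (hB.toIsMarked.fml_insH _ (fml_hat φ) (fml_hat μ))
    (fun q X h => insH_eq_zero hB hμ.scalesUnits_sgn hφ (fml_hat μ)
      (fun w X n => hμ.apply_of_mem) h) ?_ (fun X => insH_singleton hφ₁ (fml_hat μ) _)
    (rep_bOneOne μ φ)
  exact insH_of_unmarked (by simp)

theorem mapsDegenerate_homotopyTerm (hB : IsStrictMorphism G obj B μ μ' e e')
    (hμ' : IsStrict G μ' e') (hφ : VanishesOnUnits e φ) (hφ₁ : φ 1 = 0) {ψ : Q.T →ₗ[K] Q'.Tot}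
    (hψ : VanishesOnUnits e ψ) (hψ₁ : ψ 1 = 0) {T : Q.T →ₗ[K] Q'.T}
    (hT : Rep G T (lead B (homotopyTerm G B φ μ' ψ))) : MapsDegenerate G e e' T := by
  refine mapsDegenerate_lead 𝓑 he hμ hB (fml_homotopyTerm hB.toIsFunctorial)
    (fun q X h => homotopyTerm_of_mem hB hμ hμ' hφ hψ h) (homotopyTerm_of_unmarked fun _ h => by simp at h)
    (fun X => ?_) hT
  rw [homotopyTerm, sourceTerm, insH_singleton hψ₁ (fml_hat μ'),
    insH_singleton hφ₁ (fml_bsum_oneLetter hB.toIsFunctorial), sub_zero]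

end GQuiver

namespace GQuiver

variable {k : Type*} {K : Type uK} [Field k] [Field K] [Algebra k K] (v : Derivation k K K)
  {Y : Type uY} [AddCommGroup Y] {G : GradingDatum Y}
  {Q : GQuiver.{uK, uY, uO, uH} K Y} {Q' : GQuiver.{uK, uY, uO', uH'} K Y} {obj : Q.Ob → Q'.Ob}
  {e : Q.Ob → Q.Tot} {e' : Q'.Ob → Q'.Tot} {μ : Q.Cochain} {μ' : Q'.Cochain}
  {𝓑 : HomBases Q} {𝓑' : HomBases Q'}

/-- The bases contain the strict units. -/
structure IsStrictBased (G : GradingDatum Y) (μ : Q.Cochain) (e : Q.Ob → Q.Tot) (𝓑 : HomBases Q) :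
    Prop where
  isOperation : IsOperation G id (G.fromInt 1) μ
  isStrict : IsStrict G μ e
  unit_mem : ∀ X, e X ∈ Set.range 𝓑.tot

theorem IsStrict.isStrictUnit (h : IsStrict G μ e) : IsStrictUnit G μ e :=
  ⟨h.isPath_unit, h.unit_left, h.unit_right, h.unit_zero⟩

namespace IsStrictBased

variable (h : IsStrictBased G μ e 𝓑)

include h

theorem vanishesOnUnits : VanishesOnUnits e (matrixDer v 𝓑.words 𝓑.tot μ) :=
  h.isStrict.isStrictUnit.vanishesOnUnits_matrixDer v 𝓑 h.isOperation h.unit_mem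

theorem isDeformation : IsDeformation G μ (matrixDer v 𝓑.words 𝓑.tot μ) :=
  isDeformation_matrixDer v 𝓑 h.isOperation h.isStrict

theorem map_one : matrixDer v 𝓑.words 𝓑.tot μ 1 = 0 := (h.isOperation.matrixDer v 𝓑 𝓑).map_one

variable {y : Y} {x : Q.T} (hx : x ∈ Q.chains G y)

include hx

theorem coeffDer_hochschildB : coeffDer v 𝓑.words (hochschildB G μ x) =
    hochschildB G (matrixDer v 𝓑.words 𝓑.tot μ) x + hochschildB G μ (coeffDer v 𝓑.words x) := by
  rw [coeffDer_apply v 𝓑.words, (matrixDer_hochschildB v 𝓑 h.isOperation).apply hx]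

theorem coeffDer_connesB : coeffDer v 𝓑.words (connesB G e x) =
    connesB G e (coeffDer v 𝓑.words x) := by
  rw [coeffDer_apply v 𝓑.words, (matrixDer_connesB v 𝓑 fun X =>
    coeffDer_of_mem_range v 𝓑 (h.unit_mem X)).apply hx, LinearMap.zero_apply, zero_add]

theorem hochschildB_bOneOne :
    hochschildB G μ (bOneOne G μ (matrixDer v 𝓑.words 𝓑.tot μ) x) =
      bOneOne G μ (matrixDer v 𝓑.words 𝓑.tot μ) (hochschildB G μ x) :=
  ((h.isDeformation v).hochschildB_comp_bOneOne h.isStrict).apply hx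

theorem hochschildB_matrixDer : hochschildB G (matrixDer v 𝓑.words 𝓑.tot μ) x =
    bOneOne G μ (matrixDer v 𝓑.words 𝓑.tot μ) (connesB G e x) -
      connesB G e (bOneOne G μ (matrixDer v 𝓑.words 𝓑.tot μ) x) +
      connesBOneOne G e (matrixDer v 𝓑.words 𝓑.tot μ) (hochschildB G μ x) -
      hochschildB G μ (connesBOneOne G e (matrixDer v 𝓑.words 𝓑.tot μ) x) :=
  (((h.isDeformation v).cycEq_oneOne h.isStrict).apply hx).symm

theorem connesBOneOne_connesB :
    connesBOneOne G e (matrixDer v 𝓑.words 𝓑.tot μ) (connesB G e x) ∈ degenerateSpan e :=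
  connesBOneOne_mem_degenerateSpan h.isStrict (h.vanishesOnUnits v)
    ((rep_connesB e).mem_of_mem_chains (mapsPaths_unitWord h.isStrict.isPath_unit _) hx).1

theorem connesB_connesBOneOne :
    connesB G e (connesBOneOne G e (matrixDer v 𝓑.words 𝓑.tot μ) x) ∈ degenerateSpan e :=
  connesB_mem_degenerateSpan h.isStrict.isPath_unit
    (connesBOneOne_mem_unitChains h.isStrict.isPath_unit (h.isDeformation v).homog hx).1

end IsStrictBased

/-- The first homotopy between the actions of a functor on derivatives. -/
def homotopyB (G : GradingDatum Y) (𝓑 : HomBases Q) (𝓑' : HomBases Q') {F : Q.T →ₗ[K] Q'.Tot}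
    (hF : IsFunctorial G obj (functorBlocks F)) (μ : Q.Cochain) (μ' : Q'.Cochain) : Q.T →ₗ[K] Q'.T :=
  cyc G _ (fml_lead hF.toIsMarked (fml_homotopyTerm (φ := matrixDer v 𝓑.words 𝓑.tot μ) (μ' := μ')
    (ψ := matrixDer v 𝓑.words 𝓑'.tot F) hF))

/-- The second homotopy between the actions of a functor on derivatives. -/
def homotopyConnesB (G : GradingDatum Y) (𝓑 : HomBases Q) (𝓑' : HomBases Q') {F : Q.T →ₗ[K] Q'.Tot}
    (hF : IsFunctorial G obj (functorBlocks F)) (e' : Q'.Ob → Q'.Tot) : Q.T →ₗ[K] Q'.T :=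
  cyc G _ (hF.toIsMarked.fml_insH (LinearMap.id : Q'.Tot →ₗ[K] Q'.Tot)
    (fml_hat (matrixDer v 𝓑.words 𝓑'.tot F)) (fml_unitWord e'))

section Functor

variable {F : Q.T →ₗ[K] Q'.Tot} (h : IsStrictBased G μ e 𝓑) (h' : IsStrictBased G μ' e' 𝓑')
  (hF : IsStrictFunctor G obj F μ μ' e e')

include h hF in
theorem mapsDegenerate_pushforward : MapsDegenerate G e e' (pushforward G F) :=
  mapsDegenerate_morphism 𝓑 h.unit_mem h.isStrict hF.isStrictMorphism hF.rep_pushforward_leadingWord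

include hF in
theorem hasDegree_pushforward : HasDegree G (pushforward G F) 0 :=
  (GQuiver.rep_pushforward F).hasDegree_lead hF.isFunctorial (hF.homog.weight cnt)

variable (hF₀ : IsOperation G obj 0 F)

include h h' hF₀ in
theorem hasDegree_homotopyB :
    HasDegree G (homotopyB v G 𝓑 𝓑' hF.isFunctorial μ μ') (G.fromInt 1) :=
  (rep_cyc _ _).hasDegree_lead hF.isFunctorial (homog_homotopyTerm hF.isFunctorial
    (h.isDeformation v).homog h'.isStrict.homog (hF₀.matrixDer v 𝓑 𝓑').homog)

theorem rep_homotopyConnesB : Rep G (homotopyConnesB v G 𝓑 𝓑' hF.isFunctorial e')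
    (insH (functorBlocks F) (Q'.koszul G 0) (hat (matrixDer v 𝓑.words 𝓑'.tot F))
      (unitWord e')) := by
  rw [koszul_zero]
  exact rep_cyc _ _

include h' hF₀ in
theorem homotopyConnesB_mem {y : Y} {x : Q.T} (hx : x ∈ Q.chains G y) :
    homotopyConnesB v G 𝓑 𝓑' hF.isFunctorial e' x ∈
      unitChains G e' ⊓ Q'.chains G (y - G.fromInt 1) := by
  have := (rep_homotopyConnesB v hF).mem_unitChains_of_insH h'.isStrict.isPath_unit hF.isFunctorial
    (hF₀.matrixDer v 𝓑 𝓑').homog hx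
  rwa [zero_sub, ← sub_eq_add_neg] at this

include h h' hF₀ in
theorem mapsDegenerate_homotopyB :
    MapsDegenerate G e e' (homotopyB v G 𝓑 𝓑' hF.isFunctorial μ μ') :=
  mapsDegenerate_homotopyTerm 𝓑 h.unit_mem h.isStrict hF.isStrictMorphism h'.isStrict
    (h.vanishesOnUnits v) (h.map_one v) (vanishesOnUnits_matrixDer v 𝓑 𝓑' hF h.unit_mem h'.unit_mem)
    (hF₀.matrixDer v 𝓑 𝓑').map_one (rep_cyc _ _)

include h h' in
theorem mapsDegenerate_homotopyConnesB :
    MapsDegenerate G e e' (homotopyConnesB v G 𝓑 𝓑' hF.isFunctorial e') :=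
  mapsDegenerate_insH 𝓑 h.unit_mem h.isStrict hF.isStrictMorphism h'.isStrict scalesUnits_id
    (vanishesOnUnits_matrixDer v 𝓑 𝓑' hF h.unit_mem h'.unit_mem) (rep_cyc _ _)

variable {y : Y} {x : Q.T} (hx : x ∈ Q.chains G y)

include hx

include h h' hF in
theorem hochschildB_pushforward :
    hochschildB G μ' (pushforward G F x) = pushforward G F (hochschildB G μ x) :=
  (hF.isStrictMorphism.hochschildB_comp h.isStrict h'.isStrict hF.rep_pushforward).apply hx

include h hF in
theorem connesB_pushforward :
    connesB G e' (pushforward G F x) = pushforward G F (connesB G e x) :=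
  (hF.isStrictMorphism.connesB_comp h.isStrict hF.rep_pushforward).apply hx

include h h' hF₀

theorem homotopyB_hochschildB :
    hochschildB G μ' (homotopyB v G 𝓑 𝓑' hF.isFunctorial μ μ' x) +
        homotopyB v G 𝓑 𝓑' hF.isFunctorial μ μ' (hochschildB G μ x) =
      bOneOne G μ' (matrixDer v 𝓑'.words 𝓑'.tot μ') (pushforward G F x) -
        pushforward G F (bOneOne G μ (matrixDer v 𝓑.words 𝓑.tot μ) x) :=
  ((isDeformationMorphism_matrixDer v 𝓑 𝓑' hF₀ hF).bOneOne_comp hF.isStrictMorphism h.isStrict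
    h'.isStrict (h.isDeformation v) (h'.isDeformation v) hF.rep_pushforward (rep_cyc _ _)).apply hx

theorem homotopyConnesB_hochschildB :
    hochschildB G μ' (homotopyConnesB v G 𝓑 𝓑' hF.isFunctorial e' x) +
        homotopyConnesB v G 𝓑 𝓑' hF.isFunctorial e' (hochschildB G μ x) +
        connesB G e' (homotopyB v G 𝓑 𝓑' hF.isFunctorial μ μ' x) +
        homotopyB v G 𝓑 𝓑' hF.isFunctorial μ μ' (connesB G e x) =
      pushforward G F (coeffDer v 𝓑.words x) - coeffDer v 𝓑'.words (pushforward G F x) -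
        (pushforward G F (connesBOneOne G e (matrixDer v 𝓑.words 𝓑.tot μ) x) -
          connesBOneOne G e' (matrixDer v 𝓑'.words 𝓑'.tot μ') (pushforward G F x)) := by
  have := ((isDeformationMorphism_matrixDer v 𝓑 𝓑' hF₀ hF).connesBOneOne_comp hF.isStrictMorphism
    h.isStrict h'.isStrict (h.isDeformation v) (h'.isDeformation v) hF.rep_pushforward
    (rep_cyc _ (fml_lead hF.isFunctorial.toIsMarked (fml_homotopyTerm hF.isFunctorial)))
    (rep_cyc _ (hF.isFunctorial.toIsMarked.fml_insH _ (fml_hat _) (fml_unitWord e')))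
    (hF.rep_matrixDer_pushforward v 𝓑 𝓑')).apply hx
  rw [coeffDer_apply v 𝓑.words 𝓑'.words (pushforward G F) x, sub_add_cancel_right]
  exact this

end Functor

end GQuiver

open GQuiver

variable {k : Type*} {K : Type uK} [Field k] [Field K] [Algebra k K] (v : Derivation k K K)
  {Y : Type uY} [AddCommGroup Y] {G : GradingDatum Y}
  {C : AInfCat.{uK, uY, uO, uH} K G} {D : AInfCat.{uK, uY, uO', uH'} K G}

/-! ### Maps of negative cyclic homology -/

theorem mem_degenerateSeries {α : C.Series} :
    α ∈ C.degenerateSeries ↔ ∀ n, α n ∈ degenerateSpan (Q := C.plus) C.ePlus := by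
  simp [AInfCat.degenerateSeries, Submodule.mem_pi]
  rfl

theorem exists_induces_addMonoidHom (T : C.Series →+ D.Series) {p q : ℤ}
    (h₁ : ∀ y, ∀ α ∈ C.seriesFrom p y, T α ∈ D.seriesFrom q y)
    (h₂ : ∀ y, ∀ α ∈ C.seriesFrom p y, T (C.d α) - D.d (T α) ∈ D.degenerateSeries)
    (h₃ : ∀ y, ∀ α ∈ C.seriesFrom p y, α ∈ C.degenerateSeries → T α ∈ D.degenerateSeries)
    (hd : ∀ y, ∀ α ∈ C.seriesFrom p y, C.d α ∈ C.seriesFrom p (y + G.fromInt 1)) (y : Y) :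
    ∃ f : C.HC p y →+ D.HC q y, Induces T f := by
  have hT : ∀ α ∈ C.cocycles p y, T α ∈ D.cocycles q y := fun α hα => by
    refine ⟨h₁ y α hα.1, ?_⟩
    have := sub_mem (h₃ _ _ (hd y α hα.1) hα.2) (h₂ y α hα.1)
    rwa [sub_sub_cancel] at this
  let T' : C.cocycles p y →+ D.cocycles q y :=
    { toFun := fun α => ⟨T α, hT _ α.2⟩
      map_zero' := Subtype.ext (map_zero T)
      map_add' := fun α β => Subtype.ext (map_add T _ _) }
  let f : C.HC p y →+ D.HC q y := QuotientAddGroup.lift _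
    ((Submodule.mkQ ((D.coboundaries q y).comap (D.cocycles q y).subtype)).toAddMonoidHom.comp T')
    (by
      rintro ⟨α, hα⟩ h
      obtain ⟨_, ⟨β, hβ, rfl⟩, γ, hγ, rfl⟩ := Submodule.mem_sup.mp h
      refine (Submodule.Quotient.mk_eq_zero _).mpr ?_
      change T (C.d β + γ) ∈ D.coboundaries q y
      have hβ' := hd _ β hβ
      rw [sub_add_cancel] at hβ'
      have hγ' : γ ∈ C.seriesFrom p y := by simpa using sub_mem hα.1 hβ'
      rw [map_add, ← sub_add_cancel (T (C.d β)) (D.d (T β)), add_right_comm, add_comm]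
      exact Submodule.add_mem_sup ⟨T β, h₁ _ β hβ, rfl⟩ (add_mem (h₂ _ β hβ) (h₃ y γ hγ' hγ)))
  exact ⟨f, fun α => ⟨hT _ α.2, rfl⟩⟩

theorem exists_induces_linearMap (T : C.Series →ₗ[K] D.Series) {p q : ℤ} {y z : Y}
    (h : ∃ f : C.HC p y →+ D.HC q z, Induces T f) : ∃ f : C.HC p y →ₗ[K] D.HC q z, Induces T f := by
  obtain ⟨f, hf⟩ := h
  refine ⟨{ f with map_smul' := fun c x => ?_ }, hf⟩
  obtain ⟨α, rfl⟩ := Submodule.Quotient.mk_surjective _ x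
  obtain ⟨h₁, h₂⟩ := hf α
  obtain ⟨h₃, h₄⟩ := hf (c • α)
  refine h₄.trans ?_
  change _ = c • f (Submodule.Quotient.mk α)
  rw [h₂, ← Submodule.Quotient.mk_smul]
  exact congrArg _ (Subtype.ext (map_smul T c _))

theorem AInfCat.isStrictBased (C : AInfCat.{uK, uY, uO, uH} K G) (𝓑 : HomBases C.toGQuiver) :
    IsStrictBased (Q := C.plus) G (μPlus G C.μ) C.ePlus 𝓑.plus :=
  ⟨isOperation_μPlus C.isOperation, C.isStrict, ePlus_mem_range 𝓑⟩

theorem AInfCat.d_apply (α : C.Series) (n : ℤ) : C.d α n =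
    hochschildB (Q := C.plus) G (μPlus G C.μ) (α n) +
      connesB (Q := C.plus) G C.ePlus (α (n - 1)) := rfl

theorem GQuiver.HasDegree.mem_seriesFrom {T : C.plus.T →ₗ[K] D.plus.T} {c : Y}
    (hT : HasDegree (Q := C.plus) (Q' := D.plus) G T c) (i : ℤ) {y y' : Y}
    (h : y + c - G.fromInt (2 * i) = y') {p q : ℤ} (hpq : q + i ≤ p) {α : C.Series}
    (hα : α ∈ C.seriesFrom p y) : (fun n => T (α (n + i))) ∈ D.seriesFrom q y' := by
  refine ⟨fun n => ?_, fun n hn => ?_⟩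
  · have := hT _ _ (hα.1 (n + i))
    rwa [show y - G.fromInt (2 * (n + i)) + c = y' - G.fromInt (2 * n) by
      rw [← h, mul_add, map_add]; abel] at this
  · dsimp only
    rw [hα.2 _ (by omega), map_zero]

theorem AInfCat.d_mem {p : ℤ} {y : Y} {α : C.Series} (hα : α ∈ C.seriesFrom p y) :
    C.d α ∈ C.seriesFrom p (y + G.fromInt 1) := by
  have hs := C.isStrict
  have h₁ := (hasDegree_hochschildB hs.homog).mem_seriesFrom (C := C) (D := C) 0
    (y' := y + G.fromInt 1) (by simp) (q := p) (by simp) hα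
  have h₂ := (hasDegree_connesB hs.isPath_unit).mem_seriesFrom (C := C) (D := C) (-1)
    (y' := y + G.fromInt 1) (by
      rw [show (2 * -1 : ℤ) = -1 + -1 by rfl, map_add, map_neg]; abel) (q := p) (by simp) hα
  have := add_mem h₁ h₂
  simp only [add_zero] at this
  exact this

variable (C D) in
/-- The connection as an additive map. -/
def AInfCat.connectionHom (𝓑 : HomBases C.toGQuiver) : C.Series →+ C.Series where
  toFun := C.connection 𝓑 v
  map_zero' := funext fun n => by simp [AInfCat.connection]
  map_add' α β := funext fun n => by
    simp only [AInfCat.connection, Pi.add_apply, map_add]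
    abel

theorem AInfCat.connection_mem (𝓑 : HomBases C.toGQuiver) {p : ℤ} {y : Y} {α : C.Series}
    (hα : α ∈ C.seriesFrom p y) : C.connection 𝓑 v α ∈ C.seriesFrom (p - 1) y := by
  have hb := C.isStrictBased 𝓑
  have hs := hb.isStrict
  have hφ := (hb.isDeformation v).homog
  have h₀ : (fun n => coeffDer v 𝓑.plus.words (α n)) ∈ C.seriesFrom (p - 1) y :=
    ⟨fun n => coeffDer_mem_chains v 𝓑.plus (hα.1 n), fun n hn => by
      dsimp only
      rw [hα.2 n (by omega), map_zero]⟩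
  have h₁ := (hasDegree_bOneOne hs.homog hφ).mem_seriesFrom (C := C) (D := C) 1
    (y' := y) (by simp) (q := p - 1) (by simp) hα
  have h₂ := (hasDegree_connesBOneOne hs.isPath_unit hφ).mem_seriesFrom (C := C) (D := C) 0
    (y' := y) (by simp) (q := p - 1) (by simp) hα
  have := sub_mem (sub_mem h₀ h₁) h₂
  simp only [add_zero] at this
  exact this

theorem AInfCat.connection_d (𝓑 : HomBases C.toGQuiver) {p : ℤ} {y : Y} {α : C.Series}
    (hα : α ∈ C.seriesFrom p y) :
    C.connection 𝓑 v (C.d α) - C.d (C.connection 𝓑 v α) ∈ C.degenerateSeries := by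
  have hb := C.isStrictBased 𝓑
  refine mem_degenerateSeries.mpr fun n => ?_
  have h₁ := hb.coeffDer_hochschildB v (hα.1 n)
  have h₂ := hb.coeffDer_connesB v (hα.1 (n - 1))
  have h₃ := hb.hochschildB_bOneOne v (hα.1 (n + 1))
  have h₄ := hb.hochschildB_matrixDer v (hα.1 n)
  have h₅ := hb.connesBOneOne_connesB v (hα.1 (n - 1))
  have h₆ := hb.connesB_connesBOneOne v (hα.1 (n - 1))
  convert sub_mem h₆ h₅ using 1
  simp only [Pi.sub_apply, AInfCat.connection, AInfCat.d_apply, AInfCat.vμ, map_add, map_sub,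
    add_sub_cancel_right, sub_add_cancel]
  rw [h₁, h₂, h₃, h₄]
  abel

theorem AInfCat.connection_mem_degenerateSeries (𝓑 : HomBases C.toGQuiver) {p : ℤ} {y : Y}
    {α : C.Series} (hα : α ∈ C.seriesFrom p y) (h : α ∈ C.degenerateSeries) :
    C.connection 𝓑 v α ∈ C.degenerateSeries := by
  have hb := C.isStrictBased 𝓑
  rw [mem_degenerateSeries] at h ⊢
  intro n
  refine sub_mem (sub_mem (coeffDer_mem_degenerateSpan v 𝓑.plus hb.unit_mem (h n)) ?_) ?_
  · exact mapsDegenerate_bOneOne 𝓑.plus hb.unit_mem hb.isStrict (hb.vanishesOnUnits v) (hb.map_one v)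
      _ _ (h _) (hα.1 _)
  · exact mapsDegenerate_insH 𝓑.plus hb.unit_mem hb.isStrict
      (isStrictMorphism_idBlocks _ _) hb.isStrict hb.isStrict.scalesUnits_sgn (hb.vanishesOnUnits v)
      (rep_connesBOneOne _ _) _ _ (h _) (hα.1 _)

theorem AInfCat.exists_induces_connection (𝓑 : HomBases C.toGQuiver) (p : ℤ) (y : Y) :
    ∃ f : C.HC p y →+ C.HC (p - 1) y, Induces (C.connection 𝓑 v) f :=
  exists_induces_addMonoidHom (C.connectionHom v 𝓑) (fun _ _ => C.connection_mem v 𝓑)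
    (fun _ _ => C.connection_d v 𝓑) (fun _ _ => C.connection_mem_degenerateSeries v 𝓑)
    (fun _ _ => C.d_mem) y

/-! ### Functoriality of the connection -/

namespace AInfFunctor

variable (F : AInfFunctor C D)

/-- The map `F_*` as a linear map. -/
def pushforwardLinear : C.Series →ₗ[K] D.Series :=
  LinearMap.compLeft (pushforward (Q := C.plus) (Q' := D.plus) G (FPlus F.obj F.F)) ℤ

theorem pushforwardSeries_mem {p : ℤ} {y : Y} {α : C.Series} (hα : α ∈ C.seriesFrom p y) :
    F.pushforwardSeries α ∈ D.seriesFrom p y := by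
  have := (hasDegree_pushforward F.isStrictFunctor).mem_seriesFrom 0 (y' := y) (by simp) (q := p)
    (by simp) hα
  simp only [add_zero] at this
  exact this

theorem pushforwardSeries_d {p : ℤ} {y : Y} {α : C.Series} (hα : α ∈ C.seriesFrom p y) :
    F.pushforwardSeries (C.d α) = D.d (F.pushforwardSeries α) := by
  have h := C.isStrictBased (HomBases.some C.toGQuiver)
  have h' := D.isStrictBased (HomBases.some D.toGQuiver)
  funext n
  have h₁ := hochschildB_pushforward h h' F.isStrictFunctor (hα.1 n)
  have h₂ := connesB_pushforward h F.isStrictFunctor (hα.1 (n - 1))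
  simp only [pushforwardSeries, AInfCat.d_apply, map_add]
  rw [h₁, h₂]

theorem exists_induces_pushforward (p : ℤ) (y : Y) :
    ∃ f : C.HC p y →ₗ[K] D.HC p y, Induces F.pushforwardSeries f := by
  have h := C.isStrictBased (HomBases.some C.toGQuiver)
  refine exists_induces_linearMap F.pushforwardLinear (exists_induces_addMonoidHom
    F.pushforwardLinear.toAddMonoidHom (fun _ _ => F.pushforwardSeries_mem) (fun _ α hα => ?_)
    (fun _ α hα hα' => ?_) (fun _ _ => C.d_mem) y)
  · have : F.pushforwardSeries (C.d α) - D.d (F.pushforwardSeries α) ∈ D.degenerateSeries := by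
      rw [F.pushforwardSeries_d hα, sub_self]
      exact zero_mem _
    exact this
  · have : F.pushforwardSeries α ∈ D.degenerateSeries := by
      rw [mem_degenerateSeries] at hα' ⊢
      exact fun n => mapsDegenerate_pushforward h F.isStrictFunctor _ _ (hα' n) (hα.1 n)
    exact this

variable (𝓑 : HomBases C.toGQuiver) (𝓑' : HomBases D.toGQuiver)

/-- The homotopy between the composition of the functor with the connections. -/
def homotopy (α : C.Series) : D.Series := fun n =>
  homotopyB (Q := C.plus) (Q' := D.plus) v G 𝓑.plus 𝓑'.plus F.isStrictFunctor.isFunctorial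
      (μPlus G C.μ) (μPlus G D.μ) (α (n + 1)) +
    homotopyConnesB (Q := C.plus) (Q' := D.plus) v G 𝓑.plus 𝓑'.plus
      F.isStrictFunctor.isFunctorial D.ePlus (α n)

theorem homotopy_mem {p : ℤ} {y : Y} {α : C.Series} (hα : α ∈ C.seriesFrom p y) :
    F.homotopy v 𝓑 𝓑' α ∈ D.seriesFrom (p - 1) (y - G.fromInt 1) := by
  have h := C.isStrictBased 𝓑
  have h' := D.isStrictBased 𝓑'
  have hF := F.isStrictFunctor
  have hF₀ := isOperation_FPlus F.isOperation
  have h₁ := (hasDegree_homotopyB v h h' hF hF₀).mem_seriesFrom 1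
    (y' := y - G.fromInt 1) (by
      rw [show (2 * 1 : ℤ) = 1 + 1 by rfl, map_add]; abel) (q := p - 1) (by simp) hα
  have h₂ : HasDegree (Q := C.plus) (Q' := D.plus) G _ (-G.fromInt 1) := fun y x hx => by
    have := (homotopyConnesB_mem v h' hF hF₀ (𝓑 := 𝓑.plus) hx).2
    rwa [sub_eq_add_neg] at this
  have h₃ := h₂.mem_seriesFrom 0 (y' := y - G.fromInt 1) (by
    rw [mul_zero, map_zero, sub_zero, sub_eq_add_neg]) (q := p - 1) (by simp) hα
  have := add_mem h₁ h₃
  simp only [add_zero] at this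
  exact this

theorem homotopy_mem_degenerateSeries {p : ℤ} {y : Y} {α : C.Series} (hα : α ∈ C.seriesFrom p y)
    (h : α ∈ C.degenerateSeries) : F.homotopy v 𝓑 𝓑' α ∈ D.degenerateSeries := by
  have hC := C.isStrictBased 𝓑
  have hD := D.isStrictBased 𝓑'
  have hF := F.isStrictFunctor
  have hF₀ := isOperation_FPlus F.isOperation
  rw [mem_degenerateSeries] at h ⊢
  exact fun n => add_mem (mapsDegenerate_homotopyB v hC hD hF hF₀ _ _ (h _) (hα.1 _))
    (mapsDegenerate_homotopyConnesB v hC hD hF _ _ (h _) (hα.1 _))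

theorem pushforwardSeries_connection {p : ℤ} {y : Y} {α : C.Series} (hα : α ∈ C.seriesFrom p y) :
    F.pushforwardSeries (C.connection 𝓑 v α) - D.connection 𝓑' v (F.pushforwardSeries α) -
      (D.d (F.homotopy v 𝓑 𝓑' α) + F.homotopy v 𝓑 𝓑' (C.d α)) ∈ D.degenerateSeries := by
  have hC := C.isStrictBased 𝓑
  have hD := D.isStrictBased 𝓑'
  have hF := F.isStrictFunctor
  have hF₀ := isOperation_FPlus F.isOperation
  refine mem_degenerateSeries.mpr fun n => ?_
  have h₁ := homotopyB_hochschildB v hC hD hF hF₀ (hα.1 (n + 1))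
  have h₂ := homotopyConnesB_hochschildB v hC hD hF hF₀ (hα.1 n)
  have h₃ := connesB_mem_degenerateSpan hD.isStrict.isPath_unit
    (homotopyConnesB_mem v hD hF hF₀ (𝓑 := 𝓑.plus) (hα.1 (n - 1))).1
  have h₄ := (rep_homotopyConnesB v hF (𝓑 := 𝓑.plus) (𝓑' := 𝓑'.plus)).mem_of_mem_unitChains
    (N := degenerateSpan (Q := D.plus) D.ePlus)
    (fun _ _ h => insH_unitWord_mem hF.isStrictMorphism (by rw [koszul_zero]; exact scalesUnits_id)
      (vanishesOnUnits_matrixDer v 𝓑.plus 𝓑'.plus hF hC.unit_mem hD.unit_mem)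
      hD.isStrict.isPath_unit h)
    ((rep_connesB (Q := C.plus) (G := G) C.ePlus).mem_of_mem_chains
      (mapsPaths_unitWord hC.isStrict.isPath_unit _) (hα.1 (n - 1))).1
  convert neg_mem (add_mem h₃ h₄) using 1
  simp only [Pi.sub_apply, Pi.add_apply, AInfCat.connection, AInfCat.d_apply, AInfCat.vμ,
    pushforwardSeries, homotopy, map_add, map_sub, add_sub_cancel_right, sub_add_cancel]
  linear_combination (norm := abel) -h₁ - h₂

end AInfFunctor

theorem onOne_eq_zero {A M : Type*} [AddCommGroup M] {f : A → M} {l : List A} (h : l.length ≠ 1) :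
    onOne f l = 0 := by
  match l with
  | [] => rfl
  | [_] => exact absurd rfl h
  | _ :: _ :: _ => rfl

namespace GQuiver

variable {K : Type uK} [Field K] {Y : Type uY} [AddCommGroup Y] {G : GradingDatum Y}
  {Q : GQuiver.{uK, uY, uO, uH} K Y} {M : Type*} [AddCommGroup M] [Module K M]

/-! ### The identity functor -/

theorem bsum_functorBlocks_id {F : Q.T →ₗ[K] Q.Tot} (hF : ∀ l, F (word K l) = onOne id l)
    {f : List (Q.Tot × ℤ) → M} (hf : FML K f) (l : List (Q.Tot × ℤ)) :
    bsum (functorBlocks F) f l = f l := by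
  induction l generalizing f with
  | nil => exact bsum_partsBlocks_nil _ _
  | cons a l ih =>
    rw [bsum_partsBlocks_cons, splitSum_eq_left]
    · rw [ih (hf.cons _)]
      simp [markedLetter, hat, hF, onOne, cnt]
    · intro p q _ hp
      obtain ⟨b, p, rfl⟩ := List.exists_cons_of_ne_nil hp
      refine (bsum_congr fun P _ => ?_).trans (bsum_zero _ _)
      rw [markedLetter, hat, hF]
      exact hf.zero_apply [] P _

theorem IsStrictFunctor.pushforward_apply {F : Q.T →ₗ[K] Q.Tot} {μ μ' : Q.Cochain}
    {e e' : Q.Ob → Q.Tot} (h : IsStrictFunctor G id F μ μ' e e')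
    (hF : ∀ l, F (word K l) = onOne id l) {y : Y} {x : Q.T} (hx : x ∈ Q.chains G y) :
    pushforward G F x = x :=
  (h.rep_pushforward_leadingWord.cycEq rep_leadingWord
    fun l _ _ => bsum_functorBlocks_id hF fml_leadingWord l).apply hx

theorem toPlus_ofPlus_add (x : Q.plus.Tot) : Q.toPlus (Q.ofPlus x) +
    Finsupp.linearCombination K (fun X : Q.Ob => Q.ePlus X) (Q.ePlusCoeff x) = x := by
  induction x using DirectSum.induction_on with
  | zero => simp
  | add x y hx hy =>
    nth_rewrite 3 [← hx, ← hy]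
    simp only [map_add]
    abel
  | of t a =>
    change Q.toPlus (Q.ofPlus (Q.plus.inc t.src t.tgt t.deg a)) +
      Finsupp.linearCombination K (fun X : Q.Ob => Q.ePlus X)
        (Q.ePlusCoeff (Q.plus.inc t.src t.tgt t.deg a)) = Q.plus.inc t.src t.tgt t.deg a
    rcases exists_eq_toPlus_add a with h | ⟨-, -, c, h⟩
    · rw [h, ofPlus_toPlus, ePlusCoeff_toPlus, map_zero, add_zero]
    · rw [h]
      simp [ofPlus_toPlus, ePlusCoeff_toPlus, ePlusCoeff_ePlus]

theorem FPlus_id {F : Q.T →ₗ[K] Q.Tot} (hF : ∀ l, F (word K l) = onOne id l)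
    (l : List Q.plus.Tot) : FPlus (Q := Q) (Q' := Q) id F (word K l) = onOne id l := by
  rw [FPlus_word, hF]
  by_cases h : l.length = 1
  · obtain ⟨x, rfl⟩ := List.length_eq_one_iff.mp h
    exact toPlus_ofPlus_add x
  · rw [onOne_eq_zero (by simpa using h), onOne_eq_zero h, onOne_eq_zero h, map_zero, add_zero]

end GQuiver

open GQuiver

variable {k : Type*} {K : Type uK} [Field k] [Field K] [Algebra k K] (v : Derivation k K K)
  {Y : Type uY} [AddCommGroup Y] {G : GradingDatum Y} (C : AInfCat.{uK, uY, uO, uH} K G)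

/-- The identity functor. -/
def AInfFunctor.id : AInfFunctor C C where
  obj := _root_.id
  F := linExt (onOne _root_.id) (IsML.onOne LinearMap.id.isLinear)
  F_one := (linExt_word _ _ []).trans rfl
  F_mem X Z r l hl hp := by
    rw [linExt_word]
    by_cases h : l.length = 1
    · obtain ⟨x, rfl⟩ := List.length_eq_one_iff.mp h
      exact isPath_singleton_iff.mp hp
    · rw [onOne_eq_zero h]
      exact zero_mem _
  F_of_not_composable p q X W W' Z d d' a b h := by
    rw [linExt_word, onOne_eq_zero (by simp; omega)]
  F_μ X Z r l hl := by
    set F : C.T →ₗ[K] C.Tot := linExt (onOne _root_.id) (IsML.onOne LinearMap.id.isLinear) with hF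
    have hF' (l : List C.Tot) : F (word K l) = onOne _root_.id l := linExt_word _ _ l
    have h := bsum_functorBlocks_id hF' (fml_hat C.μ) (unmarked l)
    rw [hat, map_fst_unmarked, functorBlocks, bsum_partsBlocks, unmarked, parts_map,
      List.map_map] at h
    have h' : insertSum C.toGQuiver G F C.μ l = C.μ (word K l) := by
      rw [insertSum, splitSum₃, splitSum_eq_left, splitSum_eq_right]
      · simp [hF', onOne]
      · intro p q _ hq
        rw [hF', onOne_eq_zero (by simpa using hq)]
      · intro p q _ hp
        refine splitSum_eq_zero fun _ _ _ => ?_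
        have := List.length_pos_of_ne_nil hp
        rw [hF', onOne_eq_zero (by
          simp only [List.length_append, List.length_map, List.length_cons]; omega)]
    rw [h', ← h]
    refine congrArg _ (List.map_congr_left fun P _ => ?_)
    simp [hat, Function.comp_def]

variable {C} in
theorem AInfFunctor.id_pushforwardSeries {p : ℤ} {y : Y} {α : C.Series}
    (hα : α ∈ C.seriesFrom p y) : (AInfFunctor.id C).pushforwardSeries α = α :=
  funext fun n => (AInfFunctor.id C).isStrictFunctor.pushforward_apply
    (FPlus_id fun _ => linExt_word _ (IsML.onOne LinearMap.id.isLinear) _) (hα.1 n)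

variable {C} {D : AInfCat.{uK, uY, uO', uH'} K G}

theorem AInfFunctor.induces_commute (F : AInfFunctor C D) (𝓑 : HomBases C.toGQuiver)
    (𝓑' : HomBases D.toGQuiver) {p : ℤ} {y : Y} {f₀ : C.HC p y →ₗ[K] D.HC p y}
    {f₁ : C.HC (p - 1) y →ₗ[K] D.HC (p - 1) y} {g : C.HC p y →+ C.HC (p - 1) y}
    {g' : D.HC p y →+ D.HC (p - 1) y} (hf₀ : Induces F.pushforwardSeries f₀)
    (hf₁ : Induces F.pushforwardSeries f₁) (hg : Induces (C.connection 𝓑 v) g)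
    (hg' : Induces (D.connection 𝓑' v) g') (x : C.HC p y) : f₁ (g x) = g' (f₀ x) := by
  obtain ⟨α, rfl⟩ := Submodule.Quotient.mk_surjective _ x
  obtain ⟨h₁, h₁'⟩ := hf₀ α
  obtain ⟨h₂, h₂'⟩ := hg α
  obtain ⟨h₃, h₃'⟩ := hf₁ ⟨_, h₂⟩
  obtain ⟨h₄, h₄'⟩ := hg' ⟨_, h₁⟩
  rw [h₁', h₂', h₃', h₄', Submodule.Quotient.eq]
  have h := F.pushforwardSeries_connection v 𝓑 𝓑' α.2.1
  have hd := F.homotopy_mem_degenerateSeries v 𝓑 𝓑' (C.d_mem α.2.1) α.2.2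
  change F.pushforwardSeries (C.connection 𝓑 v α) - D.connection 𝓑' v (F.pushforwardSeries α) ∈
    D.coboundaries (p - 1) y
  have := Submodule.add_mem_sup (Submodule.mem_map_of_mem (f := D.d)
    (F.homotopy_mem v 𝓑 𝓑' α.2.1)) (add_mem hd h)
  rwa [← add_assoc, add_sub_cancel] at this

theorem AInfCat.induces_connection_eq (𝓑 𝓑' : HomBases C.toGQuiver) {p : ℤ} {y : Y}
    {g : C.HC p y →+ C.HC (p - 1) y} (hg : Induces (C.connection 𝓑 v) g) :
    Induces (C.connection 𝓑' v) g := by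
  obtain ⟨g', hg'⟩ := C.exists_induces_connection v 𝓑' p y
  have hid (p : ℤ) : Induces (AInfFunctor.id C).pushforwardSeries
      (LinearMap.id : C.HC p y →ₗ[K] C.HC p y) := fun α => by
    have h := AInfFunctor.id_pushforwardSeries α.2.1
    exact ⟨by rw [h]; exact α.2, congrArg Submodule.Quotient.mk (Subtype.ext h.symm)⟩
  obtain rfl : g = g' := AddMonoidHom.ext fun x =>
    (AInfFunctor.id C).induces_commute v 𝓑 𝓑' (hid p) (hid (p - 1)) hg hg' x
  exact hg'

end

theorem theorem3p14 {k : Type*} {K : Type*} [Field k] [Field K] [Algebra k K]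
    {Y : Type*} [AddCommGroup Y] {G : GradingDatum Y} (C : AInfCat K G) (D : AInfCat K G)
    (𝓑C 𝓑C' : HomBases C.toGQuiver) (𝓑D : HomBases D.toGQuiver) (F : AInfFunctor C D) :
    (∃ Fstar : ∀ (p : ℤ) (y : Y), C.HC p y →ₗ[K] D.HC p y,
      (∀ p y, Induces F.pushforwardSeries (Fstar p y)) ∧
      ∀ v : Derivation k K K,
        ∃ (nablaC : ∀ y : Y, C.HCneg y →+ C.HC (-1) y) (nablaD : ∀ y : Y, D.HCneg y →+ D.HC (-1) y),
          (∀ y, Induces (C.connection 𝓑C v) (nablaC y)) ∧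
          (∀ y, Induces (D.connection 𝓑D v) (nablaD y)) ∧
          ∀ (y : Y) (x : C.HCneg y), Fstar (-1) y (nablaC y x) = nablaD y (Fstar 0 y x)) ∧
    (∀ v : Derivation k K K,
      ∃ nablaC : ∀ y : Y, C.HCneg y →+ C.HC (-1) y,
        (∀ y, Induces (C.connection 𝓑C v) (nablaC y)) ∧
        (∀ y, Induces (C.connection 𝓑C' v) (nablaC y))) := by
  choose Fstar hF using fun p y => F.exists_induces_pushforward p y
  refine ⟨⟨Fstar, hF, fun v => ?_⟩, fun v => ?_⟩
  · choose nablaC hC using fun y => C.exists_induces_connection v 𝓑C 0 y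
    choose nablaD hD using fun y => D.exists_induces_connection v 𝓑D 0 y
    exact ⟨nablaC, nablaD, hC, hD, fun y x =>
      F.induces_commute v 𝓑C 𝓑D (hF 0 y) (hF (0 - 1) y) (hC y) (hD y) x⟩
  · choose nablaC hC using fun y => C.exists_induces_connection v 𝓑C 0 y
    exact ⟨nablaC, hC, fun y => AInfCat.induces_connection_eq v 𝓑C 𝓑C' (hC y)⟩
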